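/- **Floating-point format.** Let $p,q\in\mathbb N$ with $2\le p\le 2^{q-2}$ and $q\ge 6$. Put $e_{\min}=-2^{q-1}+2$, $e_{\max}=2^{q-1}-1$, $$\mathbb F=\{\pm(1+i/2^p)2^{e},\ \pm(i/2^p)2^{e_{\min}} : i\in\{0,\dots,2^p-1\},\ e\in\mathbb Z,\ e_{\min}\le e\le e_{\max}\}\subset\mathbb R,$$ $\Omega=\max\mathbb F=(2-2^{-p})2^{e_{\max}}$ and $\overline{\mathbb F}=\mathbb F\cup\{\infty,-\infty,\mathrm{NaN}\}$. Rounding $\lceil x\rfloor$ of $x\in\mathbb R$ is the nearest element of $\mathbb F$ (ties to the element with even $i$) if $|x|<\Omega+2^{e_{\max}-p-1}$, and $\pm\infty$ (with the sign of $x$) otherwise. For $x,y\in\mathbb F$, $x\oplus y=\lceil x+y\rfloor$ and $x\otimes y=\lceil xy\rfloor$; on non-finite arguments these follow the IEEE-754 rules. Sums $\bigoplus$ are evaluated from left to right, starting from $0$, and $\otimes$ is extended to matrices and vectors accordingly. **Activation functions.** Let $\hat\sigma$ be one of $\mathrm{ReLU}(x)=\max(0,x)$, $\mathrm{ELU}(x)=x$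 for $x\ge0$ and $e^x-1$ for $x<0$, $\mathrm{GELU}(x)=\frac x2(1+\operatorname{erf}(x/\sqrt2))$, $\mathrm{Swish}(x)=x/(1+e^{-x})$, $\mathrm{Sigmoid}(x)=1/(1+e^{-x})$, $\tanh$. Let $\sigma=\lceil\hat\sigma\rfloor$ and $\sigma'=\lceil\hat\sigma'\rfloor:\overline{\mathbb F}\to\overline{\mathbb F}$ be the rounded versions of $\hat\sigma$ and of its derivative (with $\mathrm{ReLU}'(0)=0$; at $\pm\infty$ the rounded limit; NaN is mapped to NaN). For ReLU, ELU, GELU and Swish put $M_\sigma=2^{e_{\max}-2}$ and $H_\sigma=\Omega$; for Sigmoid put $M_\sigma=2^{e_{\max}-1}$ and $H_\sigma=2^{p-1}$; for $\tanh$ put $M_\sigma=2^{e_{\max}-1}$ and $H_\sigma=2^{p-2}$. **Networks.** An $L$-layer $\sigma$ network $f:\overline{\mathbb F}^{d_0}\to\overline{\mathbb F}^{d_L}$ is $f=\rho_L\circ\sigma\circ\rho_{L-1}\circ\cdots\circ\sigma\circ\rho_1$ with $\rho_l(x)=A_l\otimes x\oplus b_l$, where $A_l\in\mathbb F^{d_l\times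 d_{l-1}}$, $b_l\in\mathbb F^{d_l}$, all $d_l\ge1$, and $\sigma$ acts coordinatewise. With $y_l$ the output of $\rho_l$ on the input $x$, automatic differentiation maps an input gradient $g\in\overline{\mathbb F}^{1\times d_L}$ to $$\mathcal D_{f,x}(g)=g\otimes A_L\otimes\operatorname{diag}(\sigma'(y_{L-1}))\otimes A_{L-1}\otimes\cdots\otimes\operatorname{diag}(\sigma'(y_1))\otimes A_1,$$ evaluated from left to right. **Theorem 3.2.** Let $d\ge1$, $\mathcal X=([-M_\sigma,M_\sigma]\cap\mathbb F)^d$, $f^*:\mathcal X\to\mathbb F$, and let $g^*:\mathbb F^d\times\mathbb F\to\mathbb F^{1\times d}$ satisfy $g^*(x,-y)=-g^*(x,y)$ for all $x\in\mathbb F^d$, $y\in\mathbb F$. Then for every $L\ge 2^{q+1}+2p+11$ there is an $L$-layer $\sigma$ network $f$ with input dimension $d$ and output dimension $1$ such that for all $x\in\mathcal X$ and all $y\in[-H_\sigma,H_\sigma]\cap\mathbb F$, $$f(x)=f^*(x)\quad\text{and}\quad\mathcal D_{f,x}(y)=g^*(x,y).$$ -/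

import Mathlib

open Filter Topology

noncomputable section

namespace FloatNet

/-! ### Finite floating-point numbers -/

/-- The smallest exponent `-2^(q-1) + 2`. -/
def emin (q : ℕ) : ℤ := -2 ^ (q - 1) + 2

/-- The largest exponent `2^(q-1) - 1`. -/
def emax (q : ℕ) : ℤ := 2 ^ (q - 1) - 1

/-- `x = ± (1 + i / 2^p) * 2^e` with `emin ≤ e ≤ emax` (normal), or
`x = ± (i / 2^p) * 2^emin` (subnormal), with `0 ≤ i ≤ 2^p - 1`. -/
def IsRep (p q : ℕ) (i : ℕ) (x : ℝ) : Prop :=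
  i < 2 ^ p ∧ ∃ s : ℝ, (s = 1 ∨ s = -1) ∧
    ((∃ e : ℤ, emin q ≤ e ∧ e ≤ emax q ∧ x = s * (1 + (i : ℝ) / 2 ^ p) * (2 : ℝ) ^ e) ∨
      x = s * ((i : ℝ) / 2 ^ p) * (2 : ℝ) ^ emin q)

/-- The set of finite floating-point numbers with `p` mantissa bits and `q` exponent bits. -/
def finiteFloats (p q : ℕ) : Set ℝ := {x | ∃ i, IsRep p q i x}

/-- The type of finite floating-point numbers. -/
abbrev Flt (p q : ℕ) : Type := finiteFloats p q

theorem zero_mem_finiteFloats (p q : ℕ) : (0 : ℝ) ∈ finiteFloats p q :=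
  ⟨0, by positivity, 1, Or.inl rfl, Or.inr (by simp)⟩

theorem neg_mem_finiteFloats {p q : ℕ} {x : ℝ} (hx : x ∈ finiteFloats p q) :
    -x ∈ finiteFloats p q := by
  obtain ⟨i, hi, s, hs, h⟩ := hx
  refine ⟨i, hi, -s, ?_, ?_⟩
  · rcases hs with rfl | rfl <;> simp
  · rcases h with ⟨e, h1, h2, rfl⟩ | rfl
    · exact Or.inl ⟨e, h1, h2, by ring⟩
    · exact Or.inr (by ring)

instance (p q : ℕ) : Zero (Flt p q) := ⟨⟨0, zero_mem_finiteFloats p q⟩⟩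

instance (p q : ℕ) : Neg (Flt p q) := ⟨fun x => ⟨-(x : ℝ), neg_mem_finiteFloats x.2⟩⟩

/-- A finite float is even if the `i` in its representation is even. -/
def IsEvenFlt {p q : ℕ} (x : Flt p q) : Prop := ∃ i, Even i ∧ IsRep p q i x

/-- The largest finite float `(2 - 2^(-p)) * 2^emax`. -/
def Omega (p q : ℕ) : ℝ := (2 - 2 ^ (-(p : ℤ))) * (2 : ℝ) ^ emax q

/-! ### Floating-point numbers with infinities and NaN, rounding, and arithmetic -/

/-- All floating-point numbers: the finite ones, the two infinities, and NaN. -/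
inductive ExtFlt (p q : ℕ) : Type
  | finite (x : Flt p q) : ExtFlt p q
  | posInf : ExtFlt p q
  | negInf : ExtFlt p q
  | nan : ExtFlt p q

variable {p q : ℕ}

instance : Zero (ExtFlt p q) := ⟨.finite 0⟩

/-- `y` minimizes `|x - y|` over the finite floats, and `y` is even in case of a tie. -/
def IsNearestEven (x : ℝ) (y : Flt p q) : Prop :=
  (∀ z : Flt p q, |x - y| ≤ |x - z|) ∧
    ((∃ z : Flt p q, z ≠ y ∧ |x - z| = |x - y|) → IsEvenFlt y)

/-- The finite float nearest to `x`, ties to even. -/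
def nearestEven (p q : ℕ) (x : ℝ) : Flt p q :=
  Classical.epsilon fun y : Flt p q => IsNearestEven x y

open Classical in
/-- The rounding operation. -/
def round (p q : ℕ) (x : ℝ) : ExtFlt p q :=
  if |x| < Omega p q + (2 : ℝ) ^ (emax q - p - 1) then .finite (nearestEven p q x)
  else if 0 < x then .posInf else .negInf

/-- Floating-point addition `⊕`. -/
def ExtFlt.add : ExtFlt p q → ExtFlt p q → ExtFlt p q
  | .finite x, .finite y => round p q ((x : ℝ) + y)
  | .nan, _ => .nan
  | _, .nan => .nan
  | .posInf, .negInf => .nan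
  | .negInf, .posInf => .nan
  | .posInf, _ => .posInf
  | _, .posInf => .posInf
  | .negInf, _ => .negInf
  | _, .negInf => .negInf

open Classical in
/-- An infinity with the sign of `r`; NaN if `r = 0`. -/
def infWithSign (p q : ℕ) (r : ℝ) : ExtFlt p q :=
  if 0 < r then .posInf else if r < 0 then .negInf else .nan

/-- Floating-point multiplication `⊗`. -/
def ExtFlt.mul : ExtFlt p q → ExtFlt p q → ExtFlt p q
  | .finite x, .finite y => round p q ((x : ℝ) * y)
  | .nan, _ => .nan
  | _, .nan => .nan
  | .posInf, .finite y => infWithSign p q y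
  | .negInf, .finite y => infWithSign p q (-(y : ℝ))
  | .finite x, .posInf => infWithSign p q x
  | .finite x, .negInf => infWithSign p q (-(x : ℝ))
  | .posInf, .posInf => .posInf
  | .posInf, .negInf => .negInf
  | .negInf, .posInf => .negInf
  | .negInf, .negInf => .posInf

/-- The left-associative floating-point sum `(⋯((0 ⊕ x₁) ⊕ x₂) ⊕ ⋯) ⊕ xₙ`. -/
def fsum : {n : ℕ} → (Fin n → ExtFlt p q) → ExtFlt p q
  | 0, _ => 0
  | n + 1, x => (fsum fun i : Fin n => x i.castSucc).add (x (Fin.last n))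

/-- The matrix-vector product `A ⊗ x`. -/
def mulVec {m n : ℕ} (A : Matrix (Fin n) (Fin m) (ExtFlt p q)) (x : Fin m → ExtFlt p q) :
    Fin n → ExtFlt p q :=
  fun i => fsum fun j => (A i j).mul (x j)

/-- The product `g ⊗ A` of a row vector and a matrix. -/
def vecMul {m n : ℕ} (g : Fin n → ExtFlt p q) (A : Matrix (Fin n) (Fin m) (ExtFlt p q)) :
    Fin m → ExtFlt p q :=
  fun j => fsum fun i => (g i).mul (A i j)

/-! ### Rounded real functions and the activation functions -/

open Classical in
/-- The rounded limit of `f` along `l`, where the limit may be infinite; NaN if there is no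
limit. -/
def roundLim (p q : ℕ) (f : ℝ → ℝ) (l : Filter ℝ) : ExtFlt p q :=
  if ∃ a, Tendsto f l (𝓝 a) then round p q (limUnder l f)
  else if Tendsto f l atTop then .posInf
  else if Tendsto f l atBot then .negInf
  else .nan

/-- The rounded version of a real function. -/
def roundFun (p q : ℕ) (f : ℝ → ℝ) : ExtFlt p q → ExtFlt p q
  | .finite x => round p q (f x)
  | .posInf => roundLim p q f atTop
  | .negInf => roundLim p q f atBot
  | .nan => .nan

/-- Names of the activation functions considered. -/
inductive Activation : Type
  | relu | elu | gelu | swish | sigmoid | tanh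

/-- The error function `erf x = (2 / √π) ∫₀ˣ exp (-t²) dt`. -/
def erf (x : ℝ) : ℝ := 2 / √Real.pi * ∫ t in (0 : ℝ)..x, Real.exp (-t ^ 2)

/-- The real activation function. -/
def Activation.toReal : Activation → ℝ → ℝ
  | .relu => fun x => max 0 x
  | .elu => fun x => if 0 ≤ x then x else Real.exp x - 1
  | .gelu => fun x => x / 2 * (1 + erf (x / √2))
  | .swish => fun x => x / (1 + Real.exp (-x))
  | .sigmoid => fun x => 1 / (1 + Real.exp (-x))
  | .tanh => Real.tanh

/-- The derivative of the real activation function. All of them are differentiable on `ℝ`,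
except ReLU at `0`, where the usual convention `ReLU'(0) = 0` is made. -/
def Activation.realDeriv : Activation → ℝ → ℝ
  | .relu => fun x => if 0 < x then 1 else 0
  | a => deriv a.toReal

/-- The floating-point activation function: the rounded real one. -/
def Activation.act (p q : ℕ) (a : Activation) : ExtFlt p q → ExtFlt p q :=
  roundFun p q a.toReal

/-- The derivative used by automatic differentiation: the rounded real one. -/
def Activation.actDeriv (p q : ℕ) (a : Activation) : ExtFlt p q → ExtFlt p q :=
  roundFun p q a.realDeriv

/-- The bound `M_σ` on the coordinates of the inputs. -/
def Activation.inputBound (q : ℕ) : Activation → ℝ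
  | .relu | .elu | .gelu | .swish => (2 : ℝ) ^ (emax q - 2)
  | .sigmoid | .tanh => (2 : ℝ) ^ (emax q - 1)

/-- The bound `H_σ` on the input gradient. -/
def Activation.gradBound (p q : ℕ) : Activation → ℝ
  | .relu | .elu | .gelu | .swish => Omega p q
  | .sigmoid => (2 : ℝ) ^ ((p : ℤ) - 1)
  | .tanh => (2 : ℝ) ^ ((p : ℤ) - 2)

/-- The cube `[-M_σ, M_σ]^d` of finite floats. -/
def inputCube (p q d : ℕ) (a : Activation) : Set (Fin d → Flt p q) :=
  {x | ∀ i, |(x i : ℝ)| ≤ a.inputBound q}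

/-! ### Networks and automatic differentiation -/

/-- Parameters of a floating-point affine transformation from dimension `m` to dimension `n`. -/
structure Affine (p q m n : ℕ) : Type where
  weight : Matrix (Fin n) (Fin m) (Flt p q)
  bias : Fin n → Flt p q

namespace Affine

variable {m n : ℕ}

/-- The weights as extended floats. -/
def extWeight (ρ : Affine p q m n) : Matrix (Fin n) (Fin m) (ExtFlt p q) :=
  ρ.weight.map .finite

/-- `x ↦ A ⊗ x ⊕ b`. -/
def eval (ρ : Affine p q m n) (x : Fin m → ExtFlt p q) : Fin n → ExtFlt p q :=
  fun i => (mulVec ρ.extWeight x i).add (.finite (ρ.bias i))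

/-- `g ↦ g ⊗ A`. -/
def grad (ρ : Affine p q m n) (g : Fin n → ExtFlt p q) : Fin m → ExtFlt p q :=
  vecMul g ρ.extWeight

end Affine

/-- `Network p q L m n`: parameters of a network with `L ≥ 1` affine layers, input dimension `m`,
output dimension `n` and positive hidden dimensions. It is one affine transformation, or an
affine transformation followed by the activation function and a network with one layer fewer. -/
inductive Network (p q : ℕ) : ℕ → ℕ → ℕ → Type
  | last {m n : ℕ} (ρ : Affine p q m n) : Network p q 1 m n
  | cons {L m k n : ℕ} (hk : 0 < k) (ρ : Affine p q m k) (f : Network p q L k n) :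
      Network p q (L + 1) m n

namespace Network

/-- The function `ρ_L ∘ σ ∘ ⋯ ∘ σ ∘ ρ₁` computed by the network. -/
def eval (a : Activation) : {L m n : ℕ} → Network p q L m n →
    (Fin m → ExtFlt p q) → (Fin n → ExtFlt p q)
  | _, _, _, .last ρ, x => ρ.eval x
  | _, _, _, .cons _ ρ f, x => f.eval a fun i => a.act p q (ρ.eval x i)

/-- The gradient `D_{f,x}(g)` computed by reverse-mode automatic differentiation from the input
gradient `g` (a row vector), by the rules `D_{ρ,x}(g) = g ⊗ A`,
`D_{σ,y}(g) = g ⊗ diag(σ'(y₁), …, σ'(y_k))` and `D_{ψ₂∘ψ₁,x} = D_{ψ₁,x} ∘ D_{ψ₂,ψ₁(x)}`. -/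
def grad (a : Activation) : {L m n : ℕ} → Network p q L m n →
    (Fin m → ExtFlt p q) → (Fin n → ExtFlt p q) → (Fin m → ExtFlt p q)
  | _, _, _, .last ρ, _, g => ρ.grad g
  | _, _, _, .cons _ ρ f, x, g =>
      ρ.grad (vecMul (f.grad a (fun i => a.act p q (ρ.eval x i)) g)
        (Matrix.diagonal fun i => a.actDeriv p q (ρ.eval x i)))

end Network

end FloatNet

end

open FloatNet

noncomputable section

namespace FloatNet

/-! Over the reals, reverse-mode differentiation is linear in the input gradient `y`; here it is
rounding that makes an arbitrary odd dependence on `y` possible. On each fixed input the backward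
pass is a program of rounded additions and multiplications by constants, and the forward pass
decides which programs are active.

Forward pass. The first layers compare each coordinate of the input with that of every target in the
finite cube, a NOR neuron recognises each target, and bits derived from it are copied up to the last
hidden layer (`InputKit.prog_cmp`, `Kit.prog_eq`, `Kit.exists_bits`). There, pieces switched by the
bits add up to the prescribed value for the recognised target and contribute zero for all others
(field `piece` of `Kit`).

Backward pass. For each target input, coordinate, positive float `y₀` and unit of the mantissa there
is a binary tree of carriers. A carrier has a twin with the same value on its target, and the two
enter the next layer with weights `A` and `-A`. Their contributions cancel exactly, so on the target
the preactivation is a fixed bias with known derivative `δ`, while `A` remains free and acts on the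
gradient alone (`Realizes.chain`). Gates at the top, controlled by the bits, have derivative zero
unless the input is the target, so only the trees of the actual input receive `y` (`Kit.top`). No
gradient returns through the other neurons: either the derivative or the incoming gradient vanishes.

The programs (`Good`). Floats are integer multiples of the smallest one, `eps`, and rounded halving
is one backward step. Halving `k` times and subtracting twice the next half isolates a signed binary
digit (`Good.exists_bit`). Let `y₀ = 2 ^ k * o * eps` with `o` odd. Multiply the digit `u` of `y` at
place `k` by the mantissa of `y₀`, subtract the result from a partly halved `y`, and call the
difference `r`: then `u ≠ 0` and `r = 0` hold together only at `y = y₀` and `y = -y₀`. The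
expression `(u + r) - r` keeps the tiny `u` when `r = 0` and loses it by absorption when `r` is
large; an `r` that is neither is amplified first (`Good.exists_kill`). The result is an odd
indicator of `y₀` (`Good.exists_indicator`), which scaling turns into a spike of height `2 ^ E`
(`Good.exists_spike`).

Assembly. A prescribed gradient `M * 2 ^ E` is the sum of `|M|` spikes of the same sign. All partial
sums are floats, so nothing is rounded, in whatever order they are added (`IsSum.exact`,
`InputKit.exists_network`). All steps are odd in `y`, which matches the oddness required of the
gradient. The depth is governed by the halvings, at most about `2 * emax q + p` of them, and by the
scaling, which gains four binary places per layer.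

Order of summation is kept unspecified (`IsSum`): sums have at most two relevant terms, or are
exact, or need only a one-sided bound, or consist of few terms of two very different sizes. Only the
last affine map uses a chosen order.

Activation functions enter only through `Kit` and `InputKit`. A `Rectifier` is the identity to
working precision from `2 ^ p` on and constant far to the left; a `Sigmoidal` function saturates on
both sides and has derivative `1 / 4` or `1` at zero. ELU and tanh have off value `-1` instead of
`0`, so their output pieces are switched off by steering the preactivation to exactly zero
(`Rectifier.exists_kit_neg_one`, `exists_kit_tanh`). -/

/-- The hypotheses on the format. -/
class Params (p q : ℕ) : Prop where
  two_le : 2 ≤ p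
  le_pow : p ≤ 2 ^ (q - 2)
  six_le : 6 ≤ q

/-- These linear relations allow `omega` to settle most exponent inequalities with `emax q` as an
atom. The third is where `p ≤ 2 ^ (q - 2)` enters, the lower bound `31` where `6 ≤ q` does. -/
theorem emax_facts (p q : ℕ) [h : Params p q] :
    emin q = 1 - emax q ∧ 31 ≤ emax q ∧ 2 * (p : ℤ) ≤ emax q + 1 ∧
      (2 : ℤ) ^ q = 2 * (emax q + 1) ∧ 2 ≤ (p : ℤ) := by
  obtain ⟨h1, h2, h3⟩ := h
  obtain ⟨k, rfl⟩ : ∃ k, q = k + 6 := ⟨q - 6, by omega⟩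
  have e1 : k + 6 - 1 = k + 5 := by omega
  have e2 : k + 6 - 2 = k + 4 := by omega
  rw [e2] at h2
  have h2' : (p : ℤ) ≤ 2 ^ (k + 4) := by exact_mod_cast h2
  have hk : (1 : ℤ) ≤ 2 ^ k := one_le_pow₀ (by norm_num)
  unfold emin emax
  rw [e1]
  simp only [pow_add] at *
  norm_num at *
  refine ⟨by ring, by linarith, by linarith, by ring, by exact_mod_cast h1⟩

/-! ### Integer mantissas -/

theorem zpow_sub_nat (e : ℤ) (k : ℕ) : (2 : ℝ) ^ e = 2 ^ k * (2 : ℝ) ^ (e - k) := by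
  rw [← zpow_natCast, ← zpow_add₀ (by norm_num)]; congr 1; ring

/-- `m * 2 ^ e` is in normal form: either `m` has `p + 1` bits, or `e` is minimal. -/
def Canon (p q : ℕ) (m e : ℤ) : Prop :=
  |m| < 2 ^ (p + 1) ∧ emin q - p ≤ e ∧ e ≤ emax q - p ∧ (2 ^ p ≤ |m| ∨ e = emin q - p)

/-- The hidden bit is absorbed into an integer mantissa. Adding `2 ^ p`, which is even, does not
change parity, so ties-to-even can be read off the mantissa. -/
theorem IsRep.exists_canon [Params p q] {i : ℕ} {x : ℝ} (h : IsRep p q i x) :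
    ∃ m e, Canon p q m e ∧ x = m * (2 : ℝ) ^ e ∧ (Even i → Even m) := by
  obtain ⟨f1, f2, f3, f4, f5⟩ := emax_facts p q
  obtain ⟨hi, s, hs, h⟩ := h
  have hi' : (i : ℤ) < 2 ^ p := by exact_mod_cast hi
  have hp : Even ((2 : ℤ) ^ p) := (even_two).pow_of_ne_zero (by omega)
  obtain ⟨t, rfl, ht⟩ : ∃ t : ℤ, s = t ∧ |t| = 1 := by
    rcases hs with rfl | rfl
    · exact ⟨1, by norm_num, by norm_num⟩
    · exact ⟨-1, by norm_num, by norm_num⟩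
  rcases h with ⟨e, h1, h2, rfl⟩ | rfl
  · refine ⟨t * (2 ^ p + i), e - p, ⟨?_, by omega, by omega, Or.inl ?_⟩, ?_, ?_⟩
    · rw [abs_mul, ht, abs_of_nonneg (by positivity), pow_succ]; linarith
    · rw [abs_mul, ht, abs_of_nonneg (by positivity)]; linarith
    · rw [zpow_sub_nat e p]; push_cast; field_simp
    · intro hev
      exact (hp.add (by exact_mod_cast hev)).mul_left _
  · refine ⟨t * i, emin q - p, ⟨?_, le_rfl, by omega, Or.inr rfl⟩, ?_, ?_⟩
    · rw [abs_mul, ht, abs_of_nonneg (by positivity), pow_succ]; linarith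
    · rw [zpow_sub_nat (emin q) p]; push_cast; field_simp
    · intro hev
      exact Even.mul_left (by exact_mod_cast hev) _

theorem Canon.exists_isRep [Params p q] {m e : ℤ} (h : Canon p q m e) :
    ∃ i, IsRep p q i (m * (2 : ℝ) ^ e) ∧ (Even m → Even i) := by
  obtain ⟨f1, f2, f3, f4, f5⟩ := emax_facts p q
  obtain ⟨h1, h2, h3, h4⟩ := h
  have hp : Even ((2 : ℤ) ^ p) := (even_two).pow_of_ne_zero (by omega)
  obtain ⟨s, hs, hm⟩ : ∃ s : ℝ, (s = 1 ∨ s = -1) ∧ (m : ℝ) = s * (|m| : ℤ) := by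
    rcases abs_cases m with h | h
    · exact ⟨1, Or.inl rfl, by rw [h.1]; ring⟩
    · exact ⟨-1, Or.inr rfl, by rw [h.1]; push_cast; ring⟩
  by_cases hc : 2 ^ p ≤ |m|
  · obtain ⟨i, hi⟩ : ∃ i : ℕ, |m| = 2 ^ p + i := ⟨(|m| - 2 ^ p).toNat, by omega⟩
    refine ⟨i, ⟨?_, s, hs, Or.inl ⟨e + p, by omega, by omega, ?_⟩⟩, ?_⟩
    · have : (i : ℤ) < 2 ^ p := by rw [hi, pow_succ] at h1; linarith
      exact_mod_cast this
    · rw [zpow_sub_nat (e + p) p, hm, hi]; push_cast; field_simp; norm_num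
    · intro hm'
      have := (even_abs.2 hm')
      rw [hi] at this
      have := (Int.even_add.1 this).1 hp
      exact_mod_cast this
  · have he : e = emin q - p := by tauto
    refine ⟨m.natAbs, ⟨?_, s, hs, Or.inr ?_⟩, ?_⟩
    · have : (m.natAbs : ℤ) < 2 ^ p := by rw [Int.natCast_natAbs]; omega
      exact_mod_cast this
    · rw [zpow_sub_nat (emin q) p, he, hm, Nat.cast_natAbs]; field_simp
    · intro hm'; exact Int.natAbs_even.2 hm'

/-- Doubling the mantissa and lowering the exponent stops when the mantissa has `p + 1` bits or the
exponent is minimal; the induction is on the distance to the minimal exponent. -/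
theorem exists_canon [Params p q] {m e : ℤ} (hm : |m| < 2 ^ (p + 1)) (h1 : emin q - p ≤ e)
    (h2 : e ≤ emax q - p) : ∃ m' e', Canon p q m' e' ∧ (m : ℝ) * 2 ^ e = m' * 2 ^ e' := by
  obtain ⟨n, hn⟩ : ∃ n : ℕ, e = emin q - p + n := ⟨(e - (emin q - p)).toNat, by omega⟩
  induction n generalizing m e with
  | zero => exact ⟨m, e, ⟨hm, h1, h2, Or.inr (by simpa using hn)⟩, rfl⟩
  | succ n ih =>
    by_cases hc : 2 ^ p ≤ |m|
    · exact ⟨m, e, ⟨hm, h1, h2, Or.inl hc⟩, rfl⟩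
    · obtain ⟨m', e', hc, he⟩ := ih (m := 2 * m) (e := e - 1)
        (by rw [abs_mul, pow_succ]; norm_num; omega) (by omega) (by omega) (by omega)
      refine ⟨m', e', hc, ?_⟩
      rw [← he, zpow_sub_nat e 1]; push_cast; ring

/-- The working description of floats: without normal form, closure properties need no distinction
between normal and subnormal numbers. -/
theorem mem_finiteFloats_iff [Params p q] {x : ℝ} : x ∈ finiteFloats p q ↔
    ∃ m e : ℤ, |m| < 2 ^ (p + 1) ∧ emin q - p ≤ e ∧ e ≤ emax q - p ∧ x = m * 2 ^ e := by
  constructor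
  · rintro ⟨i, hi⟩
    obtain ⟨m, e, ⟨h1, h2, h3, -⟩, h, -⟩ := hi.exists_canon
    exact ⟨m, e, h1, h2, h3, h⟩
  · rintro ⟨m, e, h1, h2, h3, rfl⟩
    obtain ⟨m', e', h, h'⟩ := exists_canon h1 h2 h3
    obtain ⟨i, hi, -⟩ := h.exists_isRep
    exact ⟨i, h' ▸ hi⟩

theorem mem_canon [Params p q] {x : ℝ} (hx : x ∈ finiteFloats p q) :
    ∃ m e, Canon p q m e ∧ x = m * (2 : ℝ) ^ e := by
  obtain ⟨m, e, h1, h2, h3, rfl⟩ := mem_finiteFloats_iff.1 hx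
  exact exists_canon h1 h2 h3

/-- If `e ≤ e'`, the larger number is a multiple of `2 ^ e`. If `e' < e`, normal form gives `m ≥ 2 ^
p`, and a mantissa below `2 ^ (p + 1)` at a smaller exponent cannot exceed `m * 2 ^ e`. -/
theorem Canon.succ_le [Params p q] {m e m' e' : ℤ} (h : Canon p q m e) (h0 : 0 ≤ m)
    (hm' : |m'| < 2 ^ (p + 1)) (hlt : (m : ℝ) * 2 ^ e < m' * 2 ^ e') (he' : emin q - p ≤ e') :
    ((m + 1 : ℤ) : ℝ) * 2 ^ e ≤ m' * 2 ^ e' := by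
  obtain ⟨h1, h2, h3, h4⟩ := h
  have pe : (0 : ℝ) < 2 ^ e := by positivity
  rcases le_or_gt e e' with he | he
  · obtain ⟨k, rfl⟩ : ∃ k : ℕ, e' = e + k := ⟨(e' - e).toNat, by omega⟩
    rw [zpow_sub_nat (e + k) k, add_sub_cancel_right] at *
    have : (m : ℝ) < ((m' * 2 ^ k : ℤ) : ℝ) := by
      push_cast; nlinarith
    have : m + 1 ≤ m' * 2 ^ k := by exact_mod_cast this
    have : ((m + 1 : ℤ) : ℝ) ≤ ((m' * 2 ^ k : ℤ) : ℝ) := by exact_mod_cast this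
    rw [← mul_assoc]
    refine mul_le_mul_of_nonneg_right ?_ pe.le
    push_cast at *; linarith
  · exfalso
    have h5 : 2 ^ p ≤ m := by rw [abs_of_nonneg h0] at h4; omega
    have h6 : (2 : ℝ) ^ p ≤ m := by exact_mod_cast h5
    have h7 : (m' : ℝ) < 2 ^ (p + 1) := by exact_mod_cast (le_abs_self m').trans_lt hm'
    have h8 : (2 : ℝ) ^ e' ≤ 2 ^ (e - 1) := zpow_le_zpow_right₀ (by norm_num) (by omega)
    rw [zpow_sub_nat e 1] at hlt
    have h9 : (0 : ℝ) < 2 ^ e' := by positivity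
    rw [pow_succ] at h7
    norm_num at hlt
    have h10 : (0 : ℝ) < 2 ^ (e - 1) := by positivity
    have h11 : (m' : ℝ) * 2 ^ e' ≤ 2 ^ p * 2 * 2 ^ e' := by gcongr
    have h12 : (2 : ℝ) ^ p * 2 * 2 ^ e' ≤ 2 ^ p * 2 * 2 ^ (e - 1) := by gcongr
    have h13 : (2 : ℝ) ^ p * 2 * 2 ^ (e - 1) ≤ m * 2 * 2 ^ (e - 1) := by gcongr
    linarith

instance finite_flt [Params p q] : Finite (Flt p q) := by
  let S : Set (ℤ × ℤ) := Set.Icc (-2 ^ (p + 1)) (2 ^ (p + 1)) ×ˢ Set.Icc (emin q - p) (emax q - p)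
  have hS : S.Finite := (Set.finite_Icc _ _).prod (Set.finite_Icc _ _)
  refine (Set.Finite.subset (hS.image fun z => (z.1 : ℝ) * 2 ^ z.2) ?_).to_subtype
  intro x hx
  obtain ⟨m, e, h1, h2, h3, rfl⟩ := mem_finiteFloats_iff.1 hx
  exact ⟨(m, e), ⟨⟨(abs_lt.1 h1).1.le, (abs_lt.1 h1).2.le⟩, h2, h3⟩, rfl⟩

/-! ### Rounding to nearest -/

theorem IsEvenFlt.exists_canon [Params p q] {y : Flt p q} (h : IsEvenFlt y) :
    ∃ m e, Canon p q m e ∧ (y : ℝ) = m * (2 : ℝ) ^ e ∧ Even m := by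
  obtain ⟨i, hi, hr⟩ := h
  obtain ⟨m, e, h1, h2, h3⟩ := hr.exists_canon
  exact ⟨m, e, h1, h2, h3 hi⟩

theorem Canon.isEvenFlt [Params p q] {y : Flt p q} {m e : ℤ} (h : Canon p q m e)
    (hy : (y : ℝ) = m * (2 : ℝ) ^ e) (hm : Even m) : IsEvenFlt y := by
  obtain ⟨i, hi, hr⟩ := h.exists_isRep
  exact ⟨i, hr hm, hy ▸ hi⟩

theorem IsEvenFlt.neg [Params p q] {y : Flt p q} (h : IsEvenFlt y) : IsEvenFlt (-y) := by
  obtain ⟨m, e, h1, h2, h3⟩ := h.exists_canon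
  refine Canon.isEvenFlt (m := -m) (e := e) ?_ ?_ h3.neg
  · simpa [Canon] using h1
  · change -(y : ℝ) = _
    rw [h2]; push_cast; ring

/-- An even mantissa `m` has the odd successor `m + 1`, which cannot be the power `2 ^ (p + 1)`, so
no carry occurs and the successor is an odd float. It suffices to treat nonnegative `y`; the rest
follows by negation, or by taking zero. -/
theorem exists_between_of_even [Params p q] {y z : Flt p q} (hy : IsEvenFlt y) (hz : IsEvenFlt z)
    (hlt : (y : ℝ) < z) : ∃ w : Flt p q, (y : ℝ) < w ∧ (w : ℝ) < z := by
  have key : ∀ {y z : Flt p q}, IsEvenFlt y → IsEvenFlt z → (y : ℝ) < z → 0 ≤ (y : ℝ) →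
      ∃ w : Flt p q, (y : ℝ) < w ∧ (w : ℝ) < z := by
    intro y z hy hz hlt h0
    obtain ⟨m, e, hc, h1, h2⟩ := hy.exists_canon
    obtain ⟨m', e', hc', h1', h2'⟩ := hz.exists_canon
    have pe : (0 : ℝ) < 2 ^ e := by positivity
    have hm0 : 0 ≤ m := by
      rw [h1] at h0
      exact_mod_cast nonneg_of_mul_nonneg_left h0 pe
    have hle := hc.succ_le hm0 hc'.1 (by rw [← h1, ← h1']; exact hlt) hc'.2.1
    have hlt' : m + 1 < 2 ^ (p + 1) := by
      have a := hc.1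
      rw [abs_of_nonneg hm0] at a
      have : m + 1 ≠ 2 ^ (p + 1) := by
        intro hh
        have : Even (m + 1) := hh ▸ (even_two).pow_of_ne_zero (by omega)
        exact (Int.even_add_one.1 this) h2
      omega
    have hmem : ((m + 1 : ℤ) : ℝ) * 2 ^ e ∈ finiteFloats p q :=
      mem_finiteFloats_iff.2 ⟨m + 1, e, by rw [abs_of_nonneg (by omega)]; exact hlt',
        hc.2.1, hc.2.2.1, rfl⟩
    refine ⟨⟨_, hmem⟩, ?_, ?_⟩
    · rw [h1]; push_cast; nlinarith
    · refine lt_of_le_of_ne (h1' ▸ hle) ?_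
      intro heq
      have hcw : Canon p q (m + 1) e := by
        refine ⟨by rw [abs_of_nonneg (by omega)]; exact hlt', hc.2.1, hc.2.2.1, ?_⟩
        rw [abs_of_nonneg (by omega)]
        have := hc.2.2.2
        rw [abs_of_nonneg hm0] at this
        omega
      simp only at heq
      rw [h1'] at heq
      have hm'0 : 0 ≤ m' := by
        have : (0 : ℝ) < m' * 2 ^ e' := by rw [← h1']; linarith
        have := pos_of_mul_pos_left this (by positivity)
        exact_mod_cast this.le
      -- Normal forms of a positive number are unique: with different exponents, the one with the
      -- larger exponent has mantissa at least `2 ^ p`, and the other mantissa would reach `2 ^ (p +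
      -- 1)`. With equal exponents the parities clash.
      rcases lt_trichotomy e e' with he | he | he
      · obtain ⟨k, rfl⟩ : ∃ k : ℕ, e' = e + (k + 1) := ⟨(e' - e - 1).toNat, by omega⟩
        have h5 : 2 ^ p ≤ m' := by
          have := hc'.2.2.2; rw [abs_of_nonneg hm'0] at this
          have := hc.2.1
          omega
        have : (m + 1 : ℤ) = m' * 2 ^ (k + 1) := by
          have e1 : (2 : ℝ) ^ (e + ((k : ℤ) + 1)) = 2 ^ (k + 1) * 2 ^ e := by
            rw [zpow_sub_nat (e + (k + 1)) (k + 1)]; congr 2; push_cast; ring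
          rw [e1, ← mul_assoc] at heq
          have := mul_right_cancel₀ pe.ne' heq
          exact_mod_cast this
        have : (1 : ℤ) ≤ 2 ^ k := one_le_pow₀ (by norm_num)
        rw [pow_succ] at *
        nlinarith
      · subst he
        have := mul_right_cancel₀ pe.ne' heq
        have : m + 1 = m' := by exact_mod_cast this
        exact Int.even_add_one.1 (this ▸ h2') h2
      · obtain ⟨k, rfl⟩ : ∃ k : ℕ, e = e' + (k + 1) := ⟨(e - e' - 1).toNat, by omega⟩
        have h5 : 2 ^ p ≤ m + 1 := by
          have := hcw.2.2.2; rw [abs_of_nonneg (by omega)] at this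
          have := hc'.2.1
          omega
        have pe' : (0 : ℝ) < 2 ^ e' := by positivity
        have : m' = (m + 1 : ℤ) * 2 ^ (k + 1) := by
          have e1 : (2 : ℝ) ^ (e' + ((k : ℤ) + 1)) = 2 ^ (k + 1) * 2 ^ e' := by
            rw [zpow_sub_nat (e' + (k + 1)) (k + 1)]; congr 2; push_cast; ring
          rw [e1, ← mul_assoc] at heq
          have := mul_right_cancel₀ pe'.ne' heq
          exact_mod_cast this.symm
        have h6 : (1 : ℤ) ≤ 2 ^ k := one_le_pow₀ (by norm_num)
        have h7 := hc'.1
        rw [abs_of_nonneg hm'0] at h7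
        rw [pow_succ] at *
        nlinarith
  rcases le_or_gt 0 (y : ℝ) with h0 | h0
  · exact key hy hz hlt h0
  rcases le_or_gt (z : ℝ) 0 with h1 | h1
  · obtain ⟨w, hw1, hw2⟩ := key hz.neg hy.neg (by change -(z : ℝ) < -(y : ℝ); linarith)
      (by change (0 : ℝ) ≤ -(z : ℝ); linarith)
    refine ⟨-w, ?_, ?_⟩
    · change (y : ℝ) < -(w : ℝ); change (w : ℝ) < -(y : ℝ) at hw2; linarith
    · change -(w : ℝ) < z; change -(z : ℝ) < w at hw1; linarith
  · exact ⟨0, h0, h1⟩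

/-- The successor of an odd mantissa is even, also after a carry, where it is renormalised to `2 ^
p` with the next exponent. -/
theorem exists_between_of_odd [Params p q] {y z : Flt p q} (hy : ¬ IsEvenFlt y)
    (hz : ¬ IsEvenFlt z) (hlt : (y : ℝ) < z) : ∃ w : Flt p q, (y : ℝ) < w ∧ (w : ℝ) < z := by
  obtain ⟨f1, f2, f3, f4, f5⟩ := emax_facts p q
  have key : ∀ {y z : Flt p q}, ¬ IsEvenFlt y → ¬ IsEvenFlt z → (y : ℝ) < z → 0 ≤ (y : ℝ) →
      ∃ w : Flt p q, (y : ℝ) < w ∧ (w : ℝ) < z := by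
    intro y z hy hz hlt h0
    obtain ⟨m, e, hc, h1⟩ := mem_canon y.2
    obtain ⟨m', e', hc', h1'⟩ := mem_canon z.2
    have pe : (0 : ℝ) < 2 ^ e := by positivity
    have hm0 : 0 ≤ m := by
      rw [h1] at h0
      exact_mod_cast nonneg_of_mul_nonneg_left h0 pe
    have hmo : ¬ Even m := fun hm => hy (hc.isEvenFlt h1 hm)
    have hle := hc.succ_le hm0 hc'.1 (by rw [← h1, ← h1']; exact hlt) hc'.2.1
    have hm1 : m < 2 ^ (p + 1) := by have a := hc.1; rwa [abs_of_nonneg hm0] at a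
    obtain ⟨m₁, e₁, hc₁, h₁, hev⟩ : ∃ m₁ e₁, Canon p q m₁ e₁ ∧
        ((m + 1 : ℤ) : ℝ) * 2 ^ e = m₁ * 2 ^ e₁ ∧ Even m₁ := by
      rcases lt_or_eq_of_le (show m + 1 ≤ 2 ^ (p + 1) by omega) with hm2 | hm2
      · refine ⟨m + 1, e, ⟨by rw [abs_of_nonneg (by omega)]; exact hm2, hc.2.1, hc.2.2.1, ?_⟩,
          rfl, Int.even_add_one.2 hmo⟩
        rw [abs_of_nonneg (by omega)]
        have := hc.2.2.2
        rw [abs_of_nonneg hm0] at this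
        omega
      -- A carry at the maximal exponent would exceed every float, but `z` is a float above `y`.
      · have he : e + 1 ≤ emax q - p := by
          by_contra hcon
          have he : e = emax q - p := by have := hc.2.2.1; omega
          rw [hm2] at hle
          have h5 : (m' : ℝ) < 2 ^ (p + 1) := by
            exact_mod_cast (le_abs_self m').trans_lt hc'.1
          have h6 : (2 : ℝ) ^ e' ≤ 2 ^ e :=
            zpow_le_zpow_right₀ (by norm_num) (by have := hc'.2.2.1; omega)
          have h7 : (0 : ℝ) < 2 ^ e' := by positivity
          push_cast at hle
          have : (m' : ℝ) * 2 ^ e' < 2 ^ (p + 1) * 2 ^ e' := by gcongr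
          have : (2 : ℝ) ^ (p + 1) * 2 ^ e' ≤ 2 ^ (p + 1) * 2 ^ e := by gcongr
          linarith
        refine ⟨2 ^ p, e + 1, ⟨?_, by have := hc.2.1; omega, he, Or.inl ?_⟩, ?_,
          (even_two).pow_of_ne_zero (by omega)⟩
        · rw [abs_of_nonneg (by positivity), pow_succ]
          have : (0 : ℤ) < 2 ^ p := by positivity
          omega
        · rw [abs_of_nonneg (by positivity)]
        · rw [hm2, zpow_sub_nat (e + 1) 1]; push_cast; simp [pow_succ]; ring
    have hmem : (m₁ : ℝ) * 2 ^ e₁ ∈ finiteFloats p q :=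
      mem_finiteFloats_iff.2 ⟨m₁, e₁, hc₁.1, hc₁.2.1, hc₁.2.2.1, rfl⟩
    refine ⟨⟨_, hmem⟩, ?_, ?_⟩
    · simp only; rw [h1, ← h₁]; push_cast; nlinarith
    · refine lt_of_le_of_ne (by simp only; rw [← h₁, h1']; exact hle) ?_
      intro heq
      exact hz (hc₁.isEvenFlt heq.symm hev)
  have hneg : ∀ {y : Flt p q}, ¬ IsEvenFlt y → ¬ IsEvenFlt (-y) := by
    intro y hy h
    refine hy ?_
    have := h.neg
    have e : - -y = y := Subtype.ext (neg_neg (y : ℝ))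
    rwa [e] at this
  rcases le_or_gt 0 (y : ℝ) with h0 | h0
  · exact key hy hz hlt h0
  rcases le_or_gt (z : ℝ) 0 with h1 | h1
  · obtain ⟨w, hw1, hw2⟩ := key (hneg hz) (hneg hy) (by change -(z : ℝ) < -(y : ℝ); linarith)
      (by change (0 : ℝ) ≤ -(z : ℝ); linarith)
    refine ⟨-w, ?_, ?_⟩
    · change (y : ℝ) < -(w : ℝ); change (w : ℝ) < -(y : ℝ) at hw2; linarith
    · change -(w : ℝ) < z; change -(z : ℝ) < w at hw1; linarith
  · exact ⟨0, h0, h1⟩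

/-- Two distinct floats at the same minimal distance from `x` have no float between them. -/
theorem not_between_of_tie {x : ℝ} {y z : Flt p q} (hlt : (y : ℝ) < z)
    (hy : ∀ w : Flt p q, |x - y| ≤ |x - w|) (hz : |x - z| = |x - y|) (w : Flt p q) :
    ¬ ((y : ℝ) < w ∧ (w : ℝ) < z) := by
  rintro ⟨h1, h2⟩
  have hx := hy w
  rcases abs_cases (x - y) with ⟨a, b⟩ | ⟨a, b⟩ <;> rcases abs_cases (x - z) with ⟨c, d⟩ | ⟨c, d⟩ <;>
    rcases abs_cases (x - w) with ⟨e, f⟩ | ⟨e, f⟩ <;> rw [c, a] at hz <;>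
    rw [a, e] at hx <;> linarith

/-- Finiteness gives a minimiser. In a tie between two odd floats, a float strictly between them
would be nearer. The same argument with even floats gives uniqueness below. -/
theorem exists_isNearestEven [Params p q] (x : ℝ) : ∃ y : Flt p q, IsNearestEven x y := by
  obtain ⟨y, hy⟩ := Finite.exists_min fun z : Flt p q => |x - z|
  by_cases ht : ∃ z : Flt p q, z ≠ y ∧ |x - z| = |x - y|
  · obtain ⟨z, hzy, hz⟩ := ht
    by_cases hye : IsEvenFlt y
    · exact ⟨y, hy, fun _ => hye⟩
    · refine ⟨z, fun w => hz ▸ hy w, fun _ => ?_⟩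
      by_contra hze
      rcases lt_or_gt_of_ne (fun h => hzy (Subtype.ext h) : (z : ℝ) ≠ y) with h | h
      · obtain ⟨w, hw⟩ := exists_between_of_odd hze hye h
        exact not_between_of_tie h (fun w => hz ▸ hy w) hz.symm w hw
      · obtain ⟨w, hw⟩ := exists_between_of_odd hye hze h
        exact not_between_of_tie h hy hz w hw
  · exact ⟨y, hy, fun h => absurd h ht⟩

theorem IsNearestEven.unique [Params p q] {x : ℝ} {y z : Flt p q} (hy : IsNearestEven x y)
    (hz : IsNearestEven x z) : y = z := by
  by_contra hne
  have e : |x - z| = |x - y| := le_antisymm (hz.1 y) (hy.1 z)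
  have hye := hy.2 ⟨z, fun h => hne h.symm, e⟩
  have hze := hz.2 ⟨y, hne, e.symm⟩
  rcases lt_or_gt_of_ne (fun h => hne (Subtype.ext h) : (y : ℝ) ≠ z) with h | h
  · obtain ⟨w, hw⟩ := exists_between_of_even hye hze h
    exact not_between_of_tie h hy.1 e w hw
  · obtain ⟨w, hw⟩ := exists_between_of_even hze hye h
    exact not_between_of_tie h hz.1 e.symm w hw

theorem nearestEven_spec [Params p q] (x : ℝ) : IsNearestEven x (nearestEven p q x) :=
  Classical.epsilon_spec (exists_isNearestEven x)

/-- The value of the finite float nearest to `x`. -/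
def fl (p q : ℕ) (x : ℝ) : ℝ := nearestEven p q x

theorem fl_mem (x : ℝ) : fl p q x ∈ finiteFloats p q := (nearestEven p q x).2

theorem abs_sub_fl_le [Params p q] (x : ℝ) {z : ℝ} (hz : z ∈ finiteFloats p q) :
    |x - fl p q x| ≤ |x - z| := (nearestEven_spec x).1 ⟨z, hz⟩

theorem fl_of_mem [Params p q] {x : ℝ} (hx : x ∈ finiteFloats p q) : fl p q x = x := by
  have := abs_sub_fl_le x hx
  rw [sub_self, abs_zero] at this
  have := abs_nonpos_iff.1 this
  linarith

/-- Negation preserves evenness, so ties are broken symmetrically. This oddness is inherited by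
everything that the backward pass computes. -/
theorem fl_neg [Params p q] (x : ℝ) : fl p q (-x) = -fl p q x := by
  have h := nearestEven_spec (p := p) (q := q) x
  have h' : IsNearestEven (-x) (-nearestEven p q x) := by
    have key : ∀ z : Flt p q, |-x - z| = |x - (-z : Flt p q)| := by
      intro z; change _ = |x - -(z : ℝ)|; rw [← abs_neg]; congr 1; ring
    have nn : ∀ z : Flt p q, - -z = z := fun z => Subtype.ext (neg_neg (z : ℝ))
    refine ⟨fun z => ?_, ?_⟩
    · rw [key, key, nn]; exact h.1 _
    · rintro ⟨z, hz, hz'⟩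
      rw [key, key, nn] at hz'
      exact (h.2 ⟨-z, fun e => hz (by rw [← e, nn]), hz'⟩).neg
  have := (nearestEven_spec (p := p) (q := q) (-x)).unique h'
  unfold fl
  rw [this]; rfl

/-- Bounds by floats survive rounding. With its counterpart `fl_le`, this replaces error estimates
in most places. -/
theorem le_fl [Params p q] {a x : ℝ} (ha : a ∈ finiteFloats p q) (h : a ≤ x) : a ≤ fl p q x := by
  by_contra hc
  have := abs_sub_fl_le x ha
  rw [abs_of_nonneg (by linarith), abs_of_nonneg (by linarith)] at this
  linarith

theorem fl_le [Params p q] {a x : ℝ} (ha : a ∈ finiteFloats p q) (h : x ≤ a) : fl p q x ≤ a := by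
  by_contra hc
  have := abs_sub_fl_le x ha
  rw [abs_of_nonpos (by linarith), abs_of_nonpos (by linarith)] at this
  linarith

theorem fl_mono [Params p q] {x y : ℝ} (h : x ≤ y) : fl p q x ≤ fl p q y := by
  by_contra hc
  push Not at hc
  have h1 := abs_sub_fl_le x (fl_mem (p := p) (q := q) y)
  have h2 := abs_sub_fl_le y (fl_mem (p := p) (q := q) x)
  have : x = y := by
    rcases abs_cases (x - fl p q x) with ⟨a, b⟩ | ⟨a, b⟩ <;>
    rcases abs_cases (x - fl p q y) with ⟨c, d⟩ | ⟨c, d⟩ <;>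
    rcases abs_cases (y - fl p q x) with ⟨e, f⟩ | ⟨e, f⟩ <;>
    rcases abs_cases (y - fl p q y) with ⟨g, i⟩ | ⟨g, i⟩ <;>
    rw [a, c] at h1 <;> rw [e, g] at h2 <;> linarith
  rw [this] at hc
  exact lt_irrefl _ hc

/-- The rounding of a point of an interval around a float that is free of other floats. -/
theorem fl_eq_of_near [Params p q] {a x : ℝ} (ha : a ∈ finiteFloats p q)
    (h : ∀ z ∈ finiteFloats p q, z ≠ a → |x - a| < |x - z|) : fl p q x = a := by
  by_contra hc
  have := h _ (fl_mem x) hc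
  exact absurd (abs_sub_fl_le x ha) (not_le.2 this)

/-! ### Membership -/

theorem neg_mem {x : ℝ} (hx : x ∈ finiteFloats p q) : -x ∈ finiteFloats p q :=
  neg_mem_finiteFloats hx

theorem zero_mem : (0 : ℝ) ∈ finiteFloats p q := zero_mem_finiteFloats p q

/-- The mantissa `2 ^ (p + 1)` itself is allowed because it can be renormalised, at the price of
excluding the largest exponent. -/
theorem int_mul_mem [Params p q] {m e : ℤ} (hm : |m| ≤ 2 ^ (p + 1)) (h1 : emin q - p ≤ e)
    (h2 : e < emax q - p) : (m : ℝ) * 2 ^ e ∈ finiteFloats p q := by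
  rcases lt_or_eq_of_le hm with h | h
  · exact mem_finiteFloats_iff.2 ⟨m, e, h, h1, h2.le, rfl⟩
  · have key : (2 : ℝ) ^ (p + 1) * 2 ^ e ∈ finiteFloats p q := by
      refine mem_finiteFloats_iff.2 ⟨2 ^ p, e + 1, ?_, by omega, by omega, ?_⟩
      · rw [abs_of_nonneg (by positivity), pow_succ]
        have : (0 : ℤ) < 2 ^ p := by positivity
        omega
      · rw [zpow_sub_nat (e + 1) 1]; push_cast; simp [pow_succ]; ring
    rcases abs_cases m with ⟨h3, -⟩ | ⟨h3, -⟩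
    · rw [h3] at h; rw [h]; exact_mod_cast key
    · have : m = -2 ^ (p + 1) := by omega
      rw [this]; push_cast; rw [neg_mul]; exact neg_mem key

theorem two_zpow_mem [Params p q] {e : ℤ} (h1 : emin q - p ≤ e) (h2 : e ≤ emax q) :
    (2 : ℝ) ^ e ∈ finiteFloats p q := by
  obtain ⟨f1, f2, f3, f4, f5⟩ := emax_facts p q
  rcases le_or_gt e (emax q - p) with h | h
  · refine mem_finiteFloats_iff.2 ⟨1, e, ?_, h1, h, by simp⟩
    rw [abs_one, pow_succ]
    have : (0 : ℤ) < 2 ^ p := by positivity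
    omega
  · refine mem_finiteFloats_iff.2 ⟨2 ^ p, e - p, ?_, by omega, by omega, ?_⟩
    · rw [abs_of_nonneg (by positivity), pow_succ]
      have : (0 : ℤ) < 2 ^ p := by positivity
      omega
    · rw [zpow_sub_nat e p]; push_cast; ring

theorem Omega_eq (p q : ℕ) : Omega p q = ((2 ^ (p + 1) - 1 : ℤ) : ℝ) * 2 ^ (emax q - p) := by
  unfold Omega
  rw [zpow_sub_nat (emax q) p, zpow_neg, zpow_natCast]
  push_cast; field_simp; ring

theorem Omega_mem [Params p q] : Omega p q ∈ finiteFloats p q := by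
  obtain ⟨f1, f2, f3, f4, f5⟩ := emax_facts p q
  rw [Omega_eq]
  refine mem_finiteFloats_iff.2 ⟨_, _, ?_, by omega, le_rfl, rfl⟩
  have : (0 : ℤ) < 2 ^ p := by positivity
  rw [abs_of_nonneg (by rw [pow_succ]; omega)]; omega

theorem abs_le_Omega [Params p q] {x : ℝ} (hx : x ∈ finiteFloats p q) : |x| ≤ Omega p q := by
  obtain ⟨m, e, h1, h2, h3, rfl⟩ := mem_finiteFloats_iff.1 hx
  rw [Omega_eq, abs_mul, abs_of_pos (by positivity : (0 : ℝ) < 2 ^ e), ← Int.cast_abs]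
  have a : |m| ≤ 2 ^ (p + 1) - 1 := by omega
  have a' : ((|m| : ℤ) : ℝ) ≤ ((2 ^ (p + 1) - 1 : ℤ) : ℝ) := by exact_mod_cast a
  have b : (2 : ℝ) ^ e ≤ 2 ^ (emax q - p) := zpow_le_zpow_right₀ (by norm_num) h3
  have c : (0 : ℝ) ≤ ((2 ^ (p + 1) - 1 : ℤ) : ℝ) :=
    le_trans (by exact_mod_cast abs_nonneg m) a'
  exact mul_le_mul a' b (by positivity) c

theorem Omega_lt (p q : ℕ) : Omega p q < 2 ^ (emax q + 1) := by
  rw [zpow_add_one₀ (by norm_num)]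
  unfold Omega
  have : (0 : ℝ) < 2 ^ (-(p : ℤ)) := by positivity
  have : (0 : ℝ) < 2 ^ (emax q) := by positivity
  nlinarith

theorem three_halves_le_Omega [Params p q] : 3 / 2 * (2 : ℝ) ^ emax q ≤ Omega p q := by
  obtain ⟨f1, f2, f3, f4, f5⟩ := emax_facts p q
  unfold Omega
  have : (2 : ℝ) ^ (-(p : ℤ)) ≤ 2 ^ (-1 : ℤ) := zpow_le_zpow_right₀ (by norm_num) (by omega)
  have : (0 : ℝ) < 2 ^ (emax q) := by positivity
  norm_num at *
  nlinarith

theorem two_zpow_le_Omega [Params p q] {e : ℤ} (h2 : e ≤ emax q) : (2 : ℝ) ^ e ≤ Omega p q := by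
  have h := three_halves_le_Omega (p := p) (q := q)
  have : (2 : ℝ) ^ e ≤ 2 ^ (emax q) := zpow_le_zpow_right₀ (by norm_num) h2
  have : (0 : ℝ) < 2 ^ (emax q) := by positivity
  linarith

theorem Omega_pos [Params p q] : 0 < Omega p q :=
  lt_of_lt_of_le (by positivity) (two_zpow_le_Omega le_rfl)

/-- Scaling up by a power of two. -/
theorem mul_two_pow_mem [Params p q] {x : ℝ} (hx : x ∈ finiteFloats p q) (k : ℕ)
    (h : |x * 2 ^ k| ≤ Omega p q) : x * 2 ^ k ∈ finiteFloats p q := by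
  obtain ⟨f1, f2, f3, f4, f5⟩ := emax_facts p q
  by_cases h0 : x = 0
  · rw [h0, zero_mul]; exact zero_mem
  induction k with
  | zero => simpa using hx
  | succ k ih =>
    have hk : x * 2 ^ k ∈ finiteFloats p q := by
      apply ih
      refine le_trans ?_ h
      rw [abs_mul, abs_mul, pow_succ]
      refine mul_le_mul_of_nonneg_left ?_ (abs_nonneg _)
      rw [abs_mul]
      exact le_mul_of_one_le_right (abs_nonneg _) (by norm_num)
    obtain ⟨m, e, hc, he⟩ := mem_canon hk
    have e1 : x * 2 ^ (k + 1) = m * 2 ^ (e + 1) := by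
      rw [pow_succ, ← mul_assoc, he, zpow_add_one₀ (by norm_num)]; ring
    rw [e1] at h ⊢
    refine mem_finiteFloats_iff.2 ⟨m, e + 1, hc.1, by have := hc.2.1; omega, ?_, rfl⟩
    by_contra hcon
    have he' : e = emax q - p := by have := hc.2.2.1; omega
    have hm : 2 ^ p ≤ |m| := by have := hc.2.2.2; omega
    have hm' : (2 : ℝ) ^ p ≤ ((|m| : ℤ) : ℝ) := by exact_mod_cast hm
    rw [abs_mul, ← Int.cast_abs, abs_of_pos (by positivity : (0 : ℝ) < 2 ^ (e + 1))] at h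
    have : (2 : ℝ) ^ p * 2 ^ (e + 1) ≤ Omega p q := le_trans (by gcongr) h
    have e2 : (2 : ℝ) ^ p * 2 ^ (e + 1) = 2 ^ (emax q + 1) := by
      rw [zpow_sub_nat (emax q + 1) p, he']; congr 2; ring
    rw [e2] at this
    exact absurd (Omega_lt p q) (not_lt.2 this)

theorem mul_two_zpow_mem [Params p q] {x : ℝ} (hx : x ∈ finiteFloats p q) {k : ℤ} (hk : 0 ≤ k)
    (h : |x * 2 ^ k| ≤ Omega p q) : x * 2 ^ k ∈ finiteFloats p q := by
  lift k to ℕ using hk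
  simp only [zpow_natCast] at *
  exact mul_two_pow_mem hx k h

/-- The smallest positive float. -/
def eps (p q : ℕ) : ℝ := (2 : ℝ) ^ (emin q - p)

theorem eps_pos : 0 < eps p q := by unfold eps; positivity

theorem exists_int_eps [Params p q] {x : ℝ} (hx : x ∈ finiteFloats p q) :
    ∃ (m : ℤ) (i : ℕ), |m| < 2 ^ (p + 1) ∧ x = ((m * 2 ^ i : ℤ) : ℝ) * eps p q := by
  obtain ⟨m, e, h1, h2, h3, rfl⟩ := mem_finiteFloats_iff.1 hx
  obtain ⟨i, rfl⟩ : ∃ i : ℕ, e = emin q - p + i := ⟨(e - (emin q - p)).toNat, by omega⟩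
  refine ⟨m, i, h1, ?_⟩
  unfold eps
  rw [zpow_sub_nat (emin q - p + i) i, add_sub_cancel_right]; push_cast; ring

theorem int_mul_eps_mem [Params p q] {n : ℤ} (h : |n| ≤ 2 ^ (p + 1)) :
    (n : ℝ) * eps p q ∈ finiteFloats p q := by
  obtain ⟨f1, f2, f3, f4, f5⟩ := emax_facts p q
  exact int_mul_mem h le_rfl (by omega)

theorem eps_mem [Params p q] : eps p q ∈ finiteFloats p q := by
  have := int_mul_eps_mem (p := p) (q := q) (n := 1) (by rw [abs_one]; exact one_le_pow₀ (by norm_num))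
  simpa using this

theorem eps_le_abs [Params p q] {x : ℝ} (hx : x ∈ finiteFloats p q) (h0 : x ≠ 0) :
    eps p q ≤ |x| := by
  obtain ⟨m, i, -, rfl⟩ := exists_int_eps hx
  have h1 : m * 2 ^ i ≠ 0 := by
    intro h; rw [h] at h0; simp at h0
  have h2 : 1 ≤ |m * 2 ^ i| := Int.one_le_abs h1
  rw [abs_mul, abs_of_pos (eps_pos (p := p) (q := q)), ← Int.cast_abs]
  have h3 : (1 : ℝ) ≤ ((|m * 2 ^ i| : ℤ) : ℝ) := by exact_mod_cast h2
  have := eps_pos (p := p) (q := q)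
  nlinarith

/-- Floats of size at least `2 ^ e` are multiples of `2 ^ (e - p)`; hence the gaps. -/
theorem gap_of_le_abs [Params p q] {x y : ℝ} (hx : x ∈ finiteFloats p q)
    (hy : y ∈ finiteFloats p q) {e : ℤ} (h1 : 2 ^ e ≤ |x|) (h2 : 2 ^ e ≤ |y|)
    (hxy : x ≠ y) : 2 ^ (e - p) ≤ |x - y| := by
  have key : ∀ z ∈ finiteFloats p q, 2 ^ e ≤ |z| → ∃ n : ℤ, z = n * 2 ^ (e - p) := by
    intro z hz hle
    obtain ⟨m, f, h1, h2, h3, rfl⟩ := mem_finiteFloats_iff.1 hz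
    have hf : e - p ≤ f := by
      by_contra hcon
      rw [abs_mul, abs_of_pos (by positivity : (0 : ℝ) < 2 ^ f), ← Int.cast_abs] at hle
      have a : ((|m| : ℤ) : ℝ) < 2 ^ (p + 1) := by exact_mod_cast h1
      have b : (2 : ℝ) ^ f ≤ 2 ^ (e - p - 1) := zpow_le_zpow_right₀ (by norm_num) (by omega)
      have c : (2 : ℝ) ^ e = 2 ^ (p + 1) * 2 ^ (e - p - 1) := by
        rw [zpow_sub_nat e (p + 1)]; congr 2; push_cast; ring
      have d : (0 : ℝ) < 2 ^ f := by positivity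
      have : ((|m| : ℤ) : ℝ) * 2 ^ f < 2 ^ (p + 1) * 2 ^ f := by gcongr
      have : (2 : ℝ) ^ (p + 1) * 2 ^ f ≤ 2 ^ (p + 1) * 2 ^ (e - p - 1) := by gcongr
      linarith
    obtain ⟨i, hi⟩ : ∃ i : ℕ, f = e - p + i := ⟨(f - (e - p)).toNat, by omega⟩
    refine ⟨m * 2 ^ i, ?_⟩
    rw [hi, zpow_sub_nat (e - p + i) i, add_sub_cancel_right]; push_cast; ring
  obtain ⟨n, rfl⟩ := key x hx h1
  obtain ⟨n', rfl⟩ := key y hy h2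
  have pe : (0 : ℝ) < 2 ^ (e - p) := by positivity
  have hn : n - n' ≠ 0 := by
    intro h
    apply hxy
    have : n = n' := by omega
    rw [this]
  have : (1 : ℝ) ≤ ((|n - n'| : ℤ) : ℝ) := by exact_mod_cast Int.one_le_abs hn
  rw [← sub_mul, abs_mul, abs_of_pos pe, ← Int.cast_sub, ← Int.cast_abs]
  nlinarith

/-- Absorption: a perturbation of `a` by less than half the gap below is rounded off. -/
theorem fl_eq_of_abs_sub_lt [Params p q] {a x : ℝ} (ha : a ∈ finiteFloats p q) {e : ℤ}
    (h1 : 2 ^ (e + 1) ≤ |a|) (h : |x - a| < 2 ^ (e - p) / 2) : fl p q x = a := by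
  refine fl_eq_of_near ha fun z hz hza => ?_
  -- The spare binade in `h1` covers the floats just below a power of two, where the spacing is
  -- halved.
  have h2 : (2 : ℝ) ^ (e - p) ≤ |z - a| := by
    by_cases hc : 2 ^ e ≤ |z|
    · refine gap_of_le_abs hz ha hc (le_trans ?_ h1) hza
      exact zpow_le_zpow_right₀ (by norm_num) (by omega)
    · have h3 : |a| - |z| ≤ |z - a| := by
        rw [abs_sub_comm]; exact abs_sub_abs_le_abs_sub a z
      have h4 : (2 : ℝ) ^ (e - p) ≤ 2 ^ e := zpow_le_zpow_right₀ (by norm_num) (by omega)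
      have h5 : (2 : ℝ) ^ (e + 1) = 2 * 2 ^ e := by rw [zpow_add_one₀ (by norm_num)]; ring
      push Not at hc
      linarith
  have h3 : |z - a| ≤ |x - z| + |x - a| := by
    have := abs_add_le (z - x) (x - a)
    rw [abs_sub_comm z x] at this
    simpa using this
  linarith

theorem fl_eq_zero_of_abs_lt [Params p q] {x : ℝ} (h : |x| < eps p q / 2) : fl p q x = 0 := by
  refine fl_eq_of_near zero_mem fun z hz hz0 => ?_
  have h1 := eps_le_abs hz hz0
  have h2 : |z| ≤ |x - z| + |x| := by
    have := abs_add_le (z - x) x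
    rw [abs_sub_comm z x] at this
    simpa using this
  rw [sub_zero]; linarith

/-! ### Finite values of extended floats -/

/-- The extended float `z` is finite with value `r`. -/
def Val (z : ExtFlt p q) (r : ℝ) : Prop := ∃ h : r ∈ finiteFloats p q, z = .finite ⟨r, h⟩

theorem Val.mem {z : ExtFlt p q} {r : ℝ} (h : Val z r) : r ∈ finiteFloats p q := h.1

theorem Val.unique {z : ExtFlt p q} {r s : ℝ} (h : Val z r) (h' : Val z s) : r = s := by
  obtain ⟨h1, rfl⟩ := h
  obtain ⟨h2, h3⟩ := h'
  simpa using h3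

theorem Val.eq {z z' : ExtFlt p q} {r : ℝ} (h : Val z r) (h' : Val z' r) : z = z' := by
  obtain ⟨h1, rfl⟩ := h
  obtain ⟨h2, rfl⟩ := h'
  rfl

theorem Val.congr {z : ExtFlt p q} {r s : ℝ} (h : Val z r) (e : r = s) : Val z s := e ▸ h

theorem val_finite (x : Flt p q) : Val (.finite x) (x : ℝ) := ⟨x.2, rfl⟩

theorem val_mk {x : ℝ} (hx : x ∈ finiteFloats p q) : Val (.finite ⟨x, hx⟩) x := ⟨hx, rfl⟩

theorem val_zero : Val (0 : ExtFlt p q) 0 := val_finite 0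

theorem Val.eq_zero {z : ExtFlt p q} (h : Val z 0) : z = 0 := h.eq val_zero

theorem Val.eq_finite {z : ExtFlt p q} {x : Flt p q} (h : Val z (x : ℝ)) : z = .finite x :=
  h.eq (val_finite x)

theorem val_round_of_lt [Params p q] {x : ℝ}
    (h : |x| < Omega p q + (2 : ℝ) ^ (emax q - p - 1)) : Val (round p q x) (fl p q x) := by
  unfold round
  rw [if_pos h]
  exact val_finite _

theorem val_round [Params p q] {x : ℝ} (h : |x| ≤ Omega p q) : Val (round p q x) (fl p q x) :=
  val_round_of_lt (h.trans_lt (by linarith [show (0 : ℝ) < 2 ^ (emax q - p - 1) by positivity]))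

theorem val_round_mem [Params p q] {x : ℝ} (h : x ∈ finiteFloats p q) : Val (round p q x) x := by
  have := val_round (abs_le_Omega h)
  rwa [fl_of_mem h] at this

theorem Val.add [Params p q] {a b : ExtFlt p q} {r s : ℝ} (ha : Val a r) (hb : Val b s)
    (h : |r + s| ≤ Omega p q) : Val (a.add b) (fl p q (r + s)) := by
  obtain ⟨h1, rfl⟩ := ha
  obtain ⟨h2, rfl⟩ := hb
  exact val_round h

theorem Val.add_mem [Params p q] {a b : ExtFlt p q} {r s : ℝ} (ha : Val a r) (hb : Val b s)
    (h : r + s ∈ finiteFloats p q) : Val (a.add b) (r + s) := by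
  have := ha.add hb (abs_le_Omega h)
  rwa [fl_of_mem h] at this

theorem Val.mul [Params p q] {a b : ExtFlt p q} {r s : ℝ} (ha : Val a r) (hb : Val b s)
    (h : |r * s| ≤ Omega p q) : Val (a.mul b) (fl p q (r * s)) := by
  obtain ⟨h1, rfl⟩ := ha
  obtain ⟨h2, rfl⟩ := hb
  exact val_round h

theorem Val.mul_mem [Params p q] {a b : ExtFlt p q} {r s : ℝ} (ha : Val a r) (hb : Val b s)
    (h : r * s ∈ finiteFloats p q) : Val (a.mul b) (r * s) := by
  have := ha.mul hb (abs_le_Omega h)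
  rwa [fl_of_mem h] at this

theorem Val.mul_zero [Params p q] {a : ExtFlt p q} {r : ℝ} (ha : Val a r) : a.mul 0 = 0 := by
  have := ha.mul_mem val_zero (by rw [MulZeroClass.mul_zero]; exact zero_mem)
  rw [MulZeroClass.mul_zero] at this
  exact this.eq_zero

theorem Val.zero_mul [Params p q] {a : ExtFlt p q} {r : ℝ} (ha : Val a r) :
    (0 : ExtFlt p q).mul a = 0 := by
  have := val_zero.mul_mem ha (by rw [MulZeroClass.zero_mul]; exact zero_mem)
  rw [MulZeroClass.zero_mul] at this
  exact this.eq_zero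

theorem ExtFlt.add_zero [Params p q] (a : ExtFlt p q) : a.add 0 = a := by
  cases a with
  | finite x =>
    have := (val_finite x).add_mem val_zero (by rw [_root_.add_zero]; exact x.2)
    rw [_root_.add_zero] at this
    exact this.eq_finite
  | _ => rfl

/-- Addition is commutative though not associative; this is what makes sums of two terms independent
of their order. -/
theorem ExtFlt.add_comm (a b : ExtFlt p q) : a.add b = b.add a := by
  cases a <;> cases b <;> simp [ExtFlt.add, _root_.add_comm]

theorem ExtFlt.zero_add [Params p q] (a : ExtFlt p q) : (0 : ExtFlt p q).add a = a := by
  rw [ExtFlt.add_comm, ExtFlt.add_zero]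

/-- `z` is negative infinity or finite of value at most `r`. -/
def AtMost (z : ExtFlt p q) (r : ℝ) : Prop := z = .negInf ∨ ∃ s ≤ r, Val z s

theorem Val.atMost {z : ExtFlt p q} {r s : ℝ} (h : Val z s) (hs : s ≤ r) : AtMost z r :=
  Or.inr ⟨s, hs, h⟩

theorem AtMost.mono {z : ExtFlt p q} {r s : ℝ} (h : AtMost z r) (hs : r ≤ s) : AtMost z s := by
  rcases h with h | ⟨t, ht, h⟩
  · exact Or.inl h
  · exact Or.inr ⟨t, ht.trans hs, h⟩

/-- Rounding respects upper bounds that are floats. -/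
theorem atMost_round [Params p q] {x r : ℝ} (hr : r ∈ finiteFloats p q) (h : x ≤ r) :
    AtMost (round p q x) r := by
  by_cases hx : |x| < Omega p q + (2 : ℝ) ^ (emax q - p - 1)
  · exact (val_round_of_lt hx).atMost (fl_le hr h)
  · left
    unfold round
    rw [if_neg hx, if_neg]
    intro h0
    rw [abs_of_pos h0] at hx
    have := (le_abs_self r).trans (abs_le_Omega hr)
    have : (0 : ℝ) < 2 ^ (emax q - p - 1) := by positivity
    linarith

theorem AtMost.add [Params p q] {a b : ExtFlt p q} {r s t : ℝ} (ha : AtMost a r) (hb : AtMost b s)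
    (ht : t ∈ finiteFloats p q) (h : r + s ≤ t) : AtMost (a.add b) t := by
  rcases ha with rfl | ⟨r', hr, hr1, rfl⟩ <;> rcases hb with rfl | ⟨s', hs, hs1, rfl⟩
  · exact Or.inl rfl
  · exact Or.inl rfl
  · exact Or.inl rfl
  · exact atMost_round ht (by simp only; linarith)

theorem Val.atMost_mul [Params p q] {a b : ExtFlt p q} {r s t : ℝ} (ha : Val a r) (hb : Val b s)
    (ht : t ∈ finiteFloats p q) (h : r * s ≤ t) : AtMost (a.mul b) t := by
  obtain ⟨h1, rfl⟩ := ha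
  obtain ⟨h2, rfl⟩ := hb
  exact atMost_round ht h

/-! ### Sums in unspecified order -/

/-- The left-associative sum of a list. -/
def lsum (l : List (ExtFlt p q)) : ExtFlt p q := l.foldl ExtFlt.add 0

theorem lsum_concat (l : List (ExtFlt p q)) (a : ExtFlt p q) :
    lsum (l ++ [a]) = (lsum l).add a := by
  simp [lsum]

theorem fsum_eq_lsum {n : ℕ} (x : Fin n → ExtFlt p q) : fsum x = lsum (List.ofFn x) := by
  induction n with
  | zero => simp [fsum, lsum]
  | succ n ih =>
    rw [List.ofFn_succ', List.concat_eq_append, lsum_concat, ← ih]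
    rfl

theorem fsum_get {ι : Type*} (l : List ι) (f : ι → ExtFlt p q) :
    fsum (fun k : Fin l.length => f (l.get k)) = lsum (l.map f) := by
  rw [fsum_eq_lsum]
  congr 1
  have := List.ofFn_get l
  conv_rhs => rw [← this]
  rw [List.map_ofFn]; rfl

/-- `s` is the sum of the family `f`, zero terms being optional, in some order. -/
def IsSum {ι : Type*} (f : ι → ExtFlt p q) (s : ExtFlt p q) : Prop :=
  ∃ l : List ι, l.Nodup ∧ (∀ i, f i ≠ 0 → i ∈ l) ∧ lsum (l.map f) = s

/-- Zero is neutral and addition commutative, so at most two nonzero terms can be added in any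
order. The induction records which of the two indices have already occurred. -/
theorem IsSum.pair [Params p q] {ι : Type*} {f : ι → ExtFlt p q} {s : ExtFlt p q}
    (h : IsSum f s) (a b : ι) (hab : a ≠ b) (h0 : ∀ i, i ≠ a → i ≠ b → f i = 0) :
    s = (f a).add (f b) := by
  classical
  obtain ⟨l, hl, hc, rfl⟩ := h
  have key : ∀ l : List ι, l.Nodup → lsum (l.map f) =
      (if a ∈ l then f a else 0).add (if b ∈ l then f b else 0) := by
    intro l
    induction l using List.reverseRecOn with
    | nil => intro _; simp [lsum, ExtFlt.add_zero]
    | append_singleton l i ih =>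
      intro hl
      rw [List.nodup_append] at hl
      obtain ⟨h1, -, h2⟩ := hl
      have hi : i ∉ l := fun hi => h2 i hi i (by simp) rfl
      rw [List.map_append, List.map_singleton, lsum_concat, ih h1]
      by_cases hia : i = a
      · subst hia
        have e : (b ∈ l ++ [i]) = (b ∈ l) := by simp [hab.symm]
        rw [if_neg hi, ExtFlt.zero_add, if_pos (show i ∈ l ++ [i] by simp), ExtFlt.add_comm]
        simp only [e]
      · by_cases hib : i = b
        · subst hib
          have e : (a ∈ l ++ [i]) = (a ∈ l) := by simp [hab]
          rw [if_neg hi, ExtFlt.add_zero, if_pos (show i ∈ l ++ [i] by simp)]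
          simp only [e]
        · rw [h0 i hia hib, ExtFlt.add_zero]
          congr 1
          · simp [Ne.symm hia]
          · simp [Ne.symm hib]
  rw [key l hl]
  congr 1
  · split_ifs with h
    · rfl
    · by_contra h'; exact h (hc a (Ne.symm h'))
  · split_ifs with h
    · rfl
    · by_contra h'; exact h (hc b (Ne.symm h'))

theorem lsum_eq_zero [Params p q] (l : List (ExtFlt p q)) (h : ∀ z ∈ l, z = 0) : lsum l = 0 := by
  induction l using List.reverseRecOn with
  | nil => rfl
  | append_singleton l i ih =>
    rw [lsum_concat, ih fun z hz => h z (by simp [hz]), h i (by simp), ExtFlt.add_zero]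

theorem IsSum.single [Params p q] {ι : Type*} {f : ι → ExtFlt p q} {s : ExtFlt p q}
    (h : IsSum f s) (a : ι) (h0 : ∀ i, i ≠ a → f i = 0) : s = f a := by
  by_cases hb : ∃ b, b ≠ a
  · obtain ⟨b, hb⟩ := hb
    rw [h.pair a b hb.symm fun i hi _ => h0 i hi, h0 b hb, ExtFlt.add_zero]
  · push Not at hb
    obtain ⟨l, hl, hc, rfl⟩ := h
    match l, hl with
    | [], _ =>
      by_contra h'
      simpa using hc a (by simpa [lsum] using Ne.symm h')
    | [b], _ =>
      rw [hb b]
      simp [lsum, ExtFlt.zero_add]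
    | b :: c :: l, hl =>
      rw [hb b, hb c] at hl
      simp at hl

theorem IsSum.zero [Params p q] {ι : Type*} {f : ι → ExtFlt p q} {s : ExtFlt p q}
    (h : IsSum f s) (h0 : ∀ i, f i = 0) : s = 0 := by
  obtain ⟨l, hl, hc, rfl⟩ := h
  apply lsum_eq_zero
  intro z hz
  obtain ⟨i, -, rfl⟩ := List.mem_map.1 hz
  exact h0 i

/-- Restriction of a sum to a set of indices that contains the nonzero terms. -/
theorem IsSum.comp [Params p q] {ι κ : Type*} {f : ι → ExtFlt p q} {s : ExtFlt p q}
    (h : IsSum f s) (g : κ → ι) (hg : g.Injective) (h0 : ∀ i, (∀ k, g k ≠ i) → f i = 0) :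
    IsSum (fun k => f (g k)) s := by
  classical
  obtain ⟨l, hl, hc, rfl⟩ := h
  let r : ι → Option κ := fun i => if h : ∃ k, g k = i then some h.choose else none
  have hr : ∀ i k, r i = some k ↔ g k = i := by
    intro i k
    simp only [r]
    split_ifs with h
    · constructor
      · intro e
        rw [← Option.some.inj e]; exact h.choose_spec
      · intro e
        congr 1
        exact hg (h.choose_spec.trans e.symm)
    · simp only [false_iff]
      exact fun e => h ⟨k, e⟩
  refine ⟨l.filterMap r, ?_, ?_, ?_⟩
  · refine hl.filterMap ?_
    intro a a' b hb hb'
    exact ((hr _ _).1 hb).symm.trans ((hr _ _).1 hb')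
  · intro k hk
    rw [List.mem_filterMap]
    exact ⟨g k, hc _ hk, (hr _ _).2 rfl⟩
  · clear hc hl
    induction l using List.reverseRecOn with
    | nil => rfl
    | append_singleton l i ih =>
      rw [List.filterMap_append, List.map_append, List.map_append, List.map_singleton, lsum_concat,
        ← ih]
      cases hi : r i with
      | none =>
        have : f i = 0 := h0 i fun k hk => by
          rw [(hr i k).2 hk] at hi; simp at hi
        simp [hi, this, ExtFlt.add_zero]
      | some k =>
        simp [hi, lsum_concat, (hr i k).1 hi]

/-- A sum of multiples of `u` is exact, in any order, if all small multiples of `u` are floats. -/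
theorem IsSum.exact [Params p q] {ι : Type*} [Fintype ι] {f : ι → ExtFlt p q} {s : ExtFlt p q}
    (h : IsSum f s) (n : ι → ℤ) (u : ℝ) (hf : ∀ i, Val (f i) (n i * u))
    (hB : ∀ k : ℤ, |k| ≤ ∑ i, |n i| → (k : ℝ) * u ∈ finiteFloats p q) :
    Val s ((∑ i, n i : ℤ) * u) := by
  classical
  obtain ⟨l, hl, hc, rfl⟩ := h
  by_cases hu : u = 0
  · subst hu
    have : ∀ i, f i = 0 := fun i => ((hf i).congr (by simp)).eq_zero
    rw [lsum_eq_zero]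
    · simpa using val_zero
    · intro z hz
      obtain ⟨i, -, rfl⟩ := List.mem_map.1 hz
      exact this i
  have key : ∀ l : List ι, l.Nodup →
      Val (lsum (l.map f)) (((l.map n).sum : ℤ) * u) := by
    intro l
    induction l using List.reverseRecOn with
    | nil => intro _; simpa [lsum] using val_zero
    | append_singleton l i ih =>
      intro hl
      have hl' := hl
      rw [List.nodup_append] at hl
      rw [List.map_append, List.map_singleton, lsum_concat]
      have e : (((l.map n).sum : ℤ) : ℝ) * u + n i * u =
          (((l ++ [i]).map n).sum : ℤ) * u := by
        simp; ring
      refine ((ih hl.1).add_mem (hf i) ?_).congr e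
      rw [e]
      apply hB
      -- A partial sum runs over a set of indices, so its coefficient is bounded by the sum of all
      -- absolute values, and the hypothesis on floats applies to it.
      calc |((l ++ [i]).map n).sum| = |∑ j ∈ (l ++ [i]).toFinset, n j| := by
            rw [List.sum_toFinset _ hl']
        _ ≤ ∑ j ∈ (l ++ [i]).toFinset, |n j| := Finset.abs_sum_le_sum_abs _ _
        _ ≤ ∑ j, |n j| :=
            Finset.sum_le_sum_of_subset_of_nonneg (Finset.subset_univ _) fun _ _ _ => abs_nonneg _
  have e : (l.map n).sum = ∑ i, n i := by
    rw [← List.sum_toFinset _ hl]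
    apply Finset.sum_subset (Finset.subset_univ _)
    intro i _ hi
    by_contra hn
    refine hi (List.mem_toFinset.2 (hc i fun hz => hn ?_))
    have := (hf i).unique (hz ▸ val_zero)
    have : (n i : ℝ) = 0 := by
      rcases mul_eq_zero.1 this with h | h
      · exact h
      · exact absurd h hu
    exact_mod_cast this
  rw [← e]
  exact key l hl

/-- With nonpositive terms the partial sums never rise above zero, and never above `r` once the term
at `a` has been added; an overflow to negative infinity is harmless. -/
theorem IsSum.atMost [Params p q] {ι : Type*} {f : ι → ExtFlt p q} {s : ExtFlt p q}
    (h : IsSum f s) (hf : ∀ i, AtMost (f i) 0) (a : ι) {r : ℝ} (hr : r ∈ finiteFloats p q)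
    (ha : AtMost (f a) r) : AtMost s r := by
  obtain ⟨l, hl, hc, rfl⟩ := h
  have key : ∀ l : List ι, AtMost (lsum (l.map f)) 0 ∧ (a ∈ l → AtMost (lsum (l.map f)) r) := by
    intro l
    induction l using List.reverseRecOn with
    | nil => exact ⟨(val_zero (p := p) (q := q)).atMost le_rfl, by simp⟩
    | append_singleton l i ih =>
      rw [List.map_append, List.map_singleton, lsum_concat]
      refine ⟨ih.1.add (hf i) zero_mem (by simp), fun hm => ?_⟩
      rw [List.mem_append, List.mem_singleton] at hm
      rcases hm with hm | rfl
      · exact (ih.2 hm).add (hf i) hr (by simp)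
      · exact ih.1.add ha hr (by simp)
  by_cases hal : a ∈ l
  · exact (key l).2 hal
  · have h0 : f a = 0 := by by_contra hn; exact hal (hc a hn)
    rw [h0] at ha
    rcases ha with ha | ⟨t, ht, ha⟩
    · cases ha
    · have := ha.unique val_zero
      exact (key l).1.mono (by linarith)

/-! ### Building networks layer by layer -/

theorem isSum_fsum {n : ℕ} (x : Fin n → ExtFlt p q) : IsSum x (fsum x) :=
  ⟨List.finRange n, List.nodup_finRange n, fun i _ => List.mem_finRange i, by
    rw [fsum_eq_lsum, List.ofFn_eq_map]⟩

theorem isSum_fsum_get {ι : Type*} {l : List ι} (h1 : l.Nodup) (h2 : ∀ i, i ∈ l)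
    (f : ι → ExtFlt p q) : IsSum f (fsum fun k : Fin l.length => f (l.get k)) :=
  ⟨l, h1, fun i _ => h2 i, (fsum_get l f).symm⟩

theorem vecMul_diagonal [Params p q] {n : ℕ} (g d : Fin n → ExtFlt p q)
    (hg : ∀ i, ∃ r, Val (g i) r) (j : Fin n) :
    vecMul g (Matrix.diagonal d) j = (g j).mul (d j) := by
  have := (isSum_fsum fun i => (g i).mul (Matrix.diagonal d i j)).single j fun i hi => by
    obtain ⟨r, hr⟩ := hg i
    rw [Matrix.diagonal_apply_ne _ hi, hr.mul_zero]
  rw [Matrix.diagonal_apply_eq] at this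
  exact this

/-- There is a network with `t` layers that maps activations `h` with `V x h` to `F x`, and whose
gradient there satisfies `G x y`. The neurons are indexed by `ι`, in some order. -/
def Realizes (a : Activation) {X : Type} (F : X → Flt p q) (t : ℕ) {ι : Type}
    (V : X → (ι → ExtFlt p q) → Prop) (G : X → Flt p q → (ι → ExtFlt p q) → Prop) : Prop :=
  ∃ (l : List ι) (f : Network p q t l.length 1), l.Nodup ∧ (∀ i, i ∈ l) ∧
    ∀ x (y : Flt p q), |(y : ℝ)| ≤ a.gradBound p q → ∀ h, V x h →
      (f.eval a (fun k => h (l.get k)) = fun _ => .finite (F x)) ∧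
      ∃ g, G x y g ∧ ∀ k, f.grad a (fun k => h (l.get k)) (fun _ => .finite y) k = g (l.get k)

theorem isSum_fsum_equiv {ι : Type*} {n : ℕ} (e : Fin n ≃ ι) (f : ι → ExtFlt p q) :
    IsSum f (fsum fun k => f (e k)) :=
  ⟨List.ofFn e, List.nodup_ofFn.2 e.injective,
    fun i _ => List.mem_ofFn.2 ⟨e.symm i, e.apply_symm_apply i⟩, by
    rw [fsum_eq_lsum, List.map_ofFn]; rfl⟩

/-- Adding a layer at the input side, with the inputs in a given order. -/
theorem Realizes.exists_network [Params p q] {a : Activation} {X : Type} {F : X → Flt p q} {t : ℕ}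
    {ι κ : Type} [Nonempty κ] {V : X → (κ → ExtFlt p q) → Prop}
    {G : X → Flt p q → (κ → ExtFlt p q) → Prop} (hR : Realizes a F t V G)
    {V' : X → (ι → ExtFlt p q) → Prop} {G' : X → Flt p q → (ι → ExtFlt p q) → Prop}
    (w : κ → ι → Flt p q) (b : κ → Flt p q)
    (hs : ∀ x h, V' x h → ∀ S : κ → ExtFlt p q,
      (∀ k, IsSum (fun i => (ExtFlt.finite (w k i)).mul (h i)) (S k)) →
      V x (fun k => a.act p q ((S k).add (.finite (b k)))) ∧
      ∀ y : Flt p q, |(y : ℝ)| ≤ a.gradBound p q → ∀ g, G x y g → (∀ k, ∃ r, Val (g k) r) ∧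
        ∀ out : ι → ExtFlt p q, (∀ i, IsSum (fun k =>
          ((g k).mul (a.actDeriv p q ((S k).add (.finite (b k))))).mul (.finite (w k i)))
            (out i)) → G' x y out) {n : ℕ} (e : Fin n ≃ ι) :
    ∃ f : Network p q (t + 1) n 1,
      ∀ x (y : Flt p q), |(y : ℝ)| ≤ a.gradBound p q → ∀ h, V' x h →
        (f.eval a (fun k => h (e k)) = fun _ => .finite (F x)) ∧
        ∃ g, G' x y g ∧ ∀ k, f.grad a (fun k => h (e k)) (fun _ => .finite y) k = g (e k) := by
  obtain ⟨l, f, hl, hc, hf⟩ := hR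
  have hpos : 0 < l.length := by
    obtain ⟨k⟩ := ‹Nonempty κ›
    exact List.length_pos_of_mem (hc k)
  let ρ : Affine p q n l.length := ⟨fun k i => w (l.get k) (e i), fun k => b (l.get k)⟩
  refine ⟨.cons hpos ρ f, fun x y hy h hV => ?_⟩
  let S : κ → ExtFlt p q := fun k => fsum fun i : Fin n => (ExtFlt.finite (w k (e i))).mul (h (e i))
  have hS : ∀ k, IsSum (fun i => (ExtFlt.finite (w k i)).mul (h i)) (S k) := fun k =>
    isSum_fsum_equiv e fun i => (ExtFlt.finite (w k i)).mul (h i)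
  have hev : ∀ k, ρ.eval (fun i => h (e i)) k =
      (S (l.get k)).add (.finite (b (l.get k))) := fun k => rfl
  obtain ⟨h1, h2⟩ := hs x h hV S hS
  obtain ⟨h3, g, hg, hgk⟩ := hf x y hy _ h1
  obtain ⟨h4, h5⟩ := h2 y hy g hg
  refine ⟨?_, ?_⟩
  · rw [Network.eval]
    simp only [hev]
    exact h3
  · refine ⟨fun i => fsum fun k : Fin l.length => ((g (l.get k)).mul (a.actDeriv p q
      ((S (l.get k)).add (.finite (b (l.get k)))))).mul (.finite (w (l.get k) i)), h5 _ ?_, ?_⟩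
    · intro i
      exact isSum_fsum_get hl hc fun k => ((g k).mul (a.actDeriv p q
        ((S k).add (.finite (b k))))).mul (.finite (w k i))
    · intro i
      rw [Network.grad]
      change fsum _ = _
      congr 1
      funext k
      rw [vecMul_diagonal]
      · simp only [hev, hgk]
        rfl
      · intro k
        simp only [hev, hgk]
        exact h4 _

/-- Between hidden layers any enumeration of the neurons will do. Only the first layer needs the
version with a prescribed order, since its inputs are the coordinates. -/
theorem Realizes.step [Params p q] {a : Activation} {X : Type} {F : X → Flt p q} {t : ℕ}
    {ι κ : Type} [Finite ι] [Nonempty κ] {V : X → (κ → ExtFlt p q) → Prop}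
    {G : X → Flt p q → (κ → ExtFlt p q) → Prop} (hR : Realizes a F t V G)
    {V' : X → (ι → ExtFlt p q) → Prop} {G' : X → Flt p q → (ι → ExtFlt p q) → Prop}
    (w : κ → ι → Flt p q) (b : κ → Flt p q)
    (hs : ∀ x h, V' x h → ∀ S : κ → ExtFlt p q,
      (∀ k, IsSum (fun i => (ExtFlt.finite (w k i)).mul (h i)) (S k)) →
      V x (fun k => a.act p q ((S k).add (.finite (b k)))) ∧
      ∀ y : Flt p q, |(y : ℝ)| ≤ a.gradBound p q → ∀ g, G x y g → (∀ k, ∃ r, Val (g k) r) ∧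
        ∀ out : ι → ExtFlt p q, (∀ i, IsSum (fun k =>
          ((g k).mul (a.actDeriv p q ((S k).add (.finite (b k))))).mul (.finite (w k i)))
            (out i)) → G' x y out) :
    Realizes a F (t + 1) V' G' := by
  classical
  have := Fintype.ofFinite ι
  have hl' : (Finset.univ : Finset ι).toList.Nodup := Finset.nodup_toList _
  have hc' : ∀ i, i ∈ (Finset.univ : Finset ι).toList := fun i => by simp
  obtain ⟨f, hf⟩ := hR.exists_network w b hs
    (hl'.getEquivOfForallMemList (Finset.univ : Finset ι).toList hc')
  exact ⟨_, f, hl', hc', hf⟩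

/-! ### Layers of carriers, twins and information neurons -/

/-- Opposite weights give exactly opposite rounded products, so carriers and twins, and the two
members of a gate pair, cancel without error. -/
theorem finite_mul_neg [Params p q] {x y z : Flt p q}
    (h : (ExtFlt.finite x).mul (.finite y) = .finite z) :
    (ExtFlt.finite x).mul (.finite (-y)) = .finite (-z) := by
  have e : (x : ℝ) * ((-y : Flt p q) : ℝ) = -(x * y) := by
    change (x : ℝ) * -(y : ℝ) = _; ring
  simp only [ExtFlt.mul, e] at *
  unfold round at *
  rw [abs_neg]
  split_ifs at h with h1 h2
  rw [if_pos h1]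
  congr 1
  apply Subtype.ext
  change fl p q (-(x * y)) = -(z : ℝ)
  rw [fl_neg, ← ExtFlt.finite.inj h]; rfl

theorem finite_add_neg [Params p q] {x y z : Flt p q}
    (h : (ExtFlt.finite x).add (.finite y) = .finite z) :
    (ExtFlt.finite (-x)).add (.finite (-y)) = .finite (-z) := by
  have e : ((-x : Flt p q) : ℝ) + ((-y : Flt p q) : ℝ) = -(x + y) := by
    change -(x : ℝ) + -(y : ℝ) = _; ring
  simp only [ExtFlt.add, e] at *
  unfold round at *
  rw [abs_neg]
  split_ifs at h with h1 h2
  rw [if_pos h1]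
  congr 1
  apply Subtype.ext
  change fl p q (-(x + y)) = -(z : ℝ)
  rw [fl_neg, ← ExtFlt.finite.inj h]; rfl

theorem finite_mul_zero [Params p q] (x : Flt p q) :
    (ExtFlt.finite x).mul (.finite 0) = (0 : ExtFlt p q) := (val_finite x).mul_zero

theorem zero_mul_finite [Params p q] (x : Flt p q) :
    (0 : ExtFlt p q).mul (.finite x) = 0 := (val_finite x).zero_mul

theorem finite_zero_mul [Params p q] (x : Flt p q) :
    (ExtFlt.finite 0).mul (.finite x) = (0 : ExtFlt p q) := (val_finite x).zero_mul

/-- The possible activations of a layer: each carrier has the value `κ` on the input that it is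
labelled with, and a value satisfying `J` otherwise; twins have the value `κ`. -/
def LayerVal {X C B : Type} (κ : Flt p q) (J : Flt p q → Prop) (lab : C → X)
    (val : B → X → Flt p q) (x : X) (h : C ⊕ C ⊕ B → ExtFlt p q) : Prop :=
  (∀ c, ∃ j, J j ∧ h (.inl c) = .finite j ∧ (lab c = x → j = κ)) ∧
    (∀ c, h (.inr (.inl c)) = .finite κ) ∧ ∀ b, h (.inr (.inr b)) = .finite (val b x)

open Classical in
/-- The possible gradients of a layer: each carrier has the gradient `γ c y` on the input that it
is labelled with, and zero otherwise; the gradient of an information neuron is zero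
where `gz` holds. -/
def LayerGrad {X C B : Type} (lab : C → X) (γ : C → Flt p q → Flt p q) (gz : B → X → Prop)
    (x : X) (y : Flt p q) (g : C ⊕ C ⊕ B → ExtFlt p q) : Prop :=
  (∀ c, g (.inl c) = if lab c = x then .finite (γ c y) else 0) ∧
    (∀ c, ∃ r : Flt p q, g (.inr (.inl c)) = .finite r) ∧
    ∀ b, ∃ r : Flt p q, g (.inr (.inr b)) = .finite r ∧ (gz b x → r = 0)

/-- One step of the backward pass: `g` is `(g₁ ⊗ δ) ⊗ a₁ ⊕ (g₂ ⊗ δ) ⊗ a₂`. -/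
def BackStep (δ a₁ a₂ g₁ g₂ g : Flt p q) : Prop :=
  ∃ s₁ s₂ t₁ t₂ : Flt p q, (ExtFlt.finite g₁).mul (.finite δ) = .finite s₁ ∧
    (ExtFlt.finite g₂).mul (.finite δ) = .finite s₂ ∧
    (ExtFlt.finite s₁).mul (.finite a₁) = .finite t₁ ∧
    (ExtFlt.finite s₂).mul (.finite a₂) = .finite t₂ ∧
    (ExtFlt.finite t₁).add (.finite t₂) = .finite g

open Classical in
/-- The weights of a layer in which carrier `c` below feeds the carriers `(c, false)` and
`(c, true)` above, its twin cancels its contribution, and information neurons are connected among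
themselves. -/
def chainWeight {C B B' : Type} (A : C × Bool → Flt p q) (w : B → B' → Flt p q) :
    (C × Bool) ⊕ (C × Bool) ⊕ B → C ⊕ C ⊕ B' → Flt p q
  | .inl k, .inl c => if k.1 = c then A k else 0
  | .inl k, .inr (.inl c) => if k.1 = c then -A k else 0
  | .inr (.inr b), .inr (.inr b') => w b b'
  | _, _ => 0

/-- The biases of such a layer. -/
def chainBias {C B : Type} (τ : Flt p q) (β : B → Flt p q) : (C × Bool) ⊕ (C × Bool) ⊕ B → Flt p q
  | .inr (.inr b) => β b
  | _ => τ

/-- On the labelled input, carrier and twin both have value `κ'`, their contributions cancel for any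
weight `A`, and the derivative is `δ`; this frees `A` for the backward pass, whose two summands come
from the copies `(c, false)` and `(c, true)`. On other inputs the incoming gradient is zero, and `J`
only has to keep everything finite so that it stays zero. An information neuron passes nothing down
because its gradient (under `gz`) or its derivative (otherwise) vanishes. -/
theorem Realizes.chain [Params p q] {a : Activation} {X : Type} {F : X → Flt p q} {t : ℕ}
    {C B B' : Type} [Finite C] [Nonempty C] [Finite B'] {κ κ' τ δ : Flt p q}
    {J J' : Flt p q → Prop} {lab : C → X}
    {val : B → X → Flt p q} {val' : B' → X → Flt p q} {gz : B → X → Prop}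
    {γ : C × Bool → Flt p q → Flt p q} {γ' : C → Flt p q → Flt p q}
    (hR : Realizes a F t (LayerVal κ J (fun k : C × Bool => lab k.1) val)
      (LayerGrad (fun k : C × Bool => lab k.1) γ gz))
    (A : C × Bool → Flt p q) (w : B → B' → Flt p q) (β : B → Flt p q)
    (hact : a.act p q (.finite τ) = .finite κ) (hder : a.actDeriv p q (.finite τ) = .finite δ)
    (hδ : |(δ : ℝ)| ≤ 1)
    (hA : ∀ k j, J' j → ∀ z, z = (((ExtFlt.finite (A k)).mul (.finite j)).add
        ((ExtFlt.finite (-A k)).mul (.finite κ'))).add (.finite τ) →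
      (∃ j', J j' ∧ a.act p q z = .finite j') ∧ (∃ r, a.actDeriv p q z = .finite r) ∧
      (j = κ' → z = .finite τ))
    (hinfo : ∀ x b S, IsSum (fun b' => (ExtFlt.finite (w b b')).mul (.finite (val' b' x))) S →
      a.act p q (S.add (.finite (β b))) = .finite (val b x) ∧
      ∃ r, a.actDeriv p q (S.add (.finite (β b))) = .finite r ∧ (¬ gz b x → r = 0))
    (hγ : ∀ c (y : Flt p q), |(y : ℝ)| ≤ a.gradBound p q →
      BackStep δ (A (c, false)) (A (c, true)) (γ (c, false) y) (γ (c, true) y) (γ' c y)) :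
    Realizes a F (t + 1) (LayerVal κ' J' lab val') (LayerGrad lab γ' fun _ _ => True) := by
  refine hR.step (chainWeight A w) (chainBias τ β) fun x h ⟨hV1, hV2, hV3⟩ S hS => ?_
  choose j hj hhj hjκ using hV1
  have hfin : ∀ i, ∃ r : Flt p q, h i = .finite r := by
    rintro (c | c | b)
    · exact ⟨_, hhj c⟩
    · exact ⟨_, hV2 c⟩
    · exact ⟨_, hV3 b⟩
  have hz : ∀ i, (ExtFlt.finite (0 : Flt p q)).mul (h i) = 0 := fun i => by
    obtain ⟨r, hr⟩ := hfin i
    rw [hr]; exact finite_zero_mul r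
  have hS1 : ∀ k, S (.inl k) = ((ExtFlt.finite (A k)).mul (.finite (j k.1))).add
      ((ExtFlt.finite (-A k)).mul (.finite κ')) := by
    intro k
    rw [(hS (.inl k)).pair (.inl k.1) (.inr (.inl k.1)) (by simp) ?_]
    · simp [chainWeight, hhj, hV2]
    · rintro (c | c | b) h1 h2
      · have : k.1 ≠ c := fun e => h1 (by rw [e])
        simp only [chainWeight, if_neg this, hz]
      · have : k.1 ≠ c := fun e => h2 (by rw [e])
        simp only [chainWeight, if_neg this, hz]
      · simp only [chainWeight, hz]
  -- Twins have no incoming weights: they see only the bias `τ`, and hence have the same value on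
  -- every input.
  have hS2 : ∀ k, S (.inr (.inl k)) = 0 := by
    intro k
    refine (hS (.inr (.inl k))).zero ?_
    rintro (c | c | b) <;> simp only [chainWeight, hz]
  have hS3 : ∀ b, IsSum (fun b' => (ExtFlt.finite (w b b')).mul (.finite (val' b' x)))
      (S (.inr (.inr b))) := by
    intro b
    have := (hS (.inr (.inr b))).comp (fun b' : B' => (.inr (.inr b') : C ⊕ C ⊕ B'))
      (fun b₁ b₂ hb => by simpa using hb) ?_
    · simpa only [chainWeight, hV3] using this
    · rintro (c | c | b') hb'
      · simp only [chainWeight, hz]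
      · simp only [chainWeight, hz]
      · exact absurd rfl (hb' b')
  have hA' : ∀ k, (∃ j', J j' ∧ a.act p q ((S (.inl k)).add (.finite τ)) = .finite j') ∧
      (∃ r, a.actDeriv p q ((S (.inl k)).add (.finite τ)) = .finite r) ∧
      (lab k.1 = x → (S (.inl k)).add (.finite τ) = .finite τ) := by
    intro k
    obtain ⟨h1, h2, h3⟩ := hA k (j k.1) (hj k.1) _ (by rw [← hS1])
    exact ⟨h1, h2, fun e => h3 (hjκ _ e)⟩
  refine ⟨⟨fun k => ?_, fun k => ?_, fun b => (hinfo x b _ (hS3 b)).1⟩, ?_⟩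
  · obtain ⟨⟨j', hj', he⟩, -, h3⟩ := hA' k
    refine ⟨j', hj', he, fun e => ?_⟩
    have := h3 e
    simp only [this, hact] at he
    exact (ExtFlt.finite.inj he).symm
  · change a.act p q ((S (.inr (.inl k))).add (.finite τ)) = _
    rw [hS2, ExtFlt.zero_add, hact]
  · intro y hy g ⟨hg1, hg2, hg3⟩
    have hgf : ∀ k, ∃ r : Flt p q, g k = .finite r := by
      rintro (c | c | b)
      · rw [hg1]; split_ifs
        · exact ⟨_, rfl⟩
        · exact ⟨0, rfl⟩
      · exact hg2 c
      · obtain ⟨r, hr, -⟩ := hg3 b; exact ⟨r, hr⟩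
    refine ⟨fun k => ?_, fun out hout => ?_⟩
    · obtain ⟨r, hr⟩ := hgf k
      exact ⟨r, hr ▸ val_finite r⟩
    -- the gradients below the activation function
    let G : (C × Bool) ⊕ (C × Bool) ⊕ B → ExtFlt p q := fun k =>
      (g k).mul (a.actDeriv p q ((S k).add (.finite (chainBias τ β k))))
    have hG1 : ∀ k, lab k.1 = x → G (.inl k) = (ExtFlt.finite (γ k y)).mul (.finite δ) := by
      intro k hk
      simp only [G, hg1, if_pos hk]
      change (ExtFlt.finite (γ k y)).mul (a.actDeriv p q ((S (.inl k)).add (.finite τ))) = _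
      rw [(hA' k).2.2 hk, hder]
    have hG1' : ∀ k, lab k.1 ≠ x → G (.inl k) = 0 := by
      intro k hk
      obtain ⟨r, hr⟩ := (hA' k).2.1
      simp only [G, hg1, if_neg hk]
      change (0 : ExtFlt p q).mul (a.actDeriv p q ((S (.inl k)).add (.finite τ))) = _
      rw [hr, zero_mul_finite]
    have hG2 : ∀ k, ∃ r : Flt p q, G (.inr (.inl k)) = .finite r := by
      intro k
      obtain ⟨r, hr⟩ := hg2 k
      have : G (.inr (.inl k)) = (ExtFlt.finite r).mul (.finite δ) := by
        simp only [G, hr]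
        change (ExtFlt.finite r).mul (a.actDeriv p q ((S (.inr (.inl k))).add (.finite τ))) = _
        rw [hS2, ExtFlt.zero_add, hder]
      rw [this]
      obtain ⟨hm, he⟩ := (val_finite r).mul (val_finite δ) (by
        rw [abs_mul]
        exact (mul_le_of_le_one_right (abs_nonneg _) hδ).trans (abs_le_Omega r.2))
      exact ⟨_, he⟩
    have hG3 : ∀ b, G (.inr (.inr b)) = 0 := by
      intro b
      obtain ⟨r, hr, hr0⟩ := hg3 b
      obtain ⟨-, r', hr', hr0'⟩ := hinfo x b _ (hS3 b)
      have : G (.inr (.inr b)) = (ExtFlt.finite r).mul (.finite r') := by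
        simp only [G, hr]
        change (ExtFlt.finite r).mul (a.actDeriv p q ((S (.inr (.inr b))).add (.finite (β b)))) = _
        rw [hr']
      rw [this]
      by_cases hb : gz b x
      · rw [hr0 hb]; exact finite_zero_mul r'
      · rw [hr0' hb]; exact finite_mul_zero r
    have hGf : ∀ k, ∃ r : Flt p q, G k = .finite r := by
      rintro (k | k | b)
      · by_cases hk : lab k.1 = x
        · obtain ⟨s₁, s₂, t₁, t₂, e1, e2, -⟩ := hγ k.1 y hy
          rw [hG1 k hk]
          rcases k with ⟨c, _ | _⟩
          · exact ⟨_, e1⟩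
          · exact ⟨_, e2⟩
        · exact ⟨0, hG1' k hk⟩
      · exact hG2 k
      · exact ⟨0, hG3 b⟩
    have hGz : ∀ k, (G k).mul (.finite 0) = 0 := fun k => by
      obtain ⟨r, hr⟩ := hGf k
      rw [hr]; exact finite_mul_zero r
    have hout' : ∀ i, IsSum (fun k => (G k).mul (.finite (chainWeight A w k i))) (out i) := hout
    have ho1 : ∀ c, out (.inl c) = ((G (.inl (c, false))).mul (.finite (A (c, false)))).add
        ((G (.inl (c, true))).mul (.finite (A (c, true)))) := by
      intro c
      rw [(hout' (.inl c)).pair (.inl (c, false)) (.inl (c, true)) (by simp) ?_]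
      · simp [chainWeight]
      · rintro (⟨c', v⟩ | k | b) h1 h2
        · have : c' ≠ c := by
            rintro rfl
            cases v
            · exact h1 rfl
            · exact h2 rfl
          simp only [chainWeight, if_neg this, hGz]
        · simp only [chainWeight, hGz]
        · simp only [chainWeight, hGz]
    -- The gradient of a twin is the negative of that of its carrier. Only its finiteness matters,
    -- since it is later multiplied by zero weights.
    have ho2 : ∀ c, out (.inr (.inl c)) = ((G (.inl (c, false))).mul (.finite (-A (c, false)))).add
        ((G (.inl (c, true))).mul (.finite (-A (c, true)))) := by
      intro c
      rw [(hout' (.inr (.inl c))).pair (.inl (c, false)) (.inl (c, true)) (by simp) ?_]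
      · simp [chainWeight]
      · rintro (⟨c', v⟩ | k | b) h1 h2
        · have : c' ≠ c := by
            rintro rfl
            cases v
            · exact h1 rfl
            · exact h2 rfl
          simp only [chainWeight, if_neg this, hGz]
        · simp only [chainWeight, hGz]
        · simp only [chainWeight, hGz]
    refine ⟨fun c => ?_, fun c => ?_, fun b => ⟨0, ?_, fun _ => rfl⟩⟩
    · rw [ho1]
      by_cases hc : lab c = x
      · obtain ⟨s₁, s₂, t₁, t₂, e1, e2, e3, e4, e5⟩ := hγ c y hy
        rw [if_pos hc, hG1 (c, false) hc, hG1 (c, true) hc, e1, e2, e3, e4, e5]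
      · rw [if_neg hc, hG1' (c, false) hc, hG1' (c, true) hc, zero_mul_finite, zero_mul_finite,
          ExtFlt.zero_add]
    · rw [ho2]
      by_cases hc : lab c = x
      · obtain ⟨s₁, s₂, t₁, t₂, e1, e2, e3, e4, e5⟩ := hγ c y hy
        exact ⟨_, by rw [hG1 (c, false) hc, hG1 (c, true) hc, e1, e2, finite_mul_neg e3,
          finite_mul_neg e4, finite_add_neg e5]⟩
      · exact ⟨0, by rw [hG1' (c, false) hc, hG1' (c, true) hc, zero_mul_finite, zero_mul_finite,
          ExtFlt.zero_add]; rfl⟩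
    · refine (hout' (.inr (.inr b))).zero ?_
      rintro (k | k | b')
      · simp only [chainWeight, hGz]
      · simp only [chainWeight, hGz]
      · rw [hG3]; exact zero_mul_finite _

/-! ### Floats as integer multiples of the smallest one -/

/-- The integer `n` with `x = n * eps`. -/
def num (p q : ℕ) (x : ℝ) : ℤ := ⌊x / eps p q⌋

theorem num_int_mul (n : ℤ) : num p q (n * eps p q) = n := by
  unfold num
  rw [mul_div_cancel_right₀ _ eps_pos.ne', Int.floor_intCast]

theorem num_mul_eps [Params p q] {x : ℝ} (hx : x ∈ finiteFloats p q) :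
    (num p q x : ℝ) * eps p q = x := by
  obtain ⟨m, i, -, rfl⟩ := exists_int_eps hx
  rw [num_int_mul]

theorem num_neg [Params p q] {x : ℝ} (hx : x ∈ finiteFloats p q) :
    num p q (-x) = -num p q x := by
  conv_lhs => rw [← num_mul_eps hx, ← neg_mul, ← Int.cast_neg, num_int_mul]

theorem num_zero : num p q 0 = 0 := by simp [num]

theorem exists_num_eq [Params p q] {x : ℝ} (hx : x ∈ finiteFloats p q) :
    ∃ (m : ℤ) (i : ℕ), |m| < 2 ^ (p + 1) ∧ num p q x = m * 2 ^ i := by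
  obtain ⟨m, i, hm, rfl⟩ := exists_int_eps hx
  exact ⟨m, i, hm, num_int_mul _⟩

theorem two_pow_mul_eps_le_Omega [Params p q] {k : ℕ} (h : (k : ℤ) ≤ 2 * emax q + p - 1) :
    (2 : ℝ) ^ k * eps p q ≤ Omega p q := by
  obtain ⟨f1, f2, f3, f4, f5⟩ := emax_facts p q
  unfold eps
  rw [← zpow_natCast, ← zpow_add₀ (by norm_num)]
  exact two_zpow_le_Omega (by omega)

theorem int_mul_pow_mul_eps_mem [Params p q] {m : ℤ} {i : ℕ} (hm : |m| ≤ 2 ^ (p + 1))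
    (h : |(m * 2 ^ i : ℝ) * eps p q| ≤ Omega p q) :
    (m * 2 ^ i : ℝ) * eps p q ∈ finiteFloats p q := by
  have e : (m * 2 ^ i : ℝ) * eps p q = m * eps p q * 2 ^ i := by ring
  rw [e] at h ⊢
  exact mul_two_pow_mem (int_mul_eps_mem hm) i h

/-! ### Rounded halving -/

/-- Half of `x`, rounded. -/
def half (p q : ℕ) (x : ℝ) : ℝ := fl p q (x / 2)

theorem half_mem (x : ℝ) : half p q x ∈ finiteFloats p q := fl_mem _

theorem half_neg [Params p q] (x : ℝ) : half p q (-x) = -half p q x := by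
  unfold half; rw [neg_div, fl_neg]

theorem half_eq_of_mem [Params p q] {x : ℝ} (h : x / 2 ∈ finiteFloats p q) :
    half p q x = x / 2 := fl_of_mem h

/-- Half of the smallest float is a tie between `0` and `eps`, and zero is even. Repeated halving
therefore reaches zero. -/
theorem half_eps [Params p q] : half p q (eps p q) = 0 := by
  obtain ⟨f1, f2, f3, f4, f5⟩ := emax_facts p q
  have hε := eps_pos (p := p) (q := q)
  have h : IsNearestEven (eps p q / 2) (0 : Flt p q) := by
    constructor
    · intro z
      change |eps p q / 2 - 0| ≤ _
      rw [sub_zero, abs_of_pos (by linarith)]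
      by_cases hz : (z : ℝ) = 0
      · rw [hz, sub_zero]; exact le_abs_self _
      · have h1 := eps_le_abs z.2 hz
        have h2 := abs_sub_abs_le_abs_sub (z : ℝ) (eps p q / 2)
        rw [abs_of_pos (by linarith : 0 < eps p q / 2), abs_sub_comm] at h2
        linarith
    · intro _
      exact ⟨0, by simp, ⟨by positivity, 1, Or.inl rfl, Or.inr (by
        change (0 : ℝ) = _; simp)⟩⟩
  have := h.unique (nearestEven_spec _)
  change ((nearestEven p q (eps p q / 2) : Flt p q) : ℝ) = 0
  rw [← this]; rfl

/-- A mantissa has at most `p + 1` bits, so from `2 ^ (p + 1)` on the last place of a float is at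
least `2 * eps`. -/
theorem even_num_of_le [Params p q] {x : ℝ} (hx : x ∈ finiteFloats p q)
    (h : 2 ^ (p + 1) ≤ |num p q x|) : Even (num p q x) := by
  obtain ⟨m, i, hm, e⟩ := exists_num_eq hx
  rw [e] at h ⊢
  rcases i with _ | i
  · rw [pow_zero, mul_one] at h; omega
  · rw [pow_succ]
    exact ⟨m * 2 ^ i, by ring⟩

theorem half_of_even [Params p q] {x : ℝ} (hx : x ∈ finiteFloats p q) (h : Even (num p q x)) :
    half p q x = x / 2 ∧ num p q x = 2 * num p q (half p q x) := by
  have key : half p q x = x / 2 := by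
    apply half_eq_of_mem
    obtain ⟨m, i, hm, e⟩ := exists_num_eq hx
    have hx' := num_mul_eps hx
    rcases i with _ | i
    · obtain ⟨r, hr⟩ := h
      have : x / 2 = r * eps p q := by
        rw [← hx', hr]; push_cast; ring
      rw [this]
      apply int_mul_eps_mem
      rw [pow_zero, mul_one] at e
      rw [abs_lt] at hm
      rw [abs_le]
      omega
    · have e1 : x / 2 = (m * 2 ^ i : ℝ) * eps p q := by
        rw [← hx', e]; push_cast; ring
      rw [e1]
      apply int_mul_pow_mul_eps_mem hm.le
      rw [← e1, abs_div]
      have := abs_le_Omega hx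
      rw [abs_two]
      have := abs_nonneg x
      linarith
  refine ⟨key, ?_⟩
  have h1 := num_mul_eps (half_mem (p := p) (q := q) x)
  have h2 := num_mul_eps hx
  have : ((num p q x : ℤ) : ℝ) * eps p q = ((2 * num p q (half p q x) : ℤ) : ℝ) * eps p q := by
    push_cast
    rw [mul_assoc, h1, h2, key]; ring
  exact_mod_cast mul_right_cancel₀ eps_pos.ne' this

theorem num_half_of_abs_le_one [Params p q] {x : ℝ} (hx : x ∈ finiteFloats p q)
    (h : |num p q x| ≤ 1) : num p q (half p q x) = 0 := by
  have h2 := num_mul_eps hx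
  have : num p q x = 0 ∨ num p q x = 1 ∨ num p q x = -1 := by
    rw [abs_le] at h; omega
  have key : half p q x = 0 := by
    rcases this with e | e | e <;> rw [e] at h2 <;> push_cast at h2
    · rw [half, ← h2]; rw [zero_mul, zero_div]; exact fl_of_mem zero_mem
    · rw [← h2, one_mul, half_eps]
    · rw [← h2, neg_one_mul, half_neg, half_eps, neg_zero]
  rw [key, num_zero]

/-- Halving is inexact only for odd numerators. These are below `2 ^ (p + 1)`, where the halves of
both neighbouring even numbers are floats at distance `eps / 2`. The difference is thus a signed
binary digit `-1`, `0` or `1`. -/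
theorem abs_num_sub_half_le [Params p q] {x : ℝ} (hx : x ∈ finiteFloats p q) :
    |num p q x - 2 * num p q (half p q x)| ≤ 1 := by
  by_cases h : Even (num p q x)
  · have := (half_of_even hx h).2
    rw [← this, sub_self]; simp
  · have hlt : |num p q x| < 2 ^ (p + 1) := by
      by_contra hc
      exact h (even_num_of_le hx (not_lt.1 hc))
    rw [Int.not_even_iff_odd] at h
    obtain ⟨r, hr⟩ := h
    have hmem : (r : ℝ) * eps p q ∈ finiteFloats p q := by
      apply int_mul_eps_mem
      rw [abs_lt] at hlt
      rw [abs_le]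
      omega
    have h1 := abs_sub_fl_le (p := p) (q := q) (x / 2) hmem
    change |x / 2 - half p q x| ≤ _ at h1
    have hε := eps_pos (p := p) (q := q)
    have h2 := num_mul_eps hx
    have h3 := num_mul_eps (half_mem (p := p) (q := q) x)
    have e1 : x / 2 - half p q x =
        ((num p q x - 2 * num p q (half p q x) : ℤ) : ℝ) * (eps p q / 2) := by
      push_cast
      linear_combination (1 / 2) * (-h2) + h3
    have e2 : x / 2 - r * eps p q = eps p q / 2 := by
      rw [← h2, hr]; push_cast; ring
    rw [e1, e2, abs_mul, abs_of_pos (by linarith : 0 < eps p q / 2)] at h1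
    have : |((num p q x - 2 * num p q (half p q x) : ℤ) : ℝ)| ≤ 1 := by
      by_contra hc
      push Not at hc
      have := mul_lt_mul_of_pos_right hc (by linarith : 0 < eps p q / 2)
      linarith
    exact_mod_cast this

/-- Only an odd numerator can be rounded up, and being below `2 ^ (p + 1)` it does not pass this
power. -/
theorem two_mul_abs_num_half_le [Params p q] {x : ℝ} (hx : x ∈ finiteFloats p q) :
    2 * |num p q (half p q x)| ≤ max |num p q x| (2 ^ (p + 1)) := by
  by_cases h : Even (num p q x)
  · have := (half_of_even hx h).2
    rw [le_max_iff]; left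
    rw [this, abs_mul]; simp
  · have hlt : |num p q x| < 2 ^ (p + 1) := by
      by_contra hc
      exact h (even_num_of_le hx (not_lt.1 hc))
    have := abs_num_sub_half_le hx
    rw [le_max_iff]; right
    have h3 : |2 * num p q (half p q x)| ≤ |num p q x| + 1 := by
      have := abs_sub_abs_le_abs_sub (2 * num p q (half p q x)) (num p q x)
      rw [abs_sub_comm] at this
      omega
    rw [abs_mul, abs_two] at h3
    omega

theorem half_iterate_mem [Params p q] {x : ℝ} (hx : x ∈ finiteFloats p q) (j : ℕ) :
    (half p q)^[j] x ∈ finiteFloats p q := by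
  rcases j with _ | j
  · exact hx
  · rw [Function.iterate_succ_apply']; exact half_mem _

theorem half_iterate_neg [Params p q] (x : ℝ) (j : ℕ) :
    (half p q)^[j] (-x) = -(half p q)^[j] x := by
  induction j with
  | zero => rfl
  | succ j ih => rw [Function.iterate_succ_apply', ih, half_neg, Function.iterate_succ_apply']

theorem num_half_iterate_of_dvd [Params p q] {x : ℝ} (hx : x ∈ finiteFloats p q) {k : ℕ} {o : ℤ}
    (h : num p q x = 2 ^ k * o) : num p q ((half p q)^[k] x) = o := by
  induction k generalizing x with
  | zero => simpa using h
  | succ k ih =>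
    rw [Function.iterate_succ_apply]
    refine ih (half_mem _) ?_
    have hev : Even (num p q x) := ⟨2 ^ k * o, by rw [h]; ring⟩
    have := (half_of_even hx hev).2
    rw [h, pow_succ] at this
    linarith

theorem num_half_iterate_eq_zero [Params p q] {x : ℝ} (hx : x ∈ finiteFloats p q) {k : ℕ}
    (h : |num p q x| ≤ 2 ^ k) : num p q ((half p q)^[k + 1] x) = 0 := by
  induction k generalizing x with
  | zero => simpa using num_half_of_abs_le_one hx h
  | succ k ih =>
    rw [Function.iterate_succ_apply]
    refine ih (half_mem _) ?_
    have h1 := abs_num_sub_half_le hx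
    rw [pow_succ] at h
    rw [abs_le] at *
    omega

/-- The digits lost in successive halvings have weights `1, 2, ..., 2 ^ (k - 1)`, whose sum is less
than `2 ^ k`. -/
theorem abs_num_sub_half_iterate_lt [Params p q] {x : ℝ} (hx : x ∈ finiteFloats p q) (k : ℕ) :
    |num p q x - 2 ^ k * num p q ((half p q)^[k] x)| < 2 ^ k := by
  induction k with
  | zero => simp
  | succ k ih =>
    have h1 := abs_num_sub_half_le (half_iterate_mem hx k)
    rw [Function.iterate_succ_apply']
    set a := num p q ((half p q)^[k] x)
    set b := num p q (half p q ((half p q)^[k] x))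
    have e : num p q x - 2 ^ (k + 1) * b = (num p q x - 2 ^ k * a) + 2 ^ k * (a - 2 * b) := by ring
    rw [e]
    refine (abs_add_le _ _).trans_lt ?_
    rw [abs_mul, abs_of_nonneg (by positivity : (0 : ℤ) ≤ 2 ^ k), pow_succ]
    have : (2 : ℤ) ^ k * |a - 2 * b| ≤ 2 ^ k * 1 := mul_le_mul_of_nonneg_left h1 (by positivity)
    linarith

/-- This excludes overflow when halvings are undone by multiplication: rounding up can enlarge only
small numbers. -/
theorem two_pow_mul_abs_num_half_iterate_le [Params p q] {x : ℝ} (hx : x ∈ finiteFloats p q)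
    (k : ℕ) : 2 ^ k * |num p q ((half p q)^[k] x)| ≤ max |num p q x| (2 ^ (p + k)) := by
  induction k with
  | zero => simp
  | succ k ih =>
    have h1 := two_mul_abs_num_half_le (half_iterate_mem hx k)
    rw [Function.iterate_succ_apply']
    set a := num p q ((half p q)^[k] x)
    set b := num p q (half p q ((half p q)^[k] x))
    have pk : (0 : ℤ) < 2 ^ k := by positivity
    have e : (2 : ℤ) ^ (k + 1) * |b| = 2 ^ k * (2 * |b|) := by ring
    rw [e]
    rcases le_max_iff.1 h1 with h | h
    · refine (mul_le_mul_of_nonneg_left h pk.le).trans (ih.trans ?_)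
      refine max_le_max le_rfl (pow_le_pow_right₀ (by norm_num) (by omega))
    · refine (mul_le_mul_of_nonneg_left h pk.le).trans ?_
      rw [← pow_add]
      refine le_max_of_le_right (pow_le_pow_right₀ (by norm_num) (by omega))

theorem lt_abs_num_of_half_iterate [Params p q] {x : ℝ} (hx : x ∈ finiteFloats p q) {k : ℕ}
    (h : num p q ((half p q)^[k + 1] x) ≠ 0) : 2 ^ k < |num p q x| := by
  by_contra hc
  exact h (num_half_iterate_eq_zero hx (not_lt.1 hc))

/-- Halving is exact as long as many more halvings do not give zero. -/
theorem half_iterate_exact [Params p q] {x : ℝ} (hx : x ∈ finiteFloats p q) {s : ℕ}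
    (h : num p q ((half p q)^[s + (p + 1)] x) ≠ 0) :
    num p q x = 2 ^ s * num p q ((half p q)^[s] x) := by
  induction s generalizing x with
  | zero => simp
  | succ s ih =>
    rw [show s + 1 + (p + 1) = (s + (p + 1)) + 1 by ring] at h
    -- A nonzero value after `s + p + 2` halvings forces a numerator above `2 ^ (s + p + 1)`, a
    -- range in which floats are even and halving is exact.
    have h1 := lt_abs_num_of_half_iterate hx h
    rw [Function.iterate_succ_apply] at h
    have h2 := ih (half_mem _) h
    have h3 : (2 : ℤ) ^ (p + 1) ≤ 2 ^ (s + (p + 1)) := pow_le_pow_right₀ (by norm_num) (by omega)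
    rw [(half_of_even hx (even_num_of_le hx (by omega))).2, h2, Function.iterate_succ_apply]
    ring

/-! ### Scaled rounding -/

/-- The derivative `δ` of the activation function at the carriers, and its inverse `D`. -/
structure GradScale (δ D : Flt p q) : Prop where
  mul_eq : (δ : ℝ) * D = 1
  pow : ∃ c ≤ 2, (D : ℝ) = 2 ^ c

theorem GradScale.one_le {δ D : Flt p q} (h : GradScale δ D) : 1 ≤ (D : ℝ) := by
  obtain ⟨c, -, e⟩ := h.pow
  rw [e]; exact one_le_pow₀ (by norm_num)

theorem GradScale.le_four {δ D : Flt p q} (h : GradScale δ D) : (D : ℝ) ≤ 4 := by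
  obtain ⟨c, hc, e⟩ := h.pow
  rw [e]
  exact (pow_le_pow_right₀ (by norm_num) hc).trans (by norm_num)

theorem GradScale.delta_eq {δ D : Flt p q} (h : GradScale δ D) : (δ : ℝ) = 1 / D :=
  eq_one_div_of_mul_eq_one_left h.mul_eq

theorem GradScale.mul_mem [Params p q] {δ D : Flt p q} (h : GradScale δ D) {x : ℝ}
    (hx : x ∈ finiteFloats p q) (hb : |D * x| ≤ Omega p q) : D * x ∈ finiteFloats p q := by
  obtain ⟨c, hc, e⟩ := h.pow
  rw [e, mul_comm] at hb ⊢
  exact mul_two_pow_mem hx c hb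

/-- The value of `x` rounded at scale `D`. -/
def rd (D : Flt p q) (x : ℝ) : ℝ := fl p q (D * x) / D

theorem GradScale.mul_rd {δ D : Flt p q} (h : GradScale δ D) (x : ℝ) :
    D * rd D x = fl p q (D * x) := by
  have := h.one_le
  unfold rd; field_simp

section rd

variable [Params p q] {δ D : Flt p q}

theorem GradScale.abs_mul_rd_le (h : GradScale δ D) (x : ℝ) : |D * rd D x| ≤ Omega p q := by
  rw [h.mul_rd]; exact abs_le_Omega (fl_mem _)

theorem rd_neg (D : Flt p q) (x : ℝ) : rd D (-x) = -rd D x := by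
  unfold rd; rw [mul_neg, fl_neg, neg_div]

theorem GradScale.rd_of_mem (h : GradScale δ D) {x : ℝ} (hx : x ∈ finiteFloats p q)
    (hb : |D * x| ≤ Omega p q) : rd D x = x := by
  have := h.one_le
  unfold rd
  rw [fl_of_mem (h.mul_mem hx hb)]
  field_simp

theorem GradScale.abs_sub_rd_le (h : GradScale δ D) (x : ℝ) {z : ℝ} (hz : z ∈ finiteFloats p q)
    (hb : |D * z| ≤ Omega p q) : |x - rd D x| ≤ |x - z| := by
  have hD := h.one_le
  have := abs_sub_fl_le (D * x) (h.mul_mem hz hb)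
  rw [← h.mul_rd, ← mul_sub, ← mul_sub, abs_mul, abs_mul] at this
  exact le_of_mul_le_mul_left this (by rw [abs_of_pos] <;> linarith)

/-- The exponent `2 * p + 5` is what numbers need that are halved at most `p + 5` times and then
scaled back. Since `2 * p ≤ emax q + 1`, it stays far below overflow, even after multiplication by
`D ≤ 4`. -/
theorem GradScale.small_le_Omega (h : GradScale δ D) {x : ℝ}
    (hx : |x| ≤ 2 ^ (2 * p + 5) * eps p q) : |D * x| ≤ Omega p q := by
  obtain ⟨f1, f2, f3, f4, f5⟩ := emax_facts p q
  have h1 := h.one_le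
  have h2 := h.le_four
  rw [abs_mul, abs_of_pos (by linarith)]
  have h3 := two_pow_mul_eps_le_Omega (p := p) (q := q) (k := 2 * p + 7) (by push_cast; omega)
  have e : (2 : ℝ) ^ (2 * p + 7) = 4 * 2 ^ (2 * p + 5) := by ring
  rw [e] at h3
  have := mul_le_mul h2 hx (abs_nonneg _) (by norm_num)
  linarith

/-- The right-hand side is the distance from the largest float to the overflow threshold: a tiny
term may be added to any admissible value, even to one as large as `Omega p q`. -/
theorem GradScale.small_lt (h : GradScale δ D) {x : ℝ}
    (hx : |x| ≤ 2 ^ (2 * p + 5) * eps p q) : |D * x| < 2 ^ (emax q - p - 1) := by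
  obtain ⟨f1, f2, f3, f4, f5⟩ := emax_facts p q
  have h1 := h.one_le
  have h2 := h.le_four
  rw [abs_mul, abs_of_pos (by linarith)]
  have e : (4 : ℝ) * (2 ^ (2 * p + 5) * eps p q) < 2 ^ (emax q - p - 1) := by
    have : (4 : ℝ) * (2 ^ (2 * p + 5) * eps p q) = 2 ^ (emin q + p + 7) := by
      unfold eps
      rw [← zpow_natCast, ← zpow_add₀ (by norm_num), show (4 : ℝ) = 2 ^ (2 : ℤ) by norm_num,
        ← zpow_add₀ (by norm_num)]
      congr 1; push_cast; ring
    rw [this]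
    exact zpow_lt_zpow_right₀ (by norm_num) (by omega)
  have := mul_le_mul h2 hx (abs_nonneg _) (by norm_num)
  linarith

/-- Dividing by `D` could underflow. But `rd` does not move small multiples of `eps`, and for large
ones the exponent of `D * n * eps` is high enough for an exact division by `D = 2 ^ c`. -/
theorem GradScale.rd_mem (h : GradScale δ D) (n : ℤ) : rd D (n * eps p q) ∈ finiteFloats p q := by
  obtain ⟨f1, f2, f3, f4, f5⟩ := emax_facts p q
  have hε := eps_pos (p := p) (q := q)
  rcases le_or_gt |n| (2 ^ (p + 1)) with hn | hn
  · rw [h.rd_of_mem (int_mul_eps_mem hn)]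
    · exact int_mul_eps_mem hn
    · apply h.small_le_Omega
      rw [abs_mul, abs_of_pos hε]
      refine mul_le_mul_of_nonneg_right ?_ hε.le
      have : (|n| : ℝ) ≤ 2 ^ (p + 1) := by exact_mod_cast hn
      exact this.trans (pow_le_pow_right₀ (by norm_num) (by omega))
  · obtain ⟨c, hc, e⟩ := h.pow
    have hc' : (c : ℤ) ≤ 2 := by exact_mod_cast hc
    have hn' : (2 : ℝ) ^ (p + 1) ≤ |(n : ℝ)| := by exact_mod_cast hn.le
    have hmem : (2 : ℝ) ^ (emin q + 1 + c) ∈ finiteFloats p q := two_zpow_mem (by omega) (by omega)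
    have hbig : (2 : ℝ) ^ (emin q + 1 + c) ≤ |(D : ℝ) * (n * eps p q)| := by
      rw [abs_mul, abs_mul, abs_of_pos hε, e, abs_of_pos (by positivity)]
      have : (2 : ℝ) ^ (emin q + 1 + c) = 2 ^ c * (2 ^ (p + 1) * eps p q) := by
        unfold eps
        rw [← zpow_natCast, ← zpow_natCast, ← zpow_add₀ (by norm_num), ← zpow_add₀ (by norm_num)]
        congr 1; push_cast; ring
      rw [this]
      gcongr
    have hg : (2 : ℝ) ^ (emin q + 1 + c) ≤ |fl p q ((D : ℝ) * (n * eps p q))| := by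
      rcases abs_cases (D * (n * eps p q) : ℝ) with ⟨h1, h2⟩ | ⟨h1, h2⟩
      · rw [h1] at hbig
        exact (le_fl hmem hbig).trans (le_abs_self _)
      · rw [h1] at hbig
        have := fl_le (neg_mem hmem) (by linarith : (D * (n * eps p q) : ℝ) ≤ -2 ^ (emin q + 1 + c))
        exact (by linarith : _ ≤ -fl p q ((D : ℝ) * (n * eps p q))).trans (neg_le_abs _)
    obtain ⟨m, f, h1, h2, h3, hm⟩ := mem_finiteFloats_iff.1
      (fl_mem (p := p) (q := q) (D * (n * eps p q)))
    unfold rd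
    rw [hm] at hg
    rw [hm, e]
    refine mem_finiteFloats_iff.2 ⟨m, f - c, h1, ?_, by omega, ?_⟩
    · rw [abs_mul, abs_of_pos (by positivity : (0 : ℝ) < 2 ^ f)] at hg
      have h1' : (|m| : ℝ) < 2 ^ (p + 1) := by exact_mod_cast h1
      have : (2 : ℝ) ^ (emin q + 1 + c) < 2 ^ ((p : ℤ) + 1 + f) := by
        refine hg.trans_lt ?_
        rw [zpow_add₀ (by norm_num)]
        have : (2 : ℝ) ^ ((p : ℤ) + 1) = 2 ^ (p + 1) := by exact_mod_cast zpow_natCast (2 : ℝ) (p + 1)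
        rw [this]
        gcongr
      have := (zpow_lt_zpow_iff_right₀ (by norm_num)).1 this
      omega
    · rw [zpow_sub₀ (by norm_num), zpow_natCast]; ring

theorem GradScale.rd_mem_of_eq (h : GradScale δ D) {x : ℝ} {n : ℤ} (hx : x = n * eps p q) :
    rd D x ∈ finiteFloats p q := by
  rw [hx]; exact h.rd_mem n

/-- For a positive multiple of `eps`, the float `eps` is a strictly better approximation than zero.
Thus a rounded sum vanishes only if the exact one does. -/
theorem GradScale.rd_eq_zero (h : GradScale δ D) {n : ℤ} (h0 : rd D (n * eps p q) = 0) :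
    n = 0 := by
  by_contra hn
  have hε := eps_pos (p := p) (q := q)
  have key : ∀ m : ℤ, 0 < m → rd D (m * eps p q) ≠ 0 := by
    intro m hm he
    have h1 := h.abs_sub_rd_le (m * eps p q) eps_mem (h.small_le_Omega (by
      rw [abs_of_pos hε]
      exact le_mul_of_one_le_left hε.le (one_le_pow₀ (by norm_num))))
    have hm' : (1 : ℝ) ≤ m := by exact_mod_cast hm
    rw [he, sub_zero, abs_of_pos (by positivity), abs_of_nonneg (by nlinarith)] at h1
    linarith
  rcases lt_or_gt_of_ne hn with h' | h'
  · refine key (-n) (by omega) ?_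
    push_cast
    rw [neg_mul, rd_neg, h0, neg_zero]
  · exact key n h' h0

/-- Adding a tiny number to a large one has no effect. -/
theorem GradScale.rd_add_of_large (h : GradScale δ D) {u r : ℝ} (hr : r ∈ finiteFloats p q)
    (hb : |D * r| ≤ Omega p q) (hu : |u| ≤ 2 * eps p q) (hl : 2 ^ (p + 4) * eps p q ≤ |r|) :
    rd D (u + r) = r := by
  have hD := h.one_le
  have hε := eps_pos (p := p) (q := q)
  obtain ⟨c, hc, e⟩ := h.pow
  unfold rd
  rw [fl_eq_of_abs_sub_lt (h.mul_mem hr hb) (e := emin q + 3 + c)]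
  · field_simp
  · rw [abs_mul, e, abs_of_pos (by positivity)]
    have : (2 : ℝ) ^ (emin q + 3 + c + 1) = 2 ^ c * (2 ^ (p + 4) * eps p q) := by
      unfold eps
      rw [← zpow_natCast, ← zpow_natCast, ← zpow_add₀ (by norm_num), ← zpow_add₀ (by norm_num)]
      congr 1; push_cast; ring
    rw [this]
    gcongr
  · have : (2 : ℝ) ^ (emin q + 3 + c - p) = 2 ^ c * (8 * eps p q) := by
      unfold eps
      rw [← zpow_natCast, show (8 : ℝ) = 2 ^ (3 : ℤ) by norm_num, ← zpow_add₀ (by norm_num),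
        ← zpow_add₀ (by norm_num)]
      congr 1; ring
    rw [this, ← e]
    have e2 : (D : ℝ) * (u + r) - D * r = D * u := by ring
    rw [e2, abs_mul, abs_of_pos (by linarith)]
    nlinarith

theorem GradScale.abs_two_pow_mul_half_iterate_le (h : GradScale δ D) {x : ℝ}
    (hx : x ∈ finiteFloats p q) (hb : |D * x| ≤ Omega p q) {k : ℕ} (hk : k ≤ p + 5) :
    |D * (2 ^ k * (half p q)^[k] x)| ≤ Omega p q := by
  have hD := h.one_le
  have hε := eps_pos (p := p) (q := q)
  have key : |2 ^ k * (half p q)^[k] x| ≤ max |x| (2 ^ (p + k) * eps p q) := by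
    have h1 := two_pow_mul_abs_num_half_iterate_le hx k
    have e1 : |x| = (|num p q x| : ℤ) * eps p q := by
      conv_lhs => rw [← num_mul_eps hx]
      rw [abs_mul, abs_of_pos hε, Int.cast_abs]
    have e2 : |(half p q)^[k] x| = (|num p q ((half p q)^[k] x)| : ℤ) * eps p q := by
      conv_lhs => rw [← num_mul_eps (half_iterate_mem hx k)]
      rw [abs_mul, abs_of_pos hε, Int.cast_abs]
    rw [abs_mul, e1, e2, ← max_mul_of_nonneg _ _ hε.le, abs_of_pos (by positivity), ← mul_assoc]
    exact mul_le_mul_of_nonneg_right (by exact_mod_cast h1) hε.le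
  rcases le_max_iff.1 key with h1 | h1
  · refine le_trans ?_ hb
    rw [abs_mul, abs_mul (D : ℝ) x]
    exact mul_le_mul_of_nonneg_left h1 (abs_nonneg _)
  · refine h.small_le_Omega (h1.trans ?_)
    refine mul_le_mul_of_nonneg_right (pow_le_pow_right₀ (by norm_num) (by omega)) hε.le

end rd

/-! ### Functions computed by the backward pass -/

/-- `γ` is obtained by `t` backward steps from the input gradient. -/
def Avail (δ D : Flt p q) (H : ℝ) : ℕ → (Flt p q → Flt p q) → Prop
  | 0, γ => ∀ y : Flt p q, |(y : ℝ)| ≤ H → (ExtFlt.finite y).mul (.finite D) = .finite (γ y)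
  | t + 1, γ => ∃ (γ₁ γ₂ : Flt p q → Flt p q) (a₁ a₂ : Flt p q), Avail δ D H t γ₁ ∧ Avail δ D H t γ₂ ∧
      -- The same weights multiply the carriers in the forward pass; the bound keeps those products
      -- finite. It is `4 * 16`, from `D ≤ 4` and the coefficients allowed in `Good.lin`.
      |(a₁ : ℝ)| ≤ 64 ∧ |(a₂ : ℝ)| ≤ 64 ∧
      ∀ y : Flt p q, |(y : ℝ)| ≤ H → BackStep δ a₁ a₂ (γ₁ y) (γ₂ y) (γ y)

/-- Up to the factor `δ`, the function `φ` is obtained by `t` backward steps. -/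
def Good (δ D : Flt p q) (H : ℝ) (t : ℕ) (φ : Flt p q → ℝ) : Prop :=
  ∃ γ, Avail δ D H t γ ∧ ∀ y : Flt p q, |(y : ℝ)| ≤ H →
    Val ((ExtFlt.finite (γ y)).mul (.finite δ)) (φ y) ∧ |D * φ y| ≤ Omega p q

theorem Good.mem {δ D : Flt p q} {H : ℝ} {t : ℕ} {φ : Flt p q → ℝ} (h : Good δ D H t φ)
    {y : Flt p q} (hy : |(y : ℝ)| ≤ H) : φ y ∈ finiteFloats p q := by
  obtain ⟨γ, -, h⟩ := h
  exact (h y hy).1.mem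

theorem Good.abs_le {δ D : Flt p q} {H : ℝ} {t : ℕ} {φ : Flt p q → ℝ} (h : Good δ D H t φ)
    {y : Flt p q} (hy : |(y : ℝ)| ≤ H) : |D * φ y| ≤ Omega p q := by
  obtain ⟨γ, -, h⟩ := h
  exact (h y hy).2

theorem Good.congr {δ D : Flt p q} {H : ℝ} {t : ℕ} {φ ψ : Flt p q → ℝ} (h : Good δ D H t φ)
    (e : ∀ y : Flt p q, |(y : ℝ)| ≤ H → φ y = ψ y) : Good δ D H t ψ := by
  obtain ⟨γ, hA, hγ⟩ := h
  exact ⟨γ, hA, fun y hy => by rw [← e y hy]; exact hγ y hy⟩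

theorem small_nat_mem [Params p q] (k : ℕ) (hk : k ≤ 5) : (2 : ℝ) ^ k ∈ finiteFloats p q := by
  obtain ⟨f1, f2, f3, f4, f5⟩ := emax_facts p q
  have := two_zpow_mem (p := p) (q := q) (e := k) (by omega) (by omega)
  rwa [zpow_natCast] at this

theorem one_mem [Params p q] : (1 : ℝ) ∈ finiteFloats p q := by
  simpa using small_nat_mem (p := p) (q := q) 0

section Good

variable [Params p q] {δ D : Flt p q} {H : ℝ} {t : ℕ}

theorem GradScale.val_mul_delta (h : GradScale δ D) {g : Flt p q} {φ : ℝ}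
    (hg : (g : ℝ) = D * φ) (hφ : φ ∈ finiteFloats p q) :
    Val ((ExtFlt.finite g).mul (.finite δ)) φ := by
  have e : (g : ℝ) * δ = φ := by
    rw [hg]; linear_combination φ * h.mul_eq
  exact ((val_finite g).mul_mem (val_finite δ) (by rw [e]; exact hφ)).congr e

/-- The output weight `D` multiplies `y` on entry and the derivative `δ` takes the factor off again.
The hypothesis on `H` says that this does not overflow. -/
theorem GradScale.good_zero (h : GradScale δ D)
    (hH : ∀ y : Flt p q, |(y : ℝ)| ≤ H → |(D : ℝ) * y| ≤ Omega p q) :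
    Good δ D H 0 (fun y => (y : ℝ)) := by
  classical
  let γ : Flt p q → Flt p q := fun y =>
    if hy : |(D : ℝ) * y| ≤ Omega p q then ⟨D * y, h.mul_mem y.2 hy⟩ else 0
  have hγ : ∀ y : Flt p q, |(y : ℝ)| ≤ H → (γ y : ℝ) = D * y := by
    intro y hy
    simp only [γ, dif_pos (hH y hy)]
  refine ⟨γ, fun y hy => ?_, fun y hy => ⟨h.val_mul_delta (hγ y hy) y.2, hH y hy⟩⟩
  have := (val_finite y).mul_mem (val_finite D) (by
    rw [mul_comm]; exact h.mul_mem y.2 (hH y hy))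
  exact Val.eq_finite (this.congr ((mul_comm _ _).trans (hγ y hy).symm))

/-- Linear combinations. -/
theorem Good.lin (hs : GradScale δ D) {φ₁ φ₂ : Flt p q → ℝ} (h₁ : Good δ D H t φ₁)
    (h₂ : Good δ D H t φ₂) (c₁ c₂ : ℝ) (hc₁ : c₁ ∈ finiteFloats p q) (hc₂ : c₂ ∈ finiteFloats p q)
    (hb₁ : |c₁| ≤ 16) (hb₂ : |c₂| ≤ 16)
    (hm₁ : ∀ y : Flt p q, |(y : ℝ)| ≤ H → c₁ * φ₁ y ∈ finiteFloats p q ∧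
      |D * (c₁ * φ₁ y)| ≤ Omega p q)
    (hm₂ : ∀ y : Flt p q, |(y : ℝ)| ≤ H → c₂ * φ₂ y ∈ finiteFloats p q ∧
      |D * (c₂ * φ₂ y)| ≤ Omega p q)
    (hm : ∀ y : Flt p q, |(y : ℝ)| ≤ H →
      |D * (c₁ * φ₁ y + c₂ * φ₂ y)| < Omega p q + 2 ^ (emax q - p - 1)) :
    Good δ D H (t + 1) fun y => rd D (c₁ * φ₁ y + c₂ * φ₂ y) := by
  obtain ⟨f1, f2, f3, f4, f5⟩ := emax_facts p q
  have hD := hs.one_le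
  have hD4 := hs.le_four
  obtain ⟨γ₁, hA₁, hγ₁⟩ := h₁
  obtain ⟨γ₂, hA₂, hγ₂⟩ := h₂
  have hw : ∀ c : ℝ, c ∈ finiteFloats p q → |c| ≤ 16 → |(D * c : ℝ)| ≤ 64 := by
    intro c _ hc
    rw [abs_mul, abs_of_pos (by linarith)]
    have := mul_le_mul hD4 hc (abs_nonneg _) (by norm_num)
    linarith
  have hwm : ∀ c : ℝ, c ∈ finiteFloats p q → |c| ≤ 16 → (D * c : ℝ) ∈ finiteFloats p q := by
    intro c h1 h2
    refine hs.mul_mem h1 ((hw c h1 h2).trans ?_)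
    have : (2 : ℝ) ^ (6 : ℤ) ≤ Omega p q := two_zpow_le_Omega (by omega)
    norm_num at this; exact this
  refine ⟨fun y => ⟨fl p q (D * (c₁ * φ₁ y + c₂ * φ₂ y)), fl_mem _⟩,
    ⟨γ₁, γ₂, (⟨_, hwm c₁ hc₁ hb₁⟩ : Flt p q), (⟨_, hwm c₂ hc₂ hb₂⟩ : Flt p q), hA₁, hA₂, hw c₁ hc₁ hb₁, hw c₂ hc₂ hb₂,
      fun y hy => ?_⟩, fun y hy => ⟨hs.val_mul_delta (hs.mul_rd _).symm ?_,
        hs.abs_mul_rd_le _⟩⟩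
  · obtain ⟨m1, e1⟩ := (hγ₁ y hy).1
    obtain ⟨m2, e2⟩ := (hγ₂ y hy).1
    have k1 := hs.mul_mem (hm₁ y hy).1 (hm₁ y hy).2
    have k2 := hs.mul_mem (hm₂ y hy).1 (hm₂ y hy).2
    have r1 : φ₁ y * (D * c₁) = D * (c₁ * φ₁ y) := by ring
    have r2 : φ₂ y * (D * c₂) = D * (c₂ * φ₂ y) := by ring
    refine ⟨⟨_, m1⟩, ⟨_, m2⟩, ⟨_, k1⟩, ⟨_, k2⟩, e1, e2, ?_, ?_, ?_⟩
    · exact Val.eq_finite (((val_finite ⟨_, m1⟩).mul_mem (val_finite _)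
        (by simpa only [r1] using k1)).congr r1)
    · exact Val.eq_finite (((val_finite ⟨_, m2⟩).mul_mem (val_finite _)
        (by simpa only [r2] using k2)).congr r2)
    · refine Val.eq_finite ?_
      have : (D * (c₁ * φ₁ y) + D * (c₂ * φ₂ y) : ℝ) = D * (c₁ * φ₁ y + c₂ * φ₂ y) := by ring
      have h3 := val_round_of_lt (hm y hy)
      change Val (round p q (D * (c₁ * φ₁ y) + D * (c₂ * φ₂ y))) (fl p q _)
      rw [this]
      exact h3
  · have e : c₁ * φ₁ y + c₂ * φ₂ y =
        ((num p q (c₁ * φ₁ y) + num p q (c₂ * φ₂ y) : ℤ) : ℝ) * eps p q := by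
      push_cast
      rw [add_mul, num_mul_eps (hm₁ y hy).1, num_mul_eps (hm₂ y hy).1]
    exact hs.rd_mem_of_eq e

theorem Good.scale (hs : GradScale δ D) {φ : Flt p q → ℝ} (h : Good δ D H t φ)
    (c : ℝ) (hc : c ∈ finiteFloats p q) (hb : |c| ≤ 16)
    (hm : ∀ y : Flt p q, |(y : ℝ)| ≤ H → c * φ y ∈ finiteFloats p q ∧
      |D * (c * φ y)| ≤ Omega p q) : Good δ D H (t + 1) fun y => c * φ y := by
  refine (Good.lin hs h h c 0 hc zero_mem hb (by simp) hm ?_ ?_).congr ?_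
  · intro y hy
    rw [zero_mul, mul_zero, abs_zero]
    exact ⟨zero_mem, Omega_pos.le⟩
  · intro y hy
    rw [zero_mul, add_zero]
    exact (hm y hy).2.trans_lt (by linarith [show (0 : ℝ) < 2 ^ (emax q - p - 1) by positivity])
  · intro y hy
    rw [zero_mul, add_zero, hs.rd_of_mem (hm y hy).1 (hm y hy).2]

theorem Good.succ (hs : GradScale δ D) {φ : Flt p q → ℝ} (h : Good δ D H t φ) :
    Good δ D H (t + 1) φ := by
  refine (h.scale hs 1 one_mem (by norm_num) fun y hy => ?_).congr fun y hy => one_mul _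
  rw [one_mul]
  exact ⟨h.mem hy, h.abs_le hy⟩

theorem Good.mono (hs : GradScale δ D) {φ : Flt p q → ℝ} (h : Good δ D H t φ) {t' : ℕ}
    (ht : t ≤ t') : Good δ D H t' φ := by
  induction ht with
  | refl => exact h
  | step _ ih => exact ih.succ hs

/-- One step gains at most four binary places, because `16` is the largest coefficient admitted in
`Good.lin`. -/
theorem Good.zpow_two (hs : GradScale δ D) {φ : Flt p q → ℝ} (h : Good δ D H t φ) (r m : ℕ)
    (hm : m ≤ 4 * r)
    (hb : ∀ y : Flt p q, |(y : ℝ)| ≤ H → |D * (2 ^ m * φ y)| ≤ Omega p q) :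
    Good δ D H (t + r) fun y => 2 ^ m * φ y := by
  induction r generalizing m with
  | zero =>
    obtain rfl : m = 0 := by omega
    exact h.congr fun y _ => by simp
  | succ r ih =>
    obtain ⟨m', j, rfl, hj, hm'⟩ : ∃ m' j, m = m' + j ∧ j ≤ 4 ∧ m' ≤ 4 * r := by
      refine ⟨m - min m 4, min m 4, ?_, ?_, ?_⟩ <;> omega
    have hj1 : (1 : ℝ) ≤ 2 ^ j := one_le_pow₀ (by norm_num)
    have key := ih m' hm' fun y hy => by
      refine le_trans ?_ (hb y hy)
      rw [show (D * (2 ^ (m' + j) * φ y) : ℝ) = 2 ^ j * (D * (2 ^ m' * φ y)) by ring,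
        abs_mul (2 ^ j : ℝ), abs_of_pos (by positivity : (0 : ℝ) < 2 ^ j)]
      exact le_mul_of_one_le_left (abs_nonneg _) hj1
    have hj4 : (2 : ℝ) ^ j ≤ 2 ^ 4 := pow_le_pow_right₀ (by norm_num) hj
    refine (key.scale hs (2 ^ j) (small_nat_mem j (by omega)) ?_ fun y hy => ?_).congr
      fun y hy => by ring
    · rw [abs_of_pos (by positivity)]; norm_num at hj4; exact hj4
    · have e : (2 : ℝ) ^ j * (2 ^ m' * φ y) = 2 ^ (m' + j) * φ y := by ring
      rw [e]
      refine ⟨?_, hb y hy⟩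
      rw [mul_comm]
      refine mul_two_pow_mem (h.mem hy) _ ?_
      rw [mul_comm]
      refine le_trans ?_ (hb y hy)
      rw [abs_mul (D : ℝ)]
      refine le_mul_of_one_le_left (abs_nonneg _) ?_
      have := hs.one_le
      rwa [abs_of_pos (by linarith)]

/-- The weight is `D / 2`. If `D = 1`, the rounding happens in the product with this weight; if `D`
is `2` or `4`, that product is exact and the rounding happens in the next product with `δ`. Either
way the halving is rounded only once. -/
theorem Good.half (hs : GradScale δ D) {φ : Flt p q → ℝ} (h : Good δ D H t φ) :
    Good δ D H (t + 1) fun y => half p q (φ y) := by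
  obtain ⟨f1, f2, f3, f4, f5⟩ := emax_facts p q
  have hD := hs.one_le
  have hD4 := hs.le_four
  have hh : (2 : ℝ) ^ (-1 : ℤ) ∈ finiteFloats p q := two_zpow_mem (by omega) (by omega)
  have hΩ : (2 : ℝ) ^ (1 : ℤ) ≤ Omega p q := two_zpow_le_Omega (by omega)
  have hw : (D / 2 : ℝ) ∈ finiteFloats p q := by
    have := hs.mul_mem hh (by
      norm_num at hΩ ⊢
      rw [abs_of_pos (by linarith)]
      linarith)
    norm_num at this
    rwa [mul_one_div] at this
  obtain ⟨γ, hA, hγ⟩ := h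
  have hbd : ∀ y : Flt p q, |(y : ℝ)| ≤ H → |φ y * (D / 2)| ≤ Omega p q := by
    intro y hy
    have h1 := (hγ y hy).2
    rw [show (φ y * (D / 2) : ℝ) = D * φ y / 2 by ring, abs_div, abs_two]
    linarith [abs_nonneg (D * φ y)]
  refine ⟨fun y => ⟨fl p q (φ y * (D / 2)), fl_mem _⟩, ⟨γ, γ, (⟨_, hw⟩ : Flt p q), 0, hA, hA, ?_,
    by change |(0 : ℝ)| ≤ 64; norm_num, fun y hy => ?_⟩, fun y hy => ⟨?_, ?_⟩⟩
  · change |(D / 2 : ℝ)| ≤ 64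
    rw [abs_of_pos (by linarith)]; linarith
  · obtain ⟨m1, e1⟩ := (hγ y hy).1
    refine ⟨_, _, ⟨_, fl_mem (φ y * (D / 2))⟩, 0, e1, e1, ?_, ?_, ?_⟩
    · exact Val.eq_finite ((val_finite ⟨_, m1⟩).mul (val_finite _) (hbd y hy))
    · exact finite_mul_zero _
    · exact ExtFlt.add_zero _
  · obtain ⟨c, hc, e⟩ := hs.pow
    rcases c with _ | c
    · rw [pow_zero] at e
      have hδ : (δ : ℝ) = 1 := by rw [hs.delta_eq, e, div_one]
      have e1 : fl p q (φ y * (D / 2)) = FloatNet.half p q (φ y) := by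
        rw [e]; unfold FloatNet.half; congr 1; ring
      have e2 : FloatNet.half p q (φ y) * δ = FloatNet.half p q (φ y) := by rw [hδ, mul_one]
      simp only [e1]
      exact ((val_mk (half_mem _)).mul_mem (val_finite δ)
        (by rw [e2]; exact half_mem _)).congr e2
    · have e0 : (D / 2 : ℝ) = 2 ^ c := by rw [e, pow_succ]; ring
      have e1 : fl p q (φ y * (D / 2)) = φ y * (D / 2) := by
        have := hbd y hy
        rw [e0] at *
        exact fl_of_mem (mul_two_pow_mem (hγ y hy).1.mem c this)
      have e2 : φ y * (D / 2) * δ = φ y / 2 := by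
        linear_combination φ y / 2 * hs.mul_eq
      have h3 := (val_mk (fl_mem (p := p) (q := q) (φ y * (D / 2)))).mul (val_finite δ) (by
        rw [e1, e2, abs_div, abs_two]
        linarith [abs_nonneg (φ y), abs_le_Omega (hγ y hy).1.mem])
      refine h3.congr ?_
      rw [e1, e2]; rfl
  · have h1 := hs.abs_two_pow_mul_half_iterate_le (hγ y hy).1.mem (hγ y hy).2 (k := 1) (by omega)
    refine le_trans ?_ h1
    rw [pow_one, Function.iterate_one, abs_mul, abs_mul, abs_mul, abs_two]
    nlinarith [mul_nonneg (abs_nonneg (D : ℝ)) (abs_nonneg (FloatNet.half p q (φ y)))]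

end Good

/-! ### Singling out one gradient by rounding and absorption. -/

section Indicator

variable [Params p q] {δ D : Flt p q} {H : ℝ} {t : ℕ}

theorem Good.add (hs : GradScale δ D) {φ₁ φ₂ : Flt p q → ℝ} (h₁ : Good δ D H t φ₁)
    (h₂ : Good δ D H t φ₂) (hm : ∀ y : Flt p q, |(y : ℝ)| ≤ H →
      |D * (φ₁ y + φ₂ y)| < Omega p q + 2 ^ (emax q - p - 1)) :
    Good δ D H (t + 1) fun y => rd D (φ₁ y + φ₂ y) := by
  refine (Good.lin hs h₁ h₂ 1 1 one_mem one_mem (by norm_num) (by norm_num) ?_ ?_ ?_).congr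
    fun y hy => by rw [one_mul, one_mul]
  · intro y hy; rw [one_mul]; exact ⟨h₁.mem hy, h₁.abs_le hy⟩
  · intro y hy; rw [one_mul]; exact ⟨h₂.mem hy, h₂.abs_le hy⟩
  · simpa only [one_mul] using hm

theorem Good.sub (hs : GradScale δ D) {φ₁ φ₂ : Flt p q → ℝ} (h₁ : Good δ D H t φ₁)
    (h₂ : Good δ D H t φ₂) (hm : ∀ y : Flt p q, |(y : ℝ)| ≤ H →
      |D * (φ₁ y - φ₂ y)| < Omega p q + 2 ^ (emax q - p - 1)) :
    Good δ D H (t + 1) fun y => rd D (φ₁ y - φ₂ y) := by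
  refine (Good.lin hs h₁ h₂ 1 (-1) one_mem (neg_mem one_mem) (by norm_num) (by norm_num)
    ?_ ?_ ?_).congr fun y hy => by rw [one_mul, neg_one_mul, sub_eq_add_neg]
  · intro y hy; rw [one_mul]; exact ⟨h₁.mem hy, h₁.abs_le hy⟩
  · intro y hy
    rw [neg_one_mul, mul_neg, abs_neg]; exact ⟨neg_mem (h₂.mem hy), h₂.abs_le hy⟩
  · intro y hy
    rw [one_mul, neg_one_mul, ← sub_eq_add_neg]; exact hm y hy

theorem Good.half_iterate (hs : GradScale δ D) {φ : Flt p q → ℝ} (h : Good δ D H t φ) (j : ℕ) :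
    Good δ D H (t + j) fun y => (FloatNet.half p q)^[j] (φ y) := by
  induction j with
  | zero => exact h
  | succ j ih => exact (ih.half hs).congr fun y _ => (Function.iterate_succ_apply' _ _ _).symm

/-- This is `u` if `r` vanishes and `0` if `r` is large, as long as `u` is tiny. -/
def kill (D : Flt p q) (u r : ℝ) : ℝ := rd D (rd D (u + r) - r)

omit [Params p q] in
theorem pow_mul_eps_le {a b : ℕ} (h : a ≤ b) : (2 : ℝ) ^ a * eps p q ≤ 2 ^ b * eps p q :=
  mul_le_mul_of_nonneg_right (pow_le_pow_right₀ (by norm_num) h) eps_pos.le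

omit [Params p q] in
theorem two_mul_eps_le (k : ℕ) : 2 * eps p q ≤ 2 ^ (k + 1) * eps p q := by
  simpa using pow_mul_eps_le (p := p) (q := q) (show 1 ≤ k + 1 by omega)

theorem Good.kill (hs : GradScale δ D) {u r : Flt p q → ℝ} (hu : Good δ D H t u)
    (hr : Good δ D H t r) (hs' : ∀ y : Flt p q, |(y : ℝ)| ≤ H → |u y| ≤ 2 * eps p q) :
    Good δ D H (t + 2) fun y => kill D (u y) (r y) := by
  have h1 := hu.add hs hr fun y hy => by
    have h1 := hs.small_lt ((hs' y hy).trans (two_mul_eps_le _))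
    have h2 := hr.abs_le hy
    rw [mul_add]
    exact (abs_add_le _ _).trans_lt (by linarith)
  refine h1.sub hs (hr.succ hs) fun y hy => ?_
  have h3 := hs.abs_sub_rd_le (u y + r y) (hr.mem hy) (hr.abs_le hy)
  rw [add_sub_cancel_right] at h3
  have h4 : |rd D (u y + r y) - r y| ≤ 2 ^ 2 * eps p q := by
    have e : rd D (u y + r y) - r y = u y - (u y + r y - rd D (u y + r y)) := by ring
    rw [e]
    have := abs_sub (u y) (u y + r y - rd D (u y + r y))
    have := hs' y hy
    norm_num
    linarith
  have h5 := hs.small_lt (h4.trans (pow_mul_eps_le (by omega)))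
  linarith [Omega_pos (p := p) (q := q)]

theorem GradScale.rd_zero (hs : GradScale δ D) : rd D 0 = 0 :=
  hs.rd_of_mem zero_mem (by rw [mul_zero, abs_zero]; exact Omega_pos.le)

theorem GradScale.kill_zero_right (hs : GradScale δ D) {u : ℝ} (hu : u ∈ finiteFloats p q)
    (hb : |D * u| ≤ Omega p q) : FloatNet.kill D u 0 = u := by
  unfold FloatNet.kill
  rw [add_zero, sub_zero, hs.rd_of_mem hu hb, hs.rd_of_mem hu hb]

theorem GradScale.kill_zero_left (hs : GradScale δ D) {r : ℝ} (hr : r ∈ finiteFloats p q)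
    (hb : |D * r| ≤ Omega p q) : FloatNet.kill D 0 r = 0 := by
  unfold FloatNet.kill
  rw [zero_add, hs.rd_of_mem hr hb, sub_self, hs.rd_zero]

theorem GradScale.kill_large (hs : GradScale δ D) {u r : ℝ} (hr : r ∈ finiteFloats p q)
    (hb : |D * r| ≤ Omega p q) (hu : |u| ≤ 2 * eps p q) (hl : 2 ^ (p + 4) * eps p q ≤ |r|) :
    FloatNet.kill D u r = 0 := by
  unfold FloatNet.kill
  rw [hs.rd_add_of_large hr hb hu hl, sub_self, hs.rd_zero]

/-- For an `r` of intermediate size the sum `u + r` may be rounded either way and leave a remainder.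
It is still tiny, so a second application can remove it. -/
theorem GradScale.abs_kill_le (hs : GradScale δ D) {u r : ℝ} (hr : r ∈ finiteFloats p q)
    (hb : |D * r| ≤ Omega p q) (hu : |u| ≤ eps p q) (n : ℤ) (hun : u = n * eps p q) :
    |FloatNet.kill D u r| ≤ 2 * eps p q := by
  have h3 := hs.abs_sub_rd_le (u + r) hr hb
  rw [add_sub_cancel_right] at h3
  have h4 : |rd D (u + r) - r| ≤ 2 * eps p q := by
    have e : rd D (u + r) - r = u - (u + r - rd D (u + r)) := by ring
    rw [e]
    have := abs_sub u (u + r - rd D (u + r))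
    linarith
  have hε := eps_pos (p := p) (q := q)
  have hg : rd D (u + r) ∈ finiteFloats p q := by
    have e : u + r = ((n + num p q r : ℤ) : ℝ) * eps p q := by
      push_cast
      rw [add_mul, num_mul_eps hr, hun]
    exact hs.rd_mem_of_eq e
  have hz : (2 * eps p q : ℝ) ∈ finiteFloats p q := by
    have := int_mul_eps_mem (p := p) (q := q) (n := 2)
      (by rw [abs_two, pow_succ]; have : (1 : ℤ) ≤ 2 ^ p := one_le_pow₀ (by norm_num); linarith)
    simpa using this
  have e : rd D (u + r) - r = ((num p q (rd D (u + r)) - num p q r : ℤ) : ℝ) * eps p q := by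
    push_cast
    rw [sub_mul, num_mul_eps hr, num_mul_eps hg]
  have hle : |num p q (rd D (u + r)) - num p q r| ≤ 2 := by
    rw [e, abs_mul, abs_of_pos hε] at h4
    have := le_of_mul_le_mul_right h4 hε
    exact_mod_cast this
  unfold FloatNet.kill
  rw [hs.rd_of_mem, ]
  · exact h4
  · rw [e]
    apply int_mul_eps_mem
    refine hle.trans ?_
    rw [pow_succ]; have : (1 : ℤ) ≤ 2 ^ p := one_le_pow₀ (by norm_num); linarith
  · exact hs.small_le_Omega (h4.trans (two_mul_eps_le _))

/-- The difference between `x` and its leading digits, for a float that is not too small. -/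
def residue (D : Flt p q) (x : ℝ) : ℝ :=
  rd D (x - 2 ^ (p + 5) * (half p q)^[p + 5] x)

theorem Good.residue (hs : GradScale δ D) {r : Flt p q → ℝ} (hr : Good δ D H t r) :
    Good δ D H (t + (p + 5) + (p / 4 + 2) + 1) fun y => residue D (r y) := by
  have h1 := (hr.half_iterate hs (p + 5)).zpow_two hs (p / 4 + 2) (p + 5) (by omega)
    fun y hy => hs.abs_two_pow_mul_half_iterate_le (hr.mem hy) (hr.abs_le hy) le_rfl
  refine Good.sub hs (hr.mono hs (by omega)) h1 fun y hy => ?_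
  have h2 := abs_num_sub_half_iterate_lt (hr.mem hy) (p + 5)
  have hε := eps_pos (p := p) (q := q)
  have h3 : |r y - 2 ^ (p + 5) * (FloatNet.half p q)^[p + 5] (r y)| ≤
      2 ^ (p + 5) * eps p q := by
    have e : r y - 2 ^ (p + 5) * (FloatNet.half p q)^[p + 5] (r y) =
        ((num p q (r y) - 2 ^ (p + 5) * num p q ((FloatNet.half p q)^[p + 5] (r y)) : ℤ) : ℝ) *
          eps p q := by
      push_cast
      rw [sub_mul, mul_assoc, num_mul_eps (hr.mem hy), num_mul_eps (half_iterate_mem (hr.mem hy) _)]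
    rw [e, abs_mul, abs_of_pos hε]
    exact mul_le_mul_of_nonneg_right (by exact_mod_cast h2.le) hε.le
  have h4 := hs.small_lt (h3.trans (pow_mul_eps_le (by omega)))
  linarith [Omega_pos (p := p) (q := q)]

theorem GradScale.abs_residue_le (hs : GradScale δ D) {x : ℝ} (hx : x ∈ finiteFloats p q) :
    |FloatNet.residue D x| ≤ 2 ^ (p + 5) * eps p q := by
  have hε := eps_pos (p := p) (q := q)
  have h2 := abs_num_sub_half_iterate_lt hx (p + 5)
  have e : x - 2 ^ (p + 5) * (FloatNet.half p q)^[p + 5] x =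
      ((num p q x - 2 ^ (p + 5) * num p q ((FloatNet.half p q)^[p + 5] x) : ℤ) : ℝ) * eps p q := by
    push_cast
    rw [sub_mul, mul_assoc, num_mul_eps hx, num_mul_eps (half_iterate_mem hx _)]
  have hz : (2 : ℝ) ^ (p + 5) * eps p q ∈ finiteFloats p q := by
    have := two_zpow_mem (p := p) (q := q) (e := emin q + 5)
      (by have := emax_facts p q; omega) (by have := emax_facts p q; omega)
    have e : (2 : ℝ) ^ (p + 5) * eps p q = 2 ^ (emin q + 5) := by
      unfold eps
      rw [← zpow_natCast, ← zpow_add₀ (by norm_num)]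
      congr 1; push_cast; ring
    rwa [e]
  have hzb : |D * (2 ^ (p + 5) * eps p q)| ≤ Omega p q := hs.small_le_Omega (by
    rw [abs_of_pos (by positivity)]
    exact pow_mul_eps_le (by omega))
  have h3 : |x - 2 ^ (p + 5) * (FloatNet.half p q)^[p + 5] x| ≤ 2 ^ (p + 5) * eps p q := by
    rw [e, abs_mul, abs_of_pos hε]
    exact mul_le_mul_of_nonneg_right (by exact_mod_cast h2.le) hε.le
  set w := x - 2 ^ (p + 5) * (FloatNet.half p q)^[p + 5] x with hw
  change |rd D w| ≤ _
  rw [abs_le] at h3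
  have hD := hs.one_le
  have hDz := hs.mul_mem hz hzb
  have k1 := fl_le hDz (mul_le_mul_of_nonneg_left h3.2 (by linarith : (0 : ℝ) ≤ D))
  have k2 := le_fl (neg_mem hDz) (x := D * w) (by
    rw [← mul_neg]
    exact mul_le_mul_of_nonneg_left h3.1 (by linarith : (0 : ℝ) ≤ D))
  rw [← hs.mul_rd] at k1 k2
  rw [abs_le]
  constructor
  · rw [← mul_neg] at k2
    exact le_of_mul_le_mul_left k2 (by linarith)
  · exact le_of_mul_le_mul_left k1 (by linarith)

/-- A number of at most `2 ^ (p + 4)` units is annihilated by `p + 5` halvings, so nothing is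
subtracted. For larger numbers only the bound `abs_residue_le` is needed. -/
theorem GradScale.residue_of_small (hs : GradScale δ D) {x : ℝ} (hx : x ∈ finiteFloats p q)
    (h : |x| ≤ 2 ^ (p + 4) * eps p q) : FloatNet.residue D x = x := by
  have hε := eps_pos (p := p) (q := q)
  have h1 : num p q ((FloatNet.half p q)^[p + 5] x) = 0 := by
    apply num_half_iterate_eq_zero hx
    rw [← num_mul_eps hx, abs_mul, abs_of_pos hε] at h
    have := le_of_mul_le_mul_right h hε
    exact_mod_cast this
  have h2 := num_mul_eps (half_iterate_mem hx (p + 5))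
  rw [h1] at h2
  unfold FloatNet.residue
  rw [← h2, Int.cast_zero, zero_mul, mul_zero, sub_zero, hs.rd_of_mem hx]
  exact hs.small_le_Omega (h.trans (pow_mul_eps_le (by omega)))

/-- The exact value of `u` if `r = 0`, and otherwise zero. -/
theorem Good.exists_kill (hs : GradScale δ D) {u r : Flt p q → ℝ} (hu : Good δ D H t u)
    (hr : Good δ D H t r) (hs' : ∀ y : Flt p q, |(y : ℝ)| ≤ H → |u y| ≤ eps p q) :
    ∃ φ, Good δ D H (t + (p + 2 * (p / 4) + 14)) φ ∧ ∀ y : Flt p q, |(y : ℝ)| ≤ H →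
      (r y = 0 → φ y = u y) ∧ (u y = 0 ∨ r y ≠ 0 → φ y = 0) := by
  have hε := eps_pos (p := p) (q := q)
  have h1 := hu.kill hs hr fun y hy => (hs' y hy).trans (by linarith)
  have hZb : ∀ y : Flt p q, |(y : ℝ)| ≤ H →
      |D * (2 ^ (p + 4) * FloatNet.residue D (r y))| ≤ Omega p q := by
    intro y hy
    obtain ⟨f1, f2, f3, f4, f5⟩ := emax_facts p q
    have h2 := hs.abs_residue_le (hr.mem hy)
    rw [abs_mul, abs_mul]
    have hD := hs.one_le
    have hD4 := hs.le_four
    rw [abs_of_pos (by linarith : (0 : ℝ) < D), abs_of_pos (by positivity : (0 : ℝ) < 2 ^ (p + 4))]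
    have h3 := two_pow_mul_eps_le_Omega (p := p) (q := q) (k := 2 * p + 11) (by push_cast; omega)
    refine le_trans ?_ h3
    have e : (2 : ℝ) ^ (2 * p + 11) * eps p q = 4 * (2 ^ (p + 4) * (2 ^ (p + 5) * eps p q)) := by
      ring
    rw [e]
    gcongr
  -- If `r` is too small to absorb `u`, its residue is `r` itself, and the factor `2 ^ (p + 4)`
  -- makes it large enough. If `r` is large, the first application has already produced zero.
  -- Passing to the residue keeps the scaled number from overflowing.
  have h2 := (hr.residue hs).zpow_two hs (p / 4 + 2) (p + 4) (by omega) hZb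
  have hv : ∀ y : Flt p q, |(y : ℝ)| ≤ H → |FloatNet.kill D (u y) (r y)| ≤ 2 * eps p q :=
    fun y hy => hs.abs_kill_le (hr.mem hy) (hr.abs_le hy) (hs' y hy) _
      (num_mul_eps (hu.mem hy)).symm
  have h3 := (h1.mono hs (by omega)).kill hs h2 hv
  refine ⟨_, h3.mono hs (by omega), fun y hy => ⟨fun h => ?_, fun h => ?_⟩⟩
  · have e : FloatNet.residue D 0 = 0 :=
      hs.residue_of_small zero_mem (by rw [abs_zero]; positivity)
    simp only [h, e, mul_zero]
    rw [hs.kill_zero_right (hu.mem hy) (hu.abs_le hy), hs.kill_zero_right (hu.mem hy) (hu.abs_le hy)]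
  · have hz := hs.kill_zero_left (h2.mem hy) (hZb y hy)
    by_cases hu0 : u y = 0
    · simp only [hu0]
      rw [hs.kill_zero_left (hr.mem hy) (hr.abs_le hy), hz]
    · have hr0 : r y ≠ 0 := by tauto
      rcases le_or_gt (2 ^ (p + 4) * eps p q) |r y| with hl | hl
      · rw [hs.kill_large (hr.mem hy) (hr.abs_le hy) ((hs' y hy).trans (by linarith)) hl, hz]
      · refine hs.kill_large (h2.mem hy) (hZb y hy) (hv y hy) ?_
        rw [hs.residue_of_small (hr.mem hy) hl.le, abs_mul, abs_of_pos (by positivity)]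
        exact mul_le_mul_of_nonneg_left (eps_le_abs (hr.mem hy) hr0) (by positivity)

/-- The power of two contained in the mantissa is moved into the exponent. The bound on `k`, which
comes from the largest float, limits the number of halvings and hence the depth. -/
theorem exists_num_eq_odd {x : ℝ} (hx : x ∈ finiteFloats p q) (h0 : x ≠ 0) :
    ∃ (k : ℕ) (o : ℤ), Odd o ∧ |o| < 2 ^ (p + 1) ∧ num p q x = 2 ^ k * o ∧
      (k : ℤ) < 2 * emax q + p := by
  obtain ⟨f1, f2, f3, f4, f5⟩ := emax_facts p q
  obtain ⟨m, i, hm, e⟩ := exists_num_eq hx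
  have hn := num_mul_eps hx
  have hm0 : m.natAbs ≠ 0 := by
    intro h
    rw [Int.natAbs_eq_zero] at h
    rw [e, h] at hn
    simp at hn
    exact h0 hn.symm
  obtain ⟨a, b, hb, hab⟩ := Nat.exists_eq_two_pow_mul_odd hm0
  have hab' : |m| = 2 ^ a * (b : ℤ) := by
    rw [Int.abs_eq_natAbs, hab]; push_cast; ring
  obtain ⟨s, hs, hms⟩ : ∃ s : ℤ, (s = 1 ∨ s = -1) ∧ m = s * |m| := by
    rcases abs_choice m with h | h
    · exact ⟨1, Or.inl rfl, by rw [h]; ring⟩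
    · exact ⟨-1, Or.inr rfl, by rw [h]; ring⟩
  have hsa : |s| = 1 := by rcases hs with rfl | rfl <;> rfl
  have hb1 : (0 : ℤ) < b := by exact_mod_cast hb.pos
  have ho : Odd (s * (b : ℤ)) := by
    refine Odd.mul ?_ (by exact_mod_cast hb)
    rcases hs with rfl | rfl <;> decide
  have habs : |s * (b : ℤ)| = b := by rw [abs_mul, hsa, one_mul, abs_of_pos hb1]
  have hnum : num p q x = 2 ^ (a + i) * (s * b) := by
    rw [e, hms, hab', pow_add]; ring
  refine ⟨a + i, s * b, ho, ?_, hnum, ?_⟩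
  · rw [habs]
    refine lt_of_le_of_lt ?_ hm
    rw [hab']
    exact le_mul_of_one_le_left hb1.le (one_le_pow₀ (by norm_num))
  · have h1 := (abs_le_Omega hx).trans_lt (Omega_lt p q)
    rw [← hn, hnum, abs_mul, abs_of_pos eps_pos, ← Int.cast_abs, abs_mul, habs,
      abs_of_pos (by positivity)] at h1
    have hb1' : (1 : ℝ) ≤ b := by exact_mod_cast hb.pos
    have h2 : (2 : ℝ) ^ ((a + i : ℕ) + (emin q - p)) < 2 ^ (emax q + 1) := by
      refine lt_of_le_of_lt ?_ h1
      rw [zpow_add₀ (by norm_num), zpow_natCast]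
      push_cast
      refine mul_le_mul_of_nonneg_right (le_mul_of_one_le_right (by positivity) hb1') eps_pos.le
    have := (zpow_lt_zpow_iff_right₀ (by norm_num)).1 h2
    omega

/-- The `k`-th bit of `y`, up to sign. -/
theorem Good.exists_bit (hs : GradScale δ D)
    (hH : ∀ y : Flt p q, |(y : ℝ)| ≤ H → |(D : ℝ) * y| ≤ Omega p q) (k : ℕ) :
    Good δ D H (k + 3) fun y => ((num p q ((FloatNet.half p q)^[k] y) -
      2 * num p q (FloatNet.half p q ((FloatNet.half p q)^[k] y)) : ℤ) : ℝ) * eps p q := by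
  have hε := eps_pos (p := p) (q := q)
  have h1 : Good δ D H k fun y => (FloatNet.half p q)^[k] (y : ℝ) := by
    simpa using (hs.good_zero hH).half_iterate hs k
  have h2 := (h1.half hs).zpow_two hs 1 1 (by norm_num) fun y hy => by
    have := hs.abs_two_pow_mul_half_iterate_le (h1.mem hy) (h1.abs_le hy) (k := 1) (by omega)
    rwa [Function.iterate_one] at this
  have e : ∀ y : Flt p q, |(y : ℝ)| ≤ H → (FloatNet.half p q)^[k] (y : ℝ) -
      2 ^ 1 * FloatNet.half p q ((FloatNet.half p q)^[k] (y : ℝ)) =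
      ((num p q ((FloatNet.half p q)^[k] y) -
      2 * num p q (FloatNet.half p q ((FloatNet.half p q)^[k] y)) : ℤ) : ℝ) * eps p q := by
    intro y hy
    push_cast
    rw [sub_mul, mul_assoc, num_mul_eps (h1.mem hy), num_mul_eps (half_mem _), pow_one]
  have hb : ∀ y : Flt p q, |(y : ℝ)| ≤ H → |num p q ((FloatNet.half p q)^[k] y) -
      2 * num p q (FloatNet.half p q ((FloatNet.half p q)^[k] y))| ≤ 1 :=
    fun y hy => abs_num_sub_half_le (h1.mem hy)
  have hb' : ∀ y : Flt p q, |(y : ℝ)| ≤ H → |((num p q ((FloatNet.half p q)^[k] y) -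
      2 * num p q (FloatNet.half p q ((FloatNet.half p q)^[k] y)) : ℤ) : ℝ) * eps p q| ≤
        2 ^ (2 * p + 5) * eps p q := by
    intro y hy
    rw [abs_mul, abs_of_pos hε]
    refine mul_le_mul_of_nonneg_right ?_ hε.le
    refine (show _ ≤ (1 : ℝ) by exact_mod_cast hb y hy).trans (one_le_pow₀ (by norm_num))
  refine (Good.sub hs (h1.mono hs (t' := k + 2) (by omega)) h2 fun y hy => ?_).congr fun y hy => ?_
  · rw [e y hy]
    exact (hs.small_lt (hb' y hy)).trans_le (by linarith [Omega_pos (p := p) (q := q)])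
  · rw [e y hy]
    refine hs.rd_of_mem (int_mul_eps_mem ((hb y hy).trans (one_le_pow₀ (by norm_num)))) ?_
    exact hs.small_le_Omega (hb' y hy)

/-- The backward pass can single out a given gradient and its negative. -/
theorem Good.exists_indicator (hs : GradScale δ D)
    (hH : ∀ y : Flt p q, |(y : ℝ)| ≤ H → |(D : ℝ) * y| ≤ Omega p q) (y₀ : Flt p q)
    (h0 : (y₀ : ℝ) ≠ 0) :
    ∃ (t : ℕ) (φ : Flt p q → ℝ) (s : ℝ), (t : ℤ) < 2 * emax q + p + (2 * p + 20) ∧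
      Good δ D H t φ ∧ (s = 1 ∨ s = -1) ∧
      ∀ y : Flt p q, |(y : ℝ)| ≤ H → (y = y₀ → φ y = s * eps p q) ∧
        (y = -y₀ → φ y = -(s * eps p q)) ∧ (y ≠ y₀ → y ≠ -y₀ → φ y = 0) := by
  have hε := eps_pos (p := p) (q := q)
  obtain ⟨k, o, ho, hob, hn0, hk⟩ := exists_num_eq_odd y₀.2 h0
  -- The comparison with `y₀` takes place after `s` halvings, while the digit is taken after `k = s
  -- + i`. If `s > 0` then `i = p + 1`, and a nonzero digit certifies that the first `s` halvings
  -- were exact; `i` stays small enough for the comparison to avoid overflow.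
  obtain ⟨i, s, rfl, hi, his⟩ : ∃ i s, k = s + i ∧ i ≤ p + 1 ∧ (s = 0 ∨ i = p + 1) :=
    ⟨min k (p + 1), k - min k (p + 1), by omega, by omega, by omega⟩
  let F : ℝ → ℝ := fun y => (FloatNet.half p q)^[s + i] y
  let b : ℝ → ℤ := fun y => num p q (F y) - 2 * num p q (FloatNet.half p q (F y))
  have hu : Good δ D H (s + i + 3) fun y => (b y : ℝ) * eps p q := Good.exists_bit hs hH (s + i)
  have hb : ∀ y : Flt p q, |b y| ≤ 1 := fun y => abs_num_sub_half_le (half_iterate_mem y.2 _)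
  have hP : Good δ D H s fun y => (FloatNet.half p q)^[s] (y : ℝ) := by
    simpa using (hs.good_zero hH).half_iterate hs s
  -- the value at the target and its negative
  have hτ : ∀ τ : ℤ, (τ = 1 ∨ τ = -1) → ∀ y : Flt p q, (y : ℝ) = τ * y₀ → b y = τ * b y₀ ∧
      num p q ((FloatNet.half p q)^[s] (y : ℝ)) = τ * (2 ^ i * o) := by
    intro τ hτ y hy
    have hP0 : num p q ((FloatNet.half p q)^[s] (y₀ : ℝ)) = 2 ^ i * o :=
      num_half_iterate_of_dvd y₀.2 (by rw [hn0, pow_add]; ring)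
    rcases hτ with rfl | rfl
    · rw [Int.cast_one, one_mul] at hy
      rw [hy, one_mul, one_mul]
      exact ⟨rfl, hP0⟩
    · rw [Int.cast_neg, Int.cast_one, neg_one_mul] at hy
      rw [hy, half_iterate_neg, num_neg (half_iterate_mem y₀.2 _), hP0]
      refine ⟨?_, by ring⟩
      simp only [b, F]
      rw [half_iterate_neg, half_neg, num_neg (half_iterate_mem y₀.2 _), num_neg (half_mem _)]
      ring
  have hF0 : num p q (F y₀) = o := num_half_iterate_of_dvd y₀.2 hn0
  have hσ : b y₀ = 1 ∨ b y₀ = -1 := by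
    have h1 := hb y₀
    -- After `k` halvings the numerator of `y₀` is the odd number `o`, so subtracting an even number
    -- does not give zero.
    have h2 : b y₀ ≠ 0 := by
      intro h
      obtain ⟨r, hr⟩ := ho
      simp only [b, hF0] at h
      omega
    rw [Int.abs_le_one_iff] at h1
    tauto
  set σ := b y₀ with hσdef
  -- the coefficient
  have hW := hu.zpow_two hs (p / 2 + 1) (p + i) (by omega) fun y hy => by
    apply hs.small_le_Omega
    rw [abs_mul, abs_mul, abs_of_pos hε, abs_of_pos (by positivity : (0 : ℝ) < 2 ^ (p + i))]
    have h1 : |(b y : ℝ)| ≤ 1 := by exact_mod_cast hb y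
    have h2 : (2 : ℝ) ^ (p + i) ≤ 2 ^ (2 * p + 5) := pow_le_pow_right₀ (by norm_num) (by omega)
    calc (2 : ℝ) ^ (p + i) * (|(b y : ℝ)| * eps p q) ≤ 2 ^ (p + i) * (1 * eps p q) := by gcongr
      _ ≤ _ := by rw [one_mul]; gcongr
  -- The term to be added is `-σ * o * b y * 2 ^ i * eps`. The factor `o` is scaled by `2 ^ (-p)` to
  -- meet the bound on coefficients, and the power `2 ^ (p + i)` is built up beforehand in `hW`.
  let c : ℝ := ((-(σ * o) : ℤ) : ℝ) * 2 ^ (-(p : ℤ))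
  have hσ1 : |σ| = 1 := by rcases hσ with h | h <;> rw [h] <;> rfl
  have hσo : |(-(σ * o))| < 2 ^ (p + 1) := by rw [abs_neg, abs_mul, hσ1, one_mul]; exact hob
  have hc : c ∈ finiteFloats p q := by
    obtain ⟨f1, f2, f3, f4, f5⟩ := emax_facts p q
    exact int_mul_mem hσo.le (by omega) (by omega)
  have hc16 : |c| ≤ 16 := by
    have h1 : |((-(σ * o) : ℤ) : ℝ)| ≤ 2 ^ (p + 1) := by exact_mod_cast hσo.le
    rw [abs_mul, abs_of_pos (by positivity : (0 : ℝ) < 2 ^ (-(p : ℤ)))]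
    calc _ ≤ (2 : ℝ) ^ (p + 1) * 2 ^ (-(p : ℤ)) := by gcongr
      _ = 2 := by rw [pow_succ, zpow_neg, zpow_natCast]; field_simp
      _ ≤ 16 := by norm_num
  have hcW : ∀ y : Flt p q, c * (2 ^ (p + i) * ((b y : ℝ) * eps p q)) =
      (((-(σ * o) * b y : ℤ) : ℝ) * 2 ^ i) * eps p q := by
    intro y
    simp only [c]
    push_cast
    rw [pow_add, zpow_neg, zpow_natCast]
    field_simp
  have hcb : ∀ y : Flt p q, |-(σ * o) * b y| ≤ 2 ^ (p + 1) := by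
    intro y
    rw [abs_mul]
    calc _ ≤ |(-(σ * o))| * 1 := mul_le_mul_of_nonneg_left (hb y) (abs_nonneg _)
      _ ≤ _ := by rw [mul_one]; exact hσo.le
  have hcs : ∀ y : Flt p q, |(((-(σ * o) * b y : ℤ) : ℝ) * 2 ^ i) * eps p q| ≤
      2 ^ (2 * p + 5) * eps p q := by
    intro y
    rw [abs_mul, abs_mul, abs_of_pos hε, abs_of_pos (by positivity : (0 : ℝ) < 2 ^ i)]
    have h1 : |((-(σ * o) * b y : ℤ) : ℝ)| ≤ 2 ^ (p + 1) := by exact_mod_cast hcb y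
    calc _ ≤ (2 : ℝ) ^ (p + 1) * 2 ^ i * eps p q := by gcongr
      _ = 2 ^ (p + 1 + i) * eps p q := by rw [pow_add (2 : ℝ) (p + 1) i]
      _ ≤ _ := pow_mul_eps_le (by omega)
  have hcO : ∀ y : Flt p q, |(((-(σ * o) * b y : ℤ) : ℝ) * 2 ^ i) * eps p q| ≤ Omega p q := by
    intro y
    have hD := hs.one_le
    refine le_trans ?_ (hs.small_le_Omega (hcs y))
    rw [abs_mul (D : ℝ)]
    exact le_mul_of_one_le_left (abs_nonneg _) (by rwa [abs_of_pos (by linarith)])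
  have hr := Good.lin hs (hP.mono hs (t' := s + i + 3 + (p / 2 + 1)) (by omega)) hW 1 c one_mem hc
    (by norm_num) hc16
    (fun y hy => by rw [one_mul]; exact ⟨hP.mem hy, hP.abs_le hy⟩)
    (fun y hy => by
      rw [hcW]
      exact ⟨int_mul_pow_mul_eps_mem (hcb y) (hcO y), hs.small_le_Omega (hcs y)⟩)
    (fun y hy => by
      have h1 := hs.small_lt (hcs y)
      have h2 := hP.abs_le hy
      rw [one_mul, hcW, mul_add]
      exact (abs_add_le _ _).trans_lt (by linarith))
  obtain ⟨φ, hφ, hφ'⟩ := (hu.mono hs (t' := s + i + 3 + (p / 2 + 1) + 1) (by omega)).exists_kill hs hr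
    fun y hy => by
      rw [abs_mul, abs_of_pos hε]
      exact mul_le_of_le_one_left hε.le (by exact_mod_cast hb y)
  have hrd : ∀ y : Flt p q, rd D (1 * (FloatNet.half p q)^[s] (y : ℝ) +
      c * (2 ^ (p + i) * ((b y : ℝ) * eps p q))) =
      rd D (((num p q ((FloatNet.half p q)^[s] (y : ℝ)) - (σ * o) * b y * 2 ^ i : ℤ) : ℝ) *
        eps p q) := by
    intro y
    rw [hcW]
    congr 1
    push_cast
    rw [sub_mul, num_mul_eps (half_iterate_mem y.2 _)]; ring
  have hval : ∀ τ : ℤ, (τ = 1 ∨ τ = -1) → ∀ y : Flt p q, |(y : ℝ)| ≤ H → (y : ℝ) = τ * y₀ →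
      φ y = τ * σ * eps p q := by
    intro τ h y hy hyτ
    obtain ⟨h1, h2⟩ := hτ τ h y hyτ
    rw [(hφ' y hy).1, h1]
    · push_cast; rfl
    · have hσσ : σ * σ = 1 := by rcases hσ with h | h <;> rw [h] <;> rfl
      rw [hrd, h1, h2, show τ * (2 ^ i * o) - σ * o * (τ * σ) * 2 ^ i =
        τ * o * 2 ^ i * (1 - σ * σ) by ring, hσσ]
      simp [hs.rd_zero]
  refine ⟨_, φ, (σ : ℝ), ?_, hφ, ?_, fun y hy => ⟨?_, ?_, ?_⟩⟩
  · push_cast at hk ⊢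
    omega
  · rcases hσ with h | h <;> rw [h] <;> simp
  · rintro rfl
    rw [hval 1 (Or.inl rfl) y hy (by simp)]; simp
  · rintro rfl
    rw [hval (-1) (Or.inr rfl) _ hy (by change -(y₀ : ℝ) = _; simp)]; push_cast; ring
  · intro hy1 hy2
    refine (hφ' y hy).2 ?_
    by_contra hcon
    push Not at hcon
    obtain ⟨hu0, hr0⟩ := hcon
    have hb0 : b y ≠ 0 := by
      intro h; rw [h] at hu0; simp at hu0
    rw [hrd] at hr0
    have hr1 := hs.rd_eq_zero hr0
    have hτ' : b y = 1 ∨ b y = -1 := by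
      have := hb y
      rw [Int.abs_le_one_iff] at this
      tauto
    -- If this failed, the number left after `s + p + 1` halvings would be zero, and so would the
    -- digit.
    have hex : num p q y = 2 ^ s * num p q ((FloatNet.half p q)^[s] y) := by
      rcases his with rfl | rfl
      · simp
      · refine half_iterate_exact y.2 fun h => ?_
        have h2 : num p q (FloatNet.half p q (F y)) = 0 :=
          num_half_of_abs_le_one (half_iterate_mem y.2 _) (by rw [h]; simp)
        apply hb0
        simp only [b]
        rw [h2]
        simp only [F, h]
        rfl
    -- A vanishing remainder determines all of `y` up to the sign `σ * b y`.
    have hny : num p q y = σ * b y * num p q y₀ := by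
      rw [hex, hn0, pow_add]
      linear_combination (2 : ℤ) ^ s * hr1
    have hyy : (y : ℝ) = ((σ * b y : ℤ) : ℝ) * y₀ := by
      have e1 := num_mul_eps y.2
      rw [hny] at e1
      push_cast at e1 ⊢
      linear_combination (σ : ℝ) * (b y : ℝ) * num_mul_eps y₀.2 - e1
    have : σ * b y = 1 ∨ σ * b y = -1 := by
      rcases hσ with h | h <;> rcases hτ' with h' | h' <;> rw [h, h'] <;> simp
    rcases this with h | h
    · rw [h] at hyy
      exact hy1 (Subtype.ext (by simpa using hyy))
    · rw [h] at hyy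
      exact hy2 (Subtype.ext (by change _ = -(y₀ : ℝ); simpa using hyy))

theorem GradScale.good_const_zero (hs : GradScale δ D)
    (hH : ∀ y : Flt p q, |(y : ℝ)| ≤ H → |(D : ℝ) * y| ≤ Omega p q) (t : ℕ) :
    Good δ D H (t + 1) fun _ => 0 := by
  refine (((hs.good_zero hH).mono hs (Nat.zero_le t)).scale hs 0 zero_mem (by simp)
    fun y hy => ?_).congr fun y _ => zero_mul _
  rw [zero_mul, mul_zero, abs_zero]
  exact ⟨zero_mem, Omega_pos.le⟩

/-- The backward pass can map a given gradient to any power of two, its negative to the negative of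
that, and all others to zero. -/
theorem Good.exists_spike (hs : GradScale δ D)
    (hH : ∀ y : Flt p q, |(y : ℝ)| ≤ H → |(D : ℝ) * y| ≤ Omega p q) (y₀ : Flt p q)
    (h0 : (y₀ : ℝ) ≠ 0) {σ : ℝ} (hσ : σ = 1 ∨ σ = -1) {E : ℤ} (hE : emin q - p ≤ E)
    (hE' : E ≤ emax q) (hDE : D * (2 : ℝ) ^ E ≤ Omega p q) {T : ℕ}
    (hT : 2 * emax q + 3 * p + 22 + (2 * emax q + p) / 4 ≤ T) :
    ∃ φ, Good δ D H T φ ∧ ∀ y : Flt p q, |(y : ℝ)| ≤ H → (y = y₀ → φ y = σ * 2 ^ E) ∧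
      (y = -y₀ → φ y = -(σ * 2 ^ E)) ∧ (y ≠ y₀ → y ≠ -y₀ → φ y = 0) := by
  obtain ⟨f1, f2, f3, f4, f5⟩ := emax_facts p q
  obtain ⟨t, φ, s, ht, hφ, hsg, hφ'⟩ := Good.exists_indicator hs hH y₀ h0
  obtain ⟨k, rfl⟩ : ∃ k : ℕ, E = emin q - p + k := ⟨(E - (emin q - p)).toNat, by omega⟩
  have hc : σ * s = 1 ∨ σ * s = -1 := by
    rcases hσ with rfl | rfl <;> rcases hsg with rfl | rfl <;> norm_num
  have hε : (2 : ℝ) ^ (emin q - p + k) = 2 ^ k * eps p q := by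
    unfold eps; rw [zpow_add₀ (by norm_num), zpow_natCast, mul_comm]
  have h1 : Good δ D H (t + 1) fun y => σ * s * φ y := by
    refine hφ.scale hs _ ?_ ?_ fun y hy => ?_
    · rcases hc with h | h <;> rw [h]
      · exact one_mem
      · exact neg_mem one_mem
    · rcases hc with h | h <;> rw [h] <;> norm_num
    · rcases hc with h | h <;> rw [h]
      · rw [one_mul]; exact ⟨hφ.mem hy, hφ.abs_le hy⟩
      · rw [neg_one_mul, mul_neg, abs_neg]; exact ⟨neg_mem (hφ.mem hy), hφ.abs_le hy⟩
  have hss : s * s = 1 := by rcases hsg with rfl | rfl <;> norm_num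
  have hval : ∀ y : Flt p q, |(y : ℝ)| ≤ H →
      (y = y₀ → 2 ^ k * (σ * s * φ y) = σ * 2 ^ (emin q - p + k)) ∧
      (y = -y₀ → 2 ^ k * (σ * s * φ y) = -(σ * 2 ^ (emin q - p + k))) ∧
      (y ≠ y₀ → y ≠ -y₀ → 2 ^ k * (σ * s * φ y) = 0) := by
    intro y hy
    obtain ⟨e1, e2, e3⟩ := hφ' y hy
    refine ⟨fun h => ?_, fun h => ?_, fun h h' => ?_⟩
    · rw [e1 h, hε]; linear_combination 2 ^ k * σ * eps p q * hss
    · rw [e2 h, hε]; linear_combination -(2 ^ k * σ * eps p q * hss)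
    · rw [e3 h h']; ring
  have hσa : |σ| = 1 := by rcases hσ with rfl | rfl <;> norm_num
  have hD := hs.one_le
  have habs : |D * (σ * 2 ^ (emin q - p + k))| ≤ Omega p q := by
    rw [abs_mul, abs_mul, hσa, one_mul, abs_of_pos (by linarith), abs_of_pos (by positivity)]
    exact hDE
  -- Since `E ≤ emax q`, the exponent gap satisfies `k ≤ 2 * emax q + p - 1`; it is covered four
  -- places at a time.
  have h2 := h1.zpow_two hs ((2 * emax q + p) / 4 + 1).toNat k (by omega) fun y hy => by
    obtain ⟨e1, e2, e3⟩ := hval y hy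
    by_cases ha : y = y₀
    · rw [e1 ha]; exact habs
    · by_cases hb : y = -y₀
      · rw [e2 hb, mul_neg, abs_neg]; exact habs
      · rw [e3 ha hb, mul_zero, abs_zero]; exact Omega_pos.le
  exact ⟨_, h2.mono hs (by omega), hval⟩

end Indicator

/-! ### The last affine transformation -/

theorem finite_mul_comm (x y : Flt p q) :
    (ExtFlt.finite x).mul (.finite y) = (ExtFlt.finite y).mul (.finite x) := by
  simp only [ExtFlt.mul, mul_comm]

theorem finite_neg_mul [Params p q] {x y z : Flt p q}
    (h : (ExtFlt.finite x).mul (.finite y) = .finite z) :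
    (ExtFlt.finite (-x)).mul (.finite y) = .finite (-z) := by
  rw [finite_mul_comm] at h ⊢
  exact finite_mul_neg h

theorem finite_add_neg_self [Params p q] (x : Flt p q) :
    (ExtFlt.finite x).add (.finite (-x)) = 0 := by
  have e : (x : ℝ) + ((-x : Flt p q) : ℝ) = 0 := add_neg_cancel (x : ℝ)
  have := (val_finite x).add_mem (val_finite (-x)) (by rw [e]; exact zero_mem)
  exact (this.congr e).eq_zero

/-- A prefix with sum zero can be dropped from a left-associative sum. This removes the gate pairs,
which are listed first, from the output. -/
theorem lsum_append (l₁ l₂ : List (ExtFlt p q)) (h : lsum l₁ = 0) :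
    lsum (l₁ ++ l₂) = lsum l₂ := by
  unfold lsum at *
  rw [List.foldl_append, h]

/-- The weights of the last affine transformation: the two members of a gate pair cancel each
other. -/
def lastWeight {C Q : Type} (D : Flt p q) (A : Q → Flt p q) : (C × Bool) ⊕ Q → Flt p q
  | .inl (_, false) => D
  | .inl (_, true) => -D
  | .inr s => A s

/-- The order of the neurons is chosen here: the members of a gate pair are adjacent and precede the
pieces. Each pair cancels before anything else is added, so the large gate values do no harm. -/
theorem realizes_last [Params p q] {a : Activation} {X C Q : Type} [Finite C] [Finite Q]
    {F : X → Flt p q} (D : Flt p q) (A : Q → Flt p q) :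
    Realizes a F 1
      (fun x (h : (C × Bool) ⊕ Q → ExtFlt p q) =>
        (∀ c, ∃ v s, h (.inl (c, false)) = .finite v ∧ h (.inl (c, true)) = .finite v ∧
          (ExtFlt.finite D).mul (.finite v) = .finite s) ∧
        ∀ T, IsSum (fun s => (ExtFlt.finite (A s)).mul (h (.inr s))) T → T = .finite (F x))
      (fun _ y g => ∀ i, g i = (ExtFlt.finite y).mul (.finite (lastWeight D A i))) := by
  classical
  have := Fintype.ofFinite C
  have := Fintype.ofFinite Q
  let lC : List C := Finset.univ.toList
  let lQ : List Q := Finset.univ.toList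
  let l : List ((C × Bool) ⊕ Q) :=
    (lC.flatMap fun c => [.inl (c, false), .inl (c, true)]) ++ lQ.map .inr
  have hl : l.Nodup := by
    refine List.Nodup.append ?_ ?_ ?_
    · rw [List.nodup_flatMap]
      refine ⟨fun c _ => by simp, ?_⟩
      have : lC.Nodup := Finset.nodup_toList _
      refine this.imp fun {c c'} hne => ?_
      intro i hi hi'
      simp only [List.mem_cons, List.not_mem_nil, or_false] at hi hi'
      rcases hi with rfl | rfl <;> rcases hi' with h | h <;> simp at h <;> exact hne h
    · exact (Finset.nodup_toList _).map Sum.inr_injective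
    · intro i hi hi'
      simp only [List.mem_flatMap, List.mem_map, List.mem_cons, List.not_mem_nil, or_false] at hi hi'
      obtain ⟨c, -, rfl | rfl⟩ := hi <;> obtain ⟨s, -, h⟩ := hi' <;> simp at h
  have hc : ∀ i, i ∈ l := by
    rintro (⟨c, _ | _⟩ | s) <;> simp [l, lC, lQ]
  let ρ : Affine p q l.length 1 := ⟨fun _ k => lastWeight D A (l.get k), fun _ => 0⟩
  refine ⟨l, .last ρ, hl, hc, fun x y hy h ⟨hV1, hV2⟩ => ⟨?_, ?_⟩⟩
  · funext i
    rw [Network.eval]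
    change (fsum fun k => (ExtFlt.finite (lastWeight D A (l.get k))).mul (h (l.get k))).add
      (0 : ExtFlt p q) = _
    rw [ExtFlt.add_zero, fsum_get l fun i => (ExtFlt.finite (lastWeight D A i)).mul (h i)]
    rw [List.map_append, lsum_append]
    · rw [List.map_map]
      exact hV2 _ ⟨lQ, Finset.nodup_toList _, fun s _ => by simp [lQ], rfl⟩
    · generalize lC = m
      induction m with
      | nil => rfl
      | cons c m ih =>
        rw [List.flatMap_cons, List.map_append, lsum_append]
        · exact ih
        · obtain ⟨v, s, h1, h2, h3⟩ := hV1 c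
          simp only [List.map_cons, List.map_nil, lastWeight, h1, h2, h3, finite_neg_mul h3]
          change ((0 : ExtFlt p q).add _).add _ = 0
          rw [ExtFlt.zero_add, finite_add_neg_self]
  · refine ⟨fun i => (ExtFlt.finite y).mul (.finite (lastWeight D A i)), fun i => rfl, fun k => ?_⟩
    rw [Network.grad]
    change (fsum fun i : Fin 1 => (ExtFlt.finite y).mul (.finite (lastWeight D A (l.get k)))) = _
    change (0 : ExtFlt p q).add _ = _
    rw [ExtFlt.zero_add]

/-! ### What is needed of an activation function -/

/-- The values of the bits of kind `o` (never on, or off, or on at a target) when the input is the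
target or not. -/
def bitState (hi lo : Flt p q) (on : Bool) : Option Bool → Flt p q
  | none => lo
  | some v => if on = v then hi else lo

/-- The parameters of the construction for the activation function `a`, and the properties of `a`
that make it work. -/
structure Kit (p q : ℕ) (a : Activation) where
  /-- value of active carriers -/
  κ : Flt p q
  /-- bias of carriers -/
  τ : Flt p q
  /-- derivative at active carriers -/
  δ : Flt p q
  /-- inverse of the derivative -/
  D : Flt p q
  /-- high value of bits -/
  hi : Flt p q
  /-- low value of bits -/
  lo : Flt p q
  /-- possible values of carriers -/
  J : Flt p q → Prop
  /-- whether high bits transmit gradients -/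
  Z : Prop
  hi_ne : hi ≠ lo
  scale : GradScale δ D
  delta_le : |(δ : ℝ)| ≤ 1
  bound : ∀ y : Flt p q, |(y : ℝ)| ≤ a.gradBound p q → |(D : ℝ) * y| ≤ Omega p q
  act_τ : a.act p q (.finite τ) = .finite κ
  der_τ : a.actDeriv p q (.finite τ) = .finite δ
  J_κ : J κ
  -- Away from the target only finiteness and the invariant `J` are required; on the target the
  -- preactivation must be exactly `τ`, whatever the weight.
  carrier : ∀ A j : Flt p q, |(A : ℝ)| ≤ 64 → J j → ∀ z,
    z = (((ExtFlt.finite A).mul (.finite j)).add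
      ((ExtFlt.finite (-A)).mul (.finite κ))).add (.finite τ) →
    (∃ j', J j' ∧ a.act p q z = .finite j') ∧ (∃ r, a.actDeriv p q z = .finite r) ∧
      (j = κ → z = .finite τ)
  -- At this distance, which is `4 * (emax q + 1)`, the exponentially small tails of all activation
  -- functions and derivatives are rounded off.
  off : ∀ z, AtMost z (-2 ^ (q + 1)) → a.act p q z = .finite lo ∧ a.actDeriv p q z = 0
  bitWeight : Flt p q
  bitBias : Flt p q
  bit : ∀ h, h = hi ∨ h = lo → ∀ z,
    z = ((ExtFlt.finite bitWeight).mul (.finite h)).add (.finite bitBias) →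
    a.act p q z = .finite h ∧ ∃ r, a.actDeriv p q z = .finite r ∧ (¬ (Z ∧ h = hi) → r = 0)
  gateWeight : Flt p q
  gateBias : Flt p q
  gate_on : ∃ v s : Flt p q, (ExtFlt.finite D).mul (.finite v) = .finite s ∧
    ∀ z, z = (((ExtFlt.finite D).mul (.finite κ)).add
      ((ExtFlt.finite gateWeight).mul (.finite lo))).add (.finite gateBias) →
      a.act p q z = .finite v ∧ a.actDeriv p q z = .finite δ
  -- The value `v` must not depend on `j`: the gate of a carrier and that of its twin see different
  -- values here, but still have to cancel in the output.
  gate_off : ∃ v s : Flt p q, (ExtFlt.finite D).mul (.finite v) = .finite s ∧ ∀ j, J j →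
    ∀ z, z = (((ExtFlt.finite D).mul (.finite j)).add
      ((ExtFlt.finite gateWeight).mul (.finite hi))).add (.finite gateBias) →
      a.act p q z = .finite v ∧ a.actDeriv p q z = 0
  gate_grad : ∀ y : Flt p q, |(y : ℝ)| ≤ a.gradBound p q →
    |(y : ℝ) * gateWeight| ≤ Omega p q
  /-- pieces of the output -/
  S : Type
  /-- bits used by these pieces -/
  K : Type
  [finS : Finite S]
  [finK : Finite K]
  kind : K → Option Bool
  outWeight : Flt p q → S → Flt p q
  pieceWeight : Flt p q → S → K → Flt p q
  pieceBias : Flt p q → S → Flt p q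
  piece : ∀ (t : Flt p q) (on : Bool) (P : S → ExtFlt p q),
    (∀ s, IsSum (fun k => (ExtFlt.finite (pieceWeight t s k)).mul
      (.finite (bitState hi lo on (kind k)))) (P s)) →
    (on = true → ∀ T, IsSum (fun s => (ExtFlt.finite (outWeight t s)).mul
      (a.act p q ((P s).add (.finite (pieceBias t s))))) T → T = .finite t) ∧
    (on = false → ∀ s, (ExtFlt.finite (outWeight t s)).mul
      (a.act p q ((P s).add (.finite (pieceBias t s)))) = 0) ∧
    -- All gradients must stay finite, since an infinity times zero would be NaN. The last clause
    -- stops leaks into the information neurons: under `Z` a high bit has nonzero derivative, so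
    -- what reaches it must be zero.
    ∀ y : Flt p q, |(y : ℝ)| ≤ a.gradBound p q →
      (∀ s, (∃ r, (ExtFlt.finite y).mul (.finite (outWeight t s)) = .finite r) ∧
        ∃ r, ((ExtFlt.finite y).mul (.finite (outWeight t s))).mul
          (a.actDeriv p q ((P s).add (.finite (pieceBias t s)))) = .finite r) ∧
      ∀ k out, IsSum (fun s => (((ExtFlt.finite y).mul (.finite (outWeight t s))).mul
        (a.actDeriv p q ((P s).add (.finite (pieceBias t s))))).mul
          (.finite (pieceWeight t s k))) out →
        ∃ r, out = .finite r ∧ (Z → bitState hi lo on (kind k) = hi → r = 0)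

attribute [instance] Kit.finS Kit.finK

namespace Kit

variable {a : Activation} (kit : Kit p q a) {X : Type}

open Classical in
/-- The value of the bit that belongs to a target and a kind. -/
def bitVal (b : X × Option Bool) (x : X) : Flt p q :=
  bitState kit.hi kit.lo (decide (x = b.1)) b.2

theorem bitVal_eq (b : X × Option Bool) (x : X) :
    kit.bitVal b x = kit.hi ∨ kit.bitVal b x = kit.lo := by
  unfold bitVal bitState
  rcases b.2 with _ | v
  · exact Or.inr rfl
  · simp only
    split_ifs
    · exact Or.inl rfl
    · exact Or.inr rfl

/-- The bits used by the last layers. -/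
def topBit {C : Type} (lab : C → X) : (C × Bool) ⊕ (X × kit.K) → X × Option Bool
  | .inl k => (lab k.1, some false)
  | .inr (x, k) => (x, kit.kind k)

open Classical in
/-- The weights of the last but one affine transformation. -/
def topWeight (F : X → Flt p q) {C : Type} :
    (C × Bool) ⊕ (X × kit.S) → C ⊕ C ⊕ ((C × Bool) ⊕ (X × kit.K)) → Flt p q
  | .inl (c, false), .inl c' => if c' = c then kit.D else 0
  | .inl (c, true), .inr (.inl c') => if c' = c then kit.D else 0
  | .inl k, .inr (.inr (.inl k')) => if k' = k then kit.gateWeight else 0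
  | .inr (x, s), .inr (.inr (.inr (x', k))) => if x' = x then kit.pieceWeight (F x) s k else 0
  | _, _ => 0

/-- The biases of the last but one affine transformation. -/
def topBias (F : X → Flt p q) {C : Type} : (C × Bool) ⊕ (X × kit.S) → Flt p q
  | .inl _ => kit.gateBias
  | .inr (x, s) => kit.pieceBias (F x) s

/-- On its target a gate has derivative `δ`, so the gradient becomes `y * D * δ = y` and leaves with
weight `D`; off target the derivative is zero. This is the only place where the gradient is made to
depend on the input. The second member of a gate pair is fed by the twin and serves only to cancel
the first in the output. -/
theorem top [Params p q] [Finite X] [Nonempty X] (F : X → Flt p q) {C : Type} [Finite C] [Nonempty C]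
    (lab : C → X) (γ : C → Flt p q → Flt p q)
    (hγ : ∀ c, Avail kit.δ kit.D (a.gradBound p q) 0 (γ c)) :
    Realizes a F 2
      (LayerVal kit.κ kit.J lab fun b => kit.bitVal (kit.topBit lab b))
      (LayerGrad lab γ fun b x => kit.Z ∧ kit.bitVal (kit.topBit lab b) x = kit.hi) := by
  classical
  refine (realizes_last (C := C) kit.D fun s : X × kit.S => kit.outWeight (F s.1) s.2).step
    (kit.topWeight F) (kit.topBias F) fun x h ⟨hV1, hV2, hV3⟩ P hP => ?_
  choose j hj hhj hjκ using hV1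
  have hfin : ∀ i, ∃ r : Flt p q, h i = .finite r := by
    rintro (c | c | b)
    · exact ⟨_, hhj c⟩
    · exact ⟨_, hV2 c⟩
    · exact ⟨_, hV3 b⟩
  have hz : ∀ i, (ExtFlt.finite (0 : Flt p q)).mul (h i) = 0 := fun i => by
    obtain ⟨r, hr⟩ := hfin i
    rw [hr]; exact finite_zero_mul r
  have hbv : ∀ c, kit.bitVal (lab c, some false) x = if lab c = x then kit.lo else kit.hi := by
    intro c
    unfold bitVal bitState
    by_cases hc : lab c = x
    · simp [hc]
    · simp [hc, eq_comm (a := x)]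
  -- preactivations of the gates
  have hPg : ∀ c v, P (.inl (c, v)) =
      ((ExtFlt.finite kit.D).mul (.finite (if v then kit.κ else j c))).add
        ((ExtFlt.finite kit.gateWeight).mul (.finite (if lab c = x then kit.lo else kit.hi))) := by
    rintro c (_ | _)
    · rw [(hP (.inl (c, false))).pair (.inl c) (.inr (.inr (.inl (c, false)))) (by simp) ?_]
      · simp [topWeight, hhj, hV3, topBit, hbv]
      · rintro (c' | c' | k' | ⟨x', k⟩) h1 h2
        · have : c' ≠ c := fun e => h1 (by rw [e])
          simp only [topWeight, if_neg this, hz]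
        · simp only [topWeight, hz]
        · have : k' ≠ (c, false) := fun e => h2 (by rw [e])
          simp only [topWeight, if_neg this, hz]
        · simp only [topWeight, hz]
    · rw [(hP (.inl (c, true))).pair (.inr (.inl c)) (.inr (.inr (.inl (c, true)))) (by simp) ?_]
      · simp [topWeight, hV2, hV3, topBit, hbv]
      · rintro (c' | c' | k' | ⟨x', k⟩) h1 h2
        · simp only [topWeight, hz]
        · have : c' ≠ c := fun e => h1 (by rw [e])
          simp only [topWeight, if_neg this, hz]
        · have : k' ≠ (c, true) := fun e => h2 (by rw [e])
          simp only [topWeight, if_neg this, hz]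
        · simp only [topWeight, hz]
  have hgate : ∀ c, ∃ v s : Flt p q, (ExtFlt.finite kit.D).mul (.finite v) = .finite s ∧ ∀ b,
      a.act p q ((P (.inl (c, b))).add (.finite kit.gateBias)) = .finite v ∧
      a.actDeriv p q ((P (.inl (c, b))).add (.finite kit.gateBias)) =
        if lab c = x then .finite kit.δ else 0 := by
    intro c
    by_cases hc : lab c = x
    · obtain ⟨v, s, h1, h2⟩ := kit.gate_on
      refine ⟨v, s, h1, fun b => ?_⟩
      rw [hPg, if_pos hc, if_pos hc]
      refine h2 _ ?_
      cases b <;> simp [hjκ c hc]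
    · obtain ⟨v, s, h1, h2⟩ := kit.gate_off
      refine ⟨v, s, h1, fun b => ?_⟩
      rw [hPg, if_neg hc, if_neg hc]
      cases b
      · exact h2 _ (hj c) _ rfl
      · exact h2 _ kit.J_κ _ rfl
  -- preactivations of the pieces
  have hPp : ∀ x' s, IsSum (fun k => (ExtFlt.finite (kit.pieceWeight (F x') s k)).mul
      (.finite (bitState kit.hi kit.lo (decide (x = x')) (kit.kind k)))) (P (.inr (x', s))) := by
    intro x' s
    have := (hP (.inr (x', s))).comp
      (fun k : kit.K => (.inr (.inr (.inr (x', k))) : C ⊕ C ⊕ ((C × Bool) ⊕ (X × kit.K))))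
      (fun k k' hk => by simpa using hk) ?_
    · simp only [topWeight, if_pos, hV3] at this
      exact this
    · rintro (c' | c' | k' | ⟨x'', k⟩) h1
      · simp only [topWeight, hz]
      · simp only [topWeight, hz]
      · simp only [topWeight, hz]
      · have : x'' ≠ x' := by
          rintro rfl; exact h1 k rfl
        simp only [topWeight, if_neg this, hz]
  refine ⟨⟨fun c => ?_, fun T hT => ?_⟩, ?_⟩
  · obtain ⟨v, s, h1, h2⟩ := hgate c
    exact ⟨v, s, (h2 false).1, (h2 true).1, h1⟩
  · have h1 := hT.comp (fun s : kit.S => (x, s)) (fun s s' e => by simpa using e) ?_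
    · exact (kit.piece (F x) true (fun s => P (.inr (x, s)))
        (fun s => by simpa using hPp x s)).1 rfl T h1
    · rintro ⟨x', s⟩ hne
      have hx : x ≠ x' := by
        rintro rfl; exact hne s rfl
      exact (kit.piece (F x') false (fun s => P (.inr (x', s)))
        (fun s => by simpa [hx] using hPp x' s)).2.1 rfl s
  · intro y hy g hg
    have hyD : Val ((ExtFlt.finite y).mul (.finite kit.D)) (y * kit.D) :=
      (val_finite y).mul_mem (val_finite _) (by
        rw [mul_comm]; exact kit.scale.mul_mem y.2 (kit.bound y hy))
    have hyD' : Val ((ExtFlt.finite y).mul (.finite (-kit.D))) (-y * kit.D) := by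
      obtain ⟨h1, h2⟩ := hyD
      rw [finite_mul_neg h2]
      exact (val_finite _).congr (by change -((y : ℝ) * kit.D) = _; ring)
    have hlast : ∀ c b, ∃ y' : Flt p q, ((y' : ℝ) = y ∨ (y' : ℝ) = -y) ∧ (b = false → y' = y) ∧
        Val (g (.inl (c, b))) (y' * kit.D) := by
      rintro c (_ | _)
      · exact ⟨y, Or.inl rfl, fun _ => rfl, by rw [hg]; exact hyD⟩
      · exact ⟨-y, Or.inr rfl, by simp, by rw [hg]; exact hyD'⟩
    have hpc := fun x' s => ((kit.piece (F x') (decide (x = x')) (fun s => P (.inr (x', s)))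
      (hPp x')).2.2 y hy).1 s
    have hG1 : ∀ c b, lab c = x → ∃ y' : Flt p q, ((y' : ℝ) = y ∨ (y' : ℝ) = -y) ∧
        (b = false → y' = y) ∧ (g (.inl (c, b))).mul
          (a.actDeriv p q ((P (.inl (c, b))).add (.finite kit.gateBias))) = .finite y' := by
      intro c b hc
      obtain ⟨y', h1, h2, h3⟩ := hlast c b
      refine ⟨y', h1, h2, ?_⟩
      obtain ⟨v, s, -, h4⟩ := hgate c
      rw [(h4 b).2, if_pos hc]
      have e : (y' : ℝ) * kit.D * kit.δ = y' := by
        linear_combination (y' : ℝ) * kit.scale.mul_eq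
      exact Val.eq_finite ((h3.mul_mem (val_finite _) (by rw [e]; exact y'.2)).congr e)
    have hG0 : ∀ c b, lab c ≠ x → (g (.inl (c, b))).mul
          (a.actDeriv p q ((P (.inl (c, b))).add (.finite kit.gateBias))) = 0 := by
      intro c b hc
      obtain ⟨y', h1, h2, h3⟩ := hlast c b
      obtain ⟨v, s, -, h4⟩ := hgate c
      rw [(h4 b).2, if_neg hc, h3.mul_zero]
    have hGf : ∀ k, ∃ r : Flt p q, (g k).mul
        (a.actDeriv p q ((P k).add (.finite (kit.topBias F k)))) = .finite r := by
      rintro (⟨c, b⟩ | ⟨x', s⟩)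
      · by_cases hc : lab c = x
        · obtain ⟨y', -, -, h⟩ := hG1 c b hc
          exact ⟨y', h⟩
        · exact ⟨0, hG0 c b hc⟩
      · rw [hg]
        exact (hpc x' s).2
    refine ⟨?_, fun out hout => ?_⟩
    · rintro (⟨c, b⟩ | ⟨x', s⟩)
      · obtain ⟨y', -, -, h⟩ := hlast c b
        exact ⟨_, h⟩
      · obtain ⟨r, hr⟩ := (hpc x' s).1
        refine ⟨r, ?_⟩
        rw [hg]
        change Val ((ExtFlt.finite y).mul (.finite (kit.outWeight (F x') s))) r
        rw [hr]
        exact val_finite r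
    have hGz : ∀ k, ((g k).mul (a.actDeriv p q ((P k).add (.finite (kit.topBias F k))))).mul
        (.finite 0) = 0 := fun k => by
      obtain ⟨r, hr⟩ := hGf k
      rw [hr]; exact finite_mul_zero r
    have ho1 : ∀ c, out (.inl c) = ((g (.inl (c, false))).mul
        (a.actDeriv p q ((P (.inl (c, false))).add (.finite kit.gateBias)))).mul
          (.finite kit.D) := by
      intro c
      rw [(hout (.inl c)).single (.inl (c, false)) ?_]
      · simp [topWeight, topBias]
      · rintro (⟨c', _ | _⟩ | ⟨x', s⟩) h1
        · have : c ≠ c' := fun e => h1 (by rw [e])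
          simp only [topWeight, if_neg this, hGz]
        · simp only [topWeight, hGz]
        · simp only [topWeight, hGz]
    have ho2 : ∀ c, out (.inr (.inl c)) = ((g (.inl (c, true))).mul
        (a.actDeriv p q ((P (.inl (c, true))).add (.finite kit.gateBias)))).mul
          (.finite kit.D) := by
      intro c
      rw [(hout (.inr (.inl c))).single (.inl (c, true)) ?_]
      · simp [topWeight, topBias]
      · rintro (⟨c', _ | _⟩ | ⟨x', s⟩) h1
        · simp only [topWeight, hGz]
        · have : c ≠ c' := fun e => h1 (by rw [e])
          simp only [topWeight, if_neg this, hGz]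
        · simp only [topWeight, hGz]
    have ho3 : ∀ k, out (.inr (.inr (.inl k))) = ((g (.inl k)).mul
        (a.actDeriv p q ((P (.inl k)).add (.finite kit.gateBias)))).mul
          (.finite kit.gateWeight) := by
      intro k
      rw [(hout (.inr (.inr (.inl k)))).single (.inl k) ?_]
      · simp [topWeight, topBias]
      · rintro (k' | ⟨x', s⟩) h1
        · have : k ≠ k' := fun e => h1 (by rw [e])
          rcases k' with ⟨c', _ | _⟩ <;> simp only [topWeight, if_neg this, hGz]
        · simp only [topWeight, hGz]
    have hDy : ∀ y' : Flt p q, ((y' : ℝ) = y ∨ (y' : ℝ) = -y) →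
        ∃ r, (ExtFlt.finite y').mul (.finite kit.D) = .finite r := by
      rintro y' (h | h)
      · obtain ⟨h1, h2⟩ := hyD
        have : y' = y := Subtype.ext h
        rw [this]; exact ⟨_, h2⟩
      · obtain ⟨h1, h2⟩ := hyD
        have : y' = -y := Subtype.ext h
        rw [this]; exact ⟨_, finite_neg_mul h2⟩
    refine ⟨fun c => ?_, fun c => ?_, ?_⟩
    · rw [ho1]
      by_cases hc : lab c = x
      · obtain ⟨y', -, h2, h3⟩ := hG1 c false hc
        rw [if_pos hc, h3, h2 rfl, ← hγ c y hy]
      · rw [if_neg hc, hG0 c false hc, zero_mul_finite]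
    · rw [ho2]
      by_cases hc : lab c = x
      · obtain ⟨y', h1, h2, h3⟩ := hG1 c true hc
        rw [h3]; exact hDy y' h1
      · exact ⟨0, by rw [hG0 c true hc, zero_mul_finite]; rfl⟩
    · rintro (⟨c, b⟩ | ⟨x', k⟩)
      · rw [ho3]
        by_cases hc : lab c = x
        · obtain ⟨y', h1, h2, h3⟩ := hG1 c b hc
          have hb : |(y' : ℝ) * kit.gateWeight| ≤ Omega p q := by
            have := kit.gate_grad y hy
            rcases h1 with h | h <;> rw [h]
            · exact this
            · rwa [neg_mul, abs_neg]
          obtain ⟨h4, h5⟩ := (val_finite y').mul (val_finite kit.gateWeight) hb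
          refine ⟨_, by rw [h3, h5], fun ⟨_, h⟩ => ?_⟩
          simp only [topBit, hbv, if_pos hc] at h
          exact absurd h.symm kit.hi_ne
        · exact ⟨0, (by rw [hG0 c b hc, zero_mul_finite]; rfl), fun _ => rfl⟩
      · have h1 := (hout (.inr (.inr (.inr (x', k))))).comp
          (fun s : kit.S => (.inr (x', s) : (C × Bool) ⊕ (X × kit.S)))
          (fun s s' e => by simpa using e) ?_
        · simp only [topWeight, if_pos, hg] at h1
          obtain ⟨r, h2, h3⟩ := ((kit.piece (F x') (decide (x = x')) (fun s => P (.inr (x', s)))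
            (hPp x')).2.2 y hy).2 k _ h1
          exact ⟨r, h2, fun ⟨h4, h5⟩ => h3 h4 h5⟩
        · rintro (⟨c', _ | _⟩ | ⟨x'', s⟩) hne
          · simp only [topWeight, hGz]
          · simp only [topWeight, hGz]
          · have : x' ≠ x'' := by
              rintro rfl; exact hne s rfl
            simp only [topWeight, if_neg this, hGz]

end Kit

/-! ### From the input to the bits -/

theorem succ_le_emax [Params p q] : (q : ℤ) + 1 ≤ emax q := by
  have key : ∀ k : ℕ, k + 8 ≤ 2 ^ (k + 5) := by
    intro k
    induction k with
    | zero => norm_num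
    | succ k ih => rw [show k + 1 + 5 = k + 5 + 1 by ring, pow_succ]; omega
  have h6 := (‹Params p q›).six_le
  obtain ⟨k, rfl⟩ : ∃ k, q = k + 6 := ⟨q - 6, by omega⟩
  have h : ((k + 8 : ℕ) : ℤ) ≤ 2 ^ (k + 5) := by exact_mod_cast key k
  unfold emax
  rw [show k + 6 - 1 = k + 5 by omega]
  push_cast at *
  omega

theorem two_pow_mem [Params p q] : (2 : ℝ) ^ (q + 1) ∈ finiteFloats p q := by
  obtain ⟨f1, f2, f3, f4, f5⟩ := emax_facts p q
  have h := succ_le_emax (p := p) (q := q)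
  have := two_zpow_mem (p := p) (q := q) (e := (q + 1 : ℕ)) (by omega) (by push_cast; omega)
  rwa [zpow_natCast] at this

/-- The parameters of the layers close to the input. -/
structure InputKit {a : Activation} (kit : Kit p q a) where
  /-- value of active carriers above the first layer -/
  κ₁ : Flt p q
  τ₁ : Flt p q
  J₁ : Flt p q → Prop
  act_τ₁ : a.act p q (.finite τ₁) = .finite κ₁
  der_τ₁ : ∃ r : Flt p q, |(r : ℝ)| ≤ 1 ∧ a.actDeriv p q (.finite τ₁) = .finite r
  -- The second layer carries out the trivial backward step with weights `kit.D` and `0`, so its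
  -- carriers need no other weights.
  carrier₁ : ∀ A j : Flt p q, A = kit.D ∨ A = 0 → J₁ j → ∀ z,
    z = (((ExtFlt.finite A).mul (.finite j)).add
      ((ExtFlt.finite (-A)).mul (.finite κ₁))).add (.finite kit.τ) →
    (∃ j', kit.J j' ∧ a.act p q z = .finite j') ∧ (∃ r, a.actDeriv p q z = .finite r) ∧
      (j = κ₁ → z = .finite kit.τ)
  /-- input weight of the carriers is `2 ^ (-s₁)` -/
  s₁ : ℕ
  w₁ : Flt p q
  b₁ : Flt p q → Flt p q
  s₁_le : s₁ ≤ p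
  w₁_eq : (w₁ : ℝ) = 2 ^ (-(s₁ : ℤ))
  -- The input weight shrinks gradients by `2 ^ (-s₁)`. Spikes are made larger by `2 ^ s₁` in
  -- advance, and this must not overflow at scale `D`.
  range : ∀ e ≤ emax q - p, (kit.D : ℝ) * 2 ^ (e + s₁) ≤ Omega p q
  first : ∀ v z : Flt p q, |(v : ℝ)| ≤ a.inputBound q → |(z : ℝ)| ≤ a.inputBound q → ∀ P,
    P = ((ExtFlt.finite w₁).mul (.finite v)).add (.finite (b₁ z)) →
    (∃ j, J₁ j ∧ a.act p q P = .finite j ∧ (v = z → j = κ₁)) ∧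
      ∃ r, a.actDeriv p q P = .finite r ∧ (v = z → r = kit.δ)
  /-- the input is compared with thresholds in `m + 1` layers -/
  m : ℕ
  cmpWeight : Flt p q → Bool → Flt p q
  cmpBias : Flt p q → Bool → Flt p q
  stepWeight : ℕ → Flt p q
  stepBias : ℕ → Flt p q
  m_le : m ≤ 2
  cmp : ∀ (v z : Flt p q) (s : Bool), |(v : ℝ)| ≤ a.inputBound q → |(z : ℝ)| ≤ a.inputBound q →
    ∃ c : ℕ → Flt p q,
      (∀ P, P = ((ExtFlt.finite (cmpWeight z s)).mul (.finite v)).add (.finite (cmpBias z s)) →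
        a.act p q P = .finite (c 0) ∧ ∃ r, a.actDeriv p q P = .finite r) ∧
      (∀ i ≤ m, ∀ P,
        P = ((ExtFlt.finite (stepWeight i)).mul (.finite (c i))).add (.finite (stepBias i)) →
        a.act p q P = .finite (c (i + 1)) ∧ ∃ r, a.actDeriv p q P = .finite r) ∧
      -- The gap between `0` and `1 / 4` is what the weight `-2 ^ emax q` of the recognising neuron
      -- turns into `-2 ^ (emax q - 2)`.
      ((c (m + 1) : ℝ) = 0 ∨ 1 / 4 ≤ (c (m + 1) : ℝ)) ∧
      ((c (m + 1) : ℝ) = 0 ↔ if s then (v : ℝ) ≤ z else (z : ℝ) ≤ v)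
  /-- value of the neuron that recognizes the target -/
  on : Flt p q
  norBias : Flt p q
  nor_on : a.act p q (.finite norBias) = .finite on ∧ ∃ r, a.actDeriv p q (.finite norBias) = .finite r
  nor_off : ∀ P, AtMost P (-2 ^ (emax q - 2)) → AtMost (P.add (.finite norBias)) (-2 ^ (q + 1))
  litWeight : Bool → Flt p q
  litBias : Bool → Flt p q
  lit : ∀ e v : Bool, ∀ P,
    P = ((ExtFlt.finite (litWeight v)).mul (.finite (if e then on else kit.lo))).add
      (.finite (litBias v)) →
    a.act p q P = .finite (bitState kit.hi kit.lo e (some v)) ∧ ∃ r, a.actDeriv p q P = .finite r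

namespace Kit

variable {a : Activation} (kit : Kit p q a) {X : Type} {F : X → Flt p q}

/-- A function with `t + 1` backward steps splits into two with `t` steps, so the carriers above are
indexed by `C × Bool`: the trees are unfolded, and no carrier is shared between two uses. -/
theorem chain [Params p q] {C B B' : Type} [Finite C] [Nonempty C] [Finite B']
    {val : B → X → Flt p q} {val' : B' → X → Flt p q} {gz : B → X → Prop} {t n : ℕ} {lab : C → X}
    (hR : ∀ γ : C × Bool → Flt p q → Flt p q,
      (∀ k, Avail kit.δ kit.D (a.gradBound p q) t (γ k)) →
      Realizes a F n (LayerVal kit.κ kit.J (fun k : C × Bool => lab k.1) val)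
        (LayerGrad (fun k : C × Bool => lab k.1) γ gz))
    (w : B → B' → Flt p q) (β : B → Flt p q)
    (hinfo : ∀ x b S, IsSum (fun b' => (ExtFlt.finite (w b b')).mul (.finite (val' b' x))) S →
      a.act p q (S.add (.finite (β b))) = .finite (val b x) ∧
      ∃ r, a.actDeriv p q (S.add (.finite (β b))) = .finite r ∧ (¬ gz b x → r = 0))
    (γ : C → Flt p q → Flt p q) (hγ : ∀ c, Avail kit.δ kit.D (a.gradBound p q) (t + 1) (γ c)) :
    Realizes a F (n + 1) (LayerVal kit.κ kit.J lab val') (LayerGrad lab γ fun _ _ => True) := by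
  choose γ₁ γ₂ a₁ a₂ h1 h2 h3 h4 h5 using hγ
  refine (hR (fun k => if k.2 then γ₂ k.1 else γ₁ k.1) ?_).chain
    (fun k => if k.2 then a₂ k.1 else a₁ k.1) w β kit.act_τ kit.der_τ kit.delta_le ?_ hinfo ?_
  · rintro ⟨c, _ | _⟩
    · exact h1 c
    · exact h2 c
  · rintro ⟨c, _ | _⟩ j hj z hz
    · exact kit.carrier _ j (h3 c) hj z hz
    · exact kit.carrier _ j (h4 c) hj z hz
  · exact fun c y hy => h5 c y hy

/-- The part of the network that reads bits, with `t + 1` backward steps. -/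
theorem exists_bits [Params p q] [Finite X] [Nonempty X] (t : ℕ) (C : Type) [Finite C] [Nonempty C]
    (lab : C → X) : ∃ (B : Type) (_ : Finite B) (tb : B → X × Option Bool),
      ∀ γ : C → Flt p q → Flt p q,
        (∀ c, Avail kit.δ kit.D (a.gradBound p q) (t + 1) (γ c)) →
        Realizes a F (t + 3) (LayerVal kit.κ kit.J lab fun b => kit.bitVal (tb b))
          (LayerGrad lab γ fun _ _ => True) := by
  classical
  have hstep : ∀ {B : Type} (tb : B → X × Option Bool) (gz : B → X → Prop),
      (∀ b x, ¬ gz b x → ¬ (kit.Z ∧ kit.bitVal (tb b) x = kit.hi)) →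
      ∀ x b S, IsSum (fun b' => (ExtFlt.finite (if b' = b then kit.bitWeight else 0)).mul
        (.finite (kit.bitVal (tb b') x))) S →
      a.act p q (S.add (.finite kit.bitBias)) = .finite (kit.bitVal (tb b) x) ∧
      ∃ r, a.actDeriv p q (S.add (.finite kit.bitBias)) = .finite r ∧ (¬ gz b x → r = 0) := by
    intro B tb gz hgz x b S hS
    have e := hS.single b fun b' hb' => by rw [if_neg hb']; exact finite_zero_mul _
    rw [if_pos rfl] at e
    obtain ⟨h1, r, h2, h3⟩ := kit.bit _ (kit.bitVal_eq (tb b) x) _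
      (congrArg (fun z => z.add (.finite kit.bitBias)) e)
    exact ⟨h1, r, h2, fun h => h3 (hgz b x h)⟩
  induction t generalizing C with
  | zero =>
    refine ⟨_, inferInstance, kit.topBit (fun k : C × Bool => lab k.1), fun γ hγ => ?_⟩
    exact kit.chain (fun γ' hγ' => kit.top F (fun k : C × Bool => lab k.1) γ' hγ') _
      (fun _ => kit.bitBias) (hstep _ _ fun b x h => h) γ hγ
  | succ t ih =>
    obtain ⟨B, hB, tb, h⟩ := ih (C × Bool) fun k => lab k.1
    refine ⟨B, hB, tb, fun γ hγ => ?_⟩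
    exact kit.chain h _ (fun _ => kit.bitBias) (hstep tb _ fun b x h => absurd trivial h) γ hγ

/-- There are networks with `t` backward steps, and with information neurons of values `val` before
the activation function of their first layer. -/
def Prog (F : X → Flt p q) (t : ℕ) {B : Type} (val : B → X → Flt p q) : Prop :=
  ∀ (C : Type) [Finite C] [Nonempty C] (lab : C → X) (γ : C → Flt p q → Flt p q),
    (∀ c, Avail kit.δ kit.D (a.gradBound p q) t (γ c)) →
    Realizes a F (t + 2) (LayerVal kit.κ kit.J lab val) (LayerGrad lab γ fun _ _ => True)

theorem Prog.step [Params p q] {kit : Kit p q a} {t : ℕ} {B B' : Type} [Finite B']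
    {val : B → X → Flt p q}
    {val' : B' → X → Flt p q} (h : kit.Prog F t val) (w : B → B' → Flt p q) (β : B → Flt p q)
    (hinfo : ∀ x b S, IsSum (fun b' => (ExtFlt.finite (w b b')).mul (.finite (val' b' x))) S →
      a.act p q (S.add (.finite (β b))) = .finite (val b x) ∧
      ∃ r, a.actDeriv p q (S.add (.finite (β b))) = .finite r) : kit.Prog F (t + 1) val' := by
  intro C _ _ lab γ hγ
  refine kit.chain (h (C × Bool) fun k => lab k.1) w β (fun x b S hS => ?_) γ hγ
  obtain ⟨h1, r, h2⟩ := hinfo x b S hS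
  exact ⟨h1, r, h2, fun h => absurd trivial h⟩

open Classical in
/-- The value of the neuron that recognizes the input `x₀`. -/
def eqVal (ik : InputKit kit) (x₀ x : X) : Flt p q := if x = x₀ then ik.on else kit.lo

/-- Bits of all kinds come from the neuron that recognises their target. The bits that are never on
get weight zero and the bias `-2 ^ (q + 1)`, which switches them off. -/
theorem prog_eq [Params p q] [Finite X] [Nonempty X] (ik : InputKit kit) (t : ℕ) :
    kit.Prog F (t + 2) (kit.eqVal ik) := by
  classical
  intro C _ _ lab γ hγ
  obtain ⟨B, hB, tb, h⟩ := kit.exists_bits (F := F) t (C × Bool) fun k => lab k.1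
  refine kit.chain h (fun b x₀ => if x₀ = (tb b).1 then (tb b).2.elim 0 ik.litWeight else 0)
    (fun b => (tb b).2.elim ⟨_, neg_mem two_pow_mem⟩ ik.litBias) (fun x b S hS => ?_) γ hγ
  have e := hS.single (tb b).1 fun x' hx' => by rw [if_neg hx']; exact finite_zero_mul _
  rw [if_pos rfl] at e
  change (a.act p q (S.add (.finite ((tb b).2.elim _ ik.litBias))) = .finite
    (bitState kit.hi kit.lo (decide (x = (tb b).1)) (tb b).2)) ∧ ∃ r, a.actDeriv p q (S.add (.finite
      ((tb b).2.elim _ ik.litBias))) = .finite r ∧ (¬ True → r = 0)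
  revert e
  rcases (tb b).2 with _ | v <;> intro e
  · simp only [Option.elim] at e ⊢
    rw [finite_zero_mul] at e
    rw [e, ExtFlt.zero_add]
    obtain ⟨h1, h2⟩ := kit.off _ ((val_mk (neg_mem (two_pow_mem (p := p) (q := q)))).atMost le_rfl)
    exact ⟨h1, 0, h2, fun _ => rfl⟩
  · simp only [Option.elim] at e ⊢
    have e' : eqVal kit ik (tb b).1 x = if decide (x = (tb b).1) = true then ik.on else kit.lo := by
      unfold eqVal
      simp only [decide_eq_true_eq]
    rw [e'] at e
    obtain ⟨h1, r, h2⟩ := ik.lit (decide (x = (tb b).1)) v _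
      (congrArg (fun z => z.add (.finite (ik.litBias v))) e)
    exact ⟨h1, r, h2, fun h => absurd trivial h⟩

/-- The lowest backward step has weights `kit.D` and `0` and delivers `kit.D * φ` to the first
layer, whose derivative will take off the factor `kit.D`. The carriers may have another value `κ₁`
there, as the first layer depends on the input in a different way. -/
theorem Prog.last [Params p q] {kit : Kit p q a} (ik : InputKit kit) {t : ℕ} {B B' : Type}
    [Finite B'] {val : B → X → Flt p q} {val' : B' → X → Flt p q} (h : kit.Prog F t val)
    (w : B → B' → Flt p q) (β : B → Flt p q)
    (hinfo : ∀ x b S, IsSum (fun b' => (ExtFlt.finite (w b b')).mul (.finite (val' b' x))) S →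
      a.act p q (S.add (.finite (β b))) = .finite (val b x) ∧
      ∃ r, a.actDeriv p q (S.add (.finite (β b))) = .finite r)
    {C : Type} [Finite C] [Nonempty C] (lab : C → X) (φ : C → Flt p q → ℝ)
    (hφ : ∀ c, Good kit.δ kit.D (a.gradBound p q) t (φ c)) :
    ∃ γ : C → Flt p q → Flt p q,
      (∀ c (y : Flt p q), |(y : ℝ)| ≤ a.gradBound p q → (γ c y : ℝ) = kit.D * φ c y) ∧
      Realizes a F (t + 3) (LayerVal ik.κ₁ ik.J₁ lab val') (LayerGrad lab γ fun _ _ => True) := by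
  classical
  choose γ₀ hA hγ₀ using hφ
  let γ : C → Flt p q → Flt p q := fun c y =>
    if hy : kit.D * φ c y ∈ finiteFloats p q then ⟨_, hy⟩ else 0
  have hmem : ∀ c (y : Flt p q), |(y : ℝ)| ≤ a.gradBound p q →
      (kit.D * φ c y : ℝ) ∈ finiteFloats p q := fun c y hy =>
    kit.scale.mul_mem (hγ₀ c y hy).1.mem (hγ₀ c y hy).2
  have hγ : ∀ c (y : Flt p q), |(y : ℝ)| ≤ a.gradBound p q → (γ c y : ℝ) = kit.D * φ c y := by
    intro c y hy
    simp only [γ, dif_pos (hmem c y hy)]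
  refine ⟨γ, hγ, ?_⟩
  refine (h (C × Bool) (fun k => lab k.1) (fun k => γ₀ k.1) fun k => hA k.1).chain
    (fun k => if k.2 then 0 else kit.D) w β kit.act_τ kit.der_τ kit.delta_le ?_ ?_ ?_
  · rintro ⟨c, _ | _⟩ j hj z hz
    · exact ik.carrier₁ _ j (Or.inl rfl) hj z hz
    · exact ik.carrier₁ _ j (Or.inr rfl) hj z hz
  · intro x b S hS
    obtain ⟨h1, r, h2⟩ := hinfo x b S hS
    exact ⟨h1, r, h2, fun h => absurd trivial h⟩
  · intro c y hy
    obtain ⟨m1, e1⟩ := (hγ₀ c y hy).1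
    have e : φ c y * kit.D = γ c y := by rw [hγ c y hy, mul_comm]
    refine ⟨_, _, γ c y, 0, e1, e1, ?_, ?_, ?_⟩
    · exact Val.eq_finite (((val_mk m1).mul_mem (val_finite kit.D) (by
        rw [e]; exact (γ c y).2)).congr e)
    · exact finite_mul_zero _
    · exact ExtFlt.add_zero _

end Kit

/-! ### Recognition of inputs and assembly of the network. -/

instance [Params p q] (d : ℕ) (a : Activation) : Finite (inputCube p q d a) := Subtype.finite

instance (d : ℕ) (a : Activation) : Nonempty (inputCube p q d a) := by
  refine ⟨⟨fun _ => 0, fun i => ?_⟩⟩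
  change |(0 : ℝ)| ≤ _
  rw [abs_zero]
  cases a <;> simp only [Activation.inputBound] <;> positivity

namespace InputKit

variable {a : Activation} {kit : Kit p q a} (ik : InputKit kit) {d : ℕ}

open Classical in
/-- The values of the successive neurons that compare `v` with `z`. -/
def cmpVal (v z : Flt p q) (s : Bool) : ℕ → Flt p q :=
  if h : |(v : ℝ)| ≤ a.inputBound q ∧ |(z : ℝ)| ≤ a.inputBound q then
    (ik.cmp v z s h.1 h.2).choose
  else 0

theorem cmpVal_spec {v z : Flt p q} (hv : |(v : ℝ)| ≤ a.inputBound q)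
    (hz : |(z : ℝ)| ≤ a.inputBound q) (s : Bool) :
      (∀ P, P = ((ExtFlt.finite (ik.cmpWeight z s)).mul (.finite v)).add
        (.finite (ik.cmpBias z s)) →
        a.act p q P = .finite (ik.cmpVal v z s 0) ∧ ∃ r, a.actDeriv p q P = .finite r) ∧
      (∀ i ≤ ik.m, ∀ P,
        P = ((ExtFlt.finite (ik.stepWeight i)).mul (.finite (ik.cmpVal v z s i))).add
          (.finite (ik.stepBias i)) →
        a.act p q P = .finite (ik.cmpVal v z s (i + 1)) ∧ ∃ r, a.actDeriv p q P = .finite r) ∧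
      ((ik.cmpVal v z s (ik.m + 1) : ℝ) = 0 ∨ 1 / 4 ≤ (ik.cmpVal v z s (ik.m + 1) : ℝ)) ∧
      ((ik.cmpVal v z s (ik.m + 1) : ℝ) = 0 ↔ if s then (v : ℝ) ≤ z else (z : ℝ) ≤ v) := by
  unfold cmpVal
  rw [dif_pos ⟨hv, hz⟩]
  exact (ik.cmp v z s hv hz).choose_spec

/-- The value of the neuron in layer `i + 1` that compares a coordinate of the input with that of a
target. -/
def cubeVal (i : ℕ) (b : inputCube p q d a × Fin d × Bool) (x : inputCube p q d a) : Flt p q :=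
  ik.cmpVal (x.1 b.2.1) (b.1.1 b.2.1) b.2.2 i

theorem cubeVal_step [Params p q] {i : ℕ} (hi : i ≤ ik.m) (x : inputCube p q d a)
    (b : inputCube p q d a × Fin d × Bool) (S : ExtFlt p q) [DecidableEq (inputCube p q d a × Fin d × Bool)]
    (hS : IsSum (fun b' => (ExtFlt.finite (if b' = b then ik.stepWeight i else 0)).mul
      (.finite (ik.cubeVal i b' x))) S) :
    a.act p q (S.add (.finite (ik.stepBias i))) = .finite (ik.cubeVal (i + 1) b x) ∧
      ∃ r, a.actDeriv p q (S.add (.finite (ik.stepBias i))) = .finite r := by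
  have e := hS.single b fun b' hb' => by rw [if_neg hb']; exact finite_zero_mul _
  rw [if_pos rfl] at e
  exact (ik.cmpVal_spec (x.2 b.2.1) (b.1.2 b.2.1) b.2.2).2.1 i hi _
    (congrArg (fun z => z.add (.finite (ik.stepBias i))) e)

/-- Recognition is a NOR: the input equals the target exactly when the comparisons in both
directions give zero for all coordinates. All terms are nonpositive, so one failing comparison
pushes the sum below `-2 ^ (emax q - 2)` in any order of summation. -/
theorem prog_cmp [Params p q] {F : inputCube p q d a → Flt p q} (t k : ℕ) (hk : k ≤ ik.m) :
    kit.Prog F (t + 3 + k) (ik.cubeVal (d := d) (ik.m + 1 - k)) := by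
  classical
  have hW : (2 : ℝ) ^ emax q ∈ finiteFloats p q := by
    obtain ⟨f1, f2, f3, f4, f5⟩ := emax_facts p q
    exact two_zpow_mem (by omega) le_rfl
  induction k with
  | zero =>
    refine (kit.prog_eq (F := F) ik t).step
      (fun x₀ b => if b.1 = x₀ then ⟨-2 ^ emax q, neg_mem hW⟩ else 0)
      (fun _ => ik.norBias) fun x x₀ S hS => ?_
    by_cases hx : x = x₀
    · subst hx
      have hS0 : S = 0 := by
        refine hS.zero fun b => ?_
        by_cases hb : b.1 = x
        · have : (ik.cubeVal (ik.m + 1 - 0) b x : ℝ) = 0 := by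
            unfold cubeVal
            rw [hb]
            refine (ik.cmpVal_spec (x.2 b.2.1) (x.2 b.2.1) b.2.2).2.2.2.2 ?_
            split_ifs <;> exact le_rfl
          rw [show ik.cubeVal (ik.m + 1 - 0) b x = 0 from Subtype.ext this]
          exact finite_mul_zero _
        · rw [if_neg hb]; exact finite_zero_mul _
      rw [hS0, ExtFlt.zero_add]
      have : kit.eqVal ik x x = ik.on := by simp [Kit.eqVal]
      rw [this]
      exact ik.nor_on
    · have : kit.eqVal ik x₀ x = kit.lo := by simp [Kit.eqVal, hx]
      rw [this]
      obtain ⟨j, hj⟩ : ∃ j, x.1 j ≠ x₀.1 j := by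
        by_contra hcon
        push Not at hcon
        exact hx (Subtype.ext (funext hcon))
      obtain ⟨s, hs⟩ : ∃ s : Bool, ¬ (if s then (x.1 j : ℝ) ≤ x₀.1 j else (x₀.1 j : ℝ) ≤ x.1 j) := by
        by_contra hcon
        push Not at hcon
        have h1 := hcon true
        have h2 := hcon false
        simp only [if_true] at h1
        simp only [Bool.false_eq_true, if_false] at h2
        exact hj (Subtype.ext (le_antisymm h1 h2))
      have hval : ∀ b : inputCube p q d a × Fin d × Bool,
          (ik.cubeVal (ik.m + 1 - 0) b x : ℝ) = 0 ∨
          1 / 4 ≤ (ik.cubeVal (ik.m + 1 - 0) b x : ℝ) := fun b =>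
        (ik.cmpVal_spec (x.2 b.2.1) (b.1.2 b.2.1) b.2.2).2.2.1
      have hAt : AtMost S (-2 ^ (emax q - 2)) := by
        obtain ⟨f1, f2, f3, f4, f5⟩ := emax_facts p q
        have hm : (-2 ^ (emax q - 2) : ℝ) ∈ finiteFloats p q :=
          neg_mem (two_zpow_mem (by omega) (by omega))
        refine hS.atMost (fun b => ?_) (x₀, j, s) hm ?_
        · by_cases hb : b.1 = x₀
          · rw [if_pos hb]
            refine (val_mk (neg_mem hW)).atMost_mul (val_finite _) zero_mem ?_
            have h1 : (0 : ℝ) ≤ ik.cubeVal (ik.m + 1 - 0) b x := by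
              rcases hval b with h | h <;> linarith
            have h2 : (0 : ℝ) < 2 ^ emax q := by positivity
            nlinarith
          · rw [if_neg hb]
            exact Val.atMost (s := 0) (by rw [finite_zero_mul]; exact val_zero) le_rfl
        · rw [if_pos rfl]
          refine (val_mk (neg_mem hW)).atMost_mul (val_finite _) hm ?_
          have h1 : (1 / 4 : ℝ) ≤ ik.cubeVal (ik.m + 1 - 0) (x₀, j, s) x := by
            rcases hval (x₀, j, s) with h | h
            · exact absurd ((ik.cmpVal_spec (x.2 j) (x₀.2 j) s).2.2.2.1 h) hs
            · exact h
          have h2 : (0 : ℝ) < 2 ^ emax q := by positivity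
          have h3 : (2 : ℝ) ^ (emax q - 2) = 2 ^ emax q * (1 / 4) := by
            rw [zpow_sub₀ (by norm_num)]; norm_num; ring
          rw [h3]
          nlinarith
      obtain ⟨h1, h2⟩ := kit.off _ (ik.nor_off _ hAt)
      exact ⟨h1, 0, h2⟩
  | succ k ih =>
    have e : ik.m + 1 - k = ik.m + 1 - (k + 1) + 1 := by omega
    rw [e] at ih
    exact (ih (by omega)).step _ (fun _ => ik.stepBias (ik.m + 1 - (k + 1)))
      fun x b S hS => ik.cubeVal_step (by omega) x b S hS

/-- For input `x` and gradient `y`, the carriers that pass anything on to coordinate `j` are those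
labelled by `x`, `j` and `|y|`. Their `|M|` active units add up to the prescribed gradient. Positive
`y₀` suffice by oddness. -/
theorem exists_network [Params p q] (hd : 1 ≤ d) (F : inputCube p q d a → Flt p q)
    (G : (Fin d → Flt p q) → Flt p q → (Fin d → Flt p q)) (hodd : ∀ x y, G x (-y) = -G x y) {t : ℕ}
    (ht : 2 * emax q + 3 * p + 22 + (2 * emax q + p) / 4 ≤ ((t + 3 + ik.m : ℕ) : ℤ)) :
    ∃ f : Network p q (t + ik.m + 7) d 1,
      ∀ (x : inputCube p q d a) (y : Flt p q), |(y : ℝ)| ≤ a.gradBound p q →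
        (f.eval a (fun i => .finite (x.1 i)) = fun _ => .finite (F x)) ∧
        (f.grad a (fun i => .finite (x.1 i)) (fun _ => .finite y) =
          fun j => .finite (G x.1 y j)) := by
  classical
  obtain ⟨f1, f2, f3, f4, f5⟩ := emax_facts p q
  have hG0 : ∀ x j, G x 0 j = 0 := fun x j => by
    have h := congrFun (hodd x 0) j
    have e : (-0 : Flt p q) = 0 := Subtype.ext (neg_zero)
    rw [e] at h
    have h' : (G x 0 j : ℝ) = -(G x 0 j : ℝ) := congrArg Subtype.val h
    exact Subtype.ext (show (G x 0 j : ℝ) = 0 by linarith)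
  have hrep : ∀ (x : Fin d → Flt p q) (y : Flt p q) (j : Fin d), ∃ m e : ℤ, |m| < 2 ^ (p + 1) ∧
      emin q - p ≤ e ∧ e ≤ emax q - p ∧ (G x y j : ℝ) = m * 2 ^ e := fun x y j =>
    mem_finiteFloats_iff.1 (G x y j).2
  choose M E hM hE hE' hME using hrep
  -- The last factor enumerates units of the mantissa: `2 ^ (p + 1)` of them are enough for every
  -- float, and those beyond `|M|` stay silent.
  let C : Type := inputCube p q d a × Fin d × {y : Flt p q // 0 < (y : ℝ)} × Fin (2 ^ (p + 1))
  have : Nonempty (Fin d) := ⟨⟨0, hd⟩⟩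
  have : Nonempty {y : Flt p q // 0 < (y : ℝ)} := ⟨⟨⟨_, Omega_mem⟩, Omega_pos⟩⟩
  have : Nonempty (Fin (2 ^ (p + 1))) := ⟨⟨0, by positivity⟩⟩
  have hD := ik.range
  let N : C → ℤ := fun c =>
    if (c.2.2.2 : ℕ) < (M c.1.1 c.2.2.1.1 c.2.1).natAbs then (M c.1.1 c.2.2.1.1 c.2.1).sign else 0
  let Ec : C → ℤ := fun c => E c.1.1 c.2.2.1.1 c.2.1
  have hφ : ∀ c : C, ∃ φ, Good kit.δ kit.D (a.gradBound p q) (t + 3 + ik.m) φ ∧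
      ∀ y : Flt p q, |(y : ℝ)| ≤ a.gradBound p q →
        (y = c.2.2.1.1 → φ y = N c * 2 ^ (Ec c + ik.s₁)) ∧
        (y = -c.2.2.1.1 → φ y = -(N c * 2 ^ (Ec c + ik.s₁))) ∧
        (y ≠ c.2.2.1.1 → y ≠ -c.2.2.1.1 → φ y = 0) := by
    rintro ⟨x, j, y₀, i⟩
    by_cases hi : (i : ℕ) < (M x.1 y₀.1 j).natAbs
    · have h0 : M x.1 y₀.1 j ≠ 0 := fun h => by simp [h] at hi
      have hs := ik.s₁_le
      have h1 := hE x.1 y₀.1 j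
      have h2 := hE' x.1 y₀.1 j
      have hsg : ((M x.1 y₀.1 j).sign : ℝ) = 1 ∨ ((M x.1 y₀.1 j).sign : ℝ) = -1 := by
        rcases lt_or_gt_of_ne h0 with h | h
        · right; rw [Int.sign_eq_neg_one_of_neg h]; norm_num
        · left; rw [Int.sign_eq_one_of_pos h]; norm_num
      obtain ⟨φ, h3, h4⟩ := Good.exists_spike kit.scale kit.bound y₀.1 y₀.2.ne' hsg
        (E := E x.1 y₀.1 j + ik.s₁) (by omega) (by omega) (ik.range _ h2) ht
      refine ⟨φ, h3, fun y hy => ?_⟩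
      simp only [N, Ec, if_pos hi]
      exact h4 y hy
    · refine ⟨fun _ => 0, ?_, fun y hy => ?_⟩
      · exact kit.scale.good_const_zero kit.bound (t + 2 + ik.m) |>.mono kit.scale (by omega)
      · simp [N, if_neg hi]
  choose φ hgood hφ using hφ
  obtain ⟨γ, hγ, hR⟩ := Kit.Prog.last ik (ik.prog_cmp (F := F) t ik.m le_rfl)
    (val' := ik.cubeVal 0) (fun b b' => if b' = b then ik.stepWeight 0 else 0)
    (fun _ => ik.stepBias 0) (fun x b S hS => by
      have e : ik.m + 1 - ik.m = 0 + 1 := by omega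
      rw [e]
      exact ik.cubeVal_step (Nat.zero_le _) x b S hS) (fun c : C => c.1) φ hgood
  have hL : t + ik.m + 7 = t + 3 + ik.m + 3 + 1 := by omega
  rw [hL]
  refine Exists.imp (fun f hf x y hy => ?_) (hR.exists_network (n := d)
    (V' := fun x h => h = fun j => .finite (x.1 j))
    (G' := fun x y g => ∀ j, g j = .finite (G x.1 y j))
    (fun k j => match k with
      | .inl c => if c.2.1 = j then ik.w₁ else 0
      | .inr (.inl _) => 0
      | .inr (.inr b) => if b.2.1 = j then ik.cmpWeight (b.1.1 b.2.1) b.2.2 else 0)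
    (fun k => match k with
      | .inl c => ik.b₁ (c.1.1 c.2.1)
      | .inr (.inl _) => ik.τ₁
      | .inr (.inr b) => ik.cmpBias (b.1.1 b.2.1) b.2.2) ?_ (Equiv.refl _))
  · obtain ⟨h1, g, h2, h3⟩ := hf x y hy _ rfl
    exact ⟨h1, funext fun j => (h3 j).trans (h2 j)⟩
  rintro x _ rfl S hS
  have hS1 : ∀ c : C, S (.inl c) = (ExtFlt.finite ik.w₁).mul (.finite (x.1 c.2.1)) := fun c => by
    rw [(hS (.inl c)).single c.2.1 fun j hj => by
      simp only [if_neg hj.symm]; exact finite_zero_mul _]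
    simp only [if_true]
  have hS2 : ∀ c : C, S (.inr (.inl c)) = 0 := fun c =>
    (hS (.inr (.inl c))).zero fun j => finite_zero_mul _
  have hS3 : ∀ b, S (.inr (.inr b)) =
      (ExtFlt.finite (ik.cmpWeight (b.1.1 b.2.1) b.2.2)).mul (.finite (x.1 b.2.1)) := fun b => by
    rw [(hS (.inr (.inr b))).single b.2.1 fun j hj => by
      simp only [if_neg hj.symm]; exact finite_zero_mul _]
    simp only [if_true]
  have hfirst := fun c : C => ik.first (x.1 c.2.1) (c.1.1 c.2.1) (x.2 _) (c.1.2 _) _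
    (congrArg (fun z => z.add (.finite (ik.b₁ (c.1.1 c.2.1)))) (hS1 c))
  have hcmp := fun b => (ik.cmpVal_spec (x.2 b.2.1) (b.1.2 b.2.1) b.2.2).1 _
    (congrArg (fun z => z.add (.finite (ik.cmpBias (b.1.1 b.2.1) b.2.2))) (hS3 b))
  refine ⟨⟨fun c => ?_, fun c => ?_, fun b => (hcmp b).1⟩, fun y hy g ⟨g1, g2, g3⟩ => ?_⟩
  · obtain ⟨⟨j, h1, h2, h3⟩, -⟩ := hfirst c
    exact ⟨j, h1, h2, fun h => h3 (by rw [show c.1 = x from h])⟩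
  · simp only [hS2, ExtFlt.zero_add]
    exact ik.act_τ₁
  have g2' : ∀ c, ∃ r : Flt p q, (g (.inr (.inl c))).mul
      (a.actDeriv p q ((S (.inr (.inl c))).add (.finite ik.τ₁))) = .finite r := fun c => by
    obtain ⟨r, hr⟩ := g2 c
    obtain ⟨r', h1, h2⟩ := ik.der_τ₁
    rw [hr, hS2, ExtFlt.zero_add, h2]
    obtain ⟨h3, h4⟩ := (val_finite r).mul (val_finite r') (by
      rw [abs_mul]
      have := abs_le_Omega r.2
      nlinarith [abs_nonneg (r : ℝ), abs_nonneg (r' : ℝ)])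
    exact ⟨_, h4⟩
  have g3' : ∀ b, g (.inr (.inr b)) = 0 := fun b => by
    obtain ⟨r, h1, h2⟩ := g3 b
    rw [h1, h2 trivial]; rfl
  have hcmem : ∀ (c : C) (y : Flt p q), |(y : ℝ)| ≤ a.gradBound p q →
      Val ((ExtFlt.finite (γ c y)).mul (.finite kit.δ)) (φ c y) := fun c y hy => by
    have e : (γ c y : ℝ) * kit.δ = φ c y := by
      rw [hγ c y hy]
      linear_combination (φ c y) * kit.scale.mul_eq
    exact ((val_finite _).mul_mem (val_finite _) (by rw [e]; exact (hgood c).mem hy)).congr e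
  refine ⟨?_, fun out hout j => ?_⟩
  · rintro (c | c | b)
    · rw [g1]
      split_ifs
      · exact ⟨_, val_finite _⟩
      · exact ⟨0, val_zero⟩
    · obtain ⟨r, hr⟩ := g2 c
      exact ⟨r, by rw [hr]; exact val_finite r⟩
    · exact ⟨0, by rw [g3']; exact val_zero⟩
  have h2z : ∀ w : Flt p q, (ExtFlt.finite w).mul 0 = 0 := fun w => finite_mul_zero w
  have hzm : ∀ w : Flt p q, (0 : ExtFlt p q).mul (.finite w) = 0 := fun w => zero_mul_finite w
  -- the gradient that a carrier of the first layer passes on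
  have hcar : ∀ c : C, ((g (.inl c)).mul (a.actDeriv p q ((S (.inl c)).add
      (.finite (ik.b₁ (c.1.1 c.2.1)))))) = if c.1 = x then
        (ExtFlt.finite (γ c y)).mul (.finite kit.δ) else 0 := fun c => by
    obtain ⟨-, r, h1, h2⟩ := hfirst c
    rw [g1]
    by_cases hc : c.1 = x
    · rw [if_pos hc, if_pos hc, h1, h2 (by rw [hc])]
    · rw [if_neg hc, if_neg hc, h1, hzm]
  have hne : ∀ y₀ : {y : Flt p q // 0 < (y : ℝ)}, (y = y₀.1 ∨ y = -y₀.1) ↔ |(y : ℝ)| = y₀.1 := by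
    intro y₀
    rw [abs_eq y₀.2.le]
    exact or_congr Subtype.ext_iff Subtype.ext_iff
  -- All other neurons contribute nothing to coordinate `j`: twins have input weight zero,
  -- information neurons have gradient zero, and so have carriers of another input or another `|y|`;
  -- those of another coordinate have weight zero.
  have hzero : ∀ k, (∀ c, k = .inl c → c.1 = x → c.2.1 = j → |(y : ℝ)| = c.2.2.1.1 → False) →
      ((g k).mul (a.actDeriv p q ((S k).add (.finite (match k with
      | .inl c => ik.b₁ (c.1.1 c.2.1)
      | .inr (.inl _) => ik.τ₁
      | .inr (.inr b) => ik.cmpBias (b.1.1 b.2.1) b.2.2))))).mul (.finite (match k with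
      | .inl c => if c.2.1 = j then ik.w₁ else 0
      | .inr (.inl _) => 0
      | .inr (.inr b) => if b.2.1 = j then ik.cmpWeight (b.1.1 b.2.1) b.2.2 else 0)) = 0 := by
    rintro (c | c | b) hk
    · simp only [hcar c]
      by_cases hc : c.1 = x
      · rw [if_pos hc]
        by_cases hj : c.2.1 = j
        · have h1 : φ c y = 0 := by
            have h2 := fun h => hk c rfl hc hj ((hne c.2.2.1).1 h)
            exact (hφ c y hy).2.2 (fun h => h2 (Or.inl h)) (fun h => h2 (Or.inr h))
          rw [((hcmem c y hy).congr h1).eq_zero, hzm]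
        · rw [if_neg hj]
          obtain ⟨h1, h2⟩ := hcmem c y hy
          rw [h2]
          exact finite_mul_zero _
      · rw [if_neg hc, hzm]
    · obtain ⟨r, hr⟩ := g2' c
      simp only [hr]
      exact finite_mul_zero r
    · obtain ⟨-, r, hr⟩ := hcmp b
      simp only [g3', hr, hzm]
  -- No carrier is labelled by gradient zero; there oddness forces the prescribed gradient to
  -- vanish.
  by_cases hy0 : (y : ℝ) = 0
  · have e : y = 0 := Subtype.ext hy0
    rw [(hout j).zero fun k => hzero k fun c _ _ _ h => ?_, e, hG0]
    · rfl
    · rw [hy0, abs_zero] at h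
      exact c.2.2.1.2.ne h
  obtain ⟨y₀, hy₀⟩ : ∃ y₀ : {y : Flt p q // 0 < (y : ℝ)}, |(y : ℝ)| = y₀.1 := by
    refine ⟨⟨⟨|(y : ℝ)|, ?_⟩, abs_pos.2 hy0⟩, rfl⟩
    rcases abs_choice (y : ℝ) with h | h <;> rw [h]
    · exact y.2
    · exact neg_mem y.2
  obtain ⟨σ, hσ, hGσ, hφσ⟩ : ∃ σ : ℤ, |σ| = 1 ∧ (G x.1 y j : ℝ) = σ * G x.1 y₀.1 j ∧
      ∀ i, φ (x, j, y₀, i) y = (σ * N (x, j, y₀, i) : ℤ) * 2 ^ (E x.1 y₀.1 j + ik.s₁) := by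
    rcases (hne y₀).2 hy₀ with h | h
    · refine ⟨1, abs_one, by rw [h]; push_cast; ring, fun i => ?_⟩
      rw [(hφ (x, j, y₀, i) y hy).1 h]; push_cast; ring
    · refine ⟨-1, by norm_num, ?_, fun i => ?_⟩
      · rw [h, hodd]
        change -(G x.1 y₀.1 j : ℝ) = _
        push_cast; ring
      · rw [(hφ (x, j, y₀, i) y hy).2.1 h]; push_cast; ring
  have h1 := (hout j).comp (fun i : Fin (2 ^ (p + 1)) => (.inl (x, j, y₀, i) : C ⊕ C ⊕ _))
    (fun i i' e => (Prod.mk.inj (Prod.mk.inj (Prod.mk.inj (Sum.inl.inj e)).2).2).2)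
    (fun k hk => hzero k fun c h1 h2 h3 h4 => by
      refine hk c.2.2.2 ?_
      have : y₀ = c.2.2.1 := Subtype.ext (Subtype.ext (hy₀.symm.trans h4))
      rw [h1, this, ← h2, ← h3])
  simp only [hcar, if_true] at h1
  have hsum : ∀ c : ℤ, ∑ i : Fin (2 ^ (p + 1)),
      (if (i : ℕ) < (M x.1 y₀.1 j).natAbs then c else 0) = (M x.1 y₀.1 j).natAbs * c := fun c => by
    have hlt := hM x.1 y₀.1 j
    have hle : (M x.1 y₀.1 j).natAbs ≤ 2 ^ (p + 1) := by zify; exact hlt.le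
    rw [Fin.sum_univ_eq_sum_range fun i => if i < (M x.1 y₀.1 j).natAbs then c else 0,
      ← Finset.sum_filter]
    have : (Finset.range (2 ^ (p + 1))).filter (· < (M x.1 y₀.1 j).natAbs) =
        Finset.range (M x.1 y₀.1 j).natAbs := by
      ext i; simp only [Finset.mem_filter, Finset.mem_range]; omega
    rw [this, Finset.sum_const, Finset.card_range, nsmul_eq_mul]
  have hN : ∀ i, σ * N (x, j, y₀, i) = if (i : ℕ) < (M x.1 y₀.1 j).natAbs
      then σ * (M x.1 y₀.1 j).sign else 0 := fun i => by
    simp only [N, mul_ite, mul_zero]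
  -- All terms are `0` or the same `±2 ^ E`, and every partial sum is a multiple with coefficient
  -- below `2 ^ (p + 1)`, hence a float.
  have h2 := h1.exact (fun i => σ * N (x, j, y₀, i)) (2 ^ E x.1 y₀.1 j) (fun i => ?_) fun k hk => ?_
  · simp only [hN, hsum] at h2
    have e : ((((M x.1 y₀.1 j).natAbs : ℤ) * (σ * (M x.1 y₀.1 j).sign) : ℤ) : ℝ) *
        2 ^ E x.1 y₀.1 j = G x.1 y j := by
      rw [hGσ, hME]
      have : ((M x.1 y₀.1 j).natAbs : ℤ) * (σ * (M x.1 y₀.1 j).sign) = σ * M x.1 y₀.1 j := by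
        conv_rhs => rw [← Int.sign_mul_natAbs (M x.1 y₀.1 j)]
        ring
      rw [this]; push_cast; ring
    exact Val.eq_finite (h2.congr e)
  · have e : φ (x, j, y₀, i) y * ik.w₁ = (σ * N (x, j, y₀, i) : ℤ) * 2 ^ E x.1 y₀.1 j := by
      rw [hφσ, ik.w₁_eq, mul_assoc, ← zpow_add₀ (by norm_num)]
      congr 2; ring
    refine ((hcmem _ y hy).mul_mem (val_finite _) ?_).congr e
    rw [e]
    refine mem_finiteFloats_iff.2 ⟨_, _, ?_, hE x.1 y₀.1 j, hE' x.1 y₀.1 j, rfl⟩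
    have : |σ * N (x, j, y₀, i)| ≤ 1 := by
      rw [abs_mul, hσ, one_mul]
      simp only [N]
      split_ifs
      · rcases Int.sign_trichotomy (M x.1 y₀.1 j) with h | h | h <;> rw [h] <;> norm_num
      · simp
    have h3 : (1 : ℤ) < 2 ^ (p + 1) := one_lt_pow₀ (by norm_num) (by omega)
    omega
  · refine mem_finiteFloats_iff.2 ⟨k, _, ?_, hE x.1 y₀.1 j, hE' x.1 y₀.1 j, rfl⟩
    refine lt_of_le_of_lt hk ?_
    have h3 : ∀ i, |σ * N (x, j, y₀, i)| ≤ if (i : ℕ) < (M x.1 y₀.1 j).natAbs then 1 else 0 := by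
      intro i
      rw [abs_mul, hσ, one_mul]
      simp only [N]
      split_ifs
      · rcases Int.sign_trichotomy (M x.1 y₀.1 j) with h | h | h <;> rw [h] <;> norm_num
      · simp
    refine lt_of_le_of_lt (Finset.sum_le_sum fun i _ => h3 i) ?_
    rw [hsum, mul_one, Int.natCast_natAbs]
    exact hM x.1 y₀.1 j

end InputKit

/-! ### Rounding and small perturbations -/

theorem add_lt_emax [Params p q] : (q : ℤ) + 9 + p ≤ emax q := by
  have key : ∀ k : ℕ, k + 16 ≤ 2 ^ (k + 4) := by
    intro k
    induction k with
    | zero => norm_num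
    | succ k ih => rw [show k + 1 + 4 = k + 4 + 1 by ring, pow_succ]; omega
  have h6 := (‹Params p q›).six_le
  have h7 := (‹Params p q›).le_pow
  obtain ⟨k, rfl⟩ : ∃ k, q = k + 6 := ⟨q - 6, by omega⟩
  have h := key k
  unfold emax
  rw [show k + 6 - 1 = k + 4 + 1 by omega, pow_succ]
  rw [show k + 6 - 2 = k + 4 by omega] at h7
  zify at h h7
  push_cast
  omega

/-- Absorption in relative form. As `|a|` is at most twice the lower end of its binade, `d` is below
a quarter of the spacing there, which is safe even if `a` is a power of two. -/
theorem fl_add_eq_left [Params p q] {a d : ℝ} (ha : a ∈ finiteFloats p q)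
    (h : |d| < |a| * 2 ^ (-(p : ℤ) - 3)) : fl p q (a + d) = a := by
  have h0 : 0 < |a| := by
    have h1 : (0 : ℝ) < 2 ^ (-(p : ℤ) - 3) := by positivity
    have h2 := abs_nonneg d
    by_contra hc
    have : |a| = 0 := le_antisymm (not_lt.1 hc) (abs_nonneg a)
    rw [this, zero_mul] at h
    linarith
  obtain ⟨k, hk1, hk2⟩ := exists_mem_Ico_zpow h0 (one_lt_two (α := ℝ))
  refine fl_eq_of_abs_sub_lt (e := k - 1) ha (by rwa [sub_add_cancel]) ?_
  rw [add_sub_cancel_left]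
  refine h.trans_le ?_
  have e : (2 : ℝ) ^ (k - 1 - p) / 2 = 2 ^ (k + 1) * 2 ^ (-(p : ℤ) - 3) := by
    rw [← zpow_add₀ (by norm_num), div_eq_iff (by norm_num), ← zpow_add_one₀ (by norm_num)]
    congr 1; ring
  rw [e]
  gcongr

theorem fl_eq_one [Params p q] {x : ℝ} (h : |x - 1| < 2 ^ (-(p : ℤ) - 3)) : fl p q x = 1 := by
  have := fl_add_eq_left (p := p) (q := q) one_mem (d := x - 1) (by rwa [abs_one, one_mul])
  rwa [add_sub_cancel] at this

/-- The rounding of numbers close to `1` from above. -/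
theorem fl_eq_one_of_le [Params p q] {x : ℝ} (h1 : 1 ≤ x) (h : x - 1 < 2 ^ (-(p : ℤ) - 1)) :
    fl p q x = 1 := by
  refine fl_eq_of_near one_mem fun z hz hz1 => ?_
  rw [abs_of_nonneg (by linarith)]
  have h3 : (2 : ℝ) ^ (-(p : ℤ) - 1) = 2 ^ ((0 : ℤ) - p) / 2 := by
    rw [zpow_sub_one₀ (by norm_num)]; simp [div_eq_mul_inv]
  rcases lt_or_gt_of_ne hz1 with h2 | h2
  · have := abs_nonneg (x - z)
    rw [abs_of_pos (by linarith)]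
    linarith
  · have h4 := gap_of_le_abs (p := p) (q := q) hz one_mem (e := 0)
      (by rw [zpow_zero, abs_of_pos (by linarith)]; exact h2.le) (by simp) hz1
    rw [abs_of_pos (by linarith)] at h4
    have : 2 ^ ((0 : ℤ) - p) - (x - 1) ≤ |x - z| := by
      rw [abs_sub_comm]
      exact le_trans (by linarith) (le_abs_self _)
    linarith

theorem two_mul_sq_lt_exp {x : ℝ} (hx : 4 ≤ x) : 2 * x ^ 2 < Real.exp x := by
  have h1 : (53 : ℝ) < Real.exp 4 := by
    have := Real.exp_one_gt_d9
    have h2 : Real.exp 4 = Real.exp 1 ^ 4 := by rw [← Real.exp_nat_mul]; norm_num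
    rw [h2]
    calc (53 : ℝ) < 2.7 ^ 4 := by norm_num
      _ < Real.exp 1 ^ 4 := by gcongr; linarith
  have h2 := Real.quadratic_le_exp_of_nonneg (x := x - 4) (by linarith)
  have h3 : Real.exp x = Real.exp 4 * Real.exp (x - 4) := by rw [← Real.exp_add]; congr 1; ring
  rw [h3]
  have h4 : 0 ≤ x - 4 := by linarith
  have h5 : 0 < 1 + (x - 4) + (x - 4) ^ 2 / 2 := by positivity
  calc 2 * x ^ 2 < 53 * (1 + (x - 4) + (x - 4) ^ 2 / 2) := by nlinarith
    _ ≤ Real.exp 4 * Real.exp (x - 4) := by gcongr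

/-- Exponentially small errors are small compared with the precision. -/
theorem exp_neg_lt [Params p q] {x : ℝ} (hx : (2 : ℝ) ^ p ≤ x) :
    Real.exp (-x) < 2 ^ (-(p : ℤ) - 3) ∧ x * Real.exp (-x) < 2 ^ (-(p : ℤ) - 1) ∧ 4 ≤ x := by
  have hp := (‹Params p q›).two_le
  have h4 : (4 : ℝ) ≤ 2 ^ p := by
    calc (4 : ℝ) = 2 ^ 2 := by norm_num
      _ ≤ 2 ^ p := pow_le_pow_right₀ (by norm_num) hp
  have h := two_mul_sq_lt_exp (h4.trans hx)
  have e1 : (2 : ℝ) ^ (-(p : ℤ) - 3) = 1 / (8 * 2 ^ p) := by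
    rw [zpow_sub₀ (by norm_num), zpow_neg, zpow_natCast]; norm_num; ring
  have e2 : (2 : ℝ) ^ (-(p : ℤ) - 1) = 1 / (2 * 2 ^ p) := by
    rw [zpow_sub₀ (by norm_num), zpow_neg, zpow_natCast]; norm_num; ring
  have hpos := Real.exp_pos x
  refine ⟨?_, ?_, h4.trans hx⟩
  · rw [e1, Real.exp_neg, ← one_div]
    refine one_div_lt_one_div_of_lt (by positivity) ?_
    nlinarith
  · rw [e2, Real.exp_neg, ← div_eq_mul_inv, div_lt_div_iff₀ hpos (by positivity)]
    nlinarith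

/-- Put `u = |x|`, so `u ≥ 4 * (emax q + 1)` because `2 ^ q = 2 * (emax q + 1)`. A quarter of the
exponent pays for the factor `1 + u`, and the remaining `exp (-3 * (emax q + 1))` is below `2 ^
(-(emax q + p)) = eps p q / 2`, as `e > 2` and `p ≤ emax q`. -/
theorem exp_lt_eps [Params p q] {x : ℝ} (hx : x ≤ -2 ^ (q + 1)) :
    (1 + |x|) * Real.exp x < eps p q / 2 := by
  obtain ⟨f1, f2, f3, f4, f5⟩ := emax_facts p q
  have f4' : (2 : ℝ) ^ q = 2 * (emax q + 1) := by exact_mod_cast f4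
  have f2' : (31 : ℝ) ≤ emax q := by exact_mod_cast f2
  rw [pow_succ, f4'] at hx
  have hu : |x| = -x := abs_of_neg (by linarith)
  rw [hu]
  set u := -x with hu'
  have hxu : x = -u := by rw [hu']; ring
  have hu1 : 4 * ((emax q : ℝ) + 1) ≤ u := by linarith
  have h1 := Real.quadratic_le_exp_of_nonneg (x := u / 4) (by linarith)
  have h2 : 1 + u ≤ Real.exp (u / 4) := by nlinarith
  have h3 : (1 + u) * Real.exp x ≤ Real.exp (-(3 * ((emax q : ℝ) + 1))) := by
    calc (1 + u) * Real.exp x ≤ Real.exp (u / 4) * Real.exp x := by gcongr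
      _ = Real.exp (u / 4 + x) := by rw [Real.exp_add]
      _ ≤ _ := Real.exp_le_exp.2 (by linarith)
  refine h3.trans_lt ?_
  obtain ⟨n, hn⟩ : ∃ n : ℕ, emax q = n := ⟨(emax q).toNat, by omega⟩
  have e1 : Real.exp (-(3 * ((emax q : ℝ) + 1))) = (Real.exp 1 ^ (3 * (n + 1)))⁻¹ := by
    rw [Real.exp_neg, ← Real.exp_nat_mul, hn]; push_cast; ring_nf
  have e2 : eps p q / 2 = ((2 : ℝ) ^ (n + p))⁻¹ := by
    unfold eps
    rw [← zpow_natCast, ← zpow_neg, div_eq_iff (by norm_num), ← zpow_add_one₀ (by norm_num)]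
    congr 1; push_cast; omega
  rw [e1, e2]
  refine inv_strictAnti₀ (by positivity) ?_
  calc (2 : ℝ) ^ (n + p) ≤ 2 ^ (3 * (n + 1)) := pow_le_pow_right₀ (by norm_num) (by omega)
    _ < Real.exp 1 ^ (3 * (n + 1)) :=
      pow_lt_pow_left₀ (by linarith [Real.exp_one_gt_d9]) (by norm_num) (by omega)

/-! ### Rectifiers -/

/-- The properties common to activation functions that resemble the rectifier. -/
structure Rectifier (a : Activation) (lo : ℝ) : Prop where
  lo_eq : lo = 0 ∨ lo = -1
  bound : ∀ q, a.inputBound q = 2 ^ (emax q - 2)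
  gbound : ∀ p q, a.gradBound p q = Omega p q
  map_zero : a.toReal 0 = 0
  pos : ∀ y, 0 < y → y / 2 < a.toReal y ∧ a.toReal y ≤ y
  neg : ∀ y ≤ 0, -1 ≤ a.toReal y ∧ a.toReal y ≤ 0
  large : ∀ y, 4 ≤ y → y * (1 - Real.exp (-y)) ≤ a.toReal y
  der_large : ∀ y, 4 ≤ y → 1 - Real.exp (-y) ≤ a.realDeriv y ∧ a.realDeriv y ≤ 1 + y * Real.exp (-y)
  small : ∀ y ≤ -4, |a.toReal y - lo| ≤ (1 + |y|) * Real.exp y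
  der_small : ∀ y ≤ -4, |a.realDeriv y| ≤ (1 + |y|) * Real.exp y
  der_le : ∀ y, |a.realDeriv y| ≤ 4

theorem tendsto_exp_error : Tendsto (fun y : ℝ => (1 + |y|) * Real.exp y) atBot (𝓝 0) := by
  have h1 : Tendsto (fun x : ℝ => Real.exp (-x) + x ^ 1 * Real.exp (-x)) atTop (𝓝 (0 + 0)) :=
    Real.tendsto_exp_neg_atTop_nhds_zero.add (Real.tendsto_pow_mul_exp_neg_atTop_nhds_zero 1)
  rw [add_zero] at h1
  refine (h1.comp tendsto_neg_atBot_atTop).congr' ?_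
  filter_upwards [eventually_le_atBot 0] with y hy
  simp only [Function.comp_apply, neg_neg, pow_one, abs_of_nonpos hy]
  ring

theorem roundLim_eq [Params p q] {f : ℝ → ℝ} {l : Filter ℝ} [l.NeBot] {b : ℝ}
    (hb : b ∈ finiteFloats p q) (h : Tendsto f l (𝓝 b)) : Val (roundLim p q f l) b := by
  unfold roundLim
  rw [if_pos ⟨b, h⟩, h.limUnder_eq]
  exact val_round_mem hb

theorem Val.roundFun [Params p q] {f : ℝ → ℝ} {z : ExtFlt p q} {x : ℝ} (hz : Val z x)
    (h : |f x| ≤ Omega p q) : Val (roundFun p q f z) (fl p q (f x)) := by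
  obtain ⟨h1, rfl⟩ := hz
  exact val_round h

theorem one_le_Omega [Params p q] : 1 ≤ Omega p q := by
  have := abs_le_Omega (one_mem (p := p) (q := q))
  rwa [abs_one] at this

theorem two_pow_mem_of_le [Params p q] {k : ℕ} (h : (k : ℤ) ≤ emax q) :
    (2 : ℝ) ^ k ∈ finiteFloats p q := by
  obtain ⟨f1, f2, f3, f4, f5⟩ := emax_facts p q
  have := two_zpow_mem (p := p) (q := q) (e := k) (by omega) h
  rwa [zpow_natCast] at this

namespace Rectifier

variable {a : Activation} {lo : ℝ}

theorem lo_mem [Params p q] (h : Rectifier a lo) : lo ∈ finiteFloats p q := by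
  rcases h.lo_eq with rfl | rfl
  · exact zero_mem
  · exact neg_mem one_mem

theorem abs_toReal_le [Params p q] (h : Rectifier a lo) {x : ℝ} (hx : x ∈ finiteFloats p q) : |a.toReal x| ≤ Omega p q := by
  have h1 := abs_le_Omega hx
  have h2 := one_le_Omega (p := p) (q := q)
  rcases le_or_gt x 0 with h0 | h0
  · obtain ⟨h3, h4⟩ := h.neg x h0
    rw [abs_le]; constructor <;> linarith
  · obtain ⟨h3, h4⟩ := h.pos x h0
    rw [abs_of_pos h0] at h1
    rw [abs_le]; constructor <;> linarith

theorem val_act [Params p q] (h : Rectifier a lo) {z : ExtFlt p q} {x : ℝ} (hz : Val z x) :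
    Val (a.act p q z) (fl p q (a.toReal x)) := hz.roundFun (h.abs_toReal_le hz.mem)

theorem val_der [Params p q] (h : Rectifier a lo) {z : ExtFlt p q} {x : ℝ} (hz : Val z x) :
    Val (a.actDeriv p q z) (fl p q (a.realDeriv x)) := by
  refine hz.roundFun ((h.der_le x).trans ?_)
  have := abs_le_Omega (small_nat_mem (p := p) (q := q) 2 (by norm_num))
  norm_num at this
  exact this

/-- From `2 ^ p` on, the relative error `exp (-x)` is below `2 ^ (-p - 3)` and is absorbed: the
rounded activation function is exactly the identity. -/
theorem act_linear [Params p q] (h : Rectifier a lo) {z : ExtFlt p q} {x : ℝ} (hz : Val z x) (hx : 2 ^ p ≤ x) :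
    Val (a.act p q z) x := by
  refine (h.val_act hz).congr ?_
  obtain ⟨h1, h2, h3⟩ := exp_neg_lt (p := p) (q := q) hx
  have h4 := h.large x h3
  have h5 := (h.pos x (by linarith)).2
  have h6 := fl_add_eq_left (d := a.toReal x - x) hz.mem (by
    rw [abs_of_nonpos (by linarith), abs_of_pos (by linarith)]
    nlinarith)
  rwa [add_sub_cancel] at h6

/-- The derivative may exceed `1`, as it can for GELU and Swish, but by less than `2 ^ (-p - 1)`,
half the spacing above `1`. -/
theorem der_linear [Params p q] (h : Rectifier a lo) {z : ExtFlt p q} {x : ℝ} (hz : Val z x) (hx : 2 ^ p ≤ x) :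
    Val (a.actDeriv p q z) 1 := by
  refine (h.val_der hz).congr ?_
  obtain ⟨h1, h2, h3⟩ := exp_neg_lt (p := p) (q := q) hx
  obtain ⟨h4, h5⟩ := h.der_large x h3
  rcases le_or_gt (a.realDeriv x) 1 with h6 | h6
  · refine fl_eq_one ?_
    rw [abs_of_nonpos (by linarith)]; linarith
  · exact fl_eq_one_of_le h6.le (by linarith)

/-- At negative infinity the value is the rounded limit; at finite arguments the error bound is
below half of the smallest float. The off value `-1` then absorbs the error. -/
theorem off [Params p q] (h : Rectifier a lo) {z : ExtFlt p q} (hz : AtMost z (-2 ^ (q + 1))) :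
    Val (a.act p q z) lo ∧ Val (a.actDeriv p q z) 0 := by
  rcases hz with rfl | ⟨x, hx, hz⟩
  · have h1 : Tendsto a.toReal atBot (𝓝 lo) := by
      refine tendsto_iff_dist_tendsto_zero.2 ?_
      refine squeeze_zero' (Eventually.of_forall fun _ => dist_nonneg) ?_ tendsto_exp_error
      filter_upwards [eventually_le_atBot (-4)] with y hy
      exact h.small y hy
    have h2 : Tendsto a.realDeriv atBot (𝓝 0) := by
      refine squeeze_zero_norm' ?_ tendsto_exp_error
      filter_upwards [eventually_le_atBot (-4)] with y hy
      exact h.der_small y hy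
    exact ⟨roundLim_eq h.lo_mem h1, roundLim_eq zero_mem h2⟩
  · have h4 : x ≤ -4 := by
      refine hx.trans (neg_le_neg ?_)
      calc (4 : ℝ) = 2 ^ 2 := by norm_num
        _ ≤ 2 ^ (q + 1) := pow_le_pow_right₀ (by norm_num) (by have := (‹Params p q›).six_le; omega)
    have he := exp_lt_eps (p := p) (q := q) hx
    refine ⟨(h.val_act hz).congr ?_, (h.val_der hz).congr
      (fl_eq_zero_of_abs_lt ((h.der_small x h4).trans_lt he))⟩
    have h5 := (h.small x h4).trans_lt he
    rcases h.lo_eq with rfl | rfl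
    · rw [sub_zero] at h5
      exact fl_eq_zero_of_abs_lt h5
    · have h6 := fl_add_eq_left (p := p) (q := q) (neg_mem one_mem) (d := a.toReal x - -1) (by
        rw [abs_neg, abs_one, one_mul]
        refine h5.trans_le ?_
        obtain ⟨f1, f2, f3, f4, f5⟩ := emax_facts p q
        have : eps p q ≤ 2 ^ (-(p : ℤ) - 3) := zpow_le_zpow_right₀ (by norm_num) (by omega)
        have := eps_pos (p := p) (q := q)
        linarith)
      rwa [add_sub_cancel] at h6

theorem act_zero [Params p q] (h : Rectifier a lo) {z : ExtFlt p q} (hz : Val z 0) : Val (a.act p q z) 0 := by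
  have := h.val_act hz
  rw [h.map_zero, fl_of_mem zero_mem] at this
  exact this

/-- The strict inequality `y / 2 < a.toReal y` matters at `y = eps p q`: exactly half would be a tie
and round to zero. Otherwise a lower bound is merely halved. -/
theorem act_pos [Params p q] (h : Rectifier a lo) {z : ExtFlt p q} {y : ℝ} (hz : Val z y) (hy : 0 < y) :
    ∃ c, Val (a.act p q z) c ∧ 0 < c ∧ c ≤ y ∧ ∀ b ∈ finiteFloats p q, 2 * b ≤ y → b ≤ c := by
  refine ⟨_, h.val_act hz, ?_, fl_le hz.mem (h.pos y hy).2, fun b hb hby => le_fl hb ?_⟩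
  · have h1 := eps_le_abs hz.mem hy.ne'
    rw [abs_of_pos hy] at h1
    have h2 := (h.pos y hy).1
    have h3 := abs_sub_fl_le (p := p) (q := q) (a.toReal y) eps_mem
    by_contra hc
    have h4 := le_fl (p := p) (q := q) zero_mem (show 0 ≤ a.toReal y by linarith)
    have h5 : fl p q (a.toReal y) = 0 := le_antisymm (not_lt.1 hc) h4
    have h6 := eps_pos (p := p) (q := q)
    rw [h5, sub_zero, abs_of_pos (by linarith)] at h3
    rcases abs_cases (a.toReal y - eps p q) with ⟨h7, h8⟩ | ⟨h7, h8⟩ <;> rw [h7] at h3 <;> linarith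
  · linarith [(h.pos y hy).1]

theorem act_nonpos [Params p q] (h : Rectifier a lo) {z : ExtFlt p q} (hz : AtMost z 0) :
    ∃ c, Val (a.act p q z) c ∧ -1 ≤ c ∧ c ≤ 0 := by
  rcases hz with rfl | ⟨y, hy, hz⟩
  · refine ⟨lo, (h.off (Or.inl rfl)).1, ?_⟩
    rcases h.lo_eq with rfl | rfl <;> norm_num
  · exact ⟨_, h.val_act hz, le_fl (neg_mem one_mem) (h.neg y hy).1, fl_le zero_mem (h.neg y hy).2⟩

theorem der_finite [Params p q] (h : Rectifier a lo) {z : ExtFlt p q} {y : ℝ} (hz : AtMost z y) :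
    ∃ r, a.actDeriv p q z = .finite r := by
  rcases hz with rfl | ⟨y, hy, hz⟩
  · obtain ⟨h1, h2⟩ := (h.off (p := p) (q := q) (Or.inl rfl)).2
    exact ⟨_, h2⟩
  · obtain ⟨h1, h2⟩ := h.val_der hz
    exact ⟨_, h2⟩

end Rectifier

/-! ### The construction for rectifiers -/

theorem val_nearestEven [Params p q] {x : ℝ} (hx : x ∈ finiteFloats p q) :
    Val (.finite (nearestEven p q x)) x := (val_finite _).congr (fl_of_mem hx)

theorem coe_nearestEven [Params p q] {x : ℝ} (hx : x ∈ finiteFloats p q) :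
    (nearestEven p q x : ℝ) = x := fl_of_mem hx

theorem Val.exists_eq {z : ExtFlt p q} {r : ℝ} (h : Val z r) :
    ∃ x : Flt p q, (x : ℝ) = r ∧ z = .finite x := ⟨⟨r, h.1⟩, rfl, h.2⟩

theorem Val.eq_nearestEven [Params p q] {z : ExtFlt p q} {r : ℝ} (h : Val z r) :
    z = .finite (nearestEven p q r) := h.eq (val_nearestEven h.1)

theorem int_mul_zpow_mem [Params p q] {m e : ℤ} (hm : |m| ≤ 2 ^ (p + 1)) (he : emin q - p ≤ e)
    (h : |(m : ℝ) * 2 ^ e| ≤ Omega p q) : (m : ℝ) * 2 ^ e ∈ finiteFloats p q := by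
  have e1 : (m : ℝ) * 2 ^ e = m * eps p q * 2 ^ (e - (emin q - p)) := by
    unfold eps
    rw [mul_assoc, ← zpow_add₀ (by norm_num)]; congr 2; ring
  rw [e1] at h ⊢
  exact mul_two_zpow_mem (int_mul_eps_mem hm) (by omega) h

theorem three_mul_zpow_mem [Params p q] {e : ℤ} (h1 : emin q - p ≤ e) (h2 : e < emax q) :
    3 * (2 : ℝ) ^ e ∈ finiteFloats p q := by
  have h := int_mul_zpow_mem (p := p) (q := q) (m := 3) (e := e) ?_ h1 ?_
  · exact_mod_cast h
  · have := (‹Params p q›).two_le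
    rw [abs_of_pos (by norm_num)]
    calc (3 : ℤ) ≤ 2 ^ 2 := by norm_num
      _ ≤ 2 ^ (p + 1) := pow_le_pow_right₀ (by norm_num) (by omega)
  · rw [abs_of_pos (by positivity)]
    have h3 := three_halves_le_Omega (p := p) (q := q)
    have h4 : (2 : ℝ) ^ (e + 1) ≤ 2 ^ emax q := zpow_le_zpow_right₀ (by norm_num) (by omega)
    rw [zpow_add_one₀ (by norm_num)] at h4
    push_cast
    linarith

theorem finite_mul_add_neg_mul [Params p q] {A x : Flt p q} (h : |(A : ℝ) * x| ≤ Omega p q) :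
    ((ExtFlt.finite A).mul (.finite x)).add ((ExtFlt.finite (-A)).mul (.finite x)) = 0 := by
  obtain ⟨h1, h2⟩ := (val_finite A).mul (val_finite x) h
  rw [h2, finite_neg_mul h2, finite_add_neg_self]

theorem zpow_emax_facts (p q : ℕ) [Params p q] : (2 : ℝ) ^ p * 256 ≤ 2 ^ emax q ∧
    (2 : ℝ) ^ (q + 1) * 256 ≤ 2 ^ (emax q - p) ∧ (2 : ℝ) ^ (emax q - p) * 2 ^ p = 2 ^ emax q ∧
    (4 : ℝ) ≤ 2 ^ p ∧ (128 : ℝ) ≤ 2 ^ (q + 1) := by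
  have h := add_lt_emax (p := p) (q := q)
  have h2 := (‹Params p q›).two_le
  have h6 := (‹Params p q›).six_le
  refine ⟨?_, ?_, ?_, ?_, ?_⟩
  · rw [show (256 : ℝ) = 2 ^ (8 : ℤ) by norm_num, ← zpow_natCast, ← zpow_add₀ (by norm_num)]
    exact zpow_le_zpow_right₀ (by norm_num) (by omega)
  · rw [show (256 : ℝ) = 2 ^ (8 : ℤ) by norm_num, ← zpow_natCast, ← zpow_add₀ (by norm_num)]
    exact zpow_le_zpow_right₀ (by norm_num) (by push_cast; omega)
  · rw [← zpow_natCast, ← zpow_add₀ (by norm_num)]; congr 1; ring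
  · calc (4 : ℝ) = 2 ^ 2 := by norm_num
      _ ≤ 2 ^ p := pow_le_pow_right₀ (by norm_num) h2
  · calc (128 : ℝ) = 2 ^ 7 := by norm_num
      _ ≤ 2 ^ (q + 1) := pow_le_pow_right₀ (by norm_num) (by omega)

theorem zpow_sub_one_two (e : ℤ) : (2 : ℝ) ^ (e - 1) = 2 ^ e / 2 := by
  rw [zpow_sub_one₀ (by norm_num)]; rfl

theorem zpow_sub_two_two (e : ℤ) : (2 : ℝ) ^ (e - 2) = 2 ^ e / 4 := by
  rw [zpow_sub₀ (by norm_num)]; norm_num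

namespace Rectifier

variable {a : Activation} {lo : ℝ}

/-- What the pieces of the output have to satisfy. -/
def PieceSpec (a : Activation) (hi lo : Flt p q) {S K : Type} (kind : K → Option Bool)
    (outWeight : Flt p q → S → Flt p q) (pieceWeight : Flt p q → S → K → Flt p q)
    (pieceBias : Flt p q → S → Flt p q) : Prop :=
  ∀ (t : Flt p q) (on : Bool) (P : S → ExtFlt p q),
    (∀ s, IsSum (fun k => (ExtFlt.finite (pieceWeight t s k)).mul
      (.finite (bitState hi lo on (kind k)))) (P s)) →
    (on = true → ∀ T, IsSum (fun s => (ExtFlt.finite (outWeight t s)).mul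
      (a.act p q ((P s).add (.finite (pieceBias t s))))) T → T = .finite t) ∧
    (on = false → ∀ s, (ExtFlt.finite (outWeight t s)).mul
      (a.act p q ((P s).add (.finite (pieceBias t s)))) = 0) ∧
    ∀ y : Flt p q, |(y : ℝ)| ≤ a.gradBound p q →
      (∀ s, (∃ r, (ExtFlt.finite y).mul (.finite (outWeight t s)) = .finite r) ∧
        ∃ r, ((ExtFlt.finite y).mul (.finite (outWeight t s))).mul
          (a.actDeriv p q ((P s).add (.finite (pieceBias t s)))) = .finite r) ∧
      ∀ k out, IsSum (fun s => (((ExtFlt.finite y).mul (.finite (outWeight t s))).mul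
        (a.actDeriv p q ((P s).add (.finite (pieceBias t s))))).mul
          (.finite (pieceWeight t s k))) out →
        ∃ r, out = .finite r ∧ (True → bitState hi lo on (kind k) = hi → r = 0)

theorem off_finite [Params p q] (h : Rectifier a lo) {z : ExtFlt p q}
    (hz : AtMost z (-2 ^ (q + 1))) :
    a.act p q z = .finite (nearestEven p q lo) ∧ a.actDeriv p q z = 0 :=
  ⟨(h.off hz).1.eq_nearestEven, (h.off hz).2.eq_zero⟩

theorem linear_finite [Params p q] (h : Rectifier a lo) {x : ℝ} {z : ExtFlt p q} (hz : Val z x)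
    (hx : 2 ^ p ≤ x) : a.act p q z = .finite (nearestEven p q x) ∧
      a.actDeriv p q z = .finite (nearestEven p q 1) :=
  ⟨(h.act_linear hz hx).eq_nearestEven, (h.der_linear hz hx).eq_nearestEven⟩

/-- The kit for a rectifier. -/
def kit [Params p q] (h : Rectifier a lo) {S K : Type} [Finite S] [Finite K]
    (kind : K → Option Bool) (outWeight : Flt p q → S → Flt p q)
    (pieceWeight : Flt p q → S → K → Flt p q) (pieceBias : Flt p q → S → Flt p q)
    (piece : PieceSpec a (nearestEven p q (2 ^ emax q)) (nearestEven p q lo) kind outWeight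
      pieceWeight pieceBias) : Kit p q a := by
  have f1 := (emax_facts p q).1
  have f2 := (emax_facts p q).2.1
  have f3 := (emax_facts p q).2.2.1
  have g1 := (zpow_emax_facts p q).1
  have g2 := (zpow_emax_facts p q).2.1
  have g3 := (zpow_emax_facts p q).2.2.1
  have g4 := (zpow_emax_facts p q).2.2.2.1
  have g5 := (zpow_emax_facts p q).2.2.2.2
  have g6 : (0 : ℝ) < 2 ^ (emax q - p) := by positivity
  have g7 := three_halves_le_Omega (p := p) (q := q)
  have hE : (2 : ℝ) ^ emax q ∈ finiteFloats p q := two_zpow_mem (by omega) le_rfl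
  have hE1 : (2 : ℝ) ^ (emax q - 1) ∈ finiteFloats p q := two_zpow_mem (by omega) (by omega)
  have hE3 : 3 * (2 : ℝ) ^ (emax q - 1) ∈ finiteFloats p q :=
    three_mul_zpow_mem (by omega) (by omega)
  have h3 : (3 : ℝ) * 2 ^ (-1 : ℤ) ∈ finiteFloats p q := three_mul_zpow_mem (by omega) (by omega)
  have hp : (2 : ℝ) ^ p ∈ finiteFloats p q := two_pow_mem_of_le (by omega)
  have hlo : lo ∈ finiteFloats p q := h.lo_mem
  have hlo' : -1 ≤ lo ∧ lo ≤ 0 := by rcases h.lo_eq with rfl | rfl <;> norm_num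
  have hK : (2 : ℝ) ^ (q + 1) ∈ finiteFloats p q := two_pow_mem
  have hEK : (2 : ℝ) ^ (q + 1) * 256 ≤ 2 ^ emax q := by nlinarith
  have v1 := val_nearestEven (p := p) (q := q) one_mem
  have e1 := coe_nearestEven (p := p) (q := q) one_mem
  have vlo := val_nearestEven hlo
  have vE := val_nearestEven hE
  have vp := val_nearestEven hp
  exact {
    κ := nearestEven p q (2 ^ p)
    τ := nearestEven p q (2 ^ p)
    δ := nearestEven p q 1
    D := nearestEven p q 1
    hi := nearestEven p q (2 ^ emax q)
    lo := nearestEven p q lo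
    -- Carriers of rectifier networks have the same value on all inputs, including those away from
    -- the target.
    J := fun j => j = nearestEven p q (2 ^ p)
    Z := True
    hi_ne := fun e => by
      have := congrArg (Subtype.val) e
      rw [coe_nearestEven hE, coe_nearestEven hlo] at this
      linarith
    scale := ⟨by rw [e1, mul_one], 0, by norm_num, by rw [e1, pow_zero]⟩
    delta_le := by rw [e1, abs_one]
    bound := fun y hy => by rw [e1, one_mul]; rwa [h.gbound] at hy
    act_τ := (h.linear_finite vp le_rfl).1
    der_τ := (h.linear_finite vp le_rfl).2
    J_κ := rfl
    carrier := by
      rintro A j hA rfl z rfl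
      rw [finite_mul_add_neg_mul, ExtFlt.zero_add]
      · exact ⟨⟨_, rfl, (h.linear_finite vp le_rfl).1⟩, ⟨_, (h.linear_finite vp le_rfl).2⟩,
          fun _ => rfl⟩
      · rw [coe_nearestEven hp, abs_mul, abs_of_pos (by positivity : (0 : ℝ) < 2 ^ p)]
        nlinarith
    off := fun z hz => h.off_finite hz
    -- The map `h ↦ 3 / 2 * h - 2 ^ (emax q - 1)` fixes the high value `2 ^ emax q` and sends the
    -- low value far to the left.
    bitWeight := nearestEven p q (3 * 2 ^ (-1 : ℤ))
    bitBias := nearestEven p q (-2 ^ (emax q - 1))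
    bit := by
      have vw := val_nearestEven h3
      have vb := val_nearestEven (neg_mem hE1)
      rintro _ (rfl | rfl) z rfl
      · have hv : Val (((ExtFlt.finite (nearestEven p q (3 * 2 ^ (-1 : ℤ)))).mul
            (.finite (nearestEven p q (2 ^ emax q)))).add
              (.finite (nearestEven p q (-2 ^ (emax q - 1))))) (2 ^ emax q) := by
          have ea : (3 : ℝ) * 2 ^ (-1 : ℤ) * 2 ^ emax q = 3 * 2 ^ (emax q - 1) := by
            rw [zpow_sub_one_two]; norm_num; ring
          have eb : (3 : ℝ) * 2 ^ (emax q - 1) + -2 ^ (emax q - 1) = 2 ^ emax q := by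
            rw [zpow_sub_one_two]; ring
          exact ((((vw.mul_mem vE (by rwa [ea])).congr ea).add_mem vb (by rwa [eb]))).congr eb
        have hl := h.linear_finite hv (by linarith)
        exact ⟨hl.1, _, hl.2, fun hh => absurd ⟨trivial, rfl⟩ hh⟩
      · have hA : AtMost (((ExtFlt.finite (nearestEven p q (3 * 2 ^ (-1 : ℤ)))).mul
            (.finite (nearestEven p q lo))).add
              (.finite (nearestEven p q (-2 ^ (emax q - 1))))) (-2 ^ (q + 1)) := by
          refine (vw.atMost_mul vlo zero_mem ?_).add (vb.atMost le_rfl) (neg_mem hK) ?_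
          · norm_num; linarith
          · rw [zpow_sub_one_two]; linarith
        exact ⟨(h.off_finite hA).1, 0, (h.off_finite hA).2, fun _ => rfl⟩
    gateWeight := nearestEven p q (-1)
    -- The low bit contributes `-lo`, which this bias takes back. The intermediate sum is `2 ^ p` or
    -- `2 ^ p + 1`, exact in both cases.
    gateBias := nearestEven p q lo
    gate_on := by
      refine ⟨nearestEven p q (2 ^ p), nearestEven p q (2 ^ p), ?_, ?_⟩
      · exact ((v1.mul_mem vp (by rwa [one_mul])).congr (one_mul _)).eq_nearestEven
      · rintro z rfl
        have hm : (2 : ℝ) ^ p + -1 * lo ∈ finiteFloats p q := by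
          rcases h.lo_eq with rfl | rfl
          · rw [mul_zero, add_zero]; exact hp
          · have := int_mul_zpow_mem (p := p) (q := q) (m := 2 ^ p + 1) (e := 0) ?_ (by omega) ?_
            · convert this using 1
              push_cast; simp
            · rw [abs_of_pos (by positivity), pow_succ]
              have : (1 : ℤ) ≤ 2 ^ p := one_le_pow₀ (by norm_num)
              omega
            · push_cast
              rw [abs_of_pos (by positivity), zpow_zero, mul_one]
              linarith
        have hv := ((v1.mul_mem vp (by rwa [one_mul])).congr (one_mul _)).add_mem
          ((val_nearestEven (neg_mem one_mem)).mul_mem vlo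
            (by rw [neg_one_mul]; exact neg_mem hlo)) hm
        have hv' := (hv.add_mem vlo (by convert hp using 1; ring)).congr
          (show (2 : ℝ) ^ p + -1 * lo + lo = 2 ^ p by ring)
        exact h.linear_finite hv' le_rfl
    gate_off := by
      refine ⟨nearestEven p q lo, nearestEven p q lo, ?_, ?_⟩
      · exact ((v1.mul_mem vlo (by rwa [one_mul])).congr (one_mul _)).eq_nearestEven
      · rintro j rfl z rfl
        refine h.off_finite ?_
        refine AtMost.add (r := -2 ^ (emax q - 1)) (s := 0) ?_ (vlo.atMost hlo'.2) (neg_mem hK) ?_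
        · refine AtMost.add (r := 2 ^ p) (s := -2 ^ emax q) ?_ ?_ (neg_mem hE1) ?_
          · exact ((v1.mul_mem vp (by rwa [one_mul])).congr (one_mul _)).atMost le_rfl
          · exact ((val_nearestEven (neg_mem one_mem)).mul_mem vE
              (by rw [neg_one_mul]; exact neg_mem hE)).atMost (by rw [neg_one_mul])
          · rw [zpow_sub_one_two]; linarith
        · rw [zpow_sub_one_two]; linarith
    gate_grad := fun y hy => by
      rw [coe_nearestEven (neg_mem one_mem), mul_neg_one, abs_neg]
      rwa [h.gbound] at hy
    S := S
    K := K
    kind := kind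
    outWeight := outWeight
    pieceWeight := pieceWeight
    pieceBias := pieceBias
    piece := piece }

end Rectifier

/-! ### Comparisons and the first layers of rectifier networks. -/

namespace Rectifier

variable {a : Activation} {lo : ℝ}

/-- The carriers of the first layer. -/
theorem first_carrier [Params p q] {v : ℝ} (h : |v| ≤ 2 ^ (emax q - 2)) :
    fl p q (fl p q (2 ^ (-(p : ℤ)) * v) + 3 * 2 ^ (emax q - 1)) = 3 * 2 ^ (emax q - 1) := by
  obtain ⟨f1, f2, f3, f4, f5⟩ := emax_facts p q
  have h3 : 3 * (2 : ℝ) ^ (emax q - 1) ∈ finiteFloats p q :=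
    three_mul_zpow_mem (by omega) (by omega)
  have hb : (2 : ℝ) ^ (emax q - 2 - p) ∈ finiteFloats p q := two_zpow_mem (by omega) (by omega)
  have e1 : (2 : ℝ) ^ (emax q - 2 - p) = 2 ^ (-(p : ℤ)) * 2 ^ (emax q - 2) := by
    rw [← zpow_add₀ (by norm_num)]; congr 1; ring
  have h0 : (0 : ℝ) < 2 ^ (-(p : ℤ)) := by positivity
  rw [abs_le] at h
  have hu : |fl p q (2 ^ (-(p : ℤ)) * v)| ≤ 2 ^ (emax q - 2 - p) := by
    rw [abs_le]
    exact ⟨le_fl (neg_mem hb) (by rw [e1]; nlinarith), fl_le hb (by rw [e1]; nlinarith)⟩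
  set u := fl p q (2 ^ (-(p : ℤ)) * v)
  have e2 : (2 : ℝ) ^ (emax q - 2 - p) * 4 = 2 ^ (emax q - p) := by
    rw [show (4 : ℝ) = 2 ^ (2 : ℤ) by norm_num, ← zpow_add₀ (by norm_num)]; congr 1; ring
  have e3 : (2 : ℝ) ^ (emax q - p) ≤ 2 ^ (emax q - 1) := zpow_le_zpow_right₀ (by norm_num) (by omega)
  have e4 : (2 : ℝ) ^ (emax q - 1) * 2 = 2 ^ emax q := by rw [zpow_sub_one_two]; ring
  have hpos : (0 : ℝ) < 2 ^ (emax q - 2 - p) := by positivity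
  -- The spacing at `3 * 2 ^ (emax q - 1)` is `2 ^ (emax q - p)`, and the scaled input is at most a
  -- quarter of it. The input is thus absorbed, while its weight still acts on the gradient.
  refine fl_eq_of_near h3 fun z hz hza => ?_
  rw [add_sub_cancel_right]
  have hz' : (2 : ℝ) ^ (emax q - p) ≤ |z - 3 * 2 ^ (emax q - 1)| := by
    rcases le_or_gt ((2 : ℝ) ^ emax q) |z| with hc | hc
    · refine gap_of_le_abs hz h3 hc ?_ hza
      rw [abs_of_pos (by positivity)]; linarith
    · have := (abs_lt.1 hc).2
      rw [abs_sub_comm]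
      exact le_trans (by linarith) (le_abs_self _)
  have h5 : |z - 3 * 2 ^ (emax q - 1)| ≤ |u + 3 * 2 ^ (emax q - 1) - z| + |u| := by
    have := abs_sub (u) (u + 3 * 2 ^ (emax q - 1) - z)
    rw [show u - (u + 3 * 2 ^ (emax q - 1) - z) = z - 3 * 2 ^ (emax q - 1) by ring] at this
    linarith
  linarith

/-- The neurons that compare an input with a threshold. -/
theorem exists_cmp [Params p q] (h : Rectifier a lo) {d : ℝ} (hd : d ∈ finiteFloats p q) : ∃ c₀ c₁ c₂ c₃ : Flt p q,
      (∀ P, Val P d → a.act p q P = .finite c₀ ∧ ∃ r, a.actDeriv p q P = .finite r) ∧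
      (∀ P, P = ((ExtFlt.finite (nearestEven p q (-2 ^ emax q))).mul (.finite c₀)).add
          (.finite (nearestEven p q (2 ^ (1 - (p : ℤ))))) →
        a.act p q P = .finite c₁ ∧ ∃ r, a.actDeriv p q P = .finite r) ∧
      (∀ P, P = ((ExtFlt.finite (nearestEven p q (-2 ^ (emax q - 1)))).mul (.finite c₁)).add
          (.finite (nearestEven p q 1)) →
        a.act p q P = .finite c₂ ∧ ∃ r, a.actDeriv p q P = .finite r) ∧
      (∀ P, P = ((ExtFlt.finite (nearestEven p q 1)).mul (.finite c₂)).add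
          (.finite (nearestEven p q (-lo))) →
        a.act p q P = .finite c₃ ∧ ∃ r, a.actDeriv p q P = .finite r) ∧
      ((c₃ : ℝ) = 0 ∨ 1 / 4 ≤ (c₃ : ℝ)) ∧ ((c₃ : ℝ) = 0 ↔ d ≤ 0) := by
  obtain ⟨f1, f2, f3, f4, f5⟩ := emax_facts p q
  obtain ⟨g1, g2, g3, g4, g5⟩ := zpow_emax_facts p q
  have g6 : (0 : ℝ) < 2 ^ (emax q - p) := by positivity
  have g7 := three_halves_le_Omega (p := p) (q := q)
  have hE : (2 : ℝ) ^ emax q ∈ finiteFloats p q := two_zpow_mem (by omega) le_rfl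
  have hE1 : (2 : ℝ) ^ (emax q - 1) ∈ finiteFloats p q := two_zpow_mem (by omega) (by omega)
  have hS : (2 : ℝ) ^ (1 - (p : ℤ)) ∈ finiteFloats p q := two_zpow_mem (by omega) (by omega)
  have hS' : (2 : ℝ) ^ (-(p : ℤ)) ∈ finiteFloats p q := two_zpow_mem (by omega) (by omega)
  have e0 : (2 : ℝ) ^ (1 - (p : ℤ)) = 2 * 2 ^ (-(p : ℤ)) := by
    rw [show 1 - (p : ℤ) = 1 + -p by ring, zpow_add₀ (by norm_num)]; norm_num
  have e1 : (2 : ℝ) ^ (emax q) * eps p q = 2 ^ (1 - (p : ℤ)) := by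
    unfold eps; rw [← zpow_add₀ (by norm_num)]; congr 1; omega
  have e2 : (2 : ℝ) ^ (emax q) * 2 ^ (-(p : ℤ)) = 2 ^ (emax q - p) := by
    rw [← zpow_add₀ (by norm_num)]; congr 1
  have e3 : (2 : ℝ) ^ (emax q - 1) = 2 ^ emax q / 2 := zpow_sub_one_two _
  have hs1 : (2 : ℝ) ^ (-(p : ℤ)) ≤ 1 / 4 := by
    rw [show (1 / 4 : ℝ) = 2 ^ (-2 : ℤ) by norm_num]
    exact zpow_le_zpow_right₀ (by norm_num) (by omega)
  have hs0 : (0 : ℝ) < 2 ^ (-(p : ℤ)) := by positivity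
  have hE0 : (0 : ℝ) < 2 ^ emax q := by positivity
  have hlo := h.lo_mem (p := p) (q := q)
  have hlo' : -1 ≤ lo ∧ lo ≤ 0 := by rcases h.lo_eq with rfl | rfl <;> norm_num
  have vE := val_nearestEven (neg_mem hE)
  have vE1 := val_nearestEven (neg_mem hE1)
  have vS := val_nearestEven hS
  have v1 := val_nearestEven (p := p) (q := q) one_mem
  have vlo := val_nearestEven (neg_mem hlo)
  have hK : (2 : ℝ) ^ (q + 1) ∈ finiteFloats p q := two_pow_mem
  obtain ⟨zd, hzd⟩ : ∃ z : ExtFlt p q, Val z d := ⟨_, val_mk hd⟩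
  -- For `d ≤ 0` the values are: in `[-1, 0]`; then at least `2 ^ (-p)`, by the bias `2 ^ (1 - p)`;
  -- then switched off; then exactly `0` after adding `-lo`. For `d > 0` the first value is at least
  -- `eps p q`, and `2 ^ emax q * eps p q` just outweighs the bias, so the signs are reversed; the
  -- final value is at least `1 / 4` after two possible losses of a factor `2`.
  rcases le_or_gt d 0 with h0 | h0
  · obtain ⟨c₀, w0, b1, b2⟩ := h.act_nonpos (hzd.atMost h0)
    obtain ⟨x₀, rfl, hx₀⟩ := w0.exists_eq
    have b3 : -2 ^ emax q * (x₀ : ℝ) ≤ 2 ^ emax q := by nlinarith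
    have b4 : 0 ≤ -2 ^ emax q * (x₀ : ℝ) := by nlinarith
    have w1 := vE.mul (val_finite x₀) (by rw [abs_of_nonneg b4]; linarith)
    have b5 := le_fl (p := p) (q := q) zero_mem b4
    have b6 := fl_le hE b3
    have w2 := w1.add vS (by rw [abs_of_nonneg (by linarith)]; linarith)
    have b7 := le_fl (p := p) (q := q) hS
      (show _ ≤ fl p q (-2 ^ emax q * (x₀ : ℝ)) + 2 ^ (1 - (p : ℤ)) by linarith)
    obtain ⟨c₁, w3, b8, b9, b10⟩ := h.act_pos w2 (by linarith)
    have b11 := b10 _ hS' (by linarith)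
    obtain ⟨x₁, rfl, hx₁⟩ := w3.exists_eq
    have w4 : AtMost (((ExtFlt.finite (nearestEven p q (-2 ^ (emax q - 1)))).mul (.finite x₁)).add
          (.finite (nearestEven p q 1))) (-2 ^ (q + 1)) := by
      refine AtMost.add (r := -2 ^ (emax q - p - 1)) (s := 1) (vE1.atMost_mul (val_finite x₁)
        (neg_mem (two_zpow_mem (by omega) (by omega))) ?_) (v1.atMost le_rfl) (neg_mem hK) ?_
      · rw [zpow_sub_one_two, zpow_sub_one_two, ← e2]; nlinarith
      · rw [zpow_sub_one_two]; linarith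
    obtain ⟨x₂, hx₂, hx₂'⟩ := (h.off w4).1.exists_eq
    have w5 : Val (((ExtFlt.finite (nearestEven p q 1)).mul (.finite x₂)).add
          (.finite (nearestEven p q (-lo)))) 0 := by
      have := (v1.mul_mem (val_finite x₂) (by rw [one_mul]; exact x₂.2)).congr
        ((one_mul _).trans hx₂)
      exact (this.add_mem vlo (by rw [add_neg_cancel]; exact zero_mem)).congr (add_neg_cancel _)
    obtain ⟨x₃, hx₃, hx₃'⟩ := (h.act_zero w5).exists_eq
    refine ⟨x₀, x₁, x₂, x₃, fun P hP => ?_, ?_, ?_, ?_, Or.inl hx₃, ⟨fun _ => h0, fun _ => hx₃⟩⟩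
    · rw [hP.eq hzd]
      exact ⟨hx₀, h.der_finite (hzd.atMost le_rfl)⟩
    · rintro P rfl
      exact ⟨hx₁, h.der_finite (w2.atMost le_rfl)⟩
    · rintro P rfl
      exact ⟨hx₂', h.der_finite w4⟩
    · rintro P rfl
      exact ⟨hx₃', h.der_finite (w5.atMost le_rfl)⟩
  · obtain ⟨c₀, w0, b1, b2, -⟩ := h.act_pos hzd h0
    have b3 := eps_le_abs w0.mem b1.ne'
    rw [abs_of_pos b1] at b3
    obtain ⟨x₀, rfl, hx₀⟩ := w0.exists_eq
    have w2 : AtMost (((ExtFlt.finite (nearestEven p q (-2 ^ emax q))).mul (.finite x₀)).add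
          (.finite (nearestEven p q (2 ^ (1 - (p : ℤ)))))) 0 :=
      AtMost.add (r := -2 ^ (1 - (p : ℤ))) (vE.atMost_mul (val_finite x₀) (neg_mem hS)
        (by rw [← e1]; nlinarith)) (vS.atMost le_rfl) zero_mem (by linarith)
    obtain ⟨c₁, w3, b4, b5⟩ := h.act_nonpos w2
    obtain ⟨x₁, rfl, hx₁⟩ := w3.exists_eq
    have b6 : 0 ≤ -2 ^ (emax q - 1) * (x₁ : ℝ) := by rw [e3]; nlinarith
    have b7 : -2 ^ (emax q - 1) * (x₁ : ℝ) ≤ 2 ^ (emax q - 1) := by rw [e3]; nlinarith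
    have w4 := vE1.mul (val_finite x₁) (by rw [abs_of_nonneg b6]; linarith)
    have b8 := le_fl (p := p) (q := q) zero_mem b6
    have b9 := fl_le hE1 b7
    have w5 := w4.add v1 (by rw [abs_of_nonneg (by linarith)]; linarith)
    have b10 := le_fl (p := p) (q := q) one_mem
      (show _ ≤ fl p q (-2 ^ (emax q - 1) * (x₁ : ℝ)) + 1 by linarith)
    have b11 := fl_le (p := p) (q := q) hE
      (show fl p q (-2 ^ (emax q - 1) * (x₁ : ℝ)) + 1 ≤ _ by linarith)
    obtain ⟨c₂, w6, b12, b13, b14⟩ := h.act_pos w5 (by linarith)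
    have hhalf : (1 / 2 : ℝ) ∈ finiteFloats p q := by
      have := two_zpow_mem (p := p) (q := q) (e := -1) (by omega) (by omega)
      norm_num at this ⊢; exact this
    have hquart : (1 / 4 : ℝ) ∈ finiteFloats p q := by
      have := two_zpow_mem (p := p) (q := q) (e := -2) (by omega) (by omega)
      norm_num at this ⊢; exact this
    have b15 := b14 _ hhalf (by linarith)
    obtain ⟨x₂, rfl, hx₂⟩ := w6.exists_eq
    have w7 := ((v1.mul_mem (val_finite x₂) (by rw [one_mul]; exact x₂.2)).congr
        (one_mul _)).add vlo (by rw [abs_of_nonneg (by linarith)]; linarith)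
    have b16 := le_fl (p := p) (q := q) hhalf (show _ ≤ (x₂ : ℝ) + -lo by linarith)
    obtain ⟨c₃, w8, b17, b18, b19⟩ := h.act_pos w7 (by linarith)
    have b20 := b19 _ hquart (by linarith)
    obtain ⟨x₃, rfl, hx₃⟩ := w8.exists_eq
    refine ⟨x₀, x₁, x₂, x₃, fun P hP => ?_, ?_, ?_, ?_, Or.inr b20,
      ⟨fun hh => absurd hh b17.ne', fun hh => absurd hh (not_le.2 h0)⟩⟩
    · rw [hP.eq hzd]
      exact ⟨hx₀, h.der_finite (hzd.atMost le_rfl)⟩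
    · rintro P rfl
      exact ⟨hx₁, h.der_finite w2⟩
    · rintro P rfl
      exact ⟨hx₂, h.der_finite (w5.atMost le_rfl)⟩
    · rintro P rfl
      exact ⟨hx₃, h.der_finite (w7.atMost le_rfl)⟩

/-- Differences of floats are multiples of `eps p q`, so a positive difference rounds to at least
`eps p q`: subtraction never underflows to zero. -/
theorem fl_sub_nonpos_iff [Params p q] {x y : ℝ} (hx : x ∈ finiteFloats p q)
    (hy : y ∈ finiteFloats p q) : fl p q (x - y) ≤ 0 ↔ x ≤ y := by
  refine ⟨fun h => ?_, fun h => fl_le zero_mem (by linarith)⟩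
  by_contra hc
  obtain ⟨m, i, -, e1⟩ := exists_int_eps hx
  obtain ⟨m', i', -, e2⟩ := exists_int_eps hy
  have h0 := eps_pos (p := p) (q := q)
  have h1 : ((m * 2 ^ i - m' * 2 ^ i' : ℤ) : ℝ) * eps p q = x - y := by
    rw [e1, e2]; push_cast; ring
  have h2 : 0 < m * 2 ^ i - m' * 2 ^ i' := by
    have : 0 < ((m * 2 ^ i - m' * 2 ^ i' : ℤ) : ℝ) := by
      by_contra hn
      nlinarith
    exact_mod_cast this
  have h3 : (1 : ℝ) ≤ ((m * 2 ^ i - m' * 2 ^ i' : ℤ) : ℝ) := by exact_mod_cast h2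
  have := le_fl (p := p) (q := q) eps_mem (show eps p q ≤ x - y by rw [← h1]; nlinarith)
  linarith

section

variable [Params p q] (h : Rectifier a lo) {S K : Type} [Finite S] [Finite K]
    (kind : K → Option Bool) (outWeight : Flt p q → S → Flt p q)
    (pieceWeight : Flt p q → S → K → Flt p q) (pieceBias : Flt p q → S → Flt p q)
    (piece : PieceSpec a (nearestEven p q (2 ^ emax q)) (nearestEven p q lo) kind outWeight
      pieceWeight pieceBias)

/-- The layers of a rectifier network that are close to the input. -/
def inputKit : InputKit (h.kit kind outWeight pieceWeight pieceBias piece) := by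
  have f1 := (emax_facts p q).1
  have f2 := (emax_facts p q).2.1
  have f3 := (emax_facts p q).2.2.1
  have g1 := (zpow_emax_facts p q).1
  have g2 := (zpow_emax_facts p q).2.1
  have g3 := (zpow_emax_facts p q).2.2.1
  have g4 := (zpow_emax_facts p q).2.2.2.1
  have g5 := (zpow_emax_facts p q).2.2.2.2
  have g6 : (0 : ℝ) < 2 ^ (emax q - p) := by positivity
  have g7 := three_halves_le_Omega (p := p) (q := q)
  have hE : (2 : ℝ) ^ emax q ∈ finiteFloats p q := two_zpow_mem (by omega) le_rfl
  have hE1 : (2 : ℝ) ^ (emax q - 1) ∈ finiteFloats p q := two_zpow_mem (by omega) (by omega)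
  have hE3 : 3 * (2 : ℝ) ^ (emax q - 1) ∈ finiteFloats p q :=
    three_mul_zpow_mem (by omega) (by omega)
  have hW : 3 * (2 : ℝ) ^ (emax q - p - 1) ∈ finiteFloats p q :=
    three_mul_zpow_mem (by omega) (by omega)
  have hp : (2 : ℝ) ^ p ∈ finiteFloats p q := two_pow_mem_of_le (by omega)
  have hw : (2 : ℝ) ^ (-(p : ℤ)) ∈ finiteFloats p q := two_zpow_mem (by omega) (by omega)
  have hlo : lo ∈ finiteFloats p q := h.lo_mem
  have hlo' : -1 ≤ lo ∧ lo ≤ 0 := by rcases h.lo_eq with rfl | rfl <;> norm_num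
  have hK : (2 : ℝ) ^ (q + 1) ∈ finiteFloats p q := two_pow_mem
  have hEK : (2 : ℝ) ^ (q + 1) * 256 ≤ 2 ^ emax q := by nlinarith
  have e1 := coe_nearestEven (p := p) (q := q) one_mem
  have e2 := zpow_sub_one_two (emax q)
  have e3 := zpow_sub_two_two (emax q)
  have v1 := val_nearestEven (p := p) (q := q) one_mem
  have vw := val_nearestEven hw
  have vE := val_nearestEven hE
  have vp := val_nearestEven hp
  have vE3 := val_nearestEven hE3
  have vlo := val_nearestEven hlo
  have lin3 := h.linear_finite vE3 (by linarith)
  have eW : 3 * (2 : ℝ) ^ (emax q - p - 1) * 2 ^ p = 3 * 2 ^ (emax q - 1) := by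
    rw [zpow_sub_one_two, zpow_sub_one_two, ← g3]; ring
  have hB : (2 : ℝ) ^ emax q + 3 * 2 ^ (emax q - p - 1) * lo ∈ finiteFloats p q := by
    rcases h.lo_eq with rfl | rfl
    · rwa [mul_zero, add_zero]
    -- For `lo = -1` this number is `(2 ^ (p + 1) - 3) * 2 ^ (emax q - p - 1)`, still with at most
    -- `p + 1` bits.
    · have := int_mul_zpow_mem (p := p) (q := q) (m := 2 ^ (p + 1) - 3) (e := emax q - p - 1) ?_
        (by omega) ?_
      · convert this using 1
        push_cast
        rw [zpow_sub_one_two, ← g3]; ring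
      · have h8 : (8 : ℤ) ≤ 2 ^ (p + 1) := by
          have : (4 : ℤ) ≤ 2 ^ p := by exact_mod_cast g4
          rw [pow_succ]; linarith
        rw [abs_of_nonneg (by linarith)]; linarith
      · push_cast
        rw [zpow_sub_one_two, abs_of_nonneg]
        · rw [pow_succ]; nlinarith
        · rw [pow_succ]; nlinarith
  exact {
    κ₁ := nearestEven p q (3 * 2 ^ (emax q - 1))
    τ₁ := nearestEven p q (3 * 2 ^ (emax q - 1))
    J₁ := fun j => j = nearestEven p q (3 * 2 ^ (emax q - 1))
    act_τ₁ := lin3.1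
    der_τ₁ := ⟨_, by rw [e1, abs_one], lin3.2⟩
    carrier₁ := by
      rintro A j hA rfl z rfl
      have hA' : |(A : ℝ)| ≤ 1 := by
        rcases hA with rfl | rfl
        · change |(nearestEven p q 1 : ℝ)| ≤ 1
          rw [e1, abs_one]
        · change |(0 : ℝ)| ≤ 1
          norm_num
      rw [finite_mul_add_neg_mul, ExtFlt.zero_add]
      · exact ⟨⟨_, rfl, (h.linear_finite vp le_rfl).1⟩, ⟨_, (h.linear_finite vp le_rfl).2⟩,
          fun _ => rfl⟩
      · rw [coe_nearestEven hE3, abs_mul, abs_of_pos (by positivity : (0 : ℝ) < 3 * 2 ^ (emax q - 1))]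
        have : (0 : ℝ) < 2 ^ (emax q - 1) := by positivity
        nlinarith [abs_nonneg (A : ℝ)]
    s₁ := p
    w₁ := nearestEven p q (2 ^ (-(p : ℤ)))
    -- A bias large enough to absorb the scaled input makes the first carriers independent of the
    -- input. Gating is left entirely to the top.
    b₁ := fun _ => nearestEven p q (3 * 2 ^ (emax q - 1))
    s₁_le := le_rfl
    w₁_eq := coe_nearestEven hw
    range := by
      intro e he
      change (nearestEven p q 1 : ℝ) * _ ≤ _
      rw [e1, one_mul]
      exact two_zpow_le_Omega (by omega)
    first := by
      rintro v z hv hz P rfl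
      rw [h.bound, e3] at hv
      have hs : (0 : ℝ) < 2 ^ (-(p : ℤ)) := by positivity
      have hs1 : (2 : ℝ) ^ (-(p : ℤ)) ≤ 1 := zpow_le_one_of_nonpos₀ (by norm_num) (by omega)
      have hmul := vw.mul (val_finite v) (by
        rw [abs_mul, abs_of_pos hs]
        have := abs_nonneg (v : ℝ)
        nlinarith)
      have hq : (2 : ℝ) ^ (emax q - 2) ∈ finiteFloats p q := two_zpow_mem (by omega) (by omega)
      have h4 : |2 ^ (-(p : ℤ)) * (v : ℝ)| ≤ 2 ^ emax q / 4 := by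
        rw [abs_mul, abs_of_pos hs]
        have := abs_nonneg (v : ℝ)
        nlinarith
      rw [abs_le] at h4
      have h5 := fl_le (p := p) (q := q) hq (show 2 ^ (-(p : ℤ)) * (v : ℝ) ≤ _ by rw [e3]; exact h4.2)
      have h6 := le_fl (p := p) (q := q) (neg_mem hq)
        (show _ ≤ 2 ^ (-(p : ℤ)) * (v : ℝ) by rw [e3]; exact h4.1)
      rw [e3] at h5 h6
      have hB' := val_round_of_lt (p := p) (q := q)
        (x := fl p q (2 ^ (-(p : ℤ)) * v) + 3 * 2 ^ (emax q - 1)) ?_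
      · rw [first_carrier (by rw [e3]; exact hv)] at hB'
        have hP : Val (((ExtFlt.finite (nearestEven p q (2 ^ (-(p : ℤ))))).mul (.finite v)).add
            (.finite (nearestEven p q (3 * 2 ^ (emax q - 1))))) (3 * 2 ^ (emax q - 1)) := by
          obtain ⟨m1, h7⟩ := hmul
          obtain ⟨m2, h8⟩ := vE3
          rw [h7, h8]
          exact hB'
        have := h.linear_finite hP (by linarith)
        exact ⟨⟨_, rfl, this.1, fun _ => rfl⟩, _, this.2, fun _ => rfl⟩
      · have h7 : 7 / 4 * (2 : ℝ) ^ emax q ≤ Omega p q := by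
          have : (2 : ℝ) ^ (-(p : ℤ)) ≤ 2 ^ (-2 : ℤ) :=
            zpow_le_zpow_right₀ (by norm_num) (by have := (‹Params p q›).two_le; omega)
          norm_num at this
          have h9 : (0 : ℝ) < 2 ^ emax q := by positivity
          unfold Omega
          norm_num
          nlinarith
        have h8 : (0 : ℝ) < 2 ^ (emax q - p - 1) := by positivity
        have h9 : (0 : ℝ) < 2 ^ emax q := by positivity
        rw [e2, abs_of_nonneg (by linarith)]
        linarith
    m := 2
    cmpWeight := fun _ s => nearestEven p q (if s then 1 else -1)
    cmpBias := fun z s => if s then -z else z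
    stepWeight := fun i => match i with
      | 0 => nearestEven p q (-2 ^ emax q)
      | 1 => nearestEven p q (-2 ^ (emax q - 1))
      | _ => nearestEven p q 1
    stepBias := fun i => match i with
      | 0 => nearestEven p q (2 ^ (1 - (p : ℤ)))
      | 1 => nearestEven p q 1
      | _ => nearestEven p q (-lo)
    m_le := le_rfl
    cmp := by
      intro v z s hv hz
      rw [h.bound, e3, abs_le] at hv hz
      have key : ∀ x y : Flt p q, |(x : ℝ)| ≤ 2 ^ emax q / 4 → |(y : ℝ)| ≤ 2 ^ emax q / 4 →
          |(x : ℝ) - y| ≤ Omega p q := by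
        intro x y hx hy
        rw [abs_le] at hx hy ⊢
        constructor <;> linarith
      have hv' := abs_le.2 hv
      have hz' := abs_le.2 hz
      obtain ⟨d, hd, hdP, hd0⟩ : ∃ d, d ∈ finiteFloats p q ∧
          Val (((ExtFlt.finite (nearestEven p q (if s then 1 else -1))).mul (.finite v)).add
            (.finite (if s then -z else z))) d ∧
          (d ≤ 0 ↔ if s then (v : ℝ) ≤ z else (z : ℝ) ≤ v) := by
        cases s
        · refine ⟨fl p q ((z : ℝ) - v), fl_mem _, ?_, ?_⟩
          · simp only [Bool.false_eq_true, if_false]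
            have := ((val_nearestEven (neg_mem one_mem)).mul_mem (val_finite v)
              (by rw [neg_one_mul]; exact neg_mem v.2)).add (val_finite z)
              (by rw [neg_one_mul, neg_add_eq_sub]; exact key z v hz' hv')
            rwa [neg_one_mul, neg_add_eq_sub] at this
          · simp only [Bool.false_eq_true, if_false]
            exact fl_sub_nonpos_iff z.2 v.2
        · refine ⟨fl p q ((v : ℝ) - z), fl_mem _, ?_, ?_⟩
          · simp only [if_true]
            have := (v1.mul_mem (val_finite v)
              (by rw [one_mul]; exact v.2)).add (val_finite (-z))
              (by rw [one_mul]; exact key v z hv' hz')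
            rwa [one_mul] at this
          · simp only [if_true]
            exact fl_sub_nonpos_iff v.2 z.2
      obtain ⟨c₀, c₁, c₂, c₃, k0, k1, k2, k3, k4, k5⟩ := h.exists_cmp hd
      refine ⟨fun i => match i with | 0 => c₀ | 1 => c₁ | 2 => c₂ | _ => c₃, ?_, ?_, k4, k5.trans hd0⟩
      · rintro P rfl
        exact k0 _ hdP
      · intro i hi
        interval_cases i
        · exact k1
        · exact k2
        · exact k3
    on := nearestEven p q (2 ^ p)
    norBias := nearestEven p q (2 ^ p)
    nor_on := ⟨(h.linear_finite vp le_rfl).1, _, (h.linear_finite vp le_rfl).2⟩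
    nor_off := fun P hP => hP.add (vp.atMost le_rfl) (neg_mem hK) (by rw [e3]; linarith)
    -- Times the value `2 ^ p` of the recognising neuron this gives `3 * 2 ^ (emax q - 1)`, from
    -- which the bias of the positive bit leaves the high value `2 ^ emax q`. For the negated bit,
    -- the bias also compensates the contribution of `lo`.
    litWeight := fun v => nearestEven p q ((if v then 1 else -1) * (3 * 2 ^ (emax q - p - 1)))
    litBias := fun v => nearestEven p q
      (if v then -2 ^ (emax q - 1) else 2 ^ emax q + 3 * 2 ^ (emax q - p - 1) * lo)
    lit := by
      have g8 : (0 : ℝ) < 2 ^ (emax q - p - 1) := by positivity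
      have g9 : (2 : ℝ) ^ (emax q - p - 1) * 2 * 2 ^ p = 2 ^ emax q := by
        rw [zpow_sub_one_two, ← g3]; ring
      have g10 : (2 : ℝ) ^ (emax q - p - 1) * 8 ≤ 2 ^ emax q := by nlinarith
      have hWlo : 3 * (2 : ℝ) ^ (emax q - p - 1) * lo ∈ finiteFloats p q := by
        rcases h.lo_eq with rfl | rfl
        · rw [mul_zero]; exact zero_mem
        · rw [mul_neg_one]; exact neg_mem hW
      rintro e v P rfl
      cases v
      · simp only [Bool.false_eq_true, if_false, neg_one_mul]
        have vW := val_nearestEven (neg_mem hW)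
        have vB := val_nearestEven hB
        cases e
        · simp only [Bool.false_eq_true, if_false]
          have hv : Val (((ExtFlt.finite (nearestEven p q (-(3 * 2 ^ (emax q - p - 1))))).mul
              (.finite (nearestEven p q lo))).add (.finite (nearestEven p q
                (2 ^ emax q + 3 * 2 ^ (emax q - p - 1) * lo)))) (2 ^ emax q) := by
            have ea : -(3 * (2 : ℝ) ^ (emax q - p - 1)) * lo +
              (2 ^ emax q + 3 * 2 ^ (emax q - p - 1) * lo) = 2 ^ emax q := by ring
            exact ((vW.mul_mem vlo (by rw [neg_mul]; exact neg_mem hWlo)).add_mem vB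
              (by rwa [ea])).congr ea
          have := h.linear_finite hv (by linarith)
          exact ⟨this.1, _, this.2⟩
        · simp only [if_true]
          have hv : AtMost (((ExtFlt.finite (nearestEven p q (-(3 * 2 ^ (emax q - p - 1))))).mul
              (.finite (nearestEven p q (2 ^ p)))).add (.finite (nearestEven p q
                (2 ^ emax q + 3 * 2 ^ (emax q - p - 1) * lo)))) (-2 ^ (q + 1)) := by
            refine (vW.atMost_mul vp (neg_mem hE3) (by rw [neg_mul, eW])).add
              (vB.atMost le_rfl) (neg_mem hK) ?_
            rw [e2]
            nlinarith
          exact ⟨(h.off_finite hv).1, 0, (h.off_finite hv).2⟩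
      · simp only [if_true, one_mul]
        have vW := val_nearestEven hW
        have vB := val_nearestEven (neg_mem hE1)
        cases e
        · simp only [Bool.false_eq_true, if_false]
          have hv : AtMost (((ExtFlt.finite (nearestEven p q (3 * 2 ^ (emax q - p - 1)))).mul
              (.finite (nearestEven p q lo))).add (.finite (nearestEven p q
                (-2 ^ (emax q - 1))))) (-2 ^ (q + 1)) := by
            refine (vW.atMost_mul vlo zero_mem (by nlinarith)).add
              (vB.atMost le_rfl) (neg_mem hK) ?_
            rw [e2]
            linarith
          exact ⟨(h.off_finite hv).1, 0, (h.off_finite hv).2⟩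
        · simp only [if_true]
          have hv : Val (((ExtFlt.finite (nearestEven p q (3 * 2 ^ (emax q - p - 1)))).mul
              (.finite (nearestEven p q (2 ^ p)))).add (.finite (nearestEven p q
                (-2 ^ (emax q - 1))))) (2 ^ emax q) := by
            have ea : 3 * (2 : ℝ) ^ (emax q - 1) + -2 ^ (emax q - 1) = 2 ^ emax q := by
              rw [e2]; ring
            exact (((vW.mul_mem vp (by rwa [eW])).congr eW).add_mem vB (by rwa [ea])).congr ea
          have := h.linear_finite hv (by linarith)
          exact ⟨this.1, _, this.2⟩ }

end

end Rectifier

/-! ### The output of rectifier networks -/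

/-- Every float is a sum of two products of a small and a large float. -/
theorem exists_decomposition [Params p q] {t : ℝ} (ht : t ∈ finiteFloats p q) :
    ∃ A v : Bool → ℝ, (∀ s, A s ∈ finiteFloats p q) ∧ (∀ s, v s ∈ finiteFloats p q) ∧
      (∀ s, |A s| ≤ 1) ∧ (∀ s, 2 ^ p ≤ v s) ∧ (A true = 0 ∨ ∀ s, |A s| ≤ 1 / 2) ∧
      (∀ s, A s * v s ∈ finiteFloats p q) ∧ A false * v false + A true * v true = t := by
  obtain ⟨f1, f2, f3, f4, f5⟩ := emax_facts p q
  have hp : (2 : ℝ) ^ p ∈ finiteFloats p q := two_pow_mem_of_le (by omega)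
  have single : ∀ A v : ℝ, A ∈ finiteFloats p q → v ∈ finiteFloats p q → |A| ≤ 1 → 2 ^ p ≤ v →
      A * v = t → ∃ A v : Bool → ℝ, (∀ s, A s ∈ finiteFloats p q) ∧
        (∀ s, v s ∈ finiteFloats p q) ∧ (∀ s, |A s| ≤ 1) ∧ (∀ s, 2 ^ p ≤ v s) ∧
        (A true = 0 ∨ ∀ s, |A s| ≤ 1 / 2) ∧ (∀ s, A s * v s ∈ finiteFloats p q) ∧
        A false * v false + A true * v true = t := by
    intro A v hA hv hA1 hvp e
    refine ⟨fun s => if s then 0 else A, fun s => if s then 2 ^ p else v, ?_, ?_, ?_, ?_, ?_, ?_, ?_⟩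
    · rintro (_ | _); exacts [hA, zero_mem]
    · rintro (_ | _); exacts [hv, hp]
    · rintro (_ | _)
      · exact hA1
      · simp
    · rintro (_ | _); exacts [hvp, le_rfl]
    · exact Or.inl rfl
    · rintro (_ | _)
      · simp only [Bool.false_eq_true, if_false]; rwa [e]
      · simp only [if_true, zero_mul]; exact zero_mem
    · simp only [Bool.false_eq_true, if_false, if_true, zero_mul, add_zero]; exact e
  by_cases h0 : t = 0
  · exact single 0 (2 ^ p) zero_mem hp (by simp) le_rfl (by rw [h0, zero_mul])
  obtain ⟨σ, hσ, ht'⟩ : ∃ σ : ℝ, (σ = 1 ∨ σ = -1) ∧ t = σ * |t| := by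
    rcases abs_choice t with h | h
    · exact ⟨1, Or.inl rfl, by rw [h, one_mul]⟩
    · exact ⟨-1, Or.inr rfl, by rw [h]; ring⟩
  have hσm : ∀ {x : ℝ}, x ∈ finiteFloats p q → σ * x ∈ finiteFloats p q := fun {x} hx => by
    rcases hσ with rfl | rfl
    · rwa [one_mul]
    · rw [neg_one_mul]; exact neg_mem hx
  have hσa : ∀ x : ℝ, |σ * x| = |x| := fun x => by
    rcases hσ with rfl | rfl <;> simp
  have hta : |t| ∈ finiteFloats p q := by
    rcases abs_choice t with h | h <;> rw [h]
    exacts [ht, neg_mem ht]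
  -- Large `t` is its own linear neuron with weight a sign. A smaller `t` with a full mantissa `m ≥
  -- 2 ^ p` is the weight `2 ^ e` times the value `m`.
  rcases le_or_gt ((2 : ℝ) ^ p) |t| with h1 | h1
  · refine single σ |t| ?_ hta ?_ h1 ht'.symm
    · have := hσm one_mem; rwa [mul_one] at this
    · have := hσa 1; rw [mul_one, abs_one] at this; exact this.le
  obtain ⟨m, e, ⟨c1, c2, c3, c4⟩, he⟩ := mem_canon hta
  have hpos := abs_pos.2 h0
  have hm : 0 < m := by
    by_contra hc
    have : (m : ℝ) ≤ 0 := by exact_mod_cast not_lt.1 hc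
    have h2 : (0 : ℝ) < 2 ^ e := by positivity
    nlinarith
  rw [abs_of_pos hm] at c1 c4
  have hint : ∀ n : ℤ, |n| ≤ 2 ^ (p + 1) → (n : ℝ) ∈ finiteFloats p q := fun n hn => by
    have := int_mul_mem (p := p) (q := q) (e := 0) hn (by omega) (by omega)
    rwa [zpow_zero, mul_one] at this
  rcases le_or_gt (2 ^ p) m with h2 | h2
  · have h3 : e < 0 := by
      by_contra hc
      have h4 : (1 : ℝ) ≤ 2 ^ e := one_le_zpow₀ (by norm_num) (not_lt.1 hc)
      have h5 : ((2 ^ p : ℤ) : ℝ) ≤ m := by exact_mod_cast h2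
      push_cast at h5
      have h6 : (0 : ℝ) < 2 ^ p := by positivity
      nlinarith
    refine single (σ * 2 ^ e) m (hσm (two_zpow_mem c2 (by omega)))
      (hint m (by rw [abs_of_pos hm]; exact c1.le)) ?_ (by exact_mod_cast h2) ?_
    · rw [hσa, abs_of_pos (by positivity)]
      exact zpow_le_one_of_nonpos₀ (by norm_num) h3.le
    · rw [ht', he]; ring
  -- A mantissa below `2 ^ p` is too small for the linear range, so `m * eps` is written as the
  -- difference of `(2 ^ p + m) * eps` and `2 ^ p * eps`.
  · have hE : e = emin q - p := by
      rcases c4 with h | h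
      · exact absurd h (not_le.2 h2)
      · exact h
    have h4 : |2 ^ p + m| ≤ 2 ^ (p + 1) := by
      rw [abs_of_pos (by positivity), pow_succ]; omega
    have h5 : |(2 : ℤ) ^ p| ≤ 2 ^ (p + 1) := by
      rw [abs_of_pos (by positivity)]; exact pow_le_pow_right₀ (by norm_num) (by omega)
    have e1 : eps p q = 2 ^ e := by rw [hE]; rfl
    have hhalf : eps p q ≤ 1 / 2 := by
      rw [show (1 / 2 : ℝ) = 2 ^ (-1 : ℤ) by norm_num]
      exact zpow_le_zpow_right₀ (by norm_num) (by omega)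
    have hA : ∀ s : Bool, |if s then -(σ * eps p q) else σ * eps p q| ≤ 1 / 2 := by
      have := eps_pos (p := p) (q := q)
      rintro (_ | _) <;> simp only [Bool.false_eq_true, if_false, if_true, abs_neg, hσa] <;>
        rwa [abs_of_pos this]
    refine ⟨fun s => if s then -(σ * eps p q) else σ * eps p q,
      fun s => if s then 2 ^ p else ((2 ^ p + m : ℤ) : ℝ), ?_, ?_, ?_, ?_, ?_, ?_, ?_⟩
    · rintro (_ | _)
      exacts [hσm eps_mem, neg_mem (hσm eps_mem)]
    · rintro (_ | _)
      exacts [hint _ h4, hp]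
    · exact fun s => (hA s).trans (by norm_num)
    · rintro (_ | _)
      · simp only [Bool.false_eq_true, if_false]
        push_cast
        have : (0 : ℝ) < m := by exact_mod_cast hm
        linarith
      · exact le_rfl
    · exact Or.inr hA
    · rintro (_ | _)
      · simp only [Bool.false_eq_true, if_false]
        have := hσm (int_mul_eps_mem (p := p) (q := q) h4)
        convert this using 1; ring
      · simp only [if_true]
        have := neg_mem (hσm (int_mul_eps_mem (p := p) (q := q) h5))
        convert this using 1; push_cast; ring
    · simp only [Bool.false_eq_true, if_false, if_true]
      rw [ht', he, e1]; push_cast; ring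

/-- Two high bits overflow to negative infinity and switch a neuron off whatever its finite bias,
which may be as large as `Omega p q`. -/
theorem round_neg_two_mul [Params p q] :
    round p q (-2 ^ emax q + -2 ^ emax q) = .negInf := by
  obtain ⟨f1, f2, f3, f4, f5⟩ := emax_facts p q
  unfold round
  have h0 : (0 : ℝ) < 2 ^ emax q := by positivity
  rw [if_neg, if_neg (by linarith)]
  rw [not_lt, abs_of_neg (by linarith)]
  unfold Omega
  have e : (2 : ℝ) ^ (emax q - p - 1) = 2 ^ (-(p : ℤ)) * 2 ^ emax q / 2 := by
    rw [zpow_sub_one_two, ← zpow_add₀ (by norm_num)]; congr 2; ring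
  rw [e]
  have : (0 : ℝ) < 2 ^ (-(p : ℤ)) := by positivity
  nlinarith

namespace Rectifier

variable {a : Activation}

theorem hi_ne [Params p q] {lo : ℝ} (h : Rectifier a lo) :
    nearestEven p q (2 ^ emax q) ≠ nearestEven p q lo := fun e => by
  obtain ⟨f1, f2, f3, f4, f5⟩ := emax_facts p q
  have := congrArg (Subtype.val) e
  rw [coe_nearestEven (two_zpow_mem (by omega) le_rfl), coe_nearestEven h.lo_mem] at this
  have h0 : (0 : ℝ) < 2 ^ emax q := by positivity
  rcases h.lo_eq with rfl | rfl <;> linarith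

/-- On the target the bits are low, that is `0`, and a piece sees only its bias `v`, in the linear
range. Off the target its preactivation is negative infinity and its value and derivative are zero,
so high bits receive no gradient. -/
theorem exists_kit_zero [Params p q] (h : Rectifier a 0) :
    ∃ kit : Kit p q a, Nonempty (InputKit kit) := by
  have hdec := fun t : Flt p q => exists_decomposition t.2
  choose A v d1 d2 d3 d4 d5 d6 d7 using hdec
  obtain ⟨f1, f2, f3, f4, f5⟩ := emax_facts p q
  have hE : (2 : ℝ) ^ emax q ∈ finiteFloats p q := two_zpow_mem (by omega) le_rfl
  let hi : Flt p q := nearestEven p q (2 ^ emax q)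
  let lo : Flt p q := nearestEven p q 0
  have hlo : lo = 0 := Subtype.ext (coe_nearestEven zero_mem)
  have vm1 := val_nearestEven (p := p) (q := q) (neg_mem one_mem)
  have piece : PieceSpec a hi lo (S := Bool) (K := Bool) (fun _ => some false)
      (fun t s => ⟨A t s, d1 t s⟩) (fun _ _ _ => nearestEven p q (-1))
      (fun t s => ⟨v t s, d2 t s⟩) := by
    intro t on P hP
    have hP' : ∀ s, (P s).add (.finite ⟨v t s, d2 t s⟩) =
        if on then .finite ⟨v t s, d2 t s⟩ else .negInf := by
      intro s
      rw [(hP s).pair false true (by decide) (by rintro (_ | _) <;> simp)]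
      simp only [bitState]
      cases on
      · have v1 := vm1.mul_mem (val_nearestEven hE) (by rw [neg_one_mul]; exact neg_mem hE)
        obtain ⟨m1, v2⟩ := v1.congr (neg_one_mul _)
        simp only [Bool.false_eq_true, if_false, if_true]
        rw [v2]
        change (round p q (-2 ^ emax q + -2 ^ emax q)).add _ = _
        rw [round_neg_two_mul]
        rfl
      · have v1 : Val ((ExtFlt.finite (nearestEven p q (-1))).mul (.finite lo)) 0 := by
          rw [hlo]
          exact (vm1.mul_mem val_zero (by rw [mul_zero]; exact zero_mem)).congr (mul_zero _)
        simp only [Bool.true_eq_false, if_false, if_true]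
        rw [v1.eq_zero, ExtFlt.zero_add, ExtFlt.zero_add]
    have hlin := fun s => h.linear_finite (val_mk (d2 t s)) (d4 t s)
    have hoff := h.off_finite (p := p) (q := q) (z := .negInf) (Or.inl rfl)
    simp only [hP']
    refine ⟨?_, ?_, fun y hy => ?_⟩
    · rintro rfl T hT
      simp only [if_true, (hlin _).1] at hT
      rw [hT.pair false true (by decide) (by rintro (_ | _) <;> simp)]
      have w : ∀ s, Val ((ExtFlt.finite ⟨A t s, d1 t s⟩).mul
          (.finite (nearestEven p q (v t s)))) (A t s * v t s) := fun s =>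
        (val_mk (d1 t s)).mul_mem (val_nearestEven (d2 t s)) (d6 t s)
      exact (((w false).add_mem (w true) (by rw [d7]; exact t.2)).congr (d7 t)).eq_finite
    · rintro rfl s
      simp only [Bool.false_eq_true, if_false, hoff.1]
      change (ExtFlt.finite _).mul (.finite lo) = 0
      rw [hlo]
      exact finite_mul_zero _
    · rw [h.gbound] at hy
      have hyA : ∀ s, ∃ r : Flt p q, (r : ℝ) = fl p q (y * A t s) ∧
          (ExtFlt.finite y).mul (.finite ⟨A t s, d1 t s⟩) = .finite r := fun s => by
        have := (val_finite y).mul (val_mk (d1 t s)) (by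
          rw [abs_mul]; have := d3 t s; nlinarith [abs_nonneg (y : ℝ), abs_nonneg (A t s)])
        obtain ⟨x, hx, hx'⟩ := this.exists_eq
        exact ⟨x, hx, hx'⟩
      choose r hr hr' using hyA
      cases on
      · simp only [Bool.false_eq_true, if_false, hoff.2, hr']
        refine ⟨fun s => ⟨⟨_, rfl⟩, 0, finite_mul_zero _⟩, fun k out hout => ⟨0, ?_, fun _ _ => rfl⟩⟩
        refine hout.zero fun s => ?_
        have : (ExtFlt.finite (r s)).mul 0 = 0 := finite_mul_zero _
        rw [this]
        exact zero_mul_finite _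
      · have h1 : ∀ s, (ExtFlt.finite (r s)).mul (.finite (nearestEven p q 1)) = .finite (r s) :=
          fun s => Val.eq_finite (((val_finite (r s)).mul_mem (val_nearestEven one_mem)
            (by rw [mul_one]; exact (r s).2)).congr (mul_one _))
        simp only [if_true, hr', (hlin _).2, h1]
        refine ⟨fun s => ⟨⟨_, rfl⟩, _, rfl⟩, fun k out hout => ?_⟩
        have w : ∀ s, Val ((ExtFlt.finite (r s)).mul (.finite (nearestEven p q (-1)))) (-r s) :=
          fun s => ((val_finite (r s)).mul_mem vm1 (by rw [mul_neg_one]; exact neg_mem (r s).2)).congr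
            (mul_neg_one _)
        have e := hout.pair false true (by decide) (by rintro (_ | _) <;> simp)
        -- A bit collects gradients from both pieces. They cannot overflow, because either the
        -- second weight is zero or both are at most `1 / 2`.
        have hb : |(-r false + -r true : ℝ)| ≤ Omega p q := by
          rcases d5 t with h5 | h5
          · have : (r true : ℝ) = 0 := by rw [hr, h5, mul_zero, fl_of_mem zero_mem]
            rw [this, neg_zero, add_zero, abs_neg]
            exact abs_le_Omega (r false).2
          · have hO : Omega p q / 2 ∈ finiteFloats p q := by
              have h0 : (0 : ℤ) < 2 ^ (p + 1) := by positivity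
              have := (mem_finiteFloats_iff (p := p) (q := q)).2 ⟨2 ^ (p + 1) - 1, emax q - p - 1,
                by rw [abs_of_nonneg (by omega)]; omega, by omega, by omega, rfl⟩
              convert this using 1
              rw [Omega_eq, zpow_sub_one_two, mul_div_assoc]
            have hr2 : ∀ s, |(r s : ℝ)| ≤ Omega p q / 2 := fun s => by
              have h6 : |y * A t s| ≤ Omega p q / 2 := by
                rw [abs_mul]
                have := h5 s
                nlinarith [abs_nonneg (y : ℝ), abs_nonneg (A t s)]
              rw [abs_le] at h6
              rw [hr, abs_le]
              exact ⟨le_fl (neg_mem hO) h6.1, fl_le hO h6.2⟩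
            have := abs_add_le (-r false : ℝ) (-r true)
            rw [abs_neg, abs_neg] at this
            linarith [hr2 false, hr2 true]
        obtain ⟨m, e'⟩ := (w false).add (w true) hb
        refine ⟨_, e.trans e', fun _ hh => absurd hh ?_⟩
        simp only [bitState, Bool.true_eq_false, if_false]
        exact fun e => h.hi_ne e.symm
  exact ⟨h.kit _ _ _ _ piece, ⟨h.inputKit _ _ _ _ piece⟩⟩

end Rectifier

/-! ### The exponential linear unit -/

/-- Small terms are absorbed in a sum with large terms. -/
theorem lsum_absorb [Params p q] {ι : Type*} {f : ι → ExtFlt p q} (big : ι → Bool) {w b : ℝ}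
    (h1 : ∀ i, big i = true → Val (f i) w) (h2 : ∀ i, big i = false → Val (f i) b)
    (hw : 2 * w ∈ finiteFloats p q) (hb : 2 * b ∈ finiteFloats p q)
    (hw' : w ∈ finiteFloats p q)
    (hwb : 2 * |b| < |w| * 2 ^ (-(p : ℤ) - 3)) (l : List ι) (hl : l.countP big ≤ 2)
    (hl' : l.countP (fun i => ! big i) ≤ 2) :
    Val (lsum (l.map f)) (if l.countP big = 0 then (l.countP (fun i => ! big i) : ℝ) * b
      else (l.countP big : ℝ) * w) := by
  induction l using List.reverseRecOn with
  | nil => simpa [lsum] using val_zero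
  | append_singleton l i ih =>
    have hpos : (0 : ℝ) < 2 ^ (-(p : ℤ) - 3) := by positivity
    have hb0 := abs_nonneg b
    have hw0 := abs_nonneg w
    rw [List.countP_append] at hl hl'
    have ih' := ih (by omega) (by omega)
    rw [List.map_append, List.map_singleton, lsum_concat]
    rcases hbi : big i with _ | _
    · have e1 : [i].countP big = 0 := by simp [hbi]
      have e2 : [i].countP (fun i => ! big i) = 1 := by simp [hbi]
      rw [List.countP_append, List.countP_append, e1, e2, add_zero]
      rw [e2] at hl'
      rw [e1] at hl
      generalize l.countP big = k at *
      generalize l.countP (fun i => ! big i) = j at *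
      have hv := h2 i hbi
      by_cases hk : k = 0
      · simp only [hk, if_true] at ih' ⊢
        have e : (j : ℝ) * b + b = ((j + 1 : ℕ) : ℝ) * b := by push_cast; ring
        refine (ih'.add_mem hv ?_).congr e
        rw [e]
        have : j = 0 ∨ j = 1 := by omega
        rcases this with rfl | rfl
        · simpa using hv.mem
        · simpa using hb
      · simp only [hk, if_false] at ih' ⊢
        have hkw : |b| < |(k : ℝ) * w| * 2 ^ (-(p : ℤ) - 3) := by
          have : (1 : ℝ) ≤ k := by exact_mod_cast Nat.one_le_iff_ne_zero.2 hk
          rw [abs_mul, abs_of_nonneg (by linarith : (0 : ℝ) ≤ k)]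
          have : |w| * 2 ^ (-(p : ℤ) - 3) ≤ k * |w| * 2 ^ (-(p : ℤ) - 3) := by
            rw [mul_assoc]
            exact le_mul_of_one_le_left (by positivity) this
          linarith
        have e := fl_add_eq_left ih'.mem hkw
        have h3 : |(k : ℝ) * w + b| < Omega p q + 2 ^ (emax q - p - 1) := by
          have h4 := abs_le_Omega ih'.mem
          have h5 : |b| < 2 ^ (emax q - p - 1) := by
            refine hkw.trans_le ((mul_le_mul_of_nonneg_right
              (h4.trans (Omega_lt p q).le) hpos.le).trans ?_)
            rw [← zpow_add₀ (by norm_num)]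
            exact zpow_le_zpow_right₀ (by norm_num) (by omega)
          have := abs_add_le ((k : ℝ) * w) b
          linarith
        have := val_round_of_lt h3
        rw [e] at this
        obtain ⟨m1, e1⟩ := ih'
        obtain ⟨m2, e2⟩ := hv
        rw [e1, e2]
        exact this
    · have e1 : [i].countP big = 1 := by simp [hbi]
      have e2 : [i].countP (fun i => ! big i) = 0 := by simp [hbi]
      rw [List.countP_append, List.countP_append, e1, e2, add_zero]
      rw [e2] at hl'
      rw [e1] at hl
      generalize l.countP big = k at *
      generalize l.countP (fun i => ! big i) = j at *
      have hv := h1 i hbi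
      rw [if_neg (by omega)]
      by_cases hk : k = 0
      · simp only [hk, if_true, zero_add, Nat.cast_one, one_mul] at ih' ⊢
        have hjb : |(j : ℝ) * b| < |w| * 2 ^ (-(p : ℤ) - 3) := by
          have : (j : ℝ) ≤ 2 := by exact_mod_cast hl'
          rw [abs_mul, abs_of_nonneg (by positivity : (0 : ℝ) ≤ j)]
          nlinarith
        have e := fl_add_eq_left hw' hjb
        rw [add_comm] at e
        have h3 : |(j : ℝ) * b + w| < Omega p q + 2 ^ (emax q - p - 1) := by
          have h4 := abs_le_Omega hw'
          have h5 : |(j : ℝ) * b| < 2 ^ (emax q - p - 1) := by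
            refine hjb.trans_le ((mul_le_mul_of_nonneg_right
              (h4.trans (Omega_lt p q).le) hpos.le).trans ?_)
            rw [← zpow_add₀ (by norm_num)]
            exact zpow_le_zpow_right₀ (by norm_num) (by omega)
          have := abs_add_le ((j : ℝ) * b) w
          linarith
        have := val_round_of_lt h3
        rw [e] at this
        obtain ⟨m1, e1⟩ := ih'
        obtain ⟨m2, e2⟩ := hv
        rw [e1, e2]
        exact this
      · simp only [hk, if_false] at ih' ⊢
        have : k = 1 := by omega
        subst this
        have e : ((1 : ℕ) : ℝ) * w + w = ((1 + 1 : ℕ) : ℝ) * w := by push_cast; ring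
        refine (ih'.add_mem hv ?_).congr e
        rw [e]
        norm_num
        exact hw

/-- The parameters of a pair of neurons that contribute to the output of a network with exponential
linear units: the two neurons have output weights `A` and `-A` and bias `v`, and `u` is the weight
with which the second one is switched off. -/
structure IsPair (p q : ℕ) (A v u : ℝ) : Prop where
  mem_A : A ∈ finiteFloats p q
  mem_v : v ∈ finiteFloats p q
  mem_u : u ∈ finiteFloats p q
  mem_w : v * 2 ^ (-emax q) ∈ finiteFloats p q
  A_le : |A| ≤ 1
  v_pos : 0 < v
  v_le : v ≤ 2 ^ emax q
  u_le : u ≤ 1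
  -- Off the target the low bit `-1` contributes `u` to the second neuron; `v` absorbs it, so that
  -- the preactivation becomes exactly zero.
  u_lt : u < v * 2 ^ (-(p : ℤ) - 3)
  -- On the target the high bit outweighs the bias `v` and pushes the second neuron beyond the off
  -- threshold.
  le_u : v + 2 ^ (q + 1) ≤ u * 2 ^ emax q

theorem zpow_facts_neg [Params p q] : (2 : ℝ) ^ (-emax q) < 2 ^ (-(p : ℤ) - 3) ∧
    (2 : ℝ) ^ (emax q - p - 4) = 2 ^ (-(p : ℤ) - 4) * 2 ^ emax q ∧
    (2 : ℝ) ^ (q + 1) * 4 ≤ 2 ^ (emax q - p - 4) := by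
  have h := add_lt_emax (p := p) (q := q)
  refine ⟨zpow_lt_zpow_right₀ (by norm_num) (by omega), ?_, ?_⟩
  · rw [← zpow_add₀ (by norm_num)]; congr 1; ring
  · rw [show (4 : ℝ) = 2 ^ (2 : ℤ) by norm_num, ← zpow_natCast, ← zpow_add₀ (by norm_num)]
    exact zpow_le_zpow_right₀ (by norm_num) (by push_cast; omega)

/-- A pair with a small value. -/
theorem IsPair.of_small [Params p q] {A : ℝ} {m e : ℤ} (hA : A ∈ finiteFloats p q) (hA1 : |A| ≤ 1)
    (hm0 : 0 < m) (hm : m < 2 ^ (p + 1)) (he : -1 ≤ e) (he' : e ≤ 0) :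
    IsPair p q A (m * 2 ^ e) (m * 2 ^ e * 2 ^ (-(p : ℤ) - 4)) := by
  obtain ⟨f1, f2, f3, f4, f5⟩ := emax_facts p q
  obtain ⟨g1, g2, g3, g4, g5⟩ := zpow_emax_facts p q
  obtain ⟨g6, g7, g8⟩ := zpow_facts_neg (p := p) (q := q)
  have hm' : |m| < 2 ^ (p + 1) := by rwa [abs_of_pos hm0]
  have hm1 : (1 : ℝ) ≤ m := by exact_mod_cast hm0
  have hm2 : (m : ℝ) ≤ 2 ^ (p + 1) := by exact_mod_cast hm.le
  have he1 : (2 : ℝ) ^ e ≤ 1 := zpow_le_one_of_nonpos₀ (by norm_num) he'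
  have he2 : (1 / 2 : ℝ) ≤ 2 ^ e := by
    rw [show (1 / 2 : ℝ) = 2 ^ (-1 : ℤ) by norm_num]
    exact zpow_le_zpow_right₀ (by norm_num) he
  have hv : 0 < (m : ℝ) * 2 ^ e := by positivity
  have hv1 : 1 / 2 ≤ (m : ℝ) * 2 ^ e := by nlinarith
  have mem : ∀ k : ℤ, k ≤ 0 → -emax q ≤ k → (m : ℝ) * 2 ^ e * 2 ^ k ∈ finiteFloats p q := by
    intro k hk hk'
    rw [mul_assoc, ← zpow_add₀ (by norm_num)]
    exact mem_finiteFloats_iff.2 ⟨m, _, hm', by omega, by omega, rfl⟩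
  have hs : (2 : ℝ) ^ (-(p : ℤ) - 4) < 2 ^ (-(p : ℤ) - 3) :=
    zpow_lt_zpow_right₀ (by norm_num) (by omega)
  have hs1 : (2 : ℝ) ^ (p + 1) * 2 ^ (-(p : ℤ) - 4) ≤ 1 := by
    rw [← zpow_natCast, ← zpow_add₀ (by norm_num)]
    exact zpow_le_one_of_nonpos₀ (by norm_num) (by push_cast; omega)
  have hs0 : (0 : ℝ) < 2 ^ (-(p : ℤ) - 4) := by positivity
  have hvle : (m : ℝ) * 2 ^ e ≤ 2 ^ (p + 1) := by
    have : (0 : ℝ) < 2 ^ (p + 1) := by positivity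
    nlinarith
  refine ⟨hA, ?_, mem _ (by omega) (by omega), mem _ (by omega) le_rfl, hA1, hv, ?_, ?_, ?_, ?_⟩
  · have := mem 0 le_rfl (by omega)
    rwa [zpow_zero, mul_one] at this
  · refine hvle.trans ?_
    rw [pow_succ]; linarith
  · exact (mul_le_mul_of_nonneg_right hvle hs0.le).trans hs1
  · exact mul_lt_mul_of_pos_left hs hv
  · rw [mul_assoc, ← g7]
    nlinarith

/-- A pair with a large value. -/
theorem IsPair.of_large [Params p q] {A v : ℝ} (hA : A ∈ finiteFloats p q) (hA1 : |A| ≤ 1)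
    (hv : v ∈ finiteFloats p q) (hv1 : 2 ^ (p + 4) ≤ v) (hv2 : v ≤ Omega p q / 2) :
    IsPair p q A v 1 := by
  obtain ⟨f1, f2, f3, f4, f5⟩ := emax_facts p q
  obtain ⟨g1, g2, g3, g4, g5⟩ := zpow_emax_facts p q
  have hO : Omega p q / 2 = 2 ^ emax q - 2 ^ (emax q - p) / 2 := by
    rw [Omega_eq, ← g3]; push_cast; ring
  have h0 : (0 : ℝ) < 2 ^ (emax q - p) := by positivity
  have e1 : (2 : ℝ) ^ (p + 4) = 2 ^ p * 16 := by rw [pow_add]; norm_num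
  have hvp : 0 < v := lt_of_lt_of_le (by positivity) hv1
  refine ⟨hA, hv, one_mem, ?_, hA1, hvp, by linarith, le_rfl, ?_, by linarith⟩
  · obtain ⟨m, e, ⟨c1, c2, c3, c4⟩, rfl⟩ := mem_canon hv
    have he : 0 ≤ e := by
      by_contra hc
      have h1 : (2 : ℝ) ^ e ≤ 1 := zpow_le_one_of_nonpos₀ (by norm_num) (by omega)
      have h2 : (m : ℝ) < 2 ^ (p + 1) := by exact_mod_cast (abs_lt.1 c1).2
      have h3 : (0 : ℝ) < 2 ^ e := by positivity
      have h4 : (m : ℝ) * 2 ^ e ≤ 2 ^ (p + 1) := by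
        have : (0 : ℝ) < 2 ^ (p + 1) := by positivity
        nlinarith
      rw [pow_succ] at h4
      linarith
    rw [mul_assoc, ← zpow_add₀ (by norm_num)]
    exact mem_finiteFloats_iff.2 ⟨m, _, c1, by omega, by omega, rfl⟩
  · have e2 : (2 : ℝ) ^ (p + 4) * 2 ^ (-(p : ℤ) - 3) = 2 := by
      rw [← zpow_natCast, ← zpow_add₀ (by norm_num)]
      rw [show ((p + 4 : ℕ) : ℤ) + (-(p : ℤ) - 3) = 1 by push_cast; ring, zpow_one]
    have := mul_le_mul_of_nonneg_right hv1 (by positivity : (0 : ℝ) ≤ 2 ^ (-(p : ℤ) - 3))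
    linarith

/-- On the target the first neuron of a pair contributes the rounded `A * v`, and the second,
switched off with value `-1` and weight `-A`, contributes `A`. One pair suffices unless `|t|` is
large; then two pairs share it, because `v` cannot exceed `2 ^ emax q`. -/
theorem exists_pairs [Params p q] {t : ℝ} (ht : t ∈ finiteFloats p q) :
    ∃ A v u : Bool → ℝ, (∀ i, IsPair p q (A i) (v i) (u i)) ∧
      ∀ (g : Bool × Bool → ExtFlt p q) (s : ExtFlt p q),
        (∀ i, Val (g (i, false)) (fl p q (A i * v i))) → (∀ i, Val (g (i, true)) (A i)) →
          IsSum g s → Val s t := by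
  obtain ⟨f1, f2, f3, f4, f5⟩ := emax_facts p q
  obtain ⟨g1, g2, g3, g4, g5⟩ := zpow_emax_facts p q
  have h0 : IsPair p q 0 1 (1 * 2 ^ (-(p : ℤ) - 4)) := by
    have := IsPair.of_small (p := p) (q := q) (A := 0) (m := 1) (e := 0) zero_mem (by simp)
      one_pos (one_lt_pow₀ (by norm_num) (by omega)) (by omega) le_rfl
    simpa using this
  have single : ∀ A v u : ℝ, IsPair p q A v u → |fl p q (A * v) + A| ≤ Omega p q →
      fl p q (fl p q (A * v) + A) = t →
      ∃ A v u : Bool → ℝ, (∀ i, IsPair p q (A i) (v i) (u i)) ∧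
      ∀ (g : Bool × Bool → ExtFlt p q) (s : ExtFlt p q),
        (∀ i, Val (g (i, false)) (fl p q (A i * v i))) → (∀ i, Val (g (i, true)) (A i)) →
          IsSum g s → Val s t := by
    intro A v u h hb e
    refine ⟨fun i => if i then 0 else A, fun i => if i then 1 else v,
      fun i => if i then 1 * 2 ^ (-(p : ℤ) - 4) else u, ?_, fun g s h1 h2 hs => ?_⟩
    · rintro (_ | _)
      exacts [h, h0]
    · rw [hs.pair (false, false) (false, true) (by decide) ?_]
      · exact ((h1 false).add (h2 false) hb).congr e
      · rintro ⟨_ | _, _ | _⟩ hi hi'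
        · exact absurd rfl hi
        · exact absurd rfl hi'
        · refine ((h1 true).congr ?_).eq_zero
          simp only [if_true, zero_mul]
          exact fl_of_mem zero_mem
        · exact (h2 true).eq_zero
  by_cases ht0 : t = 0
  · refine single 0 1 _ h0 ?_ ?_
    · rw [zero_mul, fl_of_mem zero_mem, add_zero, abs_zero]
      exact Omega_pos.le
    · rw [zero_mul, fl_of_mem zero_mem, add_zero, fl_of_mem zero_mem, ht0]
  obtain ⟨σ, hσ, ht'⟩ : ∃ σ : ℝ, (σ = 1 ∨ σ = -1) ∧ t = σ * |t| := by
    rcases abs_choice t with h | h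
    · exact ⟨1, Or.inl rfl, by rw [h, one_mul]⟩
    · exact ⟨-1, Or.inr rfl, by rw [h]; ring⟩
  have hσm : ∀ {x : ℝ}, x ∈ finiteFloats p q → σ * x ∈ finiteFloats p q := fun {x} hx => by
    rcases hσ with rfl | rfl
    · rwa [one_mul]
    · rw [neg_one_mul]; exact neg_mem hx
  have hσa : ∀ x : ℝ, |σ * x| = |x| := fun x => by
    rcases hσ with rfl | rfl <;> simp
  have hσf : ∀ x : ℝ, fl p q (σ * x) = σ * fl p q x := fun x => by
    rcases hσ with rfl | rfl
    · simp
    · rw [neg_one_mul, neg_one_mul, fl_neg]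
  have hta : |t| ∈ finiteFloats p q := by
    rcases abs_choice t with h | h <;> rw [h]
    exacts [ht, neg_mem ht]
  have single' : ∀ A v u : ℝ, IsPair p q (σ * A) v u → |fl p q (A * v) + A| ≤ Omega p q →
      fl p q (fl p q (A * v) + A) = |t| → _ := fun A v u h hb e => single (σ * A) v u h
    (by rwa [mul_assoc, hσf, ← mul_add, hσa])
    (by rw [mul_assoc, hσf, ← mul_add, hσf, e, ← ht'])
  obtain ⟨m, e, ⟨c1, c2, c3, c4⟩, he⟩ := mem_canon hta
  have hpos := abs_pos.2 ht0
  have hm : 0 < m := by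
    by_contra hc
    have : (m : ℝ) ≤ 0 := by exact_mod_cast not_lt.1 hc
    have h2 : (0 : ℝ) < 2 ^ e := by positivity
    nlinarith
  rw [abs_of_pos hm] at c1 c4
  rcases le_or_gt e 0 with he0 | he0
  · have hA : (2 : ℝ) ^ e ∈ finiteFloats p q := two_zpow_mem c2 (by omega)
    have hA1 : |σ * (2 : ℝ) ^ e| ≤ 1 := by
      rw [hσa, abs_of_pos (by positivity)]
      exact zpow_le_one_of_nonpos₀ (by norm_num) he0
    -- With `A = 2 ^ e` and `v = m - 1`, the missing unit is supplied by the second neuron.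
    rcases lt_or_ge 1 m with hm1 | hm1
    · have hmem : ((m - 1 : ℤ) : ℝ) * 2 ^ e ∈ finiteFloats p q :=
        mem_finiteFloats_iff.2 ⟨m - 1, e, by rw [abs_of_pos (by omega)]; omega, c2, c3, rfl⟩
      have e1 : fl p q ((2 : ℝ) ^ e * (((m - 1 : ℤ) : ℝ) * 2 ^ (0 : ℤ))) + 2 ^ e = |t| := by
        rw [zpow_zero, mul_one, mul_comm, fl_of_mem hmem, he]; push_cast; ring
      refine single' _ _ _ (IsPair.of_small (m := m - 1) (e := 0) (hσm hA) hA1 (by omega) (by omega)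
        (by omega) le_rfl) ?_ ?_
      · rw [e1]; exact abs_le_Omega hta
      · rw [e1]; exact fl_of_mem hta
    -- For the smallest float `v` must still be positive. With `v = 1 / 2` the product is half of
    -- `eps p q`, a tie that rounds to zero, and the second neuron supplies everything.
    · have hm1' : m = 1 := by omega
      subst hm1'
      have hE : e = emin q - p := by
        rcases c4 with h | h
        · have : (1 : ℤ) < 2 ^ p := one_lt_pow₀ (by norm_num) (by omega)
          omega
        · exact h
      have e1 : fl p q ((2 : ℝ) ^ e * (((1 : ℤ) : ℝ) * 2 ^ (-1 : ℤ))) + 2 ^ e = |t| := by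
        have : (2 : ℝ) ^ e * (((1 : ℤ) : ℝ) * 2 ^ (-1 : ℤ)) = eps p q / 2 := by
          rw [hE]; unfold eps; norm_num; ring
        rw [this]
        change half p q (eps p q) + _ = _
        rw [half_eps, he]; push_cast; ring
      refine single' _ _ _ (IsPair.of_small (m := 1) (e := -1) (hσm hA) hA1 one_pos
        (one_lt_pow₀ (by norm_num) (by omega)) le_rfl (by omega)) ?_ ?_
      · rw [e1]; exact abs_le_Omega hta
      · rw [e1]; exact fl_of_mem hta
  · have hmp : (2 : ℝ) ^ p ≤ m := by
      rcases c4 with h | h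
      · exact_mod_cast h
      · omega
    have h2e : (2 : ℝ) ≤ 2 ^ e := by
      calc (2 : ℝ) = 2 ^ (1 : ℤ) := by norm_num
        _ ≤ 2 ^ e := zpow_le_zpow_right₀ (by norm_num) (by omega)
    have htl : 2 * (2 : ℝ) ^ p ≤ |t| := by
      rw [he]; nlinarith
    have e3 : (2 : ℝ) ^ p * 2 ^ (-(p : ℤ) - 3) = 1 / 8 := by
      rw [← zpow_natCast, ← zpow_add₀ (by norm_num)]
      rw [show (p : ℤ) + (-(p : ℤ) - 3) = -3 by ring]; norm_num
    have hs0 : (0 : ℝ) < 2 ^ (-(p : ℤ) - 3) := by positivity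
    have g7 := three_halves_le_Omega (p := p) (q := q)
    have hp4 : (2 : ℝ) ^ (p + 4) = 2 ^ p * 16 := by rw [pow_add]; norm_num
    have g8 : (2 : ℝ) ^ p * 1024 ≤ 2 ^ emax q := by
      have := add_lt_emax (p := p) (q := q)
      have h6 := (‹Params p q›).six_le
      rw [show (1024 : ℝ) = 2 ^ (10 : ℤ) by norm_num, ← zpow_natCast, ← zpow_add₀ (by norm_num)]
      exact zpow_le_zpow_right₀ (by norm_num) (by omega)
    -- In the middle range `A = 1 / 8` and `v = 8 * |t|`: the product is exact, the extra `1 / 8` is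
    -- absorbed by `|t|`, and `v` is large enough for `IsPair.of_large`.
    rcases le_or_gt |t| (2 ^ p * 32) with hc | hc
    · have h8 : (1 / 8 : ℝ) ∈ finiteFloats p q := by
        have := two_zpow_mem (p := p) (q := q) (e := -3) (by omega) (by omega)
        norm_num at this ⊢; exact this
      have hv : |t| * 2 ^ 3 ∈ finiteFloats p q := mul_two_pow_mem hta 3 (by
        rw [abs_of_pos (by positivity)]
        norm_num
        linarith)
      have hv' : (1 / 8 : ℝ) * (|t| * 2 ^ 3) = |t| := by ring
      have e1 : fl p q (|t| + 1 / 8) = |t| := fl_add_eq_left hta (by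
        rw [abs_of_pos (by norm_num : (0 : ℝ) < 1 / 8), abs_abs]
        nlinarith)
      refine single' (1 / 8) (|t| * 2 ^ 3) 1 (IsPair.of_large (hσm h8) ?_ hv ?_ ?_) ?_ ?_
      · rw [hσa]; norm_num
      · linarith
      · norm_num; linarith
      · rw [hv', fl_of_mem hta, abs_of_pos (by linarith)]
        linarith
      · rw [hv', fl_of_mem hta, e1]
    -- Two equal pairs give two terms `|t| / 2` and two terms `1`, up to the common sign. In every
    -- order the small terms are lost and the large ones add up exactly.
    · have hv : |t| / 2 ∈ finiteFloats p q := by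
        refine mem_finiteFloats_iff.2 ⟨m, e - 1, by rwa [abs_of_pos hm], by omega, by omega, ?_⟩
        rw [he, zpow_sub_one_two]; ring
      have hvO : |t| / 2 ≤ Omega p q / 2 := by
        have := abs_le_Omega ht
        linarith
      have h1 := hσm (one_mem (p := p) (q := q))
      have hpair := IsPair.of_large (p := p) (q := q) h1 (by rw [hσa, abs_one]) hv (by linarith) hvO
      refine ⟨fun _ => σ * 1, fun _ => |t| / 2, fun _ => 1, fun _ => hpair, ?_⟩
      rintro g s hg1 hg2 ⟨l, hl, hc', rfl⟩
      simp only [mul_one] at hg1 hg2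
      have hσ0 : σ ≠ 0 := by rcases hσ with rfl | rfl <;> norm_num
      have hw : fl p q (σ * (|t| / 2)) = σ * (|t| / 2) := fl_of_mem (hσm hv)
      rw [hw] at hg1
      have hnz : ∀ {z : ExtFlt p q} {r : ℝ}, Val z r → r ≠ 0 → z ≠ 0 := fun hz hr h => by
        rw [h] at hz
        exact hr (val_zero.unique hz).symm
      have hperm : l.Perm [(false, false), (false, true), (true, false), (true, true)] := by
        refine (List.perm_ext_iff_of_nodup hl (by decide)).2 fun i => ⟨fun _ => ?_, fun _ => ?_⟩
        · rcases i with ⟨_ | _, _ | _⟩ <;> simp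
        · refine hc' i ?_
          rcases i with ⟨i, _ | _⟩
          · exact hnz (hg1 i) (mul_ne_zero hσ0 (by linarith))
          · exact hnz (hg2 i) hσ0
      have hcount : ∀ P : Bool × Bool → Bool, l.countP P =
          [(false, false), (false, true), (true, false), (true, true)].countP P := fun P =>
        hperm.countP_eq P
      have h2 := lsum_absorb (f := g) (fun i => ! i.2) (w := σ * (|t| / 2)) (b := σ)
        (by rintro ⟨i, _ | _⟩ hi
            · exact hg1 i
            · simp at hi)
        (by rintro ⟨i, _ | _⟩ hi
            · simp at hi
            · exact hg2 i)
        (by have : 2 * (σ * (|t| / 2)) = t := by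
              rw [mul_left_comm, mul_div_cancel₀ _ (by norm_num : (2 : ℝ) ≠ 0), ← ht']
            rwa [this])
        (by have := hσm (small_nat_mem (p := p) (q := q) 1 (by norm_num))
            rwa [pow_one, mul_comm] at this)
        (hσm hv)
        (by have := hσa 1
            rw [mul_one, abs_one] at this
            rw [this, hσa, abs_of_pos (by positivity : 0 < |t| / 2)]
            nlinarith) l
        (by rw [hcount]; decide) (by rw [hcount]; decide)
      refine h2.congr ?_
      rw [hcount]
      have : [(false, false), (false, true), (true, false), (true, true)].countP
          (fun i : Bool × Bool => ! i.2) = 2 := by decide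
      rw [this, if_neg (by norm_num)]
      push_cast
      rw [mul_left_comm, mul_div_cancel₀ _ (by norm_num : (2 : ℝ) ≠ 0), ← ht']

/-- The weights of the second neuron of a pair differ from those of the first by `-u` on the bit
that is high at the target. -/
def pairWeight (v u : Bool → Flt p q) (s k : Bool × Bool) : Flt p q :=
  if k.1 = s.1 then
    match s.2, k.2 with
    | _, false => -v s.1
    | false, true => 0
    | true, true => -u s.1
  else 0

namespace Rectifier

variable {a : Activation}

/-- The off value `-1` would leave a trace in the output, so unused pieces rest at preactivation
exactly zero: a high bit of weight `-v * 2 ^ (-emax q)` cancels the bias `v`. Exactness of the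
function on the nonnegative axis is needed because `v` may lie below the range in which other
rectifiers are linear. -/
theorem exists_kit_neg_one [Params p q] (h : Rectifier a (-1)) (hf : ∀ x, 0 ≤ x → a.toReal x = x)
    (hf' : ∀ x, 0 ≤ x → a.realDeriv x = 1) : ∃ kit : Kit p q a, Nonempty (InputKit kit) := by
  have hdec := fun t : Flt p q => exists_pairs t.2
  choose A v u hpair hsum using hdec
  obtain ⟨f1, f2, f3, f4, f5⟩ := emax_facts p q
  have hE : (2 : ℝ) ^ emax q ∈ finiteFloats p q := two_zpow_mem (by omega) le_rfl
  have hE0 : (0 : ℝ) < 2 ^ emax q := by positivity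
  let hi : Flt p q := nearestEven p q (2 ^ emax q)
  let lo : Flt p q := nearestEven p q (-1)
  have vlo : Val (.finite lo) (-1) := val_nearestEven (neg_mem one_mem)
  have vhi : Val (.finite hi) (2 ^ emax q) := val_nearestEven hE
  have hOm : (2 : ℝ) ^ emax q ≤ Omega p q := two_zpow_le_Omega le_rfl
  have one : ∀ {z : ExtFlt p q} {r : ℝ}, Val z r → 0 ≤ r → Val (a.act p q z) r ∧
      Val (a.actDeriv p q z) 1 := by
    intro z r hz hr
    refine ⟨(h.val_act hz).congr ?_, (h.val_der hz).congr ?_⟩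
    · rw [hf r hr, fl_of_mem hz.mem]
    · rw [hf' r hr, fl_of_mem one_mem]
  let cA : Flt p q → Bool → Flt p q := fun t i => ⟨A t i, (hpair t i).mem_A⟩
  let cw : Flt p q → Bool → Flt p q := fun t i => ⟨_, (hpair t i).mem_w⟩
  let cu : Flt p q → Bool → Flt p q := fun t i => ⟨u t i, (hpair t i).mem_u⟩
  let cv : Flt p q → Bool → Flt p q := fun t i => ⟨v t i, (hpair t i).mem_v⟩
  have piece : PieceSpec a hi lo (S := Bool × Bool) (K := Bool × Bool) (fun k => some k.2)
      (fun t s => if s.2 then -cA t s.1 else cA t s.1) (fun t => pairWeight (cw t) (cu t))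
      (fun t s => cv t s.1) := by
    intro t on P hP
    have vw := fun i => val_finite (-cw t i)
    have vu := fun i => val_finite (-cu t i)
    have vv := fun i => val_finite (cv t i)
    have hw0 : ∀ i, (0 : ℝ) < v t i * 2 ^ (-emax q) := fun i =>
      mul_pos (hpair t i).v_pos (by positivity)
    have hwE : ∀ i, v t i * 2 ^ (-emax q) * 2 ^ emax q = v t i := fun i => by
      rw [mul_assoc, ← zpow_add₀ (by norm_num), neg_add_cancel, zpow_zero, mul_one]
    have hw1 : ∀ i, v t i * 2 ^ (-emax q) ≤ 1 := fun i => by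
      have := (hpair t i).v_le
      have h2 := hwE i
      by_contra hc
      nlinarith [hw0 i]
    have hu0 : ∀ i, 0 < u t i := fun i => by
      have h1 := (hpair t i).le_u
      have h2 := (hpair t i).v_pos
      have h3 : (0 : ℝ) < 2 ^ (q + 1) := by positivity
      by_contra hc
      nlinarith
    have hs0 : (0 : ℝ) < 2 ^ (-(p : ℤ) - 3) := by positivity
    have hsE := (zpow_facts_neg (p := p) (q := q)).1
    have hwv : ∀ i, v t i * 2 ^ (-emax q) < v t i * 2 ^ (-(p : ℤ) - 3) := fun i =>
      mul_lt_mul_of_pos_left hsE (hpair t i).v_pos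
    have hvO : ∀ i, v t i ≤ Omega p q := fun i => ((hpair t i).v_le).trans hOm
    have hUE : ∀ i, u t i * 2 ^ emax q ≤ 2 ^ emax q := fun i => by
      have := (hpair t i).u_le
      nlinarith
    have hUm : ∀ i, u t i * 2 ^ emax q ∈ finiteFloats p q := fun i =>
      mul_two_zpow_mem (hpair t i).mem_u (by omega) (by
        rw [abs_of_pos (mul_pos (hu0 i) hE0)]; exact (hUE i).trans hOm)
    have hPs : ∀ i b, P (i, b) = ((ExtFlt.finite (-cw t i)).mul
        (.finite (bitState hi lo on (some false)))).add
        ((ExtFlt.finite (if b then -cu t i else 0)).mul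
        (.finite (bitState hi lo on (some true)))) := by
      intro i b
      rw [(hP (i, b)).pair (i, false) (i, true) (by simp) ?_]
      · simp only [pairWeight, if_true]
        cases b <;> rfl
      · rintro ⟨j, c⟩ h1 h2
        have : j ≠ i := by
          rintro rfl
          cases c
          exacts [h1 rfl, h2 rfl]
        simp only [pairWeight, if_neg this]
        exact finite_zero_mul _
    -- first terms of the preactivations
    have w_off : ∀ i, Val ((ExtFlt.finite (-cw t i)).mul (.finite hi)) (-v t i) := fun i => by
      have e : -(v t i * 2 ^ (-emax q)) * 2 ^ emax q = -v t i := by rw [neg_mul, hwE]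
      exact ((vw i).mul_mem vhi (by
        change -(v t i * 2 ^ (-emax q)) * 2 ^ emax q ∈ _
        rw [e]; exact neg_mem (hpair t i).mem_v)).congr e
    have w_on : ∀ i, Val ((ExtFlt.finite (-cw t i)).mul (.finite lo)) (v t i * 2 ^ (-emax q)) :=
      fun i => by
      have e : -(v t i * 2 ^ (-emax q)) * -1 = v t i * 2 ^ (-emax q) := by ring
      exact ((vw i).mul_mem vlo (by
        change -(v t i * 2 ^ (-emax q)) * -1 ∈ _
        rw [e]; exact (hpair t i).mem_w)).congr e
    have u_off : ∀ i, Val ((ExtFlt.finite (-cu t i)).mul (.finite lo)) (u t i) := fun i => by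
      have e : -u t i * -1 = u t i := by ring
      exact ((vu i).mul_mem vlo (by
        change -u t i * -1 ∈ _
        rw [e]; exact (hpair t i).mem_u)).congr e
    have u_on : ∀ i, Val ((ExtFlt.finite (-cu t i)).mul (.finite hi)) (-(u t i * 2 ^ emax q)) :=
      fun i => by
      have e : -u t i * 2 ^ emax q = -(u t i * 2 ^ emax q) := by ring
      exact ((vu i).mul_mem vhi (by
        change -u t i * 2 ^ emax q ∈ _
        rw [e]; exact neg_mem (hUm i))).congr e
    have absorb : ∀ {x y : ExtFlt p q} {r s : ℝ}, Val x r → Val y s → |r| ≤ 2 ^ emax q →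
        |s| < |r| * 2 ^ (-(p : ℤ) - 3) → Val (x.add y) r := by
      intro x y r s hx hy hr hs
      refine (hx.add hy ?_).congr (fl_add_eq_left hx.mem hs)
      have h1 := abs_add_le r s
      have h2 : (2 : ℝ) ^ (-(p : ℤ) - 3) ≤ 2 ^ (-1 : ℤ) :=
        zpow_le_zpow_right₀ (by norm_num) (by omega)
      have h3 := three_halves_le_Omega (p := p) (q := q)
      norm_num at h2
      nlinarith [abs_nonneg r]
    have m_off : on = false → ∀ i b, Val ((P (i, b)).add (.finite (cv t i))) 0 := by
      rintro rfl i b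
      have h1 : Val (P (i, b)) (-v t i) := by
        rw [hPs]
        simp only [bitState, Bool.false_eq_true, if_false, if_true]
        cases b
        · simp only [Bool.false_eq_true, if_false]
          rw [finite_zero_mul, ExtFlt.add_zero]
          exact w_off i
        · simp only [if_true]
          refine absorb (w_off i) (u_off i) ?_ ?_
          · rw [abs_neg, abs_of_pos (hpair t i).v_pos]; exact (hpair t i).v_le
          · rw [abs_neg, abs_of_pos (hpair t i).v_pos, abs_of_pos (hu0 i)]
            exact (hpair t i).u_lt
      exact (h1.add_mem (vv i) (by
        change -v t i + v t i ∈ _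
        rw [neg_add_cancel]; exact zero_mem)).congr (neg_add_cancel _)
    have m_on : on = true → ∀ i, Val ((P (i, false)).add (.finite (cv t i))) (v t i) := by
      rintro rfl i
      have h1 : Val (P (i, false)) (v t i * 2 ^ (-emax q)) := by
        rw [hPs]
        simp only [bitState, Bool.true_eq_false, Bool.false_eq_true, if_false]
        rw [finite_zero_mul, ExtFlt.add_zero]
        exact w_on i
      rw [ExtFlt.add_comm]
      refine absorb (vv i) h1 ?_ ?_
      · rw [abs_of_pos (hpair t i).v_pos]; exact (hpair t i).v_le
      · rw [abs_of_pos (hpair t i).v_pos, abs_of_pos (hw0 i)]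
        exact hwv i
    have d_on : on = true → ∀ i,
        AtMost ((P (i, true)).add (.finite (cv t i))) (-2 ^ (q + 1)) := by
      rintro rfl i
      have h1 : Val (P (i, true)) (-(u t i * 2 ^ emax q)) := by
        rw [hPs]
        simp only [bitState, Bool.true_eq_false, if_false, if_true]
        rw [ExtFlt.add_comm]
        refine absorb (u_on i) (w_on i) ?_ ?_
        · rw [abs_neg, abs_of_pos (mul_pos (hu0 i) hE0)]; exact hUE i
        · rw [abs_neg, abs_of_pos (mul_pos (hu0 i) hE0), abs_of_pos (hw0 i)]
          refine (hwv i).trans_le (mul_le_mul_of_nonneg_right ?_ hs0.le)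
          have := (hpair t i).le_u
          have h3 : (0 : ℝ) < 2 ^ (q + 1) := by positivity
          linarith
      refine (h1.atMost le_rfl).add ((vv i).atMost le_rfl) (neg_mem two_pow_mem) ?_
      have := (hpair t i).le_u
      change _ + v t i ≤ _
      linarith
    refine ⟨?_, ?_, fun y hy => ?_⟩
    · intro hon T hT
      refine (hsum t _ _ (fun i => ?_) (fun i => ?_) hT).eq_finite
      · simp only [Bool.false_eq_true, if_false]
        refine (val_finite (cA t i)).mul (one (m_on hon i) (hpair t i).v_pos.le).1 ?_
        change |A t i * v t i| ≤ _
        rw [abs_mul, abs_of_pos (hpair t i).v_pos]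
        have h1 := (hpair t i).A_le
        have h2 := (hpair t i).v_pos
        have h3 := hvO i
        nlinarith
      · simp only [if_true]
        have e : -A t i * -1 = A t i := by ring
        exact ((val_finite (-cA t i)).mul_mem (h.off (d_on hon i)).1 (by
          change -A t i * -1 ∈ _
          rw [e]; exact (hpair t i).mem_A)).congr e
    · rintro hon ⟨i, b⟩
      rw [(one (m_off hon i b) le_rfl).1.eq_zero]
      exact finite_mul_zero _
    · rw [h.gbound] at hy
      have hyA : ∀ i, ∃ r : Flt p q, (ExtFlt.finite y).mul (.finite (cA t i)) = .finite r := fun i => by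
        have := (val_finite y).mul (val_finite (cA t i)) (by
          change |y * A t i| ≤ _
          rw [abs_mul]
          have := (hpair t i).A_le
          nlinarith [abs_nonneg (y : ℝ), abs_nonneg (A t i)])
        obtain ⟨x, -, hx'⟩ := this.exists_eq
        exact ⟨x, hx'⟩
      choose r hr using hyA
      have hr' : ∀ s : Bool × Bool, (ExtFlt.finite y).mul (.finite (if s.2 then -cA t s.1 else cA t s.1))
          = .finite (if s.2 then -r s.1 else r s.1) := by
        rintro ⟨i, _ | _⟩
        · exact hr i
        · exact finite_mul_neg (hr i)
      have hmul1 : ∀ (x : Flt p q) {z : ExtFlt p q}, Val z 1 → (ExtFlt.finite x).mul z = .finite x :=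
        fun x z hz => (((val_finite x).mul_mem hz (by rw [mul_one]; exact x.2)).congr
          (mul_one _)).eq_finite
      have hprod : ∀ x w : Flt p q, |(w : ℝ)| ≤ 1 → ∃ r, (ExtFlt.finite x).mul (.finite w) = .finite r := by
        intro x w hw
        have := (val_finite x).mul (val_finite w) (by
          rw [abs_mul]
          nlinarith [abs_nonneg (x : ℝ), abs_nonneg (w : ℝ), abs_le_Omega x.2])
        obtain ⟨x, -, hx'⟩ := this.exists_eq
        exact ⟨x, hx'⟩
      have hcw : ∀ i, |((-cw t i : Flt p q) : ℝ)| ≤ 1 := fun i => by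
        change |-(v t i * 2 ^ (-emax q))| ≤ 1
        rw [abs_neg, abs_of_pos (hw0 i)]; exact hw1 i
      have hcu : ∀ i, |((-cu t i : Flt p q) : ℝ)| ≤ 1 := fun i => by
        change |-u t i| ≤ 1
        rw [abs_neg, abs_of_pos (hu0 i)]; exact (hpair t i).u_le
      have hne : lo ≠ hi := fun e => h.hi_ne e.symm
      simp only [hr']
      have hz : ∀ w : Flt p q, (0 : ExtFlt p q).mul (.finite w) = 0 := fun w => zero_mul_finite w
      cases hon : on
      · have hd : ∀ s : Bool × Bool, (ExtFlt.finite (if s.2 then -r s.1 else r s.1)).mul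
            (a.actDeriv p q ((P s).add (.finite (cv t s.1)))) =
            .finite (if s.2 then -r s.1 else r s.1) := fun s =>
          hmul1 _ (one (m_off hon s.1 s.2) le_rfl).2
        simp only [hd]
        refine ⟨fun s => ⟨⟨_, rfl⟩, _, rfl⟩, ?_⟩
        rintro ⟨i, _ | _⟩ out hout
        -- At zero the derivative is `1`, so unused pieces do transmit gradients to a high bit. The
        -- two neurons of a pair have the same weight on it and opposite output weights, and their
        -- gradients cancel.
        · rw [hout.pair (i, false) (i, true) (by simp) ?_]
          · simp only [pairWeight, if_true, Bool.false_eq_true, if_false]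
            obtain ⟨x, hx⟩ := hprod (r i) (-cw t i) (hcw i)
            rw [hx, finite_neg_mul hx, finite_add_neg_self]
            exact ⟨0, rfl, fun _ _ => rfl⟩
          · rintro ⟨j, c⟩ h1 h2
            have : i ≠ j := by
              rintro rfl
              cases c
              exacts [h1 rfl, h2 rfl]
            simp only [pairWeight, if_neg this]
            exact finite_mul_zero _
        · rw [hout.single (i, true) ?_]
          · simp only [pairWeight, if_true]
            obtain ⟨x, hx⟩ := hprod (-r i) (-cu t i) (hcu i)
            refine ⟨x, hx, fun _ hh => absurd hh ?_⟩
            simpa [bitState] using hne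
          · rintro ⟨j, c⟩ h1
            by_cases hij : i = j
            · subst hij
              cases c
              · simp only [pairWeight, if_true]
                exact finite_mul_zero _
              · exact absurd rfl h1
            · simp only [pairWeight, if_neg hij]
              exact finite_mul_zero _
      · have hd : ∀ i, (ExtFlt.finite (r i)).mul
            (a.actDeriv p q ((P (i, false)).add (.finite (cv t i)))) = .finite (r i) := fun i =>
          hmul1 _ (one (m_on hon i) (hpair t i).v_pos.le).2
        have hd' : ∀ i, (ExtFlt.finite (-r i)).mul
            (a.actDeriv p q ((P (i, true)).add (.finite (cv t i)))) = 0 := fun i => by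
          rw [(h.off (d_on hon i)).2.eq_zero]
          exact finite_mul_zero _
        have hds : ∀ s : Bool × Bool, (ExtFlt.finite (if s.2 then -r s.1 else r s.1)).mul
            (a.actDeriv p q ((P s).add (.finite (cv t s.1)))) =
            .finite (if s.2 then 0 else r s.1) := by
          rintro ⟨i, _ | _⟩
          exacts [hd i, hd' i]
        simp only [hds]
        refine ⟨fun s => ⟨⟨_, rfl⟩, _, rfl⟩, ?_⟩
        rintro ⟨i, _ | _⟩ out hout
        · rw [hout.single (i, false) ?_]
          · simp only [pairWeight, if_true, Bool.false_eq_true, if_false]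
            obtain ⟨x, hx⟩ := hprod (r i) (-cw t i) (hcw i)
            refine ⟨x, hx, fun _ hh => absurd hh ?_⟩
            simpa [bitState] using hne
          · rintro ⟨j, _ | _⟩ h1
            · have : i ≠ j := fun e => h1 (by rw [e])
              simp only [pairWeight, if_neg this]
              exact finite_mul_zero _
            · exact finite_zero_mul _
        · refine ⟨0, ?_, fun _ _ => rfl⟩
          refine hout.zero ?_
          rintro ⟨j, _ | _⟩
          · simp only [pairWeight]
            by_cases hij : i = j
            · simp only [if_pos hij]; exact finite_mul_zero _
            · simp only [if_neg hij]; exact finite_mul_zero _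
          · exact finite_zero_mul _
  exact ⟨h.kit _ _ _ _ piece, ⟨h.inputKit _ _ _ _ piece⟩⟩

end Rectifier

/-! ### The activation functions that are rectifiers -/

theorem mul_exp_neg_le_one (t : ℝ) : t * Real.exp (-t) ≤ 1 := by
  rw [Real.exp_neg, ← div_eq_mul_inv, div_le_one (Real.exp_pos t)]
  linarith [Real.add_one_le_exp t]

theorem rectifier_relu : Rectifier .relu 0 where
  lo_eq := Or.inl rfl
  bound _ := rfl
  gbound _ _ := rfl
  map_zero := max_self 0
  pos y hy := by
    change y / 2 < max 0 y ∧ max 0 y ≤ y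
    rw [max_eq_right hy.le]
    constructor <;> linarith
  neg y hy := by
    change -1 ≤ max 0 y ∧ max 0 y ≤ 0
    rw [max_eq_left hy]
    constructor <;> norm_num
  large y hy := by
    change _ ≤ max 0 y
    have := Real.exp_pos (-y)
    refine le_max_of_le_right ?_
    nlinarith
  der_large y hy := by
    change _ ≤ (if 0 < y then (1 : ℝ) else 0) ∧ (if 0 < y then (1 : ℝ) else 0) ≤ _
    rw [if_pos (by linarith)]
    have := Real.exp_pos (-y)
    constructor <;> nlinarith
  small y hy := by
    change |max 0 y - 0| ≤ _
    rw [max_eq_left (by linarith), sub_zero, abs_zero]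
    positivity
  der_small y hy := by
    change |if 0 < y then (1 : ℝ) else 0| ≤ _
    rw [if_neg (by linarith), abs_zero]
    positivity
  der_le y := by
    change |if 0 < y then (1 : ℝ) else 0| ≤ _
    split_ifs <;> norm_num

theorem elu_of_nonneg {x : ℝ} (hx : 0 ≤ x) : Activation.elu.toReal x = x := if_pos hx

theorem elu_of_neg {x : ℝ} (hx : x < 0) : Activation.elu.toReal x = Real.exp x - 1 :=
  if_neg (not_le.2 hx)

theorem elu_of_nonpos {x : ℝ} (hx : x ≤ 0) : Activation.elu.toReal x = Real.exp x - 1 := by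
  rcases hx.lt_or_eq with h | rfl
  · exact elu_of_neg h
  · rw [elu_of_nonneg le_rfl]; simp

theorem elu_deriv_of_nonneg {x : ℝ} (hx : 0 ≤ x) : Activation.elu.realDeriv x = 1 := by
  change deriv Activation.elu.toReal x = 1
  refine HasDerivAt.deriv ?_
  rcases hx.lt_or_eq with h | rfl
  · refine (hasDerivAt_id x).congr_of_eventuallyEq ?_
    filter_upwards [lt_mem_nhds h] with y hy
    exact elu_of_nonneg hy.le
  · have h1 : HasDerivWithinAt Activation.elu.toReal 1 (Set.Ici 0) 0 :=
      (hasDerivAt_id (0 : ℝ)).hasDerivWithinAt.congr (fun y hy => elu_of_nonneg hy)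
        (elu_of_nonneg le_rfl)
    have h2 : HasDerivWithinAt Activation.elu.toReal 1 (Set.Iic 0) 0 := by
      have : HasDerivAt (fun y => Real.exp y - 1) 1 0 := by
        simpa using (Real.hasDerivAt_exp 0).sub_const 1
      exact this.hasDerivWithinAt.congr (fun y hy => elu_of_nonpos hy) (elu_of_nonpos le_rfl)
    have := h2.union h1
    rwa [Set.Iic_union_Ici, hasDerivWithinAt_univ] at this

theorem elu_deriv_of_neg {x : ℝ} (hx : x < 0) : Activation.elu.realDeriv x = Real.exp x := by
  change deriv Activation.elu.toReal x = _
  refine HasDerivAt.deriv (((Real.hasDerivAt_exp x).sub_const 1).congr_of_eventuallyEq ?_)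
  filter_upwards [gt_mem_nhds hx] with y hy
  exact elu_of_neg hy

theorem rectifier_elu : Rectifier .elu (-1) where
  lo_eq := Or.inr rfl
  bound _ := rfl
  gbound _ _ := rfl
  map_zero := elu_of_nonneg le_rfl
  pos y hy := by
    rw [elu_of_nonneg hy.le]
    constructor <;> linarith
  neg y hy := by
    rw [elu_of_nonpos hy]
    have h1 := Real.exp_pos y
    have h2 := Real.exp_le_one_iff.2 hy
    constructor <;> linarith
  large y hy := by
    rw [elu_of_nonneg (by linarith)]
    have := Real.exp_pos (-y)
    nlinarith
  der_large y hy := by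
    rw [elu_deriv_of_nonneg (by linarith)]
    have := Real.exp_pos (-y)
    constructor <;> nlinarith
  small y hy := by
    rw [elu_of_neg (by linarith), show Real.exp y - 1 - -1 = Real.exp y by ring,
      abs_of_pos (Real.exp_pos y)]
    nlinarith [Real.exp_pos y, abs_nonneg y]
  der_small y hy := by
    rw [elu_deriv_of_neg (by linarith), abs_of_pos (Real.exp_pos y)]
    nlinarith [Real.exp_pos y, abs_nonneg y]
  der_le y := by
    rcases le_or_gt 0 y with h | h
    · rw [elu_deriv_of_nonneg h]; norm_num
    · rw [elu_deriv_of_neg h, abs_of_pos (Real.exp_pos y)]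
      linarith [Real.exp_le_one_iff.2 h.le]

/-- Activation functions of the form `y * G y` with a sigmoidal function `G`. -/
theorem Rectifier.of_gate {a : Activation} (G g : ℝ → ℝ) (hb : ∀ q, a.inputBound q = 2 ^ (emax q - 2))
    (hg : ∀ p q, a.gradBound p q = Omega p q) (hf : ∀ y, a.toReal y = y * G y)
    (hf' : ∀ y, a.realDeriv y = G y + y * g y) (G0 : ∀ y, 0 ≤ G y) (G1 : ∀ y, G y ≤ 1)
    (Gpos : ∀ y, 0 < y → 1 / 2 < G y) (Glarge : ∀ y, 0 ≤ y → 1 - Real.exp (-y) ≤ G y)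
    (Gsmall : ∀ y ≤ 0, G y ≤ Real.exp y) (g0 : ∀ y, 0 ≤ g y) (g1 : ∀ y, g y ≤ Real.exp (-|y|)) :
    Rectifier a 0 where
  lo_eq := Or.inl rfl
  bound := hb
  gbound := hg
  map_zero := by rw [hf, zero_mul]
  pos y hy := by
    rw [hf]
    constructor <;> nlinarith [Gpos y hy, G1 y]
  neg y hy := by
    rw [hf]
    have h1 := mul_exp_neg_le_one (-y)
    rw [neg_neg] at h1
    have h2 := Gsmall y hy
    have h3 := G0 y
    constructor <;> nlinarith
  large y hy := by
    rw [hf]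
    exact mul_le_mul_of_nonneg_left (Glarge y (by linarith)) (by linarith)
  der_large y hy := by
    rw [hf']
    have h1 := g1 y
    rw [abs_of_nonneg (by linarith)] at h1
    have h2 := g0 y
    have h3 := Glarge y (by linarith)
    have h4 := G1 y
    constructor <;> nlinarith
  small y hy := by
    rw [hf, sub_zero, abs_mul, abs_of_nonneg (G0 y)]
    have := Gsmall y (by linarith)
    nlinarith [abs_nonneg y, Real.exp_pos y]
  der_small y hy := by
    rw [hf']
    have h1 := g1 y
    rw [abs_of_nonpos (by linarith), neg_neg] at h1
    have h2 := abs_add_le (G y) (y * g y)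
    rw [abs_of_nonneg (G0 y), abs_mul, abs_of_nonneg (g0 y)] at h2
    have h3 := Gsmall y (by linarith)
    nlinarith [abs_nonneg y]
  der_le y := by
    rw [hf']
    have h2 := abs_add_le (G y) (y * g y)
    rw [abs_of_nonneg (G0 y), abs_mul, abs_of_nonneg (g0 y)] at h2
    have h3 := mul_exp_neg_le_one |y|
    have h4 := mul_le_mul_of_nonneg_left (g1 y) (abs_nonneg y)
    linarith [G1 y]

theorem rectifier_swish : Rectifier .swish 0 := by
  have hd : ∀ y : ℝ, HasDerivAt Activation.swish.toReal
      (1 / (1 + Real.exp (-y)) + y * (Real.exp (-y) / (1 + Real.exp (-y)) ^ 2)) y := by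
    intro y
    have h0 := Real.exp_pos (-y)
    have h1 : HasDerivAt (fun y : ℝ => 1 + Real.exp (-y)) (-Real.exp (-y)) y := by
      simpa using ((hasDerivAt_neg y).exp).const_add 1
    have := (hasDerivAt_id y).div h1 (by positivity)
    refine this.congr_deriv ?_
    simp only [id]
    field_simp
    ring
  refine Rectifier.of_gate (fun y => 1 / (1 + Real.exp (-y)))
    (fun y => Real.exp (-y) / (1 + Real.exp (-y)) ^ 2) (fun _ => rfl) (fun _ _ => rfl)
    (fun y => by change y / _ = _; rw [mul_one_div]) (fun y => (hd y).deriv) ?_ ?_ ?_ ?_ ?_ ?_ ?_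
  · intro y; positivity
  · intro y
    have := Real.exp_pos (-y)
    rw [div_le_one (by positivity)]
    linarith
  · intro y hy
    have h1 := Real.exp_pos (-y)
    have h2 : Real.exp (-y) < 1 := Real.exp_lt_one_iff.2 (by linarith)
    exact one_div_lt_one_div_of_lt (by positivity) (by linarith)
  · intro y hy
    have h1 := Real.exp_pos (-y)
    rw [le_div_iff₀ (by positivity)]
    nlinarith
  · intro y hy
    have h1 := Real.exp_pos y
    rw [div_le_iff₀ (by positivity), mul_add, ← Real.exp_add, add_neg_cancel, Real.exp_zero]
    linarith
  · intro y; positivity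
  · intro y
    have h1 := Real.exp_pos (-y)
    rw [div_le_iff₀ (by positivity)]
    rcases le_or_gt 0 y with h | h
    · rw [abs_of_nonneg h]
      nlinarith [sq_nonneg (Real.exp (-y))]
    · rw [abs_of_neg h, neg_neg]
      have h2 : Real.exp y * Real.exp (-y) = 1 := by rw [← Real.exp_add]; simp
      have h3 := Real.exp_pos y
      nlinarith

/-! ### The error function and GELU. -/

theorem hasDerivAt_erf (x : ℝ) : HasDerivAt erf (2 / √Real.pi * Real.exp (-x ^ 2)) x := by
  have hc : Continuous fun t : ℝ => Real.exp (-t ^ 2) := by fun_prop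
  exact (intervalIntegral.integral_hasDerivAt_right (hc.intervalIntegrable _ _)
    hc.stronglyMeasurable.stronglyMeasurableAtFilter hc.continuousAt).const_mul _

theorem erf_neg (x : ℝ) : erf (-x) = -erf x := by
  unfold erf
  have h := intervalIntegral.integral_comp_neg (a := 0) (b := x) fun t : ℝ => Real.exp (-t ^ 2)
  simp only [neg_sq, neg_zero] at h
  rw [h, intervalIntegral.integral_symm (-x) 0]
  ring

theorem strictMono_erf : StrictMono erf := by
  refine strictMono_of_deriv_pos fun x => ?_
  rw [(hasDerivAt_erf x).deriv]
  positivity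

theorem erf_zero : erf 0 = 0 := by simp [erf]

theorem tendsto_erf : Tendsto erf atTop (𝓝 1) := by
  have h1 : MeasureTheory.IntegrableOn (fun t : ℝ => Real.exp (-t ^ 2)) (Set.Ioi 0) := by
    have := (integrable_exp_neg_mul_sq (b := 1) one_pos).integrableOn (s := Set.Ioi 0)
    simpa using this
  have h2 := MeasureTheory.intervalIntegral_tendsto_integral_Ioi 0 h1 tendsto_id
  have h3 := integral_gaussian_Ioi 1
  simp only [neg_mul, one_mul, div_one] at h3
  rw [h3] at h2
  have h4 := h2.const_mul (2 / √Real.pi)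
  have e : 2 / √Real.pi * (√Real.pi / 2) = 1 := by
    have : √Real.pi ≠ 0 := by positivity
    field_simp
  rw [e] at h4
  exact h4

/-- From `-x ^ 2 ≤ 1 - 2 * x`, the sum of `erf` and this exponential has nonpositive derivative; it
decreases to its limit `1`. -/
theorem one_sub_erf_le (x : ℝ) : 1 - erf x ≤ Real.exp (1 - 2 * x) / √Real.pi := by
  have hd : ∀ x : ℝ, HasDerivAt (fun x => erf x + Real.exp (1 - 2 * x) / √Real.pi)
      (2 / √Real.pi * Real.exp (-x ^ 2) + Real.exp (1 - 2 * x) * (-2) / √Real.pi) x := by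
    intro x
    have h1 : HasDerivAt (fun x : ℝ => 1 - 2 * x) (-2) x := by
      simpa using ((hasDerivAt_id x).const_mul 2).const_sub 1
    exact (hasDerivAt_erf x).add (h1.exp.div_const _)
  have hanti : Antitone fun x => erf x + Real.exp (1 - 2 * x) / √Real.pi := by
    refine antitone_of_deriv_nonpos (fun x => (hd x).differentiableAt) fun x => ?_
    rw [(hd x).deriv]
    have h1 : Real.exp (-x ^ 2) ≤ Real.exp (1 - 2 * x) :=
      Real.exp_le_exp.2 (by nlinarith [sq_nonneg (x - 1)])
    have h2 : (0 : ℝ) < √Real.pi := by positivity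
    have e : 2 / √Real.pi * Real.exp (-x ^ 2) + Real.exp (1 - 2 * x) * (-2) / √Real.pi =
        2 / √Real.pi * (Real.exp (-x ^ 2) - Real.exp (1 - 2 * x)) := by ring
    rw [e]
    exact mul_nonpos_of_nonneg_of_nonpos (by positivity) (by linarith)
  have hlim : Tendsto (fun x => erf x + Real.exp (1 - 2 * x) / √Real.pi) atTop (𝓝 (1 + 0 / √Real.pi)) := by
    refine tendsto_erf.add (Tendsto.div_const ?_ _)
    refine Real.tendsto_exp_atBot.comp ?_
    refine tendsto_atBot_add_const_left _ 1 ?_ |>.congr fun x => (sub_eq_add_neg _ _).symm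
    exact tendsto_neg_atTop_atBot.comp (tendsto_id.const_mul_atTop two_pos)
  rw [zero_div, add_zero] at hlim
  have := hanti.le_of_tendsto hlim x
  linarith

theorem sqrt_pi_bounds : (7 / 4 : ℝ) < √Real.pi ∧ √Real.pi < 2 := by
  have h1 := Real.pi_gt_d2
  have h2 := Real.pi_lt_four
  constructor
  · rw [Real.lt_sqrt (by norm_num)]; linarith
  · rw [Real.sqrt_lt' (by norm_num)]; linarith

theorem rectifier_gelu : Rectifier .gelu 0 := by
  have hs2 : (0 : ℝ) < √2 := by positivity
  have hs2' : √2 * √2 = (2 : ℝ) := Real.mul_self_sqrt (by norm_num)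
  have hs1 : (1 : ℝ) ≤ √2 := Real.one_le_sqrt.2 (by norm_num)
  obtain ⟨hp1, hp2⟩ := sqrt_pi_bounds
  have he1 := Real.exp_one_lt_d9
  have hE : ∀ y : ℝ, HasDerivAt (fun y => (1 + erf (y / √2)) / 2)
      (1 / √Real.pi / √2 * Real.exp (-(y ^ 2 / 2))) y := by
    intro y
    have h1 := ((hasDerivAt_erf (y / √2)).comp y ((hasDerivAt_id y).div_const √2)).const_add 1
      |>.div_const 2
    refine h1.congr_deriv ?_
    have : (y / √2) ^ 2 = y ^ 2 / 2 := by rw [div_pow, Real.sq_sqrt (by norm_num)]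
    rw [this]; ring
  have hle1 : ∀ x, erf x ≤ 1 := fun x => strictMono_erf.monotone.ge_of_tendsto tendsto_erf x
  have hge1 : ∀ x, -1 ≤ erf x := fun x => by
    have := hle1 (-x)
    rw [erf_neg] at this
    linarith
  have htail : ∀ y : ℝ, 0 ≤ y → (1 - erf (y / √2)) / 2 ≤ Real.exp (-y) := by
    intro y hy
    have h1 := one_sub_erf_le (y / √2)
    have e1 : 2 * (y / √2) = √2 * y := by
      rw [mul_div_assoc', div_eq_iff hs2.ne']; linear_combination (-y) * hs2'
    have h2 : Real.exp (1 - 2 * (y / √2)) ≤ Real.exp 1 * Real.exp (-y) := by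
      rw [← Real.exp_add, e1]
      exact Real.exp_le_exp.2 (by nlinarith)
    have h3 : Real.exp (1 - 2 * (y / √2)) / √Real.pi ≤ 2 * Real.exp (-y) := by
      rw [div_le_iff₀ (by linarith)]
      nlinarith [Real.exp_pos (-y)]
    linarith
  refine Rectifier.of_gate (fun y => (1 + erf (y / √2)) / 2)
    (fun y => 1 / √Real.pi / √2 * Real.exp (-(y ^ 2 / 2))) (fun _ => rfl) (fun _ _ => rfl)
    (fun y => by change y / 2 * (1 + erf (y / √2)) = _; ring) (fun y => ?_) ?_ ?_ ?_ ?_ ?_ ?_ ?_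
  · have h1 : Activation.gelu.toReal = fun y => y * ((1 + erf (y / √2)) / 2) := by
      funext y
      change y / 2 * (1 + erf (y / √2)) = _
      ring
    change deriv Activation.gelu.toReal y = _
    rw [h1]
    exact (((hasDerivAt_id' y).fun_mul (hE y)).congr_deriv (by simp)).deriv
  · intro y; linarith [hge1 (y / √2)]
  · intro y; linarith [hle1 (y / √2)]
  · intro y hy
    have := strictMono_erf (show 0 < y / √2 by positivity)
    rw [erf_zero] at this
    linarith
  · intro y hy
    linarith [htail y hy]
  · intro y hy
    have := htail (-y) (by linarith)
    rw [neg_div, erf_neg, neg_neg] at this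
    linarith
  · intro y; positivity
  · intro y
    -- This is `(|y| - 1) ^ 2 ≥ 0`; the constant `exp (1 / 2)` is later beaten by `√π * √2`.
    have h1 : Real.exp (-(y ^ 2 / 2)) ≤ Real.exp (1 / 2) * Real.exp (-|y|) := by
      rw [← Real.exp_add]
      refine Real.exp_le_exp.2 ?_
      have := sq_nonneg (|y| - 1)
      have h2 := sq_abs y
      nlinarith
    have h2 : Real.exp (1 / 2) ≤ 7 / 4 := by
      have h3 : Real.exp (1 / 2) * Real.exp (1 / 2) = Real.exp 1 := by
        rw [← Real.exp_add]; norm_num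
      have := Real.exp_pos (1 / 2)
      by_contra hc
      nlinarith
    have h3 : Real.exp (-(y ^ 2 / 2)) ≤ 7 / 4 * Real.exp (-|y|) :=
      h1.trans (mul_le_mul_of_nonneg_right h2 (Real.exp_pos _).le)
    rw [div_div, one_div_mul_eq_div, div_le_iff₀ (by positivity)]
    have h4 : 7 / 4 ≤ √Real.pi * √2 := by nlinarith
    have := Real.exp_pos (-|y|)
    nlinarith

/-! ### Activation functions that resemble the logistic function -/

/-- `z` is positive infinity or finite of value at least `r`. -/
def AtLeast (z : ExtFlt p q) (r : ℝ) : Prop := z = .posInf ∨ ∃ s, r ≤ s ∧ Val z s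

theorem Val.atLeast {z : ExtFlt p q} {r s : ℝ} (h : Val z s) (hs : r ≤ s) : AtLeast z r :=
  Or.inr ⟨s, hs, h⟩

theorem atLeast_round [Params p q] {x r : ℝ} (hr : r ∈ finiteFloats p q) (h : r ≤ x) :
    AtLeast (round p q x) r := by
  by_cases hx : |x| < Omega p q + (2 : ℝ) ^ (emax q - p - 1)
  · exact (val_round_of_lt hx).atLeast (le_fl hr h)
  · left
    unfold round
    rw [if_neg hx, if_pos]
    by_contra hc
    have h1 := abs_le_Omega hr
    rw [abs_of_nonpos (not_lt.1 hc)] at hx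
    have h2 : (0 : ℝ) < 2 ^ (emax q - p - 1) := by positivity
    rw [abs_le] at h1
    linarith

theorem AtLeast.add_val [Params p q] {a b : ExtFlt p q} {r s t : ℝ} (ha : AtLeast a r)
    (hb : Val b s) (ht : t ∈ finiteFloats p q) (h : t ≤ r + s) : AtLeast (a.add b) t := by
  obtain ⟨hs, rfl⟩ := hb
  rcases ha with rfl | ⟨r', hr, hr1, rfl⟩
  · exact Or.inl rfl
  · exact atLeast_round ht (by simp only; linarith)

theorem Val.atLeast_mul [Params p q] {a b : ExtFlt p q} {r s t : ℝ} (ha : Val a r) (hb : Val b s)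
    (ht : t ∈ finiteFloats p q) (h : t ≤ r * s) : AtLeast (a.mul b) t := by
  obtain ⟨h1, rfl⟩ := ha
  obtain ⟨h2, rfl⟩ := hb
  exact atLeast_round ht h

/-- The properties common to activation functions that resemble the logistic function. -/
structure Sigmoidal (a : Activation) (lo : ℝ) : Prop where
  lo_eq : lo = 0 ∨ lo = -1
  bound : ∀ q, a.inputBound q = 2 ^ (emax q - 1)
  gbound : ∀ p q, a.gradBound p q ≤ 2 ^ ((p : ℤ) - 1)
  mono : Monotone a.toReal
  -- Formulas in `lo` cover both cases: value `1 / 2` and slope `1 / 4` at zero for the logistic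
  -- function, value `0` and slope `1` for tanh.
  map_zero : a.toReal 0 = (1 + lo) / 2
  lower : ∀ y, lo ≤ a.toReal y
  upper : ∀ y, a.toReal y ≤ 1
  der_zero : a.realDeriv 0 = (1 - lo) ^ 2 / 4
  der_le : ∀ y, |a.realDeriv y| ≤ 1
  large : ∀ y, 1 - a.toReal y ≤ 2 * Real.exp (-y)
  small : ∀ y, a.toReal y - lo ≤ 2 * Real.exp y
  der_tail : ∀ y, |a.realDeriv y| ≤ 4 * Real.exp (-|y|)
  slope : ∀ y, 0 ≤ y → y ≤ 1 / 2 → (1 + lo) / 2 + (1 - lo) * y / 6 ≤ a.toReal y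

/-- The logistic function. -/
def logistic (y : ℝ) : ℝ := 1 / (1 + Real.exp (-y))

theorem logistic_pos (y : ℝ) : 0 < logistic y := by unfold logistic; positivity

theorem one_sub_logistic (y : ℝ) : 1 - logistic y = logistic (-y) := by
  have h := Real.exp_pos y
  unfold logistic
  rw [neg_neg, Real.exp_neg]
  field_simp
  ring

theorem logistic_le_exp (y : ℝ) : logistic y ≤ Real.exp y := by
  have h := Real.exp_pos y
  unfold logistic
  rw [div_le_iff₀ (by positivity), mul_add, ← Real.exp_add, add_neg_cancel, Real.exp_zero]
  linarith

theorem logistic_mono : Monotone logistic := fun x y h => by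
  unfold logistic
  have := Real.exp_le_exp.2 (neg_le_neg h)
  exact one_div_le_one_div_of_le (by positivity) (by linarith)

theorem logistic_zero : logistic 0 = 1 / 2 := by
  unfold logistic; norm_num

theorem hasDerivAt_logistic (y : ℝ) : HasDerivAt logistic (logistic y * logistic (-y)) y := by
  have h0 := Real.exp_pos (-y)
  have h1 : HasDerivAt (fun y : ℝ => 1 + Real.exp (-y)) (-Real.exp (-y)) y := by
    simpa using ((hasDerivAt_neg y).exp).const_add 1
  have h2 := (hasDerivAt_const y (1 : ℝ)).fun_div h1 (by positivity)
  refine h2.congr_deriv ?_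
  rw [← one_sub_logistic]
  unfold logistic
  field_simp
  ring

theorem logistic_slope {y : ℝ} (h0 : 0 ≤ y) (h1 : y ≤ 1) : 1 / 2 + y / 6 ≤ logistic y := by
  have h2 := Real.add_one_le_exp y
  have h3 : Real.exp (-y) ≤ 1 / (1 + y) := by
    rw [Real.exp_neg, ← one_div]
    exact one_div_le_one_div_of_le (by linarith) (by linarith)
  unfold logistic
  have h5 : 1 + Real.exp (-y) ≤ (2 + y) / (1 + y) := by
    rw [show (2 + y) / (1 + y) = 1 + 1 / (1 + y) by field_simp; ring]
    linarith
  rw [le_div_iff₀ (by positivity)]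
  refine (mul_le_mul_of_nonneg_left h5 (by positivity)).trans ?_
  rw [mul_div_assoc', div_le_one (by linarith)]
  nlinarith

theorem logistic_deriv_tail (y : ℝ) : logistic y * logistic (-y) ≤ Real.exp (-|y|) := by
  have key : ∀ y, logistic y ≤ 1 := fun y => by
    have := one_sub_logistic y; have := logistic_pos (-y); linarith
  have h1 := logistic_pos y
  have h2 := logistic_pos (-y)
  rcases abs_cases y with ⟨h, -⟩ | ⟨h, -⟩ <;> rw [h]
  · nlinarith [logistic_le_exp (-y), key y]
  · rw [neg_neg]; nlinarith [logistic_le_exp y, key (-y)]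

theorem sigmoidal_sigmoid : Sigmoidal .sigmoid 0 where
  lo_eq := Or.inl rfl
  bound _ := rfl
  gbound _ _ := le_rfl
  mono := logistic_mono
  map_zero := by change logistic 0 = _; rw [logistic_zero]; norm_num
  lower y := (logistic_pos y).le
  upper y := by
    change logistic y ≤ 1
    have := one_sub_logistic y; have := logistic_pos (-y); linarith
  der_zero := by
    refine (hasDerivAt_logistic 0).deriv.trans ?_
    rw [neg_zero, logistic_zero]; norm_num
  der_le y := by
    change |deriv logistic y| ≤ 1
    rw [(hasDerivAt_logistic y).deriv, ← one_sub_logistic]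
    have := logistic_pos y
    have := one_sub_logistic y; have := logistic_pos (-y)
    rw [abs_le]; constructor <;> nlinarith
  large y := by
    change 1 - logistic y ≤ _
    rw [one_sub_logistic]
    linarith [logistic_le_exp (-y), Real.exp_pos (-y)]
  small y := by
    change logistic y - 0 ≤ _
    linarith [logistic_le_exp y, Real.exp_pos y]
  der_tail y := by
    change |deriv logistic y| ≤ _
    rw [(hasDerivAt_logistic y).deriv, abs_of_pos (mul_pos (logistic_pos _) (logistic_pos _))]
    linarith [logistic_deriv_tail y, Real.exp_pos (-|y|)]
  slope y h0 h1 := by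
    change _ ≤ logistic y
    linarith [logistic_slope h0 (by linarith)]

theorem tanh_eq_logistic (y : ℝ) : Real.tanh y = 2 * logistic (2 * y) - 1 := by
  have h := Real.exp_pos y
  rw [Real.tanh_eq_sinh_div_cosh, Real.sinh_eq, Real.cosh_eq]
  unfold logistic
  rw [show -(2 * y) = -y + -y by ring, Real.exp_add, Real.exp_neg]
  field_simp
  ring

theorem sigmoidal_tanh : Sigmoidal .tanh (-1) := by
  have e : Activation.tanh.toReal = fun y => 2 * logistic (2 * y) - 1 := funext tanh_eq_logistic
  have hd : ∀ y, Activation.tanh.realDeriv y = 4 * (logistic (2 * y) * logistic (-(2 * y))) := by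
    intro y
    change deriv Activation.tanh.toReal y = _
    rw [e]
    have h1 : HasDerivAt (fun y : ℝ => 2 * y) 2 y := by simpa using (hasDerivAt_id y).const_mul 2
    refine ((((hasDerivAt_logistic (2 * y)).comp y h1).const_mul 2).sub_const 1).congr_deriv ?_
      |>.deriv
    ring
  refine ⟨Or.inr rfl, fun _ => rfl, fun p q => ?_, ?_, ?_, ?_, ?_, ?_, ?_, ?_, ?_, ?_, ?_⟩
  · exact zpow_le_zpow_right₀ (by norm_num) (by omega)
  · intro x y h
    rw [e]
    have := logistic_mono (show 2 * x ≤ 2 * y by linarith)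
    simp only
    linarith
  · rw [e]; simp only [mul_zero, logistic_zero]; norm_num
  · intro y
    rw [e]
    simp only
    linarith [logistic_pos (2 * y)]
  · intro y
    rw [e]
    have := one_sub_logistic (2 * y); have := logistic_pos (-(2 * y))
    simp only
    linarith
  · rw [hd]; simp only [mul_zero, neg_zero, logistic_zero]; norm_num
  · intro y
    have := logistic_pos (2 * y)
    have := one_sub_logistic (2 * y); have := logistic_pos (-(2 * y))
    rw [hd, ← one_sub_logistic, abs_le]
    constructor <;> nlinarith [sq_nonneg (2 * logistic (2 * y) - 1)]
  · intro y
    have h1 := one_sub_logistic (2 * y)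
    have h2 := logistic_pos (-(2 * y))
    rw [e]
    simp only
    rcases le_or_gt 0 y with h | h
    · have := logistic_le_exp (-(2 * y))
      have := Real.exp_le_exp.2 (show -(2 * y) ≤ -y by linarith)
      linarith
    · have := logistic_pos (2 * y)
      have := Real.one_le_exp (show 0 ≤ -y by linarith)
      linarith
  · intro y
    have h2 := logistic_pos (-(2 * y))
    have h1 := one_sub_logistic (2 * y)
    rw [e]
    simp only
    rcases le_or_gt 0 y with h | h
    · have := Real.one_le_exp h
      linarith
    · have := logistic_le_exp (2 * y)
      have := Real.exp_le_exp.2 (show 2 * y ≤ y by linarith)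
      linarith
  · intro y
    have h1 := logistic_deriv_tail (2 * y)
    have h2 : Real.exp (-|2 * y|) ≤ Real.exp (-|y|) := Real.exp_le_exp.2 (by
      rw [abs_mul, abs_two]; linarith [abs_nonneg y])
    rw [hd, abs_mul, abs_of_pos (mul_pos (logistic_pos _) (logistic_pos _))]
    norm_num
    linarith
  · intro y h0 h1
    rw [e]
    have := logistic_slope (y := 2 * y) (by linarith) (by linarith)
    simp only
    linarith

namespace Sigmoidal

variable {a : Activation} {lo : ℝ}

theorem lo_mem [Params p q] (h : Sigmoidal a lo) : lo ∈ finiteFloats p q := by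
  rcases h.lo_eq with rfl | rfl
  · exact zero_mem
  · exact neg_mem one_mem

theorem abs_le_one (h : Sigmoidal a lo) (x : ℝ) : |a.toReal x| ≤ 1 := by
  have h1 := h.lower x
  have h2 := h.upper x
  rw [abs_le]
  rcases h.lo_eq with rfl | rfl <;> constructor <;> linarith

theorem val_act [Params p q] (h : Sigmoidal a lo) {z : ExtFlt p q} {x : ℝ} (hz : Val z x) :
    Val (a.act p q z) (fl p q (a.toReal x)) :=
  hz.roundFun ((h.abs_le_one x).trans one_le_Omega)

theorem val_der [Params p q] (h : Sigmoidal a lo) {z : ExtFlt p q} {x : ℝ} (hz : Val z x) :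
    Val (a.actDeriv p q z) (fl p q (a.realDeriv x)) :=
  hz.roundFun ((h.der_le x).trans one_le_Omega)

theorem four_mul_exp_lt_eps [Params p q] {x : ℝ} (hx : 2 ^ (q + 1) ≤ x) :
    4 * Real.exp (-x) < eps p q / 2 := by
  have h1 := exp_lt_eps (p := p) (q := q) (neg_le_neg hx)
  have h2 := (zpow_emax_facts p q).2.2.2.2
  rw [abs_neg, abs_of_nonneg (by linarith)] at h1
  have := Real.exp_pos (-x)
  nlinarith

/-- Writing `exp (-x)` as the square of `exp (-(x / 2))` pays for the factor `2` in the error bound;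
hence the doubled threshold. -/
theorem act_one [Params p q] (h : Sigmoidal a lo) {z : ExtFlt p q} {x : ℝ} (hz : Val z x)
    (hx : 2 * 2 ^ p ≤ x) : Val (a.act p q z) 1 := by
  refine (h.val_act hz).congr (fl_eq_one ?_)
  obtain ⟨h1, -, h2⟩ := exp_neg_lt (p := p) (q := q) (x := x / 2) (by linarith)
  have h3 := h.large x
  rw [abs_sub_comm, abs_of_nonneg (by linarith [h.upper x])]
  have h4 : Real.exp (-x) = Real.exp (-(x / 2)) * Real.exp (-(x / 2)) := by
    rw [← Real.exp_add]; congr 1; ring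
  have h5 : Real.exp (-(x / 2)) ≤ 1 / 2 := by
    rw [Real.exp_neg, ← one_div]
    exact one_div_le_one_div_of_le (by norm_num) (by linarith [Real.add_one_le_exp (x / 2)])
  have h6 := Real.exp_pos (-(x / 2))
  nlinarith

theorem der_eq_zero [Params p q] (h : Sigmoidal a lo) {z : ExtFlt p q} {x : ℝ} (hz : Val z x)
    (hx : 2 ^ (q + 1) ≤ |x|) : Val (a.actDeriv p q z) 0 :=
  (h.val_der hz).congr (fl_eq_zero_of_abs_lt ((h.der_tail x).trans_lt (four_mul_exp_lt_eps hx)))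

theorem tendsto_exp_atBot : Tendsto (fun y => 4 * Real.exp y) atBot (𝓝 0) := by
  simpa using Real.tendsto_exp_atBot.const_mul 4

theorem posInf [Params p q] (h : Sigmoidal a lo) :
    Val (a.act p q .posInf) 1 ∧ Val (a.actDeriv p q .posInf) 0 := by
  have h0 := tendsto_exp_atBot.comp tendsto_neg_atTop_atBot
  constructor
  · refine roundLim_eq one_mem (tendsto_iff_dist_tendsto_zero.2 ?_)
    refine squeeze_zero (fun _ => dist_nonneg) (fun y => ?_) h0
    rw [dist_comm, Real.dist_eq, abs_of_nonneg (by linarith [h.upper y])]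
    have := Real.exp_pos (-y)
    exact (h.large y).trans (by simp only [Function.comp_apply]; linarith)
  · refine roundLim_eq zero_mem (squeeze_zero_norm' ?_ h0)
    filter_upwards [eventually_ge_atTop 0] with y hy
    have := h.der_tail y
    rwa [abs_of_nonneg hy] at this

theorem negInf [Params p q] (h : Sigmoidal a lo) :
    Val (a.act p q .negInf) lo ∧ Val (a.actDeriv p q .negInf) 0 := by
  constructor
  · refine roundLim_eq h.lo_mem (tendsto_iff_dist_tendsto_zero.2 ?_)
    refine squeeze_zero (fun _ => dist_nonneg) (fun y => ?_) tendsto_exp_atBot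
    rw [Real.dist_eq, abs_of_nonneg (by linarith [h.lower y])]
    have := Real.exp_pos y
    exact (h.small y).trans (by linarith)
  · refine roundLim_eq zero_mem (squeeze_zero_norm' ?_ tendsto_exp_atBot)
    filter_upwards [eventually_le_atBot 0] with y hy
    have := h.der_tail y
    rwa [abs_of_nonpos hy, neg_neg] at this

theorem off [Params p q] (h : Sigmoidal a lo) {z : ExtFlt p q} (hz : AtMost z (-2 ^ (q + 1))) :
    a.act p q z = .finite (nearestEven p q lo) ∧ a.actDeriv p q z = 0 := by
  rcases hz with rfl | ⟨x, hx, hz⟩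
  · exact ⟨h.negInf.1.eq_nearestEven, h.negInf.2.eq_zero⟩
  · have h0 : (0 : ℝ) < 2 ^ (q + 1) := by positivity
    refine ⟨((h.val_act hz).congr ?_).eq_nearestEven, (h.der_eq_zero hz ?_).eq_zero⟩
    · have h1 := four_mul_exp_lt_eps (p := p) (q := q) (x := -x) (by linarith)
      have h2 := h.small x
      have h3 := h.lower x
      have h4 := Real.exp_pos x
      rw [neg_neg] at h1
      have h5 : |a.toReal x - lo| < eps p q / 2 := by
        rw [abs_of_nonneg (by linarith)]; linarith
      rcases h.lo_eq with rfl | rfl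
      · rw [sub_zero] at h5
        exact fl_eq_zero_of_abs_lt h5
      · have h6 := fl_add_eq_left (p := p) (q := q) (neg_mem one_mem) (d := a.toReal x - -1) (by
          rw [abs_neg, abs_one, one_mul]
          refine h5.trans_le ?_
          obtain ⟨f1, f2, f3, f4, f5⟩ := emax_facts p q
          have : eps p q ≤ 2 ^ (-(p : ℤ) - 3) := zpow_le_zpow_right₀ (by norm_num) (by omega)
          have := eps_pos (p := p) (q := q)
          linarith)
        rwa [add_sub_cancel] at h6
    · rw [abs_of_nonpos (by linarith)]; linarith

theorem der_finite [Params p q] (h : Sigmoidal a lo) {z : ExtFlt p q} (hz : z ≠ .nan) :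
    ∃ r, a.actDeriv p q z = .finite r := by
  cases z with
  | finite x => exact ⟨_, (h.val_der (val_finite x)).eq_nearestEven⟩
  | posInf => exact ⟨_, h.posInf.2.eq_nearestEven⟩
  | negInf => exact ⟨_, h.negInf.2.eq_nearestEven⟩
  | nan => exact absurd rfl hz

theorem val_act_bounds [Params p q] (h : Sigmoidal a lo) {z : ExtFlt p q} {x : ℝ} (hz : Val z x) :
    ∃ c : Flt p q, a.act p q z = .finite c ∧ lo ≤ c ∧ (c : ℝ) ≤ 1 ∧ (c : ℝ) = fl p q (a.toReal x) :=
  ⟨_, (h.val_act hz).eq_nearestEven, by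
    rw [coe_nearestEven (fl_mem _)]
    exact ⟨le_fl h.lo_mem (h.lower x), fl_le one_mem (h.upper x), rfl⟩⟩

/-- The activation function respects lower bounds. -/
theorem act_atLeast [Params p q] (h : Sigmoidal a lo) {z : ExtFlt p q} {r : ℝ}
    (hz : AtLeast z r) : (∃ c : Flt p q, a.act p q z = .finite c ∧ (c : ℝ) ≤ 1 ∧
      fl p q (a.toReal r) ≤ c) ∧ ∃ r, a.actDeriv p q z = .finite r := by
  rcases hz with rfl | ⟨x, hx, hz⟩
  · refine ⟨⟨_, h.posInf.1.eq_nearestEven, ?_⟩, h.der_finite (by simp)⟩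
    rw [coe_nearestEven one_mem]
    exact ⟨le_rfl, fl_le one_mem (h.upper r)⟩
  · obtain ⟨c, h1, -, h2, h3⟩ := h.val_act_bounds hz
    refine ⟨⟨c, h1, h2, ?_⟩, _, (h.val_der hz).eq_nearestEven⟩
    rw [h3]; exact fl_mono (h.mono hx)

/-- The activation function respects upper bounds. -/
theorem act_atMost [Params p q] (h : Sigmoidal a lo) {z : ExtFlt p q} {r : ℝ}
    (hz : AtMost z r) : (∃ c : Flt p q, a.act p q z = .finite c ∧ lo ≤ (c : ℝ) ∧
      (c : ℝ) ≤ fl p q (a.toReal r)) ∧ ∃ r, a.actDeriv p q z = .finite r := by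
  rcases hz with rfl | ⟨x, hx, hz⟩
  · refine ⟨⟨_, h.negInf.1.eq_nearestEven, ?_⟩, h.der_finite (by simp)⟩
    rw [coe_nearestEven h.lo_mem]
    exact ⟨le_rfl, le_fl h.lo_mem (h.lower r)⟩
  · obtain ⟨c, h1, h2, -, h3⟩ := h.val_act_bounds hz
    refine ⟨⟨c, h1, h2, ?_⟩, _, (h.val_der hz).eq_nearestEven⟩
    rw [h3]; exact fl_mono (h.mono hx)

theorem mid_mem [Params p q] (h : Sigmoidal a lo) : (1 + lo) / 2 ∈ finiteFloats p q := by
  obtain ⟨f1, f2, f3, f4, f5⟩ := emax_facts p q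
  rcases h.lo_eq with rfl | rfl
  · have := two_zpow_mem (p := p) (q := q) (e := -1) (by omega) (by omega)
    norm_num at this ⊢; exact this
  · norm_num; exact zero_mem

theorem act_zero [Params p q] (h : Sigmoidal a lo) {z : ExtFlt p q} (hz : Val z 0) :
    Val (a.act p q z) ((1 + lo) / 2) :=
  (h.val_act hz).congr (by rw [h.map_zero, fl_of_mem h.mid_mem])

theorem threshold_mem [Params p q] (h : Sigmoidal a lo) {e : ℤ} (h1 : -1 ≤ e) (h2 : e ≤ emax q) :
    2 ^ e * ((1 + lo) / 2 + 2 ^ (-(p : ℤ) - 1)) ∈ finiteFloats p q := by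
  obtain ⟨f1, f2, f3, f4, f5⟩ := emax_facts p q
  have e1 : (2 : ℝ) ^ (-(p : ℤ) - 1) * 2 ^ p = 1 / 2 := by
    rw [← zpow_natCast, ← zpow_add₀ (by norm_num), show -(p : ℤ) - 1 + (p : ℕ) = -1 by ring]
    norm_num
  rcases h.lo_eq with rfl | rfl
  · have := (mem_finiteFloats_iff (p := p) (q := q)).2 ⟨2 ^ p + 1, e + (-(p : ℤ) - 1),
      ?_, by omega, by omega, rfl⟩
    · convert this using 1
      rw [zpow_add₀ (by norm_num)]
      push_cast
      linear_combination -(2 : ℝ) ^ e * e1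
    · have : (1 : ℤ) < 2 ^ p := one_lt_pow₀ (by norm_num) (by omega)
      rw [abs_of_pos (by positivity), pow_succ]; linarith
  · rw [show (1 + -1 : ℝ) / 2 = 0 by norm_num, zero_add, ← zpow_add₀ (by norm_num)]
    exact two_zpow_mem (by omega) (by omega)

/-- The smallest positive arguments that occur are recognized in spite of rounding. -/
theorem threshold_le [Params p q] (h : Sigmoidal a lo) :
    (1 + lo) / 2 + 2 ^ (-(p : ℤ) - 1) ≤ fl p q (a.toReal (2 ^ (1 - (p : ℤ)))) := by
  obtain ⟨f1, f2, f3, f4, f5⟩ := emax_facts p q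
  have hm := h.threshold_mem (p := p) (q := q) (e := 0) (by norm_num) (by omega)
  rw [zpow_zero, one_mul] at hm
  have e1 : (2 : ℝ) ^ (1 - (p : ℤ)) = 4 * 2 ^ (-(p : ℤ) - 1) := by
    rw [show (4 : ℝ) = 2 ^ (2 : ℤ) by norm_num, ← zpow_add₀ (by norm_num)]; congr 1; ring
  have h1 : (2 : ℝ) ^ (1 - (p : ℤ)) ≤ 1 / 2 := by
    rw [show (1 / 2 : ℝ) = 2 ^ (-1 : ℤ) by norm_num]
    exact zpow_le_zpow_right₀ (by norm_num) (by omega)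
  have h2 := h.slope _ (by positivity) h1
  rw [e1] at h2 ⊢
  have hu : (0 : ℝ) < 2 ^ (-(p : ℤ) - 1) := by positivity
  rcases h.lo_eq with hlo | hlo
  · subst hlo
    have hhalf := h.mid_mem (p := p) (q := q)
    set u : ℝ := 2 ^ (-(p : ℤ) - 1) with hu'
    set y := a.toReal (4 * u)
    -- The slope bound gives only `1 / 2 + 2 / 3 * u`, short of the threshold. But `1 / 2 + u` is
    -- the float next to `1 / 2`, and it is the nearer of the two.
    rcases le_or_gt ((1 + 0) / 2 + u) y with h3 | h3
    · exact le_fl hm h3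
    · have h4 := abs_sub_fl_le (p := p) (q := q) y hm
      rw [abs_of_neg (by linarith : y - ((1 + 0) / 2 + u) < 0), abs_le] at h4
      have h5 : (1 + 0 : ℝ) / 2 < fl p q y := by linarith
      have h6 := gap_of_le_abs (p := p) (q := q) (e := -1) (fl_mem y) hhalf
        (by rw [abs_of_pos (by linarith)]; norm_num; linarith)
        (by norm_num) h5.ne'
      rw [abs_of_pos (by linarith), show (-1 : ℤ) - p = -(p : ℤ) - 1 by ring, ← hu'] at h6
      linarith
  · subst hlo
    exact le_fl hm (by linarith)

end Sigmoidal

/-! ### The construction for sigmoidal functions -/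

theorem exists_scale [Params p q] (t : Flt p q) : ∃ (n : ℤ) (e : ℤ), |n| < 2 ^ (p + 1) ∧
    emin q - p ≤ e ∧ e ≤ emax q - p ∧ (t : ℝ) = n * 2 ^ e := mem_finiteFloats_iff.1 t.2

theorem finite_add_ne_nan (x y : Flt p q) : (ExtFlt.finite x).add (.finite y) ≠ .nan := by
  change round p q _ ≠ _
  unfold round
  split_ifs <;> simp

theorem finite_mul_ne_nan (x y : Flt p q) : (ExtFlt.finite x).mul (.finite y) ≠ .nan := by
  change round p q _ ≠ _
  unfold round
  split_ifs <;> simp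

theorem add_finite_ne_nan {z : ExtFlt p q} (hz : z ≠ .nan) (y : Flt p q) :
    z.add (.finite y) ≠ .nan := by
  cases z with
  | finite x => exact finite_add_ne_nan x y
  | posInf => simp [ExtFlt.add]
  | negInf => simp [ExtFlt.add]
  | nan => exact absurd rfl hz

namespace Sigmoidal

variable {a : Activation} {lo : ℝ}

/-- The parameters of the output pieces: a sum of `N` bits with weight `w` and bias `b` switches
the value of a neuron between `0` and `1`. -/
def SwitchSpec (a : Activation) (hi lo : Flt p q) (N : ℕ) (w b : Flt p q) : Prop :=
  ∀ (on : Bool) (P : ExtFlt p q),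
    IsSum (fun _ : Fin N => (ExtFlt.finite w).mul (.finite (bitState hi lo on (some true)))) P →
    Val (a.act p q (P.add (.finite b))) (if on then 1 else 0) ∧
    ∃ r, Val (a.actDeriv p q (P.add (.finite b))) r ∧
      -- Either no gradient passes, or the weight and the gradient bound are small enough for it to
      -- pass without overflow. The second case is that of tanh and uses its smaller bound on `y`.
      (r = 0 ∨ |r| ≤ 1 ∧ |(w : ℝ)| ≤ 4 ∧ a.gradBound p q ≤ 2 ^ ((p : ℤ) - 2))

/-- The weights of the copies of an output piece: `n` of them are `2 ^ e` (with the sign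
of `n`). -/
def copyWeight (n e : ℤ) (s : ℕ) : ℝ := if (s : ℤ) < |n| then (n.sign : ℝ) * 2 ^ e else 0

theorem copyWeight_mem [Params p q] {n e : ℤ} (h1 : emin q - p ≤ e) (h2 : e ≤ emax q - p) (s : ℕ) :
    copyWeight n e s ∈ finiteFloats p q := by
  obtain ⟨f1, f2, f3, f4, f5⟩ := emax_facts p q
  have hm : (2 : ℝ) ^ e ∈ finiteFloats p q := two_zpow_mem h1 (by omega)
  unfold copyWeight
  split_ifs
  · rcases Int.sign_trichotomy n with h | h | h <;> rw [h] <;> push_cast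
    · rwa [one_mul]
    · rw [zero_mul]; exact zero_mem
    · rw [neg_one_mul]; exact neg_mem hm
  · exact zero_mem

theorem abs_copyWeight_le {n e : ℤ} (s : ℕ) : |copyWeight n e s| ≤ 2 ^ e := by
  have h0 : (0 : ℝ) < 2 ^ e := by positivity
  unfold copyWeight
  split_ifs
  · rcases Int.sign_trichotomy n with h | h | h <;> rw [h] <;> simp [h0.le]
  · simpa using h0.le

/-- All partial sums are multiples of `2 ^ e` with coefficient at most `|n| < 2 ^ (p + 1)`, so that
`|n|` copies with value `1` reproduce a float exactly. -/
theorem sum_copies [Params p q] {n e : ℤ} (hn : |n| < 2 ^ (p + 1)) (h1 : emin q - p ≤ e)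
    (h2 : e ≤ emax q - p) {f : Fin (2 ^ (p + 1)) → ExtFlt p q} {T : ExtFlt p q} (hT : IsSum f T)
    (hf : ∀ s, Val (f s) (copyWeight n e s)) : Val T (n * 2 ^ e) := by
  have hs : ∑ s : Fin (2 ^ (p + 1)), (if ((s : ℕ) : ℤ) < |n| then (1 : ℤ) else 0) = |n| := by
    obtain ⟨k, hk⟩ : ∃ k : ℕ, |n| = k := ⟨n.natAbs, by simp⟩
    rw [hk, Fin.sum_univ_eq_sum_range (fun s : ℕ => if (s : ℤ) < (k : ℤ) then (1 : ℤ) else 0)]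
    have hk' : k ≤ 2 ^ (p + 1) := by rw [hk] at hn; exact_mod_cast hn.le
    simp only [Nat.cast_lt]
    rw [← Finset.sum_filter, Finset.sum_const, nsmul_eq_mul, mul_one]
    congr 1
    have : (Finset.range (2 ^ (p + 1))).filter (· < k) = Finset.range k := by
      ext i; simp; omega
    rw [this, Finset.card_range]
  have he : ∑ s : Fin (2 ^ (p + 1)), (if ((s : ℕ) : ℤ) < |n| then n.sign else 0) = n := by
    have : ∀ s : Fin (2 ^ (p + 1)), (if ((s : ℕ) : ℤ) < |n| then n.sign else 0) =
        n.sign * (if ((s : ℕ) : ℤ) < |n| then (1 : ℤ) else 0) := fun s => by split_ifs <;> simp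
    simp only [this]
    rw [← Finset.mul_sum, hs, Int.sign_mul_abs]
  have := hT.exact (fun s => if ((s : ℕ) : ℤ) < |n| then n.sign else 0) (2 ^ e) (fun s => ?_) ?_
  · rwa [he] at this
  · refine (hf s).congr ?_
    unfold copyWeight
    split_ifs <;> simp
  · intro k hk
    refine mem_finiteFloats_iff.2 ⟨k, e, (hk.trans ?_).trans_lt hn, h1, h2, rfl⟩
    refine (Finset.sum_le_sum fun s _ => ?_).trans_eq hs
    split_ifs
    · rcases Int.sign_trichotomy n with h | h | h <;> rw [h] <;> simp
    · simp

/-- The weights and biases of bits and gates are floats. -/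
theorem gate_facts [Params p q] (h : Sigmoidal a lo) :
    (2 : ℝ) ^ (emax q - p) * lo ∈ finiteFloats p q ∧
    4 / (1 - lo) ^ 2 ∈ finiteFloats p q ∧ (1 - lo) ^ 2 / 4 ∈ finiteFloats p q ∧
    4 / (1 - lo) ^ 2 * ((1 + lo) / 2) ∈ finiteFloats p q ∧
    4 / (1 - lo) ^ 2 * ((1 + lo) / 2) - 2 ^ (emax q - p) * lo ∈ finiteFloats p q ∧
    2 ^ emax q * ((1 + lo) / 2) ∈ finiteFloats p q ∧ 2 ^ emax q * lo ∈ finiteFloats p q ∧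
    (2 : ℝ) ^ emax q * 1 - 2 ^ emax q * ((1 + lo) / 2) ∈ finiteFloats p q ∧
    2 ^ emax q / 2 ≤ (2 : ℝ) ^ emax q * 1 - 2 ^ emax q * ((1 + lo) / 2) ∧
    (2 : ℝ) ^ emax q * 1 - 2 ^ emax q * ((1 + lo) / 2) =
      -(2 ^ emax q * lo - 2 ^ emax q * ((1 + lo) / 2)) := by
  obtain ⟨f1, f2, f3, f4, f5⟩ := emax_facts p q
  have hW : (2 : ℝ) ^ (emax q - p) ∈ finiteFloats p q := two_zpow_mem (by omega) (by omega)
  have hE : (2 : ℝ) ^ emax q ∈ finiteFloats p q := two_zpow_mem (by omega) le_rfl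
  have hE1 : (2 : ℝ) ^ (emax q - 1) ∈ finiteFloats p q := two_zpow_mem (by omega) (by omega)
  rw [zpow_sub_one_two] at hE1
  have h2 : ∀ e : ℤ, -10 ≤ e → e ≤ 10 → (2 : ℝ) ^ e ∈ finiteFloats p q := fun e h1 h2 =>
    two_zpow_mem (by omega) (by omega)
  have c2 := h2 2 (by norm_num) (by norm_num)
  have c1 := h2 1 (by norm_num) (by norm_num)
  have d2 := h2 (-2) (by norm_num) (by norm_num)
  have h0 : (0 : ℝ) < 2 ^ emax q := by positivity
  rw [zpow_ofNat] at c2 c1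
  rw [zpow_neg, zpow_ofNat] at d2
  rcases h.lo_eq with rfl | rfl
  · refine ⟨?_, ?_, ?_, ?_, ?_, ?_, ?_, ?_, ?_, ?_⟩
    · rw [mul_zero]; exact zero_mem
    · convert c2 using 1; norm_num
    · convert d2 using 1; norm_num
    · convert c1 using 1; norm_num
    · convert c1 using 1; norm_num
    · convert hE1 using 1; ring
    · rw [mul_zero]; exact zero_mem
    · convert hE1 using 1; ring
    · linarith
    · ring
  · refine ⟨?_, ?_, ?_, ?_, ?_, ?_, ?_, ?_, ?_, ?_⟩
    · rw [mul_neg_one]; exact neg_mem hW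
    · convert one_mem (p := p) (q := q) using 1; norm_num
    · convert one_mem (p := p) (q := q) using 1; norm_num
    · convert zero_mem using 1; norm_num
    · convert hW using 1; norm_num
    · convert zero_mem using 1; norm_num
    · rw [mul_neg_one]; exact neg_mem hE
    · convert hE using 1; norm_num
    · linarith
    · ring

/-- The kit for a sigmoidal function. -/
def kit [Params p q] (h : Sigmoidal a lo) {N : ℕ} {w b : Flt p q}
    (sw : SwitchSpec a (nearestEven p q 1) (nearestEven p q lo) N w b) : Kit p q a := by
  have f1 := (emax_facts p q).1
  have f2 := (emax_facts p q).2.1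
  have f3 := (emax_facts p q).2.2.1
  have f5 := (emax_facts p q).2.2.2.2
  have g1 := (zpow_emax_facts p q).1
  have g2 := (zpow_emax_facts p q).2.1
  have g3 := (zpow_emax_facts p q).2.2.1
  have g4 := (zpow_emax_facts p q).2.2.2.1
  have g5 := (zpow_emax_facts p q).2.2.2.2
  have g6 : (0 : ℝ) < 2 ^ (emax q - p) := by positivity
  have g7 := three_halves_le_Omega (p := p) (q := q)
  have hW : (2 : ℝ) ^ (emax q - p) ∈ finiteFloats p q := two_zpow_mem (by omega) (by omega)
  have hE : (2 : ℝ) ^ emax q ∈ finiteFloats p q := two_zpow_mem (by omega) le_rfl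
  have hK : (2 : ℝ) ^ (q + 1) ∈ finiteFloats p q := two_pow_mem
  have m1 := h.gate_facts (p := p) (q := q)
  have hmid := h.mid_mem (p := p) (q := q)
  have vlo := val_nearestEven h.lo_mem (p := p) (q := q)
  have v1 := val_nearestEven (p := p) (q := q) one_mem
  have vE := val_nearestEven hE
  have vD := val_nearestEven m1.2.1
  have vmid := val_nearestEven hmid
  have eD := coe_nearestEven m1.2.1
  have hlo' : -1 ≤ lo ∧ lo ≤ 0 := by rcases h.lo_eq with rfl | rfl <;> norm_num
  have hD : 0 < 4 / (1 - lo) ^ 2 ∧ 4 / (1 - lo) ^ 2 ≤ 4 := by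
    rcases h.lo_eq with rfl | rfl <;> norm_num
  have hH : ∀ y : Flt p q, |(y : ℝ)| ≤ a.gradBound p q → |(y : ℝ)| ≤ 2 ^ p / 2 := fun y hy => by
    have := hy.trans (h.gbound p q)
    rwa [zpow_sub_one_two, zpow_natCast] at this
  have act_τ : a.act p q (.finite 0) = .finite (nearestEven p q ((1 + lo) / 2)) ∧
      a.actDeriv p q (.finite 0) = .finite (nearestEven p q ((1 - lo) ^ 2 / 4)) :=
    ⟨(h.act_zero val_zero).eq_nearestEven,
      ((h.val_der val_zero).congr (by rw [h.der_zero, fl_of_mem m1.2.2.1])).eq_nearestEven⟩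
  exact {
    κ := nearestEven p q ((1 + lo) / 2)
    τ := 0
    δ := nearestEven p q ((1 - lo) ^ 2 / 4)
    D := nearestEven p q (4 / (1 - lo) ^ 2)
    hi := nearestEven p q 1
    lo := nearestEven p q lo
    -- Away from the target the carriers vary with the input, but the activation function is
    -- bounded.
    J := fun j => |(j : ℝ)| ≤ 1
    -- Both bit values lie in saturated ranges, so bits never transmit gradients.
    Z := False
    hi_ne := fun e => by
      have := congrArg Subtype.val e
      rw [coe_nearestEven one_mem, coe_nearestEven h.lo_mem] at this
      linarith
    scale := by
      refine ⟨?_, ?_⟩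
      · rw [eD, coe_nearestEven m1.2.2.1]
        have : 1 - lo ≠ 0 := by linarith
        field_simp
      · rw [eD]
        rcases h.lo_eq with rfl | rfl
        · exact ⟨2, le_rfl, by norm_num⟩
        · exact ⟨0, by norm_num, by norm_num⟩
    delta_le := by
      rw [coe_nearestEven m1.2.2.1]
      rcases h.lo_eq with rfl | rfl <;> norm_num
    bound := fun y hy => by
      have := hH y hy
      rw [eD, abs_mul, abs_of_pos hD.1]
      nlinarith [abs_nonneg (y : ℝ)]
    act_τ := act_τ.1
    der_τ := act_τ.2
    J_κ := by
      rw [coe_nearestEven hmid, abs_le]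
      constructor <;> linarith
    carrier := by
      rintro A j hA hj z rfl
      have hk : |((nearestEven p q ((1 + lo) / 2) : Flt p q) : ℝ)| ≤ 1 := by
        rw [coe_nearestEven hmid, abs_le]
        constructor <;> linarith
      have e64 : (2 : ℝ) ^ (6 : ℤ) = 64 := by norm_num
      have h64 : (64 : ℝ) ∈ finiteFloats p q := by
        rw [← e64]; exact two_zpow_mem (by omega) (by omega)
      have hb : ∀ A j : Flt p q, |(A : ℝ)| ≤ 64 → |(j : ℝ)| ≤ 1 →
          ∃ m, Val ((ExtFlt.finite A).mul (.finite j)) m ∧ |m| ≤ 64 := by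
        intro A j hA hj
        have hx : |(A : ℝ) * j| ≤ 64 := by
          rw [abs_mul]; nlinarith [abs_nonneg (A : ℝ), abs_nonneg (j : ℝ)]
        refine ⟨_, (val_finite A).mul (val_finite j) (by nlinarith), ?_⟩
        rw [abs_le] at hx ⊢
        exact ⟨le_fl (neg_mem h64) hx.1, fl_le h64 hx.2⟩
      obtain ⟨x, hx, hx'⟩ := hb A j hA hj
      obtain ⟨y, hy, hy'⟩ := hb (-A) (nearestEven p q ((1 + lo) / 2))
        (by change |-(A : ℝ)| ≤ 64; rwa [abs_neg]) hk
      have hz := hx.add hy (by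
        have := abs_add_le x y
        nlinarith)
      obtain ⟨c, c1, c2, c3, -⟩ := h.val_act_bounds hz
      have hz0 : ∀ z : ExtFlt p q, z.add (.finite 0) = z := ExtFlt.add_zero
      rw [hz0]
      refine ⟨⟨c, by rw [abs_le]; constructor <;> linarith, c1⟩,
        ⟨_, (h.val_der hz).eq_nearestEven⟩, ?_⟩
      rintro rfl
      exact finite_mul_add_neg_mul (by
        rw [abs_mul]; nlinarith [abs_nonneg (A : ℝ)])
    off := fun z hz => h.off hz
    bitWeight := nearestEven p q (2 ^ emax q)
    bitBias := nearestEven p q (-(2 ^ emax q * ((1 + lo) / 2)))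
    bit := by
      obtain ⟨-, -, -, -, -, k6, k7, k8, k9, k10⟩ := m1
      have vb := val_nearestEven (neg_mem k6)
      have hEK : (2 : ℝ) ^ (q + 1) * 256 ≤ 2 ^ emax q := by nlinarith
      rintro _ (rfl | rfl) z rfl
      · have hv := (vE.mul_mem v1 (by rwa [mul_one])).add_mem vb (by rwa [← sub_eq_add_neg])
        rw [← sub_eq_add_neg] at hv
        refine ⟨(h.act_one hv (by linarith)).eq_nearestEven, 0, ?_, fun _ => rfl⟩
        exact (h.der_eq_zero hv (by rw [abs_of_pos (by linarith)]; linarith)).eq_zero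
      · rw [k10] at k8 k9
        have k11 := neg_mem k8
        rw [neg_neg, sub_eq_add_neg] at k11
        have hv := (vE.mul_mem vlo k7).add_mem vb k11
        rw [← sub_eq_add_neg] at hv
        have := h.off (hv.atMost (by linarith))
        exact ⟨this.1, 0, this.2, fun _ => rfl⟩
    -- The size is a compromise: large enough to switch a gate off against the carrier and the bias,
    -- small enough that the product with a gradient up to `2 ^ (p - 1)` is finite. The bias below
    -- makes the preactivation exactly zero on the target.
    gateWeight := nearestEven p q (-2 ^ (emax q - p))
    gateBias := nearestEven p q (-(4 / (1 - lo) ^ 2 * ((1 + lo) / 2) - 2 ^ (emax q - p) * lo))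
    gate_on := by
      obtain ⟨k1, k2, k3, k4, k5, -⟩ := m1
      refine ⟨nearestEven p q ((1 + lo) / 2), _, (vD.mul_mem vmid k4).eq_nearestEven, ?_⟩
      rintro z rfl
      have e0 : -(2 : ℝ) ^ (emax q - p) * lo = -(2 ^ (emax q - p) * lo) := by ring
      have w := ((vD.mul_mem vmid k4).add_mem
        ((val_nearestEven (neg_mem hW)).mul_mem vlo (by rw [e0]; exact neg_mem k1))
        (by rwa [e0, ← sub_eq_add_neg])).add_mem (val_nearestEven (neg_mem k5))
        (by convert zero_mem using 1; ring)
      replace w := w.congr (s := 0) (by ring)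
      rw [w.eq_zero]
      exact act_τ
    gate_off := by
      obtain ⟨k1, k2, k3, k4, k5, -⟩ := m1
      have h4 : (4 : ℝ) ∈ finiteFloats p q := by
        have := two_zpow_mem (p := p) (q := q) (e := 2) (by omega) (by omega)
        norm_num at this; exact this
      have hDlo : 4 / (1 - lo) ^ 2 * lo ∈ finiteFloats p q := by
        rcases h.lo_eq with rfl | rfl
        · rw [mul_zero]; exact zero_mem
        · norm_num; exact neg_mem one_mem
      refine ⟨nearestEven p q lo, _, (vD.mul_mem vlo hDlo).eq_nearestEven, ?_⟩
      rintro j hj z rfl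
      refine h.off ?_
      have hb : 0 ≤ 4 / (1 - lo) ^ 2 * ((1 + lo) / 2) - 2 ^ (emax q - p) * lo := by
        have h1 : 0 ≤ 4 / (1 - lo) ^ 2 * ((1 + lo) / 2) := by
          refine mul_nonneg hD.1.le (by linarith)
        nlinarith
      have hW1 : (2 : ℝ) ^ (emax q - p - 1) ∈ finiteFloats p q :=
        two_zpow_mem (by omega) (by omega)
      have e1 := zpow_sub_one_two (emax q - p)
      refine AtMost.add (r := -2 ^ (emax q - p - 1)) (s := 0) ?_
        ((val_nearestEven (neg_mem k5)).atMost (by linarith)) (neg_mem hK) (by rw [e1]; linarith)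
      refine AtMost.add (r := 4) (s := -2 ^ (emax q - p)) ?_ ?_ (neg_mem hW1)
        (by rw [e1]; linarith)
      · refine vD.atMost_mul (val_finite j) h4 ?_
        have := (abs_le.1 hj).2
        nlinarith
      · exact (val_nearestEven (neg_mem hW)).atMost_mul v1 (neg_mem hW) (by rw [mul_one])
    gate_grad := fun y hy => by
      have := hH y hy
      rw [coe_nearestEven (neg_mem hW), abs_mul, abs_neg, abs_of_pos g6]
      nlinarith [abs_nonneg (y : ℝ)]
    S := Fin (2 ^ (p + 1))
    -- Each copy has its own `N` bits. A bit then receives gradient from a single piece, and no sum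
    -- of gradients can overflow.
    K := Fin (2 ^ (p + 1)) × Fin N
    kind := fun _ => some true
    outWeight := fun t s => nearestEven p q
      (copyWeight (exists_scale t).choose (exists_scale t).choose_spec.choose s)
    pieceWeight := fun _ s k => if k.1 = s then w else 0
    pieceBias := fun _ _ => b
    piece := by
      intro t on P hP
      obtain ⟨hn, h1, h2, ht⟩ := (exists_scale t).choose_spec.choose_spec
      generalize (exists_scale t).choose_spec.choose = e at hn h1 h2 ht ⊢
      generalize (exists_scale t).choose = n at hn h1 h2 ht ⊢
      have vA := fun s : Fin (2 ^ (p + 1)) =>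
        val_nearestEven (copyWeight_mem (n := n) h1 h2 (s : ℕ))
      have hs : ∀ s, Val (a.act p q ((P s).add (.finite b))) (if on then 1 else 0) ∧
          ∃ r, Val (a.actDeriv p q ((P s).add (.finite b))) r ∧
            (r = 0 ∨ |r| ≤ 1 ∧ |(w : ℝ)| ≤ 4 ∧ a.gradBound p q ≤ 2 ^ ((p : ℤ) - 2)) := by
        intro s
        refine sw on (P s) ?_
        have := (hP s).comp (fun i : Fin N => (s, i)) (fun i j hij => (Prod.mk.inj hij).2) ?_
        · simpa only [if_true] using this
        · rintro ⟨s', i⟩ hi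
          rw [if_neg]
          · exact finite_zero_mul _
          · rintro rfl
            exact hi i rfl
      refine ⟨?_, ?_, fun y hy => ?_⟩
      · rintro rfl T hT
        refine Val.eq_finite ((sum_copies hn h1 h2 hT fun s => ?_).congr ht.symm)
        have hv := (hs s).1
        rw [if_pos rfl] at hv
        exact ((vA s).mul_mem hv (by rw [mul_one]; exact copyWeight_mem h1 h2 _)).congr (mul_one _)
      · rintro rfl s
        have hv := (hs s).1
        rw [if_neg (by simp)] at hv
        rw [hv.eq_zero]
        exact finite_mul_zero _
      · have hA : ∀ s : Fin (2 ^ (p + 1)), |copyWeight n e s| ≤ 2 ^ (emax q - p) := fun s =>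
          (abs_copyWeight_le _).trans (zpow_le_zpow_right₀ (by norm_num) h2)
        have key : ∀ (k : ℤ) (x : ℝ), k ≤ emax q → |x| ≤ 2 ^ k → emin q - p ≤ k →
            |x| ≤ Omega p q ∧ |fl p q x| ≤ 2 ^ k := by
          intro k x hk hx hk'
          have hm : (2 : ℝ) ^ k ∈ finiteFloats p q := two_zpow_mem hk' hk
          refine ⟨hx.trans (two_zpow_le_Omega hk), ?_⟩
          rw [abs_le] at hx ⊢
          exact ⟨le_fl (neg_mem hm) hx.1, fl_le hm hx.2⟩
        have hyA : ∀ s : Fin (2 ^ (p + 1)), ∀ k : ℤ, |(y : ℝ)| ≤ 2 ^ (k - emax q + p) →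
            |(y : ℝ) * copyWeight n e s| ≤ 2 ^ k := by
          intro s k hk
          have e2 : (2 : ℝ) ^ k = 2 ^ (k - emax q + p) * 2 ^ (emax q - p) := by
            rw [← zpow_add₀ (by norm_num)]; congr 1; ring
          rw [abs_mul, e2]
          exact mul_le_mul hk (hA s) (abs_nonneg _) (by positivity)
        have hb := fun s : Fin (2 ^ (p + 1)) => key (emax q - 1) _ (by omega) (hyA s (emax q - 1) (by
          refine (hH y hy).trans_eq ?_
          rw [show emax q - 1 - emax q + (p : ℤ) = p - 1 by ring, zpow_sub_one_two, zpow_natCast]))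
          (by omega)
        have w1 := fun s => (val_finite y).mul (vA s) (hb s).1
        have w2 : ∀ s : Fin (2 ^ (p + 1)), ∃ r', Val (((ExtFlt.finite y).mul (.finite (nearestEven p q
            (copyWeight n e s)))).mul (a.actDeriv p q ((P s).add (.finite b)))) r' ∧
              |r' * w| ≤ Omega p q := by
          intro s
          obtain ⟨r, hr, hr'⟩ := (hs s).2
          rcases hr' with rfl | ⟨r1, r2, r3⟩
          · refine ⟨0, ((w1 s).mul_mem hr (by rw [mul_zero]; exact zero_mem)).congr (mul_zero _), ?_⟩
            rw [zero_mul, abs_zero]; exact Omega_pos.le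
          · have hc := (key (emax q - 2) _ (by omega) (hyA s (emax q - 2) (by
              refine hy.trans (r3.trans_eq ?_)
              congr 1; ring)) (by omega)).2
            obtain ⟨hd1, hd2⟩ := key (emax q - 2)
              (fl p q ((y : ℝ) * copyWeight n e s) * r) (by omega) (by
                rw [abs_mul, ← mul_one ((2 : ℝ) ^ _)]
                exact mul_le_mul hc r1 (abs_nonneg _) (by positivity))
              (by omega)
            refine ⟨_, (w1 s).mul hr hd1, ?_⟩
            rw [zpow_sub_two_two] at hd2
            rw [abs_mul]
            have := mul_le_mul hd2 r2 (abs_nonneg _) (by positivity)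
            have h0 : (0 : ℝ) < 2 ^ emax q := by positivity
            linarith
        refine ⟨fun s => ⟨⟨_, (w1 s).eq_nearestEven⟩, ?_⟩, ?_⟩
        · obtain ⟨r', hr, -⟩ := w2 s
          exact ⟨_, hr.eq_nearestEven⟩
        · rintro ⟨s, i⟩ out hout
          have e3 := hout.single s fun s' hs' => by
            rw [if_neg (Ne.symm hs')]
            obtain ⟨r', hr, -⟩ := w2 s'
            exact hr.mul_zero
          rw [if_pos rfl] at e3
          obtain ⟨r', hr, hr'⟩ := w2 s
          exact ⟨_, e3.trans (hr.mul (val_finite w) hr').eq_nearestEven, fun hf => hf.elim⟩ }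

end Sigmoidal

/-! ### Comparisons and the first layers of sigmoidal networks. -/

namespace Sigmoidal

variable {a : Activation} {lo : ℝ}

/-- The scale at which inputs are compared with `y`. -/
def cmpScale (q : ℕ) (y : ℝ) : ℝ := if |y| ≤ 1 then 2 ^ emax q else 2

/-- Saturation requires differences of at least `2 ^ (1 - p)`. For `|y| ≤ 1` floats may be as close
as `eps p q`, and the factor `2 ^ emax q` is just enough; for `|y| > 1` other floats are at distance
at least `2 ^ (-p)`, and the factor `2` suffices. In both cases the scaled threshold does not
overflow. -/
theorem cmpScale_facts [Params p q] {y : ℝ} (hy : y ∈ finiteFloats p q)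
    (hyb : |y| ≤ 2 ^ (emax q - 1)) :
    0 < cmpScale q y ∧ cmpScale q y ∈ finiteFloats p q ∧ cmpScale q y * y ∈ finiteFloats p q ∧
    |cmpScale q y * y| ≤ 2 ^ emax q ∧
    (∀ x ∈ finiteFloats p q, x ≠ y → 2 ^ (1 - (p : ℤ)) ≤ cmpScale q y * |x - y|) ∧
    ∀ x ∈ finiteFloats p q, |cmpScale q y * x| ≤ Omega p q →
      cmpScale q y * x ∈ finiteFloats p q := by
  obtain ⟨f1, f2, f3, f4, f5⟩ := emax_facts p q
  have hE : (2 : ℝ) ^ emax q ∈ finiteFloats p q := two_zpow_mem (by omega) le_rfl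
  have h2 : (2 : ℝ) ∈ finiteFloats p q := by
    have := two_zpow_mem (p := p) (q := q) (e := 1) (by omega) (by omega)
    rwa [zpow_one] at this
  have h0 : (0 : ℝ) < 2 ^ emax q := by positivity
  have hO : ∀ {x : ℝ}, |x| ≤ 2 ^ emax q → |x| ≤ Omega p q := fun h =>
    h.trans (two_zpow_le_Omega le_rfl)
  unfold cmpScale
  split_ifs with hc
  · have hs : ∀ x ∈ finiteFloats p q, |2 ^ emax q * x| ≤ Omega p q →
        2 ^ emax q * x ∈ finiteFloats p q := fun x hx h => by
      rw [mul_comm] at h ⊢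
      exact mul_two_zpow_mem hx (by omega) h
    have hb : |2 ^ emax q * y| ≤ 2 ^ emax q := by
      rw [abs_mul, abs_of_pos h0]; nlinarith
    refine ⟨h0, hE, hs y hy (hO hb), hb, fun x hx hxy => ?_, hs⟩
    have h1 : eps p q ≤ |x - y| := by
      obtain ⟨m, i, -, e1⟩ := exists_int_eps hx
      obtain ⟨m', i', -, e2⟩ := exists_int_eps hy
      have h1 : ((m * 2 ^ i - m' * 2 ^ i' : ℤ) : ℝ) * eps p q = x - y := by
        rw [e1, e2]; push_cast; ring
      have h2 : m * 2 ^ i - m' * 2 ^ i' ≠ 0 := by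
        intro h
        rw [h, Int.cast_zero, zero_mul] at h1
        exact hxy (by linarith)
      have h3 : (1 : ℝ) ≤ |((m * 2 ^ i - m' * 2 ^ i' : ℤ) : ℝ)| := by
        exact_mod_cast Int.one_le_abs h2
      have h4 := eps_pos (p := p) (q := q)
      rw [← h1, abs_mul, abs_of_pos h4]
      nlinarith
    calc (2 : ℝ) ^ (1 - (p : ℤ)) = 2 ^ emax q * eps p q := by
          unfold eps
          rw [← zpow_add₀ (by norm_num)]; congr 1; omega
      _ ≤ _ := by gcongr
  · have hs : ∀ x ∈ finiteFloats p q, |2 * x| ≤ Omega p q → 2 * x ∈ finiteFloats p q :=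
      fun x hx h => by
        rw [mul_comm] at h ⊢
        have := mul_two_zpow_mem hx (k := 1) (by omega) (by rwa [zpow_one])
        rwa [zpow_one] at this
    have hb : |2 * y| ≤ 2 ^ emax q := by
      rw [zpow_sub_one_two] at hyb
      rw [abs_mul, abs_two]; linarith
    refine ⟨two_pos, h2, hs y hy (hO hb), hb, fun x hx hxy => ?_, hs⟩
    have e1 : (2 : ℝ) ^ (1 - (p : ℤ)) = 2 * 2 ^ ((0 : ℤ) - p) := by
      rw [← zpow_one_add₀ (by norm_num)]; congr 1; ring
    rw [e1]
    refine mul_le_mul_of_nonneg_left ?_ two_pos.le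
    rcases le_or_gt 1 |x| with h1 | h1
    · exact gap_of_le_abs hx hy (by rwa [zpow_zero]) (by rw [zpow_zero]; linarith) hxy
    · have hya : |y| ∈ finiteFloats p q := by
        rcases abs_choice y with h | h <;> rw [h]
        exacts [hy, neg_mem hy]
      have h3 := gap_of_le_abs (p := p) (q := q) hya one_mem (e := 0)
        (by rw [zpow_zero, abs_abs]; linarith) (by simp) (by linarith)
      rw [abs_of_pos (by linarith)] at h3
      have := abs_sub_abs_le_abs_sub y x
      rw [abs_sub_comm] at this
      linarith

/-- The comparison of a float with a threshold. -/
theorem compare [Params p q] {x y : ℝ} (hx : x ∈ finiteFloats p q) (hy : y ∈ finiteFloats p q)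
    (hyb : |y| ≤ 2 ^ (emax q - 1)) {A v : Flt p q} (hA : (A : ℝ) * v = cmpScale q y * x)
    {P : ExtFlt p q} (hP : P = ((ExtFlt.finite A).mul (.finite v)).add
      (.finite (nearestEven p q (-(cmpScale q y * y))))) :
    (x ≤ y → AtMost P 0) ∧ (y < x → AtLeast P (2 ^ (1 - (p : ℤ)))) := by
  obtain ⟨f1, f2, f3, f4, f5⟩ := emax_facts p q
  obtain ⟨k1, k2, k3, k4, k5, k6⟩ := cmpScale_facts hy hyb
  have hS : (2 : ℝ) ^ (1 - (p : ℤ)) ∈ finiteFloats p q := two_zpow_mem (by omega) (by omega)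
  have hS' : (2 : ℝ) ^ (1 - (p : ℤ)) ≤ 2 ^ emax q / 2 := by
    rw [← zpow_sub_one_two]
    exact zpow_le_zpow_right₀ (by norm_num) (by omega)
  have hO := three_halves_le_Omega (p := p) (q := q)
  have vb := val_nearestEven (neg_mem k3)
  set W := cmpScale q y
  rw [abs_le] at k4
  subst hP
  rcases le_or_gt |W * x| (Omega p q) with hc | hc
  · obtain ⟨m1, e1⟩ := (val_finite A).mul_mem (val_finite v) (by rw [hA]; exact k6 x hx hc)
    obtain ⟨m2, e2⟩ := vb
    rw [e1, e2]
    refine ⟨fun h => atMost_round zero_mem ?_, fun h => atLeast_round hS ?_⟩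
    · simp only [hA]
      have := mul_le_mul_of_nonneg_left h k1.le
      linarith
    · have := k5 x hx h.ne'
      rw [abs_of_pos (by linarith)] at this
      simp only [hA]
      linarith
  -- If the scaled input overflows, its sign alone decides, because the scaled threshold is at most
  -- `2 ^ emax q` in size; the bounds also allow infinite values.
  · rcases lt_abs.1 hc with h | h
    · refine ⟨fun hxy => ?_, fun _ => ?_⟩
      · have := mul_le_mul_of_nonneg_left hxy k1.le
        have h0 : (0 : ℝ) < 2 ^ emax q := by positivity
        linarith
      · exact ((val_finite A).atLeast_mul (val_finite v) Omega_mem (by rw [hA]; exact h.le)).add_val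
          vb hS (by linarith)
    · refine ⟨fun _ => ?_, fun hxy => ?_⟩
      · refine ((val_finite A).atMost_mul (val_finite v) (neg_mem Omega_mem)
          (by rw [hA]; linarith)).add (vb.atMost le_rfl) zero_mem (by linarith)
      · have := mul_le_mul_of_nonneg_left hxy.le k1.le
        have h0 : (0 : ℝ) < 2 ^ emax q := by positivity
        linarith

/-- The parameters of the last comparison layer. -/
def FinalSpec (a : Activation) (lo : ℝ) (w b : Flt p q) : Prop :=
  ∀ c : Flt p q, ∀ P, P = ((ExtFlt.finite w).mul (.finite c)).add (.finite b) →
    ((c : ℝ) = lo → a.act p q P = 0) ∧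
    ((1 + lo) / 2 ≤ (c : ℝ) → ∃ c' : Flt p q, a.act p q P = .finite c' ∧ 1 / 4 ≤ (c' : ℝ))

/-- The first value is at most the midpoint `(1 + lo) / 2`, or above it by at least one place, `2 ^
(-p - 1)`. The factor `2 ^ emax q` and a bias between the two send the former to `lo` and the latter
to at least the midpoint; the last layer turns `lo` into exactly zero. -/
theorem exists_cmp [Params p q] (h : Sigmoidal a lo) {w b : Flt p q} (hw : FinalSpec a lo w b)
    {P : ExtFlt p q} {on : Prop} (h1 : on → AtMost P 0)
    (h2 : ¬ on → AtLeast P (2 ^ (1 - (p : ℤ)))) :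
    ∃ c₀ c₁ c₂ : Flt p q,
      (a.act p q P = .finite c₀ ∧ ∃ r, a.actDeriv p q P = .finite r) ∧
      (∀ P, P = ((ExtFlt.finite (nearestEven p q (2 ^ emax q))).mul (.finite c₀)).add
          (.finite (nearestEven p q
            (-(2 ^ emax q * ((1 + lo) / 2 + 2 ^ (-(p : ℤ) - 1)))))) →
        a.act p q P = .finite c₁ ∧ ∃ r, a.actDeriv p q P = .finite r) ∧
      (∀ P, P = ((ExtFlt.finite w).mul (.finite c₁)).add (.finite b) →
        a.act p q P = .finite c₂ ∧ ∃ r, a.actDeriv p q P = .finite r) ∧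
      ((c₂ : ℝ) = 0 ∨ 1 / 4 ≤ (c₂ : ℝ)) ∧ ((c₂ : ℝ) = 0 ↔ on) := by
  obtain ⟨f1, f2, f3, f4, f5⟩ := emax_facts p q
  obtain ⟨g1, g2, g3, g4, g5⟩ := zpow_emax_facts p q
  have hE : (2 : ℝ) ^ emax q ∈ finiteFloats p q := two_zpow_mem (by omega) le_rfl
  have hK : (2 : ℝ) ^ (q + 1) ∈ finiteFloats p q := two_pow_mem
  have vE := val_nearestEven hE
  have hθ := h.threshold_mem (p := p) (q := q) (e := emax q) (by omega) le_rfl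
  have vθ := val_nearestEven (neg_mem hθ)
  have h0 : (0 : ℝ) < 2 ^ emax q := by positivity
  have hlo' : -1 ≤ lo ∧ lo ≤ 0 := by rcases h.lo_eq with rfl | rfl <;> norm_num
  have nn : ∀ c : Flt p q, ((ExtFlt.finite w).mul (.finite c)).add (.finite b) ≠ .nan :=
    fun c => add_finite_ne_nan (finite_mul_ne_nan w c) b
  have f0 : fl p q (a.toReal 0) = (1 + lo) / 2 := by rw [h.map_zero, fl_of_mem h.mid_mem]
  by_cases hon : on
  · obtain ⟨⟨c₀, e1, e2, e3⟩, e4⟩ := h.act_atMost (h1 hon)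
    have e5 : AtMost (((ExtFlt.finite (nearestEven p q (2 ^ emax q))).mul (.finite c₀)).add
        (.finite (nearestEven p q (-(2 ^ emax q * ((1 + lo) / 2 + 2 ^ (-(p : ℤ) - 1)))))))
        (-2 ^ (q + 1)) := by
      have e6 : (2 : ℝ) ^ emax q * 2 ^ (-(p : ℤ) - 1) = 2 ^ (emax q - p) / 2 := by
        rw [← zpow_sub_one_two, ← zpow_add₀ (by norm_num)]; congr 1; ring
      have hm := (h.gate_facts (p := p) (q := q)).2.2.2.2.2.1
      rw [f0] at e3
      refine (vE.atMost_mul (val_finite c₀) hm (by nlinarith)).add (vθ.atMost le_rfl) (neg_mem hK) ?_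
      rw [mul_add, e6]
      linarith
    have e7 := h.off e5
    have e8 := (hw (nearestEven p q lo) _ rfl).1 (coe_nearestEven h.lo_mem)
    refine ⟨c₀, nearestEven p q lo, 0, ⟨e1, e4⟩, ?_, ?_, Or.inl rfl, ⟨fun _ => hon, fun _ => rfl⟩⟩
    · rintro P rfl
      exact ⟨e7.1, 0, e7.2⟩
    · rintro P rfl
      exact ⟨e8, h.der_finite (nn _)⟩
  · obtain ⟨⟨c₀, e1, -, e3⟩, e4⟩ := h.act_atLeast (h2 hon)
    have e5 : AtLeast (((ExtFlt.finite (nearestEven p q (2 ^ emax q))).mul (.finite c₀)).add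
        (.finite (nearestEven p q (-(2 ^ emax q * ((1 + lo) / 2 + 2 ^ (-(p : ℤ) - 1))))))) 0 := by
      have e6 := h.threshold_le.trans e3
      refine (vE.atLeast_mul (val_finite c₀) hθ ?_).add_val vθ zero_mem (by linarith)
      exact mul_le_mul_of_nonneg_left e6 h0.le
    obtain ⟨⟨c₁, e7, -, e8⟩, e9⟩ := h.act_atLeast e5
    rw [f0] at e8
    obtain ⟨c₂, e10, e11⟩ := (hw c₁ _ rfl).2 e8
    refine ⟨c₀, c₁, c₂, ⟨e1, e4⟩, ?_, ?_, Or.inr e11,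
      ⟨fun hh => by linarith, fun hh => absurd hh hon⟩⟩
    · rintro P rfl
      exact ⟨e7, e9⟩
    · rintro P rfl
      exact ⟨e10, h.der_finite (nn _)⟩

/-- The layers of a sigmoidal network that are close to the input. -/
def inputKit [Params p q] (h : Sigmoidal a lo) {N : ℕ} {w b w' b' : Flt p q}
    (sw : SwitchSpec a (nearestEven p q 1) (nearestEven p q lo) N w b)
    (hw : FinalSpec a lo w' b') : InputKit (h.kit sw) := by
  have f1 := (emax_facts p q).1
  have f2 := (emax_facts p q).2.1
  have f3 := (emax_facts p q).2.2.1
  have f5 := (emax_facts p q).2.2.2.2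
  have g1 := (zpow_emax_facts p q).1
  have g2 := (zpow_emax_facts p q).2.1
  have g3 := (zpow_emax_facts p q).2.2.1
  have g4 := (zpow_emax_facts p q).2.2.2.1
  have g5 := (zpow_emax_facts p q).2.2.2.2
  have g6 : (0 : ℝ) < 2 ^ (emax q - p) := by positivity
  have g7 := three_halves_le_Omega (p := p) (q := q)
  have hE : (2 : ℝ) ^ emax q ∈ finiteFloats p q := two_zpow_mem (by omega) le_rfl
  have hE3 : (2 : ℝ) ^ (emax q - 3) ∈ finiteFloats p q := two_zpow_mem (by omega) (by omega)
  have hK : (2 : ℝ) ^ (q + 1) ∈ finiteFloats p q := two_pow_mem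
  have e1 := zpow_sub_one_two (emax q)
  have e2 := zpow_sub_two_two (emax q)
  have e3 : (2 : ℝ) ^ (emax q - 3) = 2 ^ emax q / 8 := by
    rw [zpow_sub₀ (by norm_num)]; norm_num
  have m1 := h.gate_facts (p := p) (q := q)
  have v1 := val_nearestEven (p := p) (q := q) one_mem
  have vE := val_nearestEven hE
  have vlo := val_nearestEven h.lo_mem (p := p) (q := q)
  have hEK : (2 : ℝ) ^ (q + 1) * 256 ≤ 2 ^ emax q := by nlinarith
  have hDp : 4 / (1 - lo) ^ 2 ≤ 4 := by rcases h.lo_eq with rfl | rfl <;> norm_num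
  have eD := coe_nearestEven m1.2.1
  have hD : 0 < 4 / (1 - lo) ^ 2 := by rcases h.lo_eq with rfl | rfl <;> norm_num
  exact {
    κ₁ := nearestEven p q ((1 + lo) / 2)
    τ₁ := 0
    J₁ := fun j => |(j : ℝ)| ≤ 1
    act_τ₁ := (h.kit sw).act_τ
    der_τ₁ := ⟨_, (h.kit sw).delta_le, (h.kit sw).der_τ⟩
    carrier₁ := by
      intro A j hA hj
      refine (h.kit sw).carrier A j ?_ hj
      rcases hA with rfl | rfl
      · change |((nearestEven p q (4 / (1 - lo) ^ 2) : Flt p q) : ℝ)| ≤ 64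
        rw [eD, abs_of_pos hD]; linarith
      · change |(0 : ℝ)| ≤ 64
        norm_num
    s₁ := 0
    w₁ := nearestEven p q 1
    -- The preactivation `v - z` vanishes on the target and gives derivative `δ` there. Unlike for
    -- rectifiers the input is not absorbed, so the input weight can be `1` and `s₁ = 0`.
    b₁ := fun z => -z
    s₁_le := by omega
    w₁_eq := by rw [coe_nearestEven one_mem]; norm_num
    range := by
      intro e he
      change ((nearestEven p q (4 / (1 - lo) ^ 2) : Flt p q) : ℝ) * 2 ^ (e + (0 : ℕ)) ≤ Omega p q
      have h1 : (2 : ℝ) ^ (e + (0 : ℕ)) ≤ 2 ^ (emax q - p) :=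
        zpow_le_zpow_right₀ (by norm_num) (by omega)
      have h2 : (0 : ℝ) < 2 ^ (e + (0 : ℕ)) := by positivity
      have h3 := mul_le_mul hDp h1 h2.le (by norm_num)
      rw [eD]
      nlinarith
    first := by
      rintro v z hv hz P rfl
      rw [h.bound, e1, abs_le] at hv hz
      have hv0 := ((v1.mul_mem (val_finite v) (by rw [one_mul]; exact v.2)).congr (one_mul _)).add
        (val_finite (-z)) (by
          change |(v : ℝ) + -(z : ℝ)| ≤ _
          rw [abs_le]; constructor <;> linarith)
      obtain ⟨c, c1, c2, c3, -⟩ := h.val_act_bounds hv0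
      have hvz : v = z → ((ExtFlt.finite (nearestEven p q 1)).mul (.finite v)).add
          (.finite (-z)) = .finite 0 := by
        rintro rfl
        rw [((v1.mul_mem (val_finite v) (by rw [one_mul]; exact v.2)).congr
          (one_mul _)).eq_finite, finite_add_neg_self]
        rfl
      refine ⟨⟨c, ?_, c1, fun e => ?_⟩, _, (h.val_der hv0).eq_nearestEven, fun e => ?_⟩
      · rw [abs_le]
        rcases h.lo_eq with rfl | rfl <;> constructor <;> linarith
      · rw [hvz e] at c1
        exact ExtFlt.finite.inj (c1.symm.trans (h.kit sw).act_τ)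
      · have := (h.val_der hv0).eq_nearestEven
        rw [hvz e] at this
        exact ExtFlt.finite.inj (this.symm.trans (h.kit sw).der_τ)
    m := 1
    -- The comparison `z ≤ v` is treated as `-v ≤ -z`; the scale depends only on `|z|`.
    cmpWeight := fun z s => nearestEven p q ((if s then 1 else -1) * cmpScale q z)
    cmpBias := fun z s => nearestEven p q (-(cmpScale q z * ((if s then 1 else -1) * z)))
    stepWeight := fun i => if i = 0 then nearestEven p q (2 ^ emax q) else w'
    stepBias := fun i => if i = 0 then
      nearestEven p q (-(2 ^ emax q * ((1 + lo) / 2 + 2 ^ (-(p : ℤ) - 1)))) else b'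
    m_le := by norm_num
    cmp := by
      intro v z s hv hz
      rw [h.bound] at hz
      have hs : ∀ {x : ℝ}, x ∈ finiteFloats p q →
          (if s then 1 else -1) * x ∈ finiteFloats p q := fun {x} hx => by
        cases s
        · simp only [Bool.false_eq_true, if_false, neg_one_mul]; exact neg_mem hx
        · simp only [if_true, one_mul]; exact hx
      have ha : |(if s then 1 else -1) * (z : ℝ)| = |(z : ℝ)| := by
        cases s <;> simp
      have hsc : cmpScale q ((if s then 1 else -1) * (z : ℝ)) = cmpScale q z := by
        unfold cmpScale; rw [ha]
      have hc := compare (hs v.2) (hs z.2) (by rwa [ha])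
        (A := nearestEven p q ((if s then 1 else -1) * cmpScale q z)) (v := v) (by
          rw [coe_nearestEven (hs (cmpScale_facts z.2 hz).2.1), hsc]; ring) rfl
      rw [hsc] at hc
      obtain ⟨c₀, c₁, c₂, k0, k1, k2, k4, k5⟩ := h.exists_cmp hw
        (on := if s then (v : ℝ) ≤ z else (z : ℝ) ≤ v)
        (fun hon => hc.1 (by cases s <;> simpa using hon))
        (fun hon => hc.2 (by cases s <;> simpa using hon))
      refine ⟨fun i => match i with | 0 => c₀ | 1 => c₁ | _ => c₂, ?_, ?_, k4, k5⟩
      · rintro P rfl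
        exact k0
      · intro i hi
        interval_cases i
        · exact k1
        · exact k2
    on := nearestEven p q 1
    norBias := nearestEven p q (2 ^ (emax q - 3))
    nor_on := by
      have hv := val_nearestEven hE3
      exact ⟨(h.act_one hv (by rw [e3]; linarith)).eq_nearestEven,
        _, (h.val_der hv).eq_nearestEven⟩
    nor_off := fun P hP => hP.add ((val_nearestEven hE3).atMost le_rfl) (neg_mem hK)
      (by rw [e2, e3]; linarith)
    litWeight := fun v => if v then nearestEven p q (2 ^ emax q) else nearestEven p q (-2 ^ emax q)
    litBias := fun v => if v then nearestEven p q (-(2 ^ emax q * ((1 + lo) / 2)))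
      else nearestEven p q (2 ^ emax q * ((1 + lo) / 2))
    lit := by
      obtain ⟨-, -, -, -, -, k6, k7, k8, k9, k10⟩ := m1
      rintro e v P rfl
      cases v
      · have vb := val_nearestEven k6
        have vw := val_nearestEven (neg_mem hE)
        cases e
        · have ea : -2 ^ emax q * lo + 2 ^ emax q * ((1 + lo) / 2) =
              2 ^ emax q * 1 - 2 ^ emax q * ((1 + lo) / 2) := by rw [k10]; ring
          have hv := ((vw.mul_mem vlo (by rw [neg_mul]; exact neg_mem k7)).add_mem vb
            (by rwa [ea])).congr ea
          exact ⟨(h.act_one hv (by linarith)).eq_nearestEven, _, (h.val_der hv).eq_nearestEven⟩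
        · have ea : -2 ^ emax q * 1 + 2 ^ emax q * ((1 + lo) / 2) =
              -(2 ^ emax q * 1 - 2 ^ emax q * ((1 + lo) / 2)) := by ring
          have hv := ((vw.mul_mem v1 (by rw [mul_one]; exact neg_mem hE)).add_mem vb
            (by rw [ea]; exact neg_mem k8)).congr ea
          have := h.off (hv.atMost (by linarith))
          exact ⟨this.1, 0, this.2⟩
      · cases e
        · obtain ⟨r1, r, r2, -⟩ := (h.kit sw).bit _ (Or.inr rfl) _ rfl
          exact ⟨r1, r, r2⟩
        · obtain ⟨r1, r, r2, -⟩ := (h.kit sw).bit _ (Or.inl rfl) _ rfl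
          exact ⟨r1, r, r2⟩ }

end Sigmoidal

/-! ### The sigmoid and the hyperbolic tangent. -/

/-- The off value is already `0`, so a single bit of weight `2 ^ emax q` switches a piece between
two saturated states with derivative zero, and the large weight never meets a gradient. The last
comparison layer amplifies in the same way. -/
theorem exists_kit_sigmoid [Params p q] :
    ∃ kit : Kit p q .sigmoid, Nonempty (InputKit kit) := by
  have h := sigmoidal_sigmoid
  obtain ⟨f1, f2, f3, f4, f5⟩ := emax_facts p q
  obtain ⟨g1, g2, g3, g4, g5⟩ := zpow_emax_facts p q
  have hE : (2 : ℝ) ^ emax q ∈ finiteFloats p q := two_zpow_mem (by omega) le_rfl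
  have hE1 : (2 : ℝ) ^ (emax q - 1) ∈ finiteFloats p q := two_zpow_mem (by omega) (by omega)
  have hE2 : (2 : ℝ) ^ (emax q - 2) ∈ finiteFloats p q := two_zpow_mem (by omega) (by omega)
  have hK : (2 : ℝ) ^ (q + 1) ∈ finiteFloats p q := two_pow_mem
  have vE := val_nearestEven hE
  have v0 := val_nearestEven (p := p) (q := q) zero_mem
  have v1 := val_nearestEven (p := p) (q := q) one_mem
  have h0 : (0 : ℝ) < 2 ^ emax q := by positivity
  have hEK : (2 : ℝ) ^ (q + 1) * 256 ≤ 2 ^ emax q := by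
    have : (0 : ℝ) < 2 ^ (emax q - p) := by positivity
    nlinarith
  have e1 := zpow_sub_one_two (emax q)
  have e2 := zpow_sub_two_two (emax q)
  have sw : Sigmoidal.SwitchSpec .sigmoid (nearestEven p q 1) (nearestEven p q 0) 1
      (nearestEven p q (2 ^ emax q)) (nearestEven p q (-2 ^ (emax q - 1))) := by
    intro on P hP
    rw [hP.single 0 fun i hi => absurd (Subsingleton.elim i 0) hi]
    have vb := val_nearestEven (neg_mem hE1)
    cases on
    · have hv := ((vE.mul_mem v0 (by rw [mul_zero]; exact zero_mem)).add_mem vb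
        (by rw [mul_zero, zero_add]; exact neg_mem hE1))
      have := h.off (hv.atMost (by rw [e1]; linarith))
      refine ⟨?_, 0, ?_, Or.inl rfl⟩
      · simp only [bitState, Bool.false_eq_true, if_false]
        rw [this.1]
        exact v0
      · simp only [bitState, Bool.false_eq_true, if_false]
        rw [this.2]
        exact val_zero
    · have ea : (2 : ℝ) ^ emax q * 1 + -2 ^ (emax q - 1) = 2 ^ (emax q - 1) := by rw [e1]; ring
      have hv := ((vE.mul_mem v1 (by rwa [mul_one])).add_mem vb (by rwa [ea])).congr ea
      simp only [bitState, if_true]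
      refine ⟨h.act_one hv (by rw [e1]; linarith), 0, h.der_eq_zero hv ?_, Or.inl rfl⟩
      rw [abs_of_pos (by positivity), e1]; linarith
  refine ⟨h.kit sw, ⟨h.inputKit sw (w' := nearestEven p q (2 ^ emax q))
    (b' := nearestEven p q (-2 ^ (emax q - 2))) ?_⟩⟩
  rintro c P rfl
  have vb := val_nearestEven (neg_mem hE2)
  constructor
  · intro hc
    have hA : AtMost (((ExtFlt.finite (nearestEven p q (2 ^ emax q))).mul (.finite c)).add
        (.finite (nearestEven p q (-2 ^ (emax q - 2))))) (-2 ^ (q + 1)) :=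
      (vE.atMost_mul (val_finite c) zero_mem (by rw [hc, mul_zero])).add (vb.atMost le_rfl)
        (neg_mem hK) (by rw [e2]; linarith)
    rw [(h.off hA).1]
    exact v0.eq_zero
  · intro hc
    have hA : AtLeast (((ExtFlt.finite (nearestEven p q (2 ^ emax q))).mul (.finite c)).add
        (.finite (nearestEven p q (-2 ^ (emax q - 2))))) 0 :=
      (vE.atLeast_mul (val_finite c) hE1 (by rw [e1]; nlinarith)).add_val vb zero_mem
        (by rw [e1, e2]; linarith)
    obtain ⟨⟨c', h1, -, h2⟩, -⟩ := h.act_atLeast hA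
    rw [h.map_zero, fl_of_mem h.mid_mem] at h2
    exact ⟨c', h1, by linarith⟩

/-- The off value is `-1`, so unused pieces must rest at preactivation exactly zero, where the
derivative is `1` and gradients pass. A large weight would make them overflow; instead `2 ^ p` bits
of weight `4` together cancel or double the bias `4 * 2 ^ p`. In the last comparison layer `4 * c +
4` is zero at `c = -1` and at least `4` for `c ≥ 0`. -/
theorem exists_kit_tanh [Params p q] : ∃ kit : Kit p q .tanh, Nonempty (InputKit kit) := by
  have h := sigmoidal_tanh
  obtain ⟨f1, f2, f3, f4, f5⟩ := emax_facts p q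
  obtain ⟨g1, g2, g3, g4, g5⟩ := zpow_emax_facts p q
  have h4 : (4 : ℝ) ∈ finiteFloats p q := by
    have := two_zpow_mem (p := p) (q := q) (e := 2) (by omega) (by omega)
    norm_num at this; exact this
  have hB : (4 : ℝ) * 2 ^ p ∈ finiteFloats p q := by
    have := two_pow_mem_of_le (p := p) (q := q) (k := p + 2) (by push_cast; omega)
    convert this using 1; ring
  have hB2 : (8 : ℝ) * 2 ^ p ∈ finiteFloats p q := by
    have := two_pow_mem_of_le (p := p) (q := q) (k := p + 3) (by push_cast; omega)
    convert this using 1; ring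
  have v4 := val_nearestEven h4
  have vB := val_nearestEven hB
  have v1 := val_nearestEven (p := p) (q := q) one_mem
  have vm1 := val_nearestEven (p := p) (q := q) (neg_mem one_mem)
  have hz : ∀ {z : ExtFlt p q}, Val z 0 → Val (Activation.tanh.act p q z) 0 := fun hz =>
    (h.act_zero hz).congr (by norm_num)
  have sw : Sigmoidal.SwitchSpec .tanh (nearestEven p q 1) (nearestEven p q (-1)) (2 ^ p)
      (nearestEven p q 4) (nearestEven p q (4 * 2 ^ p)) := by
    intro on P hP
    have hs := hP.exact (fun _ => if on then 1 else -1) 4 ?_ ?_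
    · rw [Finset.sum_const, Finset.card_univ, Fintype.card_fin, nsmul_eq_mul] at hs
      have hval : Val (P.add (.finite (nearestEven p q (4 * 2 ^ p))))
          (if on then 8 * 2 ^ p else 0) := by
        have ea : (((2 ^ p : ℕ) * (if on then 1 else -1) : ℤ) : ℝ) * 4 + 4 * 2 ^ p =
            if on then 8 * 2 ^ p else 0 := by
          cases on <;> simp <;> ring
        refine (hs.add_mem vB ?_).congr ea
        rw [ea]
        cases on
        · exact zero_mem
        · exact hB2
      refine ⟨?_, _, h.val_der hval, Or.inr ⟨?_, ?_, le_rfl⟩⟩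
      · cases on
        · exact hz hval
        · exact h.act_one hval (by simp only [if_true]; linarith)
      · have := h.der_le (if on then 8 * 2 ^ p else 0)
        rw [abs_le] at this ⊢
        exact ⟨le_fl (neg_mem one_mem) this.1, fl_le one_mem this.2⟩
      · rw [coe_nearestEven h4, abs_of_pos (by norm_num)]
    · intro i
      cases on
      · exact (v4.mul_mem vm1 (by rw [mul_neg_one]; exact neg_mem h4)).congr (by norm_num)
      · exact (v4.mul_mem v1 (by rwa [mul_one])).congr (by norm_num)
    · intro k hk
      have h1 : |if on = true then (1 : ℤ) else -1| = 1 := by cases on <;> simp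
      simp only [h1, Finset.sum_const, Finset.card_univ, Fintype.card_fin, nsmul_eq_mul,
        mul_one] at hk
      have := int_mul_mem (p := p) (q := q) (m := k) (e := 2) ?_ (by omega) (by omega)
      · norm_num at this; exact this
      · refine hk.trans ?_
        push_cast
        exact pow_le_pow_right₀ (by norm_num) (by omega)
  refine ⟨h.kit sw, ⟨h.inputKit sw (w' := nearestEven p q 4) (b' := nearestEven p q 4) ?_⟩⟩
  rintro c P rfl
  constructor
  · intro hc
    have hv := (v4.mul_mem (val_finite c) (by rw [hc, mul_neg_one]; exact neg_mem h4)).add_mem v4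
      (by rw [hc]; norm_num; exact zero_mem)
    exact (hz (hv.congr (by rw [hc]; norm_num))).eq_zero
  · intro hc
    have hA := (v4.atLeast_mul (val_finite c) zero_mem (by linarith)).add_val v4 h4 (by linarith)
    obtain ⟨⟨c', h1, -, h2⟩, -⟩ := h.act_atLeast hA
    refine ⟨c', h1, le_trans (le_fl ?_ ?_) h2⟩
    · have := two_zpow_mem (p := p) (q := q) (e := -2) (by omega) (by omega)
      norm_num at this ⊢; exact this
    · have h5 := h.large 4
      have h6 : Real.exp (-4) ≤ 1 / 5 := by
        rw [Real.exp_neg, ← one_div]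
        exact one_div_le_one_div_of_le (by norm_num) (by linarith [Real.add_one_le_exp (4 : ℝ)])
      linarith

end FloatNet

end

open FloatNet
theorem theorem3p2 (p q d : ℕ) (hp : 2 ≤ p) (hpq : p ≤ 2 ^ (q - 2)) (hq : 6 ≤ q) (hd : 1 ≤ d)
    (σ : Activation)
    (fstar : inputCube p q d σ → Flt p q)
    (gstar : (Fin d → Flt p q) → Flt p q → (Fin d → Flt p q))
    (hodd : ∀ x y, gstar x (-y) = -gstar x y)
    (L : ℕ) (hL : 2 ^ (q + 1) + 2 * p + 11 ≤ L) :
    ∃ f : Network p q L d 1,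
      ∀ (x : inputCube p q d σ) (y : Flt p q), |(y : ℝ)| ≤ σ.gradBound p q →
        (f.eval σ (fun i => .finite (x.1 i)) = fun _ => .finite (fstar x)) ∧
        (f.grad σ (fun i => .finite (x.1 i)) (fun _ => .finite y) =
          fun j => .finite (gstar x.1 y j)) := by
  have : Params p q := ⟨hp, hpq, hq⟩
  obtain ⟨f1, f2, f3, f4, f5⟩ := emax_facts p q
  obtain ⟨kit, ⟨ik⟩⟩ : ∃ kit : Kit p q σ, Nonempty (InputKit kit) := by
    cases σ with
    | relu => exact rectifier_relu.exists_kit_zero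
    | elu =>
      exact rectifier_elu.exists_kit_neg_one (fun x hx => elu_of_nonneg hx)
        (fun x hx => elu_deriv_of_nonneg hx)
    | gelu => exact rectifier_gelu.exists_kit_zero
    | swish => exact rectifier_swish.exists_kit_zero
    | sigmoid => exact exists_kit_sigmoid
    | tanh => exact exists_kit_tanh
  have hL' : 2 * (2 * (emax q + 1)) + 2 * p + 11 ≤ L := by
    rw [← f4, ← pow_succ']
    exact_mod_cast hL
  have hm := ik.m_le
  -- Of the `t + m + 7` layers, `t + 3 + m` are backward steps available for the spikes. As `2 ^ (q
  -- + 1) = 4 * (emax q + 1)`, the required number follows from `2 * p ≤ emax q + 1`, `31 ≤ emax q`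
  -- and `m ≤ 2`.
  obtain ⟨t, rfl⟩ : ∃ t, L = t + ik.m + 7 := ⟨L - ik.m - 7, by omega⟩
  exact ik.exists_network hd fstar gstar hodd (by push_cast at *; omega)
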